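/- **Definitions.** The machine model is the real RAM: a program uses finitely many arrays of natural numbers (with addition, truncated subtraction, comparison and indirect addressing) and finitely many arrays of exact real numbers (with $+,-,\cdot,/$, comparison and conversion of natural numbers to reals, no rounding); each operation costs one step, up to constant factors. *Offline Dynamic Rectangle Cover.* An instance consists of numbers $n$ and $N\ge 1$, an initial set $\mathcal S$ of at most $n$ closed axis-parallel rectangles with integral coordinates in $[1,N]\times[1,N]$, and a sequence of $U$ updates $u_1,\dots,u_U$, each of which deletes a rectangle of $\mathcal S$ or adds to $\mathcal S$ a new rectangle with integral coordinates in $[1,N]\times[1,N]$, such that $|\mathcal S|\le n$ at all times. The task is to determine the first update $u_i$ after which the rectangles of $\mathcal S$ do not cover $[1,N]\times[1,N]$ (or to report that there is none). For orthogonal simple polygons $P,Q$ (closed regions, given by the real coordinates of their vertices in order along the boundary), $\lambda^*=\lambda^*(P,Q)$ is the largest $\lambda>0$ such that $\lambda P+\tau\subseteq Q$ for some $\tau\in\mathbb R^2$. **Lemma.** There are absolute constants $c$ and $K$ such that the following holds. Let $T(n,U)$ bound the running time of some real RAM program that solves Offline Dynamic Rectangle Cover on all instances with $N\le c\,n$,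 where $n$ is the bound on the number of rectangles and $U$ is the number of updates. Then there is a real RAM program that, given any orthogonal simple polygons $P$ and $Q$ with $p$ and $q$ vertices, respectively, computes $\lambda^*$ (which exists) in at most $$K\cdot\bigl((pq)^2\log(pq)+T(pq,(pq)^2)\bigr)$$ steps. In particular, $\lambda^*$ can be computed in time $O\bigl((pq)^2\log(pq)+T(pq,(pq)^2)\bigr)$ if $T(n,U)$ is the time to solve Offline Dynamic Rectangle Cover with $N=O(n)$. -/

import Mathlib

namespace PolygonPlacement

/-! Real RAM.  The memory consists of arrays of natural numbers (used for indices and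
combinatorial data) and arrays of exact real numbers.  A program names finitely many arrays;
cells are addressed by computed indices (indirect addressing).  On natural numbers there are
addition, truncated subtraction and comparison; on reals the four arithmetic operations and
comparison, and naturals can be read as reals.  There is no rounding, and the only constants
are natural numbers. -/

/-- A memory state: cell `i` of the natural-number array `a`, and of the real array `a`. -/
structure Store where
  nat : ℕ → ℕ → ℕ
  real : ℕ → ℕ → ℝ

/-- Natural-number expressions; `cell a e` is the content of array `a` at index `e`. -/
inductive NExpr where
  | const (k : ℕ)
  | cell (a : ℕ) (e : NExpr)
  | add (e f : NExpr)
  | sub (e f : NExpr)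

/-- Real expressions; `cast e` is the value of `e` as a real number. -/
inductive RExpr where
  | cast (e : NExpr)
  | cell (a : ℕ) (e : NExpr)
  | add (e f : RExpr)
  | sub (e f : RExpr)
  | mul (e f : RExpr)
  | div (e f : RExpr)

/-- Tests. -/
inductive Test where
  | nlt (e f : NExpr)
  | rlt (e f : RExpr)
  | not (b : Test)
  | and (b c : Test)

/-- Programs. `setN a e f` is the assignment `a[e] := f` on natural numbers, `setR` that on
reals. -/
inductive Prog where
  | skip
  | setN (a : ℕ) (e : NExpr) (f : NExpr)
  | setR (a : ℕ) (e : NExpr) (f : RExpr)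
  | seq (A B : Prog)
  | ite (b : Test) (A B : Prog)
  | loop (b : Test) (A : Prog)

/-- Value of a natural-number expression. -/
def NExpr.eval (s : Store) : NExpr → ℕ
  | .const k => k
  | .cell a e => s.nat a (e.eval s)
  | .add e f => e.eval s + f.eval s
  | .sub e f => e.eval s - f.eval s

/-- Value of a real expression. -/
noncomputable def RExpr.eval (s : Store) : RExpr → ℝ
  | .cast e => (e.eval s : ℝ)
  | .cell a e => s.real a (e.eval s)
  | .add e f => e.eval s + f.eval s
  | .sub e f => e.eval s - f.eval s
  | .mul e f => e.eval s * f.eval s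
  | .div e f => e.eval s / f.eval s

/-- Truth of a test. -/
def Test.holds (s : Store) : Test → Prop
  | .nlt e f => e.eval s < f.eval s
  | .rlt e f => e.eval s < f.eval s
  | .not b => ¬ b.holds s
  | .and b c => b.holds s ∧ c.holds s

/-- Write `v` into cell `i` of the natural-number array `a`. -/
def Store.writeN (s : Store) (a i v : ℕ) : Store where
  nat := Function.update s.nat a (Function.update (s.nat a) i v)
  real := s.real

/-- Write `v` into cell `i` of the real array `a`. -/
noncomputable def Store.writeR (s : Store) (a i : ℕ) (v : ℝ) : Store where
  nat := s.nat
  real := Function.update s.real a (Function.update (s.real a) i v)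

/-- `Exec A s s' t`: started in state `s`, the program `A` halts in state `s'` after `t` steps.
Every assignment executed and every evaluation of the test of a branch or loop is one step (the
expressions in a program have a fixed size, so this is the number of elementary operations up to
a constant factor). -/
inductive Exec : Prog → Store → Store → ℕ → Prop where
  | skip (s : Store) : Exec .skip s s 0
  | setN (s : Store) (a : ℕ) (e f : NExpr) :
      Exec (.setN a e f) s (s.writeN a (e.eval s) (f.eval s)) 1
  | setR (s : Store) (a : ℕ) (e : NExpr) (f : RExpr) :
      Exec (.setR a e f) s (s.writeR a (e.eval s) (f.eval s)) 1
  | seq {A B : Prog} {s s₁ s₂ : Store} {t₁ t₂ : ℕ} :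
      Exec A s s₁ t₁ → Exec B s₁ s₂ t₂ → Exec (.seq A B) s s₂ (t₁ + t₂)
  | ite_true {b : Test} {A B : Prog} {s s' : Store} {t : ℕ} :
      b.holds s → Exec A s s' t → Exec (.ite b A B) s s' (t + 1)
  | ite_false {b : Test} {A B : Prog} {s s' : Store} {t : ℕ} :
      ¬ b.holds s → Exec B s s' t → Exec (.ite b A B) s s' (t + 1)
  | loop_done {b : Test} {A : Prog} {s : Store} :
      ¬ b.holds s → Exec (.loop b A) s s 1
  | loop_step {b : Test} {A : Prog} {s s₁ s₂ : Store} {t₁ t₂ : ℕ} :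
      b.holds s → Exec A s s₁ t₁ → Exec (.loop b A) s₁ s₂ t₂ →
      Exec (.loop b A) s s₂ (t₁ + t₂ + 1)

/-! Offline Dynamic Rectangle Cover. -/

/-- The closed rectangle `[x₀, x₁] × [y₀, y₁]` with integral coordinates. -/
structure Rect where
  x₀ : ℕ
  x₁ : ℕ
  y₀ : ℕ
  y₁ : ℕ
deriving DecidableEq

/-- The rectangle as a set of points of the plane. -/
def Rect.toSet (R : Rect) : Set (ℝ × ℝ) :=
  Set.Icc (R.x₀ : ℝ) R.x₁ ×ˢ Set.Icc (R.y₀ : ℝ) R.y₁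

/-- `R` is a rectangle inside `[1, N] × [1, N]`. -/
def Rect.Within (R : Rect) (N : ℕ) : Prop :=
  1 ≤ R.x₀ ∧ R.x₀ ≤ R.x₁ ∧ R.x₁ ≤ N ∧ 1 ≤ R.y₀ ∧ R.y₀ ≤ R.y₁ ∧ R.y₁ ≤ N

/-- The rectangles of `S` cover all (real) points of `[1, N] × [1, N]`. -/
def Covers (S : Finset Rect) (N : ℕ) : Prop :=
  Set.Icc (1 : ℝ) N ×ˢ Set.Icc (1 : ℝ) N ⊆ ⋃ R ∈ S, R.toSet

/-- An update of a set of rectangles. -/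
inductive Update where
  | add (R : Rect)
  | delete (R : Rect)

/-- The rectangle that an update concerns. -/
def Update.rect : Update → Rect
  | .add R => R
  | .delete R => R

/-- The flag of an update in the input: `1` for an addition, `0` for a deletion. -/
def Update.flag : Update → ℕ
  | .add _ => 1
  | .delete _ => 0

/-- The effect of an update. -/
def Update.apply (S : Finset Rect) : Update → Finset Rect
  | .add R => insert R S
  | .delete R => S.erase R

/-- The update is allowed on the set `S`: a deleted rectangle is in `S`; an added one lies in
`[1, N] × [1, N]` and is new. -/
def Update.Allowed (N : ℕ) (S : Finset Rect) : Update → Prop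
  | .add R => R.Within N ∧ R ∉ S
  | .delete R => R ∈ S

/-- The set of rectangles after the first `k` updates. -/
def stateAfter (init : List Rect) (updates : List Update) (k : ℕ) : Finset Rect :=
  (updates.take k).foldl Update.apply init.toFinset

/-- An instance of Offline Dynamic Rectangle Cover: an initial set of at most `n` rectangles
in `[1, N] × [1, N]` and a sequence of updates, during which there are never more than `n`
rectangles. -/
structure CoverInstance where
  n : ℕ
  N : ℕ
  init : List Rect
  updates : List Update
  one_le_N : 1 ≤ N
  init_nodup : init.Nodup
  init_within : ∀ R ∈ init, R.Within N
  allowed : ∀ (k : ℕ) (hk : k < updates.length),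
    (updates[k]).Allowed N (stateAfter init updates k)
  card_le : ∀ k ≤ updates.length, (stateAfter init updates k).card ≤ n

/-- The correct answer: the number `i` (counted from `1`) of the first update after which the
rectangles do not cover `[1, N] × [1, N]`, or `0` if there is no such update. -/
def CoverInstance.IsAnswer (I : CoverInstance) (i : ℕ) : Prop :=
  (1 ≤ i ∧ i ≤ I.updates.length ∧ ¬ Covers (stateAfter I.init I.updates i) I.N ∧
    ∀ j, 1 ≤ j → j < i → Covers (stateAfter I.init I.updates j) I.N) ∨
  (i = 0 ∧ ∀ j, 1 ≤ j → j ≤ I.updates.length → Covers (stateAfter I.init I.updates j) I.N)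

/-- The input of a rectangle cover program.  Array `0` holds `n`, `N`, the number of initial
rectangles and the number of updates; arrays `1`-`4` hold the coordinates of the initial
rectangles, array `5` the flags and arrays `6`-`9` the coordinates of the updates.  All other
cells are `0`. -/
def CoverInstance.encode (I : CoverInstance) : Store where
  nat := fun a i => match a with
    | 0 => [I.n, I.N, I.init.length, I.updates.length].getD i 0
    | 1 => (I.init.map Rect.x₀).getD i 0
    | 2 => (I.init.map Rect.x₁).getD i 0
    | 3 => (I.init.map Rect.y₀).getD i 0
    | 4 => (I.init.map Rect.y₁).getD i 0
    | 5 => (I.updates.map Update.flag).getD i 0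
    | 6 => (I.updates.map fun u => u.rect.x₀).getD i 0
    | 7 => (I.updates.map fun u => u.rect.x₁).getD i 0
    | 8 => (I.updates.map fun u => u.rect.y₀).getD i 0
    | 9 => (I.updates.map fun u => u.rect.y₁).getD i 0
    | _ => 0
  real := fun _ _ => 0

/-- The program `A` solves Offline Dynamic Rectangle Cover on all instances with `N ≤ c * n`, and
takes at most `T n U` steps on those with parameter `n` and `U` updates.  The answer is left in
cell `0` of array `10`. -/
def SolvesRectangleCover (A : Prog) (c : ℕ) (T : ℕ → ℕ → ℕ) : Prop :=
  ∀ I : CoverInstance, I.N ≤ c * I.n →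
    ∃ (s : Store) (t : ℕ), Exec A I.encode s t ∧ t ≤ T I.n I.updates.length ∧
      I.IsAnswer (s.nat 10 0)

/-! Orthogonal simple polygons and the largest scaling factor. -/

/-- An orthogonal simple polygon with `n` vertices, listed along its boundary (in either
direction; `finRotate n i` is the cyclic successor of `i`).  The edges have positive length and
are horizontal or vertical, and the boundary curve does not meet itself: the half-open edges
(start included, end excluded) are pairwise disjoint. -/
structure OrthogonalPolygon (n : ℕ) extends Polygon (ℝ × ℝ) n where
  three_le : 3 ≤ n
  nondegenerate : toPolygon.HasNondegenerateEdges
  axis_parallel : ∀ i, (vertices i).1 = (vertices (finRotate n i)).1 ∨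
    (vertices i).2 = (vertices (finRotate n i)).2
  simple : ∀ i j, i ≠ j →
    Disjoint (toPolygon.edgeSet ℝ i \ {vertices (finRotate n i)})
      (toPolygon.edgeSet ℝ j \ {vertices (finRotate n j)})

/-- The (vertical) edge `i` is crossed by the horizontal ray that starts at `z` and goes to the
right.  An edge contains its lower but not its upper end here, so that each passage of the
boundary through the ray is counted once. -/
def OrthogonalPolygon.Crosses {n : ℕ} (P : OrthogonalPolygon n) (z : ℝ × ℝ) (i : Fin n) : Prop :=
  z.1 < (P.vertices i).1 ∧
    (((P.vertices i).2 ≤ z.2 ∧ z.2 < (P.vertices (finRotate n i)).2) ∨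
      ((P.vertices (finRotate n i)).2 ≤ z.2 ∧ z.2 < (P.vertices i).2))

/-- The closed region bounded by the polygon: its boundary and the points inside it, a point off
the boundary being inside if the horizontal ray from it to the right crosses the boundary an odd
number of times (even-odd rule, which for a simple polygon gives the bounded component of the
complement of the boundary). -/
def OrthogonalPolygon.region {n : ℕ} (P : OrthogonalPolygon n) : Set (ℝ × ℝ) :=
  P.toPolygon.boundary ℝ ∪ {z | Odd {i | P.Crosses z i}.ncard}

/-- The scaled copy `lam P` can be translated into `Q`. -/
def Fits {p q : ℕ} (P : OrthogonalPolygon p) (Q : OrthogonalPolygon q) (lam : ℝ) : Prop :=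
  ∃ τ : ℝ × ℝ, ∀ z ∈ P.region, lam • z + τ ∈ Q.region

/-- `lam` is the largest scaling factor for which `P` can be placed into `Q` by translation. -/
def IsLargestScaling {p q : ℕ} (P : OrthogonalPolygon p) (Q : OrthogonalPolygon q)
    (lam : ℝ) : Prop :=
  IsGreatest {l : ℝ | 0 < l ∧ Fits P Q l} lam

/-- Cell `i` of an array that lists the values of `f`. -/
noncomputable def cellOf {n : ℕ} (f : Fin n → ℝ) (i : ℕ) : ℝ :=
  if h : i < n then f ⟨i, h⟩ else 0

/-- The input of a polygon placement program.  The natural-number array `0` holds `p` and `q`;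
the real arrays `0`-`3` hold the abscissas and ordinates of the vertices of `P` and of `Q`.  All
other cells are `0`. -/
noncomputable def encodePolygons {p q : ℕ} (P : OrthogonalPolygon p) (Q : OrthogonalPolygon q) :
    Store where
  nat := fun a i => match a with
    | 0 => [p, q].getD i 0
    | _ => 0
  real := fun a i => match a with
    | 0 => cellOf (fun k => (P.vertices k).1) i
    | 1 => cellOf (fun k => (P.vertices k).2) i
    | 2 => cellOf (fun k => (Q.vertices k).1) i
    | 3 => cellOf (fun k => (Q.vertices k).2) i
    | _ => 0

/-- The program `A` computes the largest scaling factor for all orthogonal simple polygons with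
`p` and `q` vertices in at most `F p q` steps.  The result is left in cell `0` of the real
array `4`. -/
def ComputesLargestScaling (A : Prog) (F : ℕ → ℕ → ℝ) : Prop :=
  ∀ (p q : ℕ) (P : OrthogonalPolygon p) (Q : OrthogonalPolygon q),
    ∃ (s : Store) (t : ℕ), Exec A (encodePolygons P Q) s t ∧ (t : ℝ) ≤ F p q ∧
      IsLargestScaling P Q (s.real 4 0)

end PolygonPlacement

/-! Geometry. Slide a vertical chord through a simple orthogonal chain: every generic point lies in
an open rectangle that starts on the chord just right of some vertex, either just above or just
below that vertex. For a prescribed parity (inside or outside) each vertex starts at most one such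
rectangle, and the vertices of largest abscissa, of which there are at least two, start none. So the
inside of `P` is, up to closure, a union of at most `p - 2` open boxes, and the complement of `Q` is
one of at most `q` open boxes, two half planes included (`Chain.exists_cell`, `Chain.inside_boxes`,
`Chain.outside_boxes`). The boxes may overlap; only containment and density are used. Since the
region of `Q` is closed, a copy `lam P + τ` lies in `Q` exactly if no transformed box `B` of `P`
meets a box `C` of the complement (`fits_iff`). For one pair of boxes the forbidden `τ` form an open
rectangle with sides such as `C.l - lam * B.r`, which move linearly in `lam`. Hence `lam` is
feasible iff these `m ≤ pq - 6` moving rectangles do not cover the plane.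

Sweep. Whether they cover depends only on the order of the moving sides, so each coordinate is
replaced by its rank. While `lam` decreases from infinity to `0`, each pair of lines changes places
at most once, and a change affects two rectangles, that is, it costs four updates. The time of the
first change after which the rank rectangles fail to cover is the answer (`Kin.largest`). They cover
at the start because nothing fits for huge `lam`, and fail to cover eventually because `P` fits for
small `lam`; the existence of the maximum thus comes from the sweep and needs no compactness
argument.

Two degeneracies are removed by symbolic perturbation. Simultaneous changes are put in order by
replacing time and position by lexicographic triples; the last component of the position is `a ^ 2 -
s * a`, so that no three lines meet at one time (`Kin.Ordered.no_triple`). The moving rectangles are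
open but the rank rectangles are closed: the tie-breaking numbers `c` are positive for left and
lower sides and negative for right and upper ones, so that at equal coordinates closing sides come
first and touching rectangles leave a gap in rank space.

Cost. There are `4m` lines and at most `16(pq)²` ordered pairs, which merge sort handles in `O((pq)²
log(pq))` steps. The function `T` is not assumed to be monotone, so every call of the given program
must have exactly the parameters `pq` and `(pq)²`. The changes are therefore dealt with in 160
phases of `⌊(pq)²/4⌋` list entries each; entries without a change become harmless dummy updates, and
one filler update is appended if `(pq)²` is odd. Every phase runs its own copy of the program on
renamed arrays that are still empty, and starts from the rectangles at which the previous phase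
ended. The side length `N = 4m + 1` of the instances gives `c = 4`. -/

namespace PolygonPlacement

/-! ### Running programs -/

/-- The arrays of natural numbers that a program may write to. -/
def Prog.wN : Prog → List ℕ
  | .skip => []
  | .setN a _ _ => [a]
  | .setR _ _ _ => []
  | .seq A B => A.wN ++ B.wN
  | .ite _ A B => A.wN ++ B.wN
  | .loop _ A => A.wN

/-- The arrays of reals that a program may write to. -/
def Prog.wR : Prog → List ℕ
  | .skip => []
  | .setN _ _ _ => []
  | .setR a _ _ => [a]
  | .seq A B => A.wR ++ B.wR
  | .ite _ A B => A.wR ++ B.wR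
  | .loop _ A => A.wR

/-- Two stores agree on all arrays that a program does not write to. -/
structure SameOff (A : Prog) (s s' : Store) : Prop where
  nat : ∀ a, a ∉ A.wN → s'.nat a = s.nat a
  real : ∀ a, a ∉ A.wR → s'.real a = s.real a

theorem Store.writeN_nat (s : Store) (a i v b j : ℕ) :
    (s.writeN a i v).nat b j = if b = a ∧ j = i then v else s.nat b j := by
  unfold Store.writeN
  by_cases h : b = a
  · subst h; by_cases h' : j = i <;> simp [h']
  · simp [h]

theorem Store.writeR_real (s : Store) (a i : ℕ) (v : ℝ) (b j : ℕ) :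
    (s.writeR a i v).real b j = if b = a ∧ j = i then v else s.real b j := by
  unfold Store.writeR
  by_cases h : b = a
  · subst h; by_cases h' : j = i <;> simp [h']
  · simp [h]

theorem Store.writeN_nat_ne (s : Store) {a b : ℕ} (i v : ℕ) (h : b ≠ a) :
    (s.writeN a i v).nat b = s.nat b := by
  simp [Store.writeN, h]

theorem Store.writeR_real_ne (s : Store) {a b : ℕ} (i : ℕ) (v : ℝ) (h : b ≠ a) :
    (s.writeR a i v).real b = s.real b := by
  simp [Store.writeR, h]

theorem Store.writeN_real (s : Store) (a i v : ℕ) : (s.writeN a i v).real = s.real := rfl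

theorem Store.writeR_nat (s : Store) (a i : ℕ) (v : ℝ) : (s.writeR a i v).nat = s.nat := rfl

/-- Frame rule. The written arrays are determined syntactically, so in the correctness proofs below
that an array is preserved is a decidable membership question. -/
theorem Exec.sameOff {A : Prog} {s s' : Store} {t : ℕ} (h : Exec A s s' t) : SameOff A s s' := by
  induction h with
  | skip s => exact ⟨fun _ _ => rfl, fun _ _ => rfl⟩
  | setN s a e f =>
    refine ⟨fun b hb => ?_, fun _ _ => rfl⟩
    simp only [Prog.wN, List.mem_singleton] at hb
    exact s.writeN_nat_ne _ _ hb
  | setR s a e f =>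
    refine ⟨fun _ _ => rfl, fun b hb => ?_⟩
    simp only [Prog.wR, List.mem_singleton] at hb
    exact s.writeR_real_ne _ _ hb
  | seq _ _ h1 h2 =>
    refine ⟨fun b hb => ?_, fun b hb => ?_⟩
    · simp only [Prog.wN, List.mem_append, not_or] at hb
      rw [h2.nat b hb.2, h1.nat b hb.1]
    · simp only [Prog.wR, List.mem_append, not_or] at hb
      rw [h2.real b hb.2, h1.real b hb.1]
  | ite_true _ _ h =>
    refine ⟨fun b hb => ?_, fun b hb => ?_⟩
    · simp only [Prog.wN, List.mem_append, not_or] at hb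
      exact h.nat b hb.1
    · simp only [Prog.wR, List.mem_append, not_or] at hb
      exact h.real b hb.1
  | ite_false _ _ h =>
    refine ⟨fun b hb => ?_, fun b hb => ?_⟩
    · simp only [Prog.wN, List.mem_append, not_or] at hb
      exact h.nat b hb.2
    · simp only [Prog.wR, List.mem_append, not_or] at hb
      exact h.real b hb.2
  | loop_done => exact ⟨fun _ _ => rfl, fun _ _ => rfl⟩
  | loop_step _ _ _ h1 h2 =>
    refine ⟨fun b hb => ?_, fun b hb => ?_⟩
    · rw [h2.nat b hb]; exact h1.nat b hb
    · rw [h2.real b hb]; exact h1.real b hb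

/-- Started in `s`, the program `A` halts after at most `t` steps in a state with `Q`. -/
def Runs (A : Prog) (s : Store) (t : ℕ) (Q : Store → Prop) : Prop :=
  ∃ s' t', Exec A s s' t' ∧ t' ≤ t ∧ Q s'

theorem Runs.mono {A : Prog} {s : Store} {t t' : ℕ} {Q Q' : Store → Prop}
    (h : Runs A s t Q) (ht : t ≤ t') (hQ : ∀ s', SameOff A s s' → Q s' → Q' s') :
    Runs A s t' Q' := by
  obtain ⟨s', u, he, hu, hq⟩ := h
  exact ⟨s', u, he, hu.trans ht, hQ s' he.sameOff hq⟩

theorem Runs.seq {A B : Prog} {s : Store} {t₁ t₂ : ℕ} {Q : Store → Prop}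
    (h : Runs A s t₁ fun s₁ => Runs B s₁ t₂ Q) : Runs (.seq A B) s (t₁ + t₂) Q := by
  obtain ⟨s', u, he, hu, s'', u', he', hu', hq⟩ := h
  exact ⟨s'', _, he.seq he', Nat.add_le_add hu hu', hq⟩

theorem Runs.andThen {A B : Prog} {s : Store} {t t₁ t₂ : ℕ} {Q R : Store → Prop}
    (h : Runs A s t₁ R) (ht : t₁ + t₂ ≤ t)
    (h' : ∀ s₁, SameOff A s s₁ → R s₁ → Runs B s₁ t₂ Q) : Runs (.seq A B) s t Q :=
  (Runs.seq (h.mono le_rfl h')).mono ht fun _ _ h => h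

theorem Runs.ite {A B : Prog} {b : Test} {s : Store} {t : ℕ} {Q : Store → Prop}
    (h1 : b.holds s → Runs A s t Q) (h2 : ¬ b.holds s → Runs B s t Q) :
    Runs (.ite b A B) s (t + 1) Q := by
  by_cases hb : b.holds s
  · obtain ⟨s', u, he, hu, hq⟩ := h1 hb
    exact ⟨s', _, .ite_true hb he, by omega, hq⟩
  · obtain ⟨s', u, he, hu, hq⟩ := h2 hb
    exact ⟨s', _, .ite_false hb he, by omega, hq⟩

theorem Runs.skip {s : Store} {Q : Store → Prop} (h : Q s) : Runs .skip s 0 Q :=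
  ⟨s, 0, .skip s, le_rfl, h⟩

open Classical in
/-- The final state of a loop-free program. -/
noncomputable def Prog.run : Prog → Store → Store
  | .skip, s => s
  | .setN a e f, s => s.writeN a (e.eval s) (f.eval s)
  | .setR a e f, s => s.writeR a (e.eval s) (f.eval s)
  | .seq A B, s => B.run (A.run s)
  | .ite b A B, s => if b.holds s then A.run s else B.run s
  | .loop _ _, s => s

/-- A program without loops. -/
def Prog.straight : Prog → Bool
  | .seq A B => A.straight && B.straight
  | .ite _ A B => A.straight && B.straight
  | .loop _ _ => false
  | _ => true

/-- A bound for the running time of a loop-free program. -/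
def Prog.size : Prog → ℕ
  | .skip => 0
  | .setN _ _ _ => 1
  | .setR _ _ _ => 1
  | .seq A B => A.size + B.size
  | .ite _ A B => A.size + B.size + 1
  | .loop _ _ => 0

theorem Prog.exec_run {A : Prog} (h : A.straight = true) (s : Store) :
    ∃ t, t ≤ A.size ∧ Exec A s (A.run s) t := by
  induction A generalizing s with
  | skip => exact ⟨0, le_rfl, .skip s⟩
  | setN a e f => exact ⟨1, le_rfl, .setN s a e f⟩
  | setR a e f => exact ⟨1, le_rfl, .setR s a e f⟩
  | seq A B hA hB =>
    simp only [straight, Bool.and_eq_true] at h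
    obtain ⟨t, ht, he⟩ := hA h.1 s
    obtain ⟨u, hu, he'⟩ := hB h.2 (A.run s)
    exact ⟨t + u, Nat.add_le_add ht hu, he.seq he'⟩
  | ite b A B hA hB =>
    simp only [straight, Bool.and_eq_true] at h
    obtain ⟨t, ht, he⟩ := hA h.1 s
    obtain ⟨u, hu, he'⟩ := hB h.2 s
    by_cases hb : b.holds s
    · exact ⟨t + 1, by simp only [size]; omega, by simpa [run, hb] using Exec.ite_true hb he⟩
    · exact ⟨u + 1, by simp only [size]; omega, by simpa [run, hb] using Exec.ite_false hb he'⟩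
  | loop b A _ => simp [straight] at h

theorem Runs.straight {A : Prog} {s : Store} {t : ℕ} {Q : Store → Prop}
    (h : A.straight = true) (ht : A.size ≤ t) (hQ : Q (A.run s)) : Runs A s t Q := by
  obtain ⟨u, hu, he⟩ := Prog.exec_run h s
  exact ⟨_, u, he, hu.trans ht, hQ⟩

/-- Induction on the potential `Φ`, which pays for the body and the successful test of each round;
the additional step pays for the failing test at the end. -/
theorem Runs.loop {A : Prog} {b : Test} {s : Store} (Inv : Store → Prop) (Φ : Store → ℕ)
    (h0 : Inv s)
    (step : ∀ s₁, SameOff (.loop b A) s s₁ → Inv s₁ → b.holds s₁ →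
      ∃ τ, Runs A s₁ τ fun s₂ => Inv s₂ ∧ Φ s₂ + τ + 1 ≤ Φ s₁) :
    Runs (.loop b A) s (Φ s + 1) fun s' => Inv s' ∧ ¬ b.holds s' := by
  have main : ∀ n s₁, Φ s₁ ≤ n → SameOff (.loop b A) s s₁ → Inv s₁ →
      Runs (.loop b A) s₁ (Φ s₁ + 1) fun s' => Inv s' ∧ ¬ b.holds s' := by
    intro n
    induction n with
    | zero =>
      intro s₁ hn hs hi
      by_cases hb : b.holds s₁
      · obtain ⟨τ, s₂, u, _, _, _, h⟩ := step s₁ hs hi hb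
        omega
      · exact ⟨s₁, 1, .loop_done hb, by omega, hi, hb⟩
    | succ n ih =>
      intro s₁ hn hs hi
      by_cases hb : b.holds s₁
      · obtain ⟨τ, s₂, u, he, hu, hi₂, hΦ⟩ := step s₁ hs hi hb
        have hs₂ : SameOff (.loop b A) s s₂ :=
          ⟨fun a ha => by rw [← hs.nat a ha]; exact he.sameOff.nat a ha,
            fun a ha => by rw [← hs.real a ha]; exact he.sameOff.real a ha⟩
        obtain ⟨s₃, v, he₃, hv, hq⟩ := ih s₂ (by omega) hs₂ hi₂
        exact ⟨s₃, _, .loop_step hb he he₃, by omega, hq⟩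
      · exact ⟨s₁, 1, .loop_done hb, by omega, hi, hb⟩
  exact main _ s le_rfl ⟨fun _ _ => rfl, fun _ _ => rfl⟩ h0

/-! ### Abbreviations for expressions and programs -/

/-- The scalar variable stored in cell `0` of an array. -/
abbrev nv (a : ℕ) : NExpr := .cell a (.const 0)

/-- Disjunction of tests. -/
def Test.or (b c : Test) : Test := .not (.and (.not b) (.not c))

/-- Equality of natural numbers. -/
def Test.neq (e f : NExpr) : Test := .and (.not (.nlt e f)) (.not (.nlt f e))

/-- Equality of reals. -/
def Test.req (e f : RExpr) : Test := .and (.not (.rlt e f)) (.not (.rlt f e))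

theorem Test.holds_nlt (s : Store) (e f : NExpr) : (Test.nlt e f).holds s ↔ e.eval s < f.eval s :=
  Iff.rfl
theorem Test.holds_rlt (s : Store) (e f : RExpr) : (Test.rlt e f).holds s ↔ e.eval s < f.eval s :=
  Iff.rfl
theorem Test.holds_and (s : Store) (b c : Test) :
    (Test.and b c).holds s ↔ b.holds s ∧ c.holds s := Iff.rfl
theorem Test.holds_not (s : Store) (b : Test) : (Test.not b).holds s ↔ ¬ b.holds s := Iff.rfl
theorem Test.holds_or (s : Store) (b c : Test) :
    (Test.or b c).holds s ↔ b.holds s ∨ c.holds s := by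
  simp only [Test.or, Test.holds]; tauto
theorem Test.holds_neq (s : Store) (e f : NExpr) :
    (Test.neq e f).holds s ↔ e.eval s = f.eval s := by
  simp only [Test.neq, Test.holds]; omega
theorem Test.holds_req (s : Store) (e f : RExpr) :
    (Test.req e f).holds s ↔ e.eval s = f.eval s := by
  simp only [Test.req, Test.holds, not_lt]; exact ⟨fun h => le_antisymm h.2 h.1, fun h => ⟨h.ge, h.le⟩⟩

/-- Increment a scalar variable. -/
abbrev incr (c : ℕ) : Prog := .setN c (.const 0) (.add (nv c) (.const 1))

/-- Run `A` with the scalar variable `c` equal to `0, 1, …` as long as it is below `e`. -/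
abbrev forLoop (c : ℕ) (e : NExpr) (A : Prog) : Prog :=
  .seq (.setN c (.const 0) (.const 0)) (.loop (.nlt (nv c) e) (.seq A (incr c)))

/-- Each round costs the body, one increment and one test; the remaining two steps are the
initialization of the counter and the last test. The invariant is required after the counter has
been updated, because it may mention the array of the counter. -/
theorem Runs.for {c n tA : ℕ} {e : NExpr} {A : Prog} {s : Store} (Inv : ℕ → Store → Prop)
    (hc : c ∉ A.wN)
    (he : ∀ s₁, SameOff (forLoop c e A) s s₁ → e.eval s₁ = n)
    (h0 : Inv 0 (s.writeN c 0 0))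
    (step : ∀ i s₁, i < n → SameOff (forLoop c e A) s s₁ → s₁.nat c 0 = i → Inv i s₁ →
      Runs A s₁ tA fun s₂ => Inv (i + 1) (s₂.writeN c 0 (i + 1))) :
    Runs (forLoop c e A) s (n * (tA + 2) + 2) (Inv n) := by
  have h00 : SameOff (forLoop c e A) s (s.writeN c 0 0) :=
    ⟨fun a ha => by
      simp only [Prog.wN, List.mem_append, List.mem_singleton, not_or] at ha
      exact s.writeN_nat_ne _ _ ha.1, fun _ _ => rfl⟩
  have key : Runs (.loop (.nlt (nv c) e) (.seq A (incr c))) (s.writeN c 0 0)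
      ((fun s => (n - s.nat c 0) * (tA + 2)) (s.writeN c 0 0) + 1) fun s' =>
        (s'.nat c 0 ≤ n ∧ SameOff (forLoop c e A) s s' ∧ Inv (s'.nat c 0) s') ∧
          ¬ (Test.nlt (nv c) e).holds s' := by
    apply Runs.loop (fun s' => s'.nat c 0 ≤ n ∧ SameOff (forLoop c e A) s s' ∧
      Inv (s'.nat c 0) s') (fun s => (n - s.nat c 0) * (tA + 2))
    · refine ⟨by simp [Store.writeN_nat], h00, by simpa [Store.writeN_nat] using h0⟩
    · rintro s₁ - ⟨hle, hs₁, hi⟩ hb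
      have hlt : s₁.nat c 0 < n := by
        have := hb
        simp only [Test.holds, NExpr.eval, he s₁ hs₁] at this
        exact this
      refine ⟨tA + 1, Runs.andThen (step _ s₁ hlt hs₁ rfl hi) le_rfl ?_⟩
      intro s₂ hs₂ hi₂
      apply Runs.straight rfl le_rfl
      have hcc : s₂.nat c 0 = s₁.nat c 0 := by rw [hs₂.nat c hc]
      have hrun : (incr c).run s₂ = s₂.writeN c 0 (s₁.nat c 0 + 1) := by
        simp [Prog.run, NExpr.eval, hcc]
      rw [hrun]
      have hct : (s₂.writeN c 0 (s₁.nat c 0 + 1)).nat c 0 = s₁.nat c 0 + 1 := by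
        simp [Store.writeN_nat]
      refine ⟨⟨by rw [hct]; omega, ⟨fun a ha => ?_, fun a ha => ?_⟩, by rw [hct]; exact hi₂⟩, ?_⟩
      · have ha' := ha
        simp only [Prog.wN, List.mem_append, List.mem_singleton, not_or] at ha
        rw [s₂.writeN_nat_ne _ _ ha.1, hs₂.nat a ha.2.1, hs₁.nat a ha']
      · have ha' := ha
        simp only [Prog.wR, List.mem_append, not_or] at ha
        rw [Store.writeN_real, hs₂.real a ha.2.1, hs₁.real a ha']
      · show (n - (s₂.writeN c 0 (s₁.nat c 0 + 1)).nat c 0) * (tA + 2) + (tA + 1) + 1 ≤ _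
        rw [hct]
        obtain ⟨k, hk⟩ : ∃ k, n - s₁.nat c 0 = k + 1 := ⟨n - s₁.nat c 0 - 1, by omega⟩
        have hk' : n - (s₁.nat c 0 + 1) = k := by omega
        rw [hk, hk', Nat.add_mul]; omega
  have hz : (s.writeN c 0 0).nat c 0 = 0 := by simp [Store.writeN_nat]
  refine Runs.andThen (t₁ := 1) (t₂ := n * (tA + 2) + 1) (R := fun s' => s' = s.writeN c 0 0)
    (Runs.straight rfl le_rfl (by simp [Prog.run, NExpr.eval])) (by omega) ?_
  rintro _ - rfl
  refine key.mono (by simp [hz]) ?_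
  rintro s' - ⟨⟨h1, h2, h3⟩, h4⟩
  simp only [Test.holds, NExpr.eval, he s' h2, not_lt] at h4
  rwa [le_antisymm h1 h4] at h3

/-! ### Renaming the arrays of a program -/

/-- Rename the arrays in an expression. -/
def NExpr.rename (f : ℕ → ℕ) : NExpr → NExpr
  | .const k => .const k
  | .cell a e => .cell (f a) (e.rename f)
  | .add e e' => .add (e.rename f) (e'.rename f)
  | .sub e e' => .sub (e.rename f) (e'.rename f)

/-- Rename the arrays in an expression. -/
def RExpr.rename (f : ℕ → ℕ) : RExpr → RExpr
  | .cast e => .cast (e.rename f)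
  | .cell a e => .cell (f a) (e.rename f)
  | .add e e' => .add (e.rename f) (e'.rename f)
  | .sub e e' => .sub (e.rename f) (e'.rename f)
  | .mul e e' => .mul (e.rename f) (e'.rename f)
  | .div e e' => .div (e.rename f) (e'.rename f)

/-- Rename the arrays in a test. -/
def Test.rename (f : ℕ → ℕ) : Test → Test
  | .nlt e e' => .nlt (e.rename f) (e'.rename f)
  | .rlt e e' => .rlt (e.rename f) (e'.rename f)
  | .not b => .not (b.rename f)
  | .and b c => .and (b.rename f) (c.rename f)

/-- Rename the arrays in a program. -/
def Prog.rename (f : ℕ → ℕ) : Prog → Prog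
  | .skip => .skip
  | .setN a e e' => .setN (f a) (e.rename f) (e'.rename f)
  | .setR a e e' => .setR (f a) (e.rename f) (e'.rename f)
  | .seq A B => .seq (A.rename f) (B.rename f)
  | .ite b A B => .ite (b.rename f) (A.rename f) (B.rename f)
  | .loop b A => .loop (b.rename f) (A.rename f)

/-- The part of a store that a program with renamed arrays sees. -/
def Store.view (f : ℕ → ℕ) (s : Store) : Store := ⟨fun a => s.nat (f a), fun a => s.real (f a)⟩

theorem NExpr.eval_rename (f : ℕ → ℕ) (s : Store) (e : NExpr) :
    (e.rename f).eval s = e.eval (s.view f) := by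
  induction e with
  | const k => rfl
  | cell a e ih => simp [rename, eval, ih, Store.view]
  | add e e' h h' => simp [rename, eval, h, h']
  | sub e e' h h' => simp [rename, eval, h, h']

theorem RExpr.eval_rename (f : ℕ → ℕ) (s : Store) (e : RExpr) :
    (e.rename f).eval s = e.eval (s.view f) := by
  induction e with
  | cast e => simp [rename, eval, NExpr.eval_rename]
  | cell a e => simp [rename, eval, NExpr.eval_rename, Store.view]
  | add e e' h h' => simp [rename, eval, h, h']
  | sub e e' h h' => simp [rename, eval, h, h']
  | mul e e' h h' => simp [rename, eval, h, h']
  | div e e' h h' => simp [rename, eval, h, h']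

theorem Test.holds_rename (f : ℕ → ℕ) (s : Store) (b : Test) :
    (b.rename f).holds s ↔ b.holds (s.view f) := by
  induction b with
  | nlt e e' => simp [rename, holds, NExpr.eval_rename]
  | rlt e e' => simp [rename, holds, RExpr.eval_rename]
  | not b h => simp [rename, holds, h]
  | and b c h h' => simp [rename, holds, h, h']

theorem Store.view_writeN {f : ℕ → ℕ} (hf : f.Injective) (s : Store) (a i v : ℕ) :
    (s.writeN (f a) i v).view f = (s.view f).writeN a i v := by
  unfold view writeN
  congr 1
  funext b j
  by_cases h : b = a
  · subst h; simp
  · simp [h, hf.ne h]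

theorem Store.view_writeR {f : ℕ → ℕ} (hf : f.Injective) (s : Store) (a i : ℕ) (v : ℝ) :
    (s.writeR (f a) i v).view f = (s.view f).writeR a i v := by
  unfold view writeR
  congr 1
  funext b j
  by_cases h : b = a
  · subst h; simp
  · simp [h, hf.ne h]

/-- The input format demands zeros in all unused cells, so a second call of the same program needs
arrays that no earlier call has touched. An injective renaming simulates the program step by step,
with the same running time. -/
theorem Exec.rename {f : ℕ → ℕ} (hf : f.Injective) {A : Prog} {s s' : Store} {t : ℕ}
    (h : Exec A s s' t) (u : Store) (hu : u.view f = s) :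
    ∃ u', Exec (A.rename f) u u' t ∧ u'.view f = s' := by
  induction h generalizing u with
  | skip s => exact ⟨u, .skip u, hu⟩
  | setN s a e e' =>
    refine ⟨_, .setN u _ _ _, ?_⟩
    rw [Store.view_writeN hf, hu, NExpr.eval_rename, NExpr.eval_rename, hu]
  | setR s a e e' =>
    refine ⟨_, .setR u _ _ _, ?_⟩
    rw [Store.view_writeR hf, hu, NExpr.eval_rename, RExpr.eval_rename, hu]
  | seq _ _ h1 h2 =>
    obtain ⟨u₁, he₁, hu₁⟩ := h1 u hu
    obtain ⟨u₂, he₂, hu₂⟩ := h2 u₁ hu₁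
    exact ⟨u₂, he₁.seq he₂, hu₂⟩
  | ite_true hb _ h =>
    obtain ⟨u', he, hu'⟩ := h u hu
    exact ⟨u', .ite_true (by rwa [Test.holds_rename, hu]) he, hu'⟩
  | ite_false hb _ h =>
    obtain ⟨u', he, hu'⟩ := h u hu
    exact ⟨u', .ite_false (by rwa [Test.holds_rename, hu]) he, hu'⟩
  | loop_done hb => exact ⟨u, .loop_done (by rwa [Test.holds_rename, hu]), hu⟩
  | loop_step hb _ _ h1 h2 =>
    obtain ⟨u₁, he₁, hu₁⟩ := h1 u hu
    obtain ⟨u₂, he₂, hu₂⟩ := h2 u₁ hu₁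
    exact ⟨u₂, .loop_step (by rwa [Test.holds_rename, hu]) he₁ he₂, hu₂⟩

theorem Prog.wN_rename (f : ℕ → ℕ) (A : Prog) : (A.rename f).wN = A.wN.map f := by
  induction A <;> simp_all [rename, wN]

theorem Prog.wR_rename (f : ℕ → ℕ) (A : Prog) : (A.rename f).wR = A.wR.map f := by
  induction A <;> simp_all [rename, wR]

open Set

/-! ### Closed orthogonal chains -/

/-- The point `z` is on the axis-parallel edge from vertex `i` to vertex `i + 1`. -/
def OnEdge (X Y : ℕ → ℝ) (i : ℕ) (z : ℝ × ℝ) : Prop :=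
  z.1 ∈ uIcc (X i) (X (i + 1)) ∧ z.2 ∈ uIcc (Y i) (Y (i + 1))

/-- The edge from vertex `i` to vertex `i + 1` passes over the abscissa just right of `x`. -/
def Spans (X : ℕ → ℝ) (x : ℝ) (i : ℕ) : Prop :=
  (X i ≤ x ∧ x < X (i + 1)) ∨ (X (i + 1) ≤ x ∧ x < X i)

/-- The vertices `(X 0, Y 0), …, (X (n - 1), Y (n - 1))`, followed by the first one again, form
a closed orthogonal curve that does not meet itself. -/
structure Chain (n : ℕ) (X Y : ℕ → ℝ) : Prop where
  three_le : 3 ≤ n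
  closedX : X n = X 0
  closedY : Y n = Y 0
  axis : ∀ i < n, X i = X (i + 1) ∨ Y i = Y (i + 1)
  nondeg : ∀ i < n, ¬ (X i = X (i + 1) ∧ Y i = Y (i + 1))
  simple : ∀ i < n, ∀ j < n, ∀ z, OnEdge X Y i z → OnEdge X Y j z →
    z ≠ (X (i + 1), Y (i + 1)) → z ≠ (X (j + 1), Y (j + 1)) → i = j

open Classical in
/-- The number of edges that are crossed by the ray from `z` to the right. -/
noncomputable def crossCount (n : ℕ) (X Y : ℕ → ℝ) (z : ℝ × ℝ) : ℕ :=
  ((Finset.range n).filter fun i => z.1 < X i ∧ Spans Y z.2 i).card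

/-- The closed region bounded by a chain. -/
def chainRegion (n : ℕ) (X Y : ℕ → ℝ) : Set (ℝ × ℝ) :=
  {z | (∃ i < n, OnEdge X Y i z) ∨ Odd (crossCount n X Y z)}

theorem OnEdge.swap {X Y : ℕ → ℝ} {i : ℕ} {z : ℝ × ℝ} (h : OnEdge X Y i z) :
    OnEdge Y X i z.swap := ⟨h.2, h.1⟩

theorem Spans.mem_uIcc {X : ℕ → ℝ} {x : ℝ} {i : ℕ} (h : Spans X x i) :
    x ∈ uIcc (X i) (X (i + 1)) := by
  rcases h with h | h
  · exact Set.mem_uIcc.2 (Or.inl ⟨h.1, h.2.le⟩)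
  · exact Set.mem_uIcc.2 (Or.inr ⟨h.1, h.2.le⟩)

theorem Spans.ne {X : ℕ → ℝ} {x : ℝ} {i : ℕ} (h : Spans X x i) : X i ≠ X (i + 1) := by
  rintro e
  rcases h with h | h <;> linarith

-- Every change toggles the truth value. Around a closed chain the value returns, so the number of
-- changes is even; the parity argument for crossings rests on this.
open Classical in
theorem odd_card_changes (f : ℕ → Prop) (n : ℕ) :
    Odd ((Finset.range n).filter fun i => ¬ (f i ↔ f (i + 1))).card ↔ ¬ (f 0 ↔ f n) := by
  induction n with
  | zero => simp
  | succ n ih =>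
    rw [Finset.range_add_one, Finset.filter_insert]
    by_cases h : f n ↔ f (n + 1)
    · simp only [h, not_true_eq_false, if_false, ih]
    · simp only [h, not_false_eq_true, if_true]
      rw [Finset.card_insert_of_notMem (by simp), Nat.odd_add_one, ih]
      tauto

theorem exists_notMem_range (f : ℕ → ℝ) (n : ℕ) {x y : ℝ} (h : x < y) :
    ∃ w, x < w ∧ w < y ∧ ∀ i ≤ n, w ≠ f i := by
  classical
  obtain ⟨w, hw, hn⟩ := (Ioo_infinite h).exists_notMem_finset ((Finset.range (n + 1)).image f)
  refine ⟨w, hw.1, hw.2, fun i hi e => hn ?_⟩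
  exact Finset.mem_image.2 ⟨i, Finset.mem_range.2 (by omega), e.symm⟩

/-- Provides concrete points "just right of" `x`: no value `f i` lies in the half-open gap from `x`
(excluded) to `w` (included). -/
theorem exists_gap_right (f : ℕ → ℝ) (n : ℕ) (x : ℝ) {ε : ℝ} (h : 0 < ε) :
    ∃ w, x < w ∧ w < x + ε ∧ ∀ i ≤ n, x < f i → w < f i := by
  induction n with
  | zero =>
    by_cases hx : x < f 0
    · refine ⟨(x + min (f 0) (x + ε)) / 2, ?_, ?_, ?_⟩
      · have : x < min (f 0) (x + ε) := lt_min hx (by linarith)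
        linarith
      · have : min (f 0) (x + ε) ≤ x + ε := min_le_right _ _
        linarith
      · intro i hi _
        obtain rfl : i = 0 := by omega
        have : min (f 0) (x + ε) ≤ f 0 := min_le_left _ _
        linarith
    · exact ⟨x + ε / 2, by linarith, by linarith, fun i hi hh => by
        obtain rfl : i = 0 := by omega
        exact absurd hh hx⟩
  | succ n ih =>
    obtain ⟨w, h1, h2, h3⟩ := ih
    by_cases hx : x < f (n + 1)
    · refine ⟨(x + min (f (n + 1)) w) / 2, ?_, ?_, ?_⟩
      · have : x < min (f (n + 1)) w := lt_min hx h1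
        linarith
      · have : min (f (n + 1)) w ≤ w := min_le_right _ _
        linarith
      · intro i hi hh
        have a1 : min (f (n + 1)) w ≤ f (n + 1) := min_le_left _ _
        have a2 : min (f (n + 1)) w ≤ w := min_le_right _ _
        rcases Nat.lt_or_ge n i with h' | h'
        · obtain rfl : i = n + 1 := by omega
          linarith
        · have := h3 i h' hh
          linarith
    · refine ⟨w, h1, h2, fun i hi hh => ?_⟩
      rcases Nat.lt_or_ge n i with h' | h'
      · obtain rfl : i = n + 1 := by omega
        exact absurd hh hx
      · exact h3 i h' hh

theorem exists_gap_left (f : ℕ → ℝ) (n : ℕ) (x : ℝ) {ε : ℝ} (h : 0 < ε) :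
    ∃ w, w < x ∧ x - ε < w ∧ ∀ i ≤ n, f i < x → f i < w := by
  obtain ⟨w, h1, h2, h3⟩ := exists_gap_right (fun i => - f i) n (-x) h
  refine ⟨-w, by linarith, by linarith, fun i hi hh => ?_⟩
  have := h3 i hi (by linarith)
  linarith

/-! ### Parity and crossings for simple orthogonal chains -/

namespace Chain

variable {n : ℕ} {X Y : ℕ → ℝ}

theorem swap (h : Chain n X Y) : Chain n Y X where
  three_le := h.three_le
  closedX := h.closedY
  closedY := h.closedX
  axis i hi := (h.axis i hi).symm
  nondeg i hi e := h.nondeg i hi e.symm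
  simple i hi j hj z h1 h2 h3 h4 := h.simple i hi j hj z.swap h1.swap h2.swap
    (fun e => h3 (by rw [← z.swap_swap, e]; rfl)) (fun e => h4 (by rw [← z.swap_swap, e]; rfl))

theorem spans_axis (h : Chain n X Y) {i : ℕ} (hi : i < n) {x : ℝ} (hs : Spans X x i) :
    Y i = Y (i + 1) := (h.axis i hi).resolve_left hs.ne

theorem spans_axis' (h : Chain n X Y) {i : ℕ} (hi : i < n) {y : ℝ} (hs : Spans Y y i) :
    X i = X (i + 1) := (h.axis i hi).resolve_right hs.ne

/-- Follow around the chain whether a vertex lies in the open upper right quadrant of `z`. This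
changes an even number of times, and an edge causes a change exactly if it crosses one of the two
rays that bound the quadrant. So the rays to the right and upwards have the same parity, which makes
the even-odd rule symmetric in the coordinates and takes the place of the Jordan curve theorem. -/
theorem odd_crossCount (h : Chain n X Y) (z : ℝ × ℝ) :
    Odd (crossCount n X Y z) ↔ Odd (crossCount n Y X z.swap) := by
  classical
  have key := odd_card_changes (fun i => z.1 < X i ∧ z.2 < Y i) n
  simp only [h.closedX, h.closedY, iff_self, not_true_eq_false, iff_false] at key
  have hd : ((Finset.range n).filter fun i =>
        ¬ ((z.1 < X i ∧ z.2 < Y i) ↔ (z.1 < X (i + 1) ∧ z.2 < Y (i + 1)))) =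
      ((Finset.range n).filter fun i => z.1 < X i ∧ Spans Y z.2 i) ∪
        ((Finset.range n).filter fun i => z.2 < Y i ∧ Spans X z.1 i) := by
    ext i
    simp only [Finset.mem_filter, Finset.mem_range, Finset.mem_union]
    constructor
    · rintro ⟨hi, hc⟩
      rcases h.axis i hi with e | e
      · left
        refine ⟨hi, ?_⟩
        rw [← e] at hc
        have hx : z.1 < X i := by by_contra hx; simp [hx] at hc
        refine ⟨hx, ?_⟩
        simp only [hx, true_and] at hc
        unfold Spans
        by_cases h1 : z.2 < Y i <;> by_cases h2 : z.2 < Y (i + 1) <;> simp [h1, h2] at hc ⊢ <;>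
          linarith
      · right
        refine ⟨hi, ?_⟩
        rw [← e] at hc
        have hx : z.2 < Y i := by by_contra hx; simp [hx] at hc
        refine ⟨hx, ?_⟩
        simp only [hx, and_true] at hc
        unfold Spans
        by_cases h1 : z.1 < X i <;> by_cases h2 : z.1 < X (i + 1) <;> simp [h1, h2] at hc ⊢ <;>
          linarith
    · rintro (⟨hi, h1, h2⟩ | ⟨hi, h1, h2⟩)
      · refine ⟨hi, ?_⟩
        rw [← h.spans_axis' hi h2]
        rcases h2 with h2 | h2
        · simp [h1, h2.2, not_lt.2 h2.1]
        · simp [h1, h2.2, not_lt.2 h2.1]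
      · refine ⟨hi, ?_⟩
        rw [← h.spans_axis hi h2]
        rcases h2 with h2 | h2
        · simp [h1, h2.2, not_lt.2 h2.1]
        · simp [h1, h2.2, not_lt.2 h2.1]
  have key' : ¬ Odd (Finset.card (((Finset.range n).filter fun i => z.1 < X i ∧ Spans Y z.2 i) ∪
      ((Finset.range n).filter fun i => z.2 < Y i ∧ Spans X z.1 i))) := by
    rw [← hd]; convert key
  rw [Finset.card_union_of_disjoint] at key'
  · have e1 : crossCount n X Y z =
        ((Finset.range n).filter fun i => z.1 < X i ∧ Spans Y z.2 i).card := by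
      unfold crossCount; congr
    have e2 : crossCount n Y X z.swap =
        ((Finset.range n).filter fun i => z.2 < Y i ∧ Spans X z.1 i).card := by
      unfold crossCount; congr
    rw [e1, e2]
    rw [Nat.odd_add] at key'
    rw [← Nat.not_even_iff_odd (n := Finset.card (Finset.filter (fun i => z.2 < Y i ∧ _) _))]
    tauto
  · rw [Finset.disjoint_left]
    intro i h1 h2
    simp only [Finset.mem_filter, Finset.mem_range] at h1 h2
    exact h2.2.2.ne (h.spans_axis' h1.1 h1.2.2)

/-- Both edges are horizontal and contain a common point strictly between `x` and the nearer of
their right ends. This point is an end of neither, so simplicity identifies the edges. -/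
theorem eq_of_spans (h : Chain n X Y) {i j : ℕ} (hi : i < n) (hj : j < n) {x : ℝ}
    (hsi : Spans X x i) (hsj : Spans X x j) (e : Y i = Y j) : i = j := by
  have hyi := h.spans_axis hi hsi
  have hyj := h.spans_axis hj hsj
  have h1 : x < max (X i) (X (i + 1)) := by rcases hsi with h | h <;> simp [h.2]
  have h2 : x < max (X j) (X (j + 1)) := by rcases hsj with h | h <;> simp [h.2]
  obtain ⟨w, hw1, hw2⟩ := exists_between (lt_min h1 h2)
  rw [lt_min_iff] at hw2
  have aux : ∀ k, Spans X x k → w < max (X k) (X (k + 1)) →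
      w ∈ uIcc (X k) (X (k + 1)) ∧ w ≠ X (k + 1) := by
    intro k hk hw
    rcases hk with hk | hk
    · rw [max_eq_right (by linarith)] at hw
      exact ⟨mem_uIcc.2 (Or.inl ⟨by linarith, hw.le⟩), hw.ne⟩
    · rw [max_eq_left (by linarith)] at hw
      exact ⟨mem_uIcc.2 (Or.inr ⟨by linarith, hw.le⟩), by intro e; linarith⟩
  obtain ⟨a1, a2⟩ := aux i hsi hw2.1
  obtain ⟨b1, b2⟩ := aux j hsj hw2.2
  refine h.simple i hi j hj (w, Y i) ⟨a1, by simp⟩ ⟨b1, by simp [e]⟩ ?_ ?_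
  · exact fun e => a2 (congrArg Prod.fst e)
  · exact fun e => b2 (congrArg Prod.fst e)

/-- The crossing point would be interior to both edges, so they would coincide; but edge `i` is
vertical and edge `j` has positive width. -/
theorem no_cross (h : Chain n X Y) {i j : ℕ} (hi : i < n) (hj : j < n)
    (e : X i = X (i + 1)) (h1 : min (Y i) (Y (i + 1)) < Y j) (h2 : Y j < max (Y i) (Y (i + 1)))
    (h3 : min (X j) (X (j + 1)) < X i) (h4 : X i < max (X j) (X (j + 1))) : False := by
  have hij : i = j := by
    refine h.simple i hi j hj (X i, Y j) ⟨by simp, ⟨h1.le, h2.le⟩⟩ ⟨⟨h3.le, h4.le⟩, by simp⟩ ?_ ?_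
    · intro e'
      have e' : Y j = Y (i + 1) := congrArg Prod.snd e'
      rcases h.axis j hj with ej | ej
      · rw [← ej] at h3 h4; simp at h3 h4; linarith
      · rw [e'] at h1 h2
        rcases le_total (Y i) (Y (i + 1)) with hh | hh <;> simp [hh] at h1 h2
    · intro e'
      have e' : X i = X (j + 1) := congrArg Prod.fst e'
      rw [e'] at h3 h4
      rcases le_total (X j) (X (j + 1)) with hh | hh <;> simp [hh] at h3 h4
  subst hij
  rw [← e] at h3
  simp at h3

/-- Index `n` repeats vertex `0`; this brings the far end `i + 1` of an edge back into the range of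
genuine vertices. -/
theorem exists_index (h : Chain n X Y) {m : ℕ} (hm : m ≤ n) :
    ∃ k < n, X k = X m ∧ Y k = Y m := by
  rcases hm.eq_or_lt with rfl | hm
  · exact ⟨0, by have := h.three_le; omega, h.closedX.symm, h.closedY.symm⟩
  · exact ⟨m, hm, rfl, rfl⟩

theorem exists_edges (h : Chain n X Y) {m : ℕ} (hm : m < n) :
    ∃ k < n, k ≠ m ∧ X (k + 1) = X m ∧ Y (k + 1) = Y m := by
  have := h.three_le
  rcases Nat.eq_zero_or_pos m with rfl | hp
  · refine ⟨n - 1, by omega, by omega, ?_, ?_⟩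
    · rw [Nat.sub_add_cancel (by omega), h.closedX]
    · rw [Nat.sub_add_cancel (by omega), h.closedY]
  · exact ⟨m - 1, by omega, by omega, by rw [Nat.sub_add_cancel hp], by rw [Nat.sub_add_cancel hp]⟩

/-- At a vertex that is not an end of a vertical edge, the boundary goes straight on. -/
theorem straight (h : Chain n X Y) {m : ℕ} (hm : m < n)
    (hv : ∀ i < n, X i = X (i + 1) →
      ¬ (X i = X m ∧ (Y i = Y m ∨ Y (i + 1) = Y m))) :
    (∃ k < n, Y k = Y m ∧ X k < X m ∧
      ∀ x, X k ≤ x → x < X m → ∃ i < n, Spans X x i ∧ Y i = Y m) ∧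
    (∃ k < n, Y k = Y m ∧ X m < X k ∧
      ∀ x, X m ≤ x → x < X k → ∃ i < n, Spans X x i ∧ Y i = Y m) := by
  obtain ⟨j, hj, hjm, hjX, hjY⟩ := h.exists_edges hm
  have a1 : Y m = Y (m + 1) := (h.axis m hm).resolve_left fun e => hv m hm e ⟨rfl, Or.inl rfl⟩
  have a2 : Y j = Y (j + 1) := (h.axis j hj).resolve_left fun e =>
    hv j hj e ⟨by rw [e, hjX], Or.inr hjY⟩
  have b1 : X m ≠ X (m + 1) := fun e => h.nondeg m hm ⟨e, a1⟩
  have b2 : X j ≠ X m := fun e => h.nondeg j hj ⟨by rw [e, hjX], a2⟩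
  obtain ⟨k, hk, hkX, hkY⟩ := h.exists_index (m := m + 1) (by omega)
  have out : ∀ x, Spans X x m → ∃ i < n, Spans X x i ∧ Y i = Y m := fun x hx => ⟨m, hm, hx, rfl⟩
  have inn : ∀ x, Spans X x j → ∃ i < n, Spans X x i ∧ Y i = Y m :=
    fun x hx => ⟨j, hj, hx, by rw [a2, hjY]⟩
  -- Both edges at `m` are horizontal. In the two cases where they leave to the same side they would
  -- overlap, against `eq_of_spans`; in the other two the boundary runs straight through.
  rcases lt_or_gt_of_ne b1 with c1 | c1 <;> rcases lt_or_gt_of_ne b2 with c2 | c2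
  · refine ⟨⟨j, hj, by rw [a2, hjY], c2, fun x h1 h2 => inn x (Or.inl ⟨h1, by rwa [hjX]⟩)⟩,
      ⟨k, hk, by rw [hkY, a1], by rwa [hkX], fun x h1 h2 => out x (Or.inl ⟨h1, by rwa [hkX] at h2⟩)⟩⟩
  · exact absurd (h.eq_of_spans hm hj (x := X m) (Or.inl ⟨le_rfl, c1⟩)
      (Or.inr ⟨hjX.le, c2⟩) (by rw [a2, hjY])).symm hjm
  · refine absurd (h.eq_of_spans hm hj (x := max (X j) (X (m + 1)))
      (Or.inr ⟨le_max_right _ _, max_lt c2 c1⟩)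
      (Or.inl ⟨le_max_left _ _, by rw [hjX]; exact max_lt c2 c1⟩) (by rw [a2, hjY])).symm hjm
  · refine ⟨⟨k, hk, by rw [hkY, a1], by rwa [hkX], fun x h1 h2 => out x (Or.inr ⟨by rwa [hkX] at h1, h2⟩)⟩,
      ⟨j, hj, by rw [a2, hjY], c2, fun x h1 h2 => inn x (Or.inr ⟨by rwa [hjX], h2⟩)⟩⟩

end Chain

/-! ### Maximal rectangles in the complement of a chain -/

/-- The vertical edge `i` has a part of positive length in the open chord of the line just right
of `x` that is bounded by the edges with `Ab` above and those without `Ab` below. -/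
def Overlaps (n : ℕ) (X Y : ℕ → ℝ) (x : ℝ) (Ab : ℕ → Prop) (i : ℕ) : Prop :=
  X i = X (i + 1) ∧ (∀ j < n, Spans X x j → Ab j → min (Y i) (Y (i + 1)) < Y j) ∧
    ∀ j < n, Spans X x j → ¬ Ab j → Y j < max (Y i) (Y (i + 1))

/-- The point `z` is in the open rectangle that is bounded from above and below by the edges
over the abscissa just right of `x`, and has no vertical edges inside. -/
structure InCell (n : ℕ) (X Y : ℕ → ℝ) (x : ℝ) (Ab : ℕ → Prop) (z : ℝ × ℝ) : Prop where
  up : ∀ i < n, Spans X x i → Ab i → z.2 < Y i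
  down : ∀ i < n, Spans X x i → ¬ Ab i → Y i < z.2
  right : ∀ i < n, Overlaps n X Y x Ab i → x < X i → z.1 < X i
  left : ∀ i < n, Overlaps n X Y x Ab i → X i ≤ x → X i < z.1

namespace InCell

variable {n : ℕ} {X Y : ℕ → ℝ} {x : ℝ} {Ab : ℕ → Prop} {z : ℝ × ℝ}

theorem overlaps (hz : InCell n X Y x Ab z) {i : ℕ} (e : X i = X (i + 1))
    (hy : z.2 ∈ uIcc (Y i) (Y (i + 1))) : Overlaps n X Y x Ab i :=
  ⟨e, fun j hj hs ha => hy.1.trans_lt (hz.up j hj hs ha),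
    fun j hj hs ha => (hz.down j hj hs ha).trans_le hy.2⟩

theorem ne_height (hz : InCell n X Y x Ab z) {i : ℕ} (hi : i < n) (hs : Spans X x i) :
    Y i ≠ z.2 := by
  by_cases ha : Ab i
  · exact (hz.up i hi hs ha).ne'
  · exact (hz.down i hi hs ha).ne

/-- Consider the rightmost counterexample. No vertical edge ends there, because it would overlap the
chord and bound the cell on the wrong side of `z`. So the boundary runs on to the right, to a vertex
that is again a counterexample, or across the chord at the height of `z`, which `ne_height` forbids.
-/
theorem vertex_left (hz : InCell n X Y x Ab z) (h : Chain n X Y) :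
    ∀ m < n, Y m = z.2 → X m ≤ x → X m < z.1 := by
  classical
  by_contra! hcon
  obtain ⟨m, hm, hmax⟩ := ((Finset.range n).filter
    fun m => Y m = z.2 ∧ X m ≤ x ∧ z.1 ≤ X m).exists_max_image X (by
      obtain ⟨m, h1, h2, h3, h4⟩ := hcon
      exact ⟨m, by simp [h1, h2, h3, h4]⟩)
  simp only [Finset.mem_filter, Finset.mem_range] at hm hmax
  obtain ⟨hmn, hmy, hmx, hmz⟩ := hm
  obtain ⟨k, hk, hkY, hkX, hks⟩ := (h.straight hmn (by
    rintro i hi e ⟨h1, h2⟩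
    have := hz.left i hi (hz.overlaps e (by
      rw [← hmy]; rcases h2 with h2 | h2 <;> simp [← h2])) (by rwa [h1])
    linarith)).2
  rcases le_or_gt (X k) x with hkx | hkx
  · exact absurd (hmax k ⟨hk, hkY.trans hmy, hkx, by linarith⟩) (by linarith)
  · obtain ⟨i, hi, hs, hy⟩ := hks x hmx hkx
    exact hz.ne_height hi hs (hy.trans hmy)

theorem vertex_right (hz : InCell n X Y x Ab z) (h : Chain n X Y) :
    ∀ m < n, Y m = z.2 → x < X m → z.1 < X m := by
  classical
  by_contra! hcon
  obtain ⟨m, hm, hmax⟩ := ((Finset.range n).filter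
    fun m => Y m = z.2 ∧ x < X m ∧ X m ≤ z.1).exists_min_image X (by
      obtain ⟨m, h1, h2, h3, h4⟩ := hcon
      exact ⟨m, by simp [h1, h2, h3, h4]⟩)
  simp only [Finset.mem_filter, Finset.mem_range] at hm hmax
  obtain ⟨hmn, hmy, hmx, hmz⟩ := hm
  obtain ⟨k, hk, hkY, hkX, hks⟩ := (h.straight hmn (by
    rintro i hi e ⟨h1, h2⟩
    have := hz.right i hi (hz.overlaps e (by
      rw [← hmy]; rcases h2 with h2 | h2 <;> simp [← h2])) (by rwa [h1])
    linarith)).1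
  rcases le_or_gt (X k) x with hkx | hkx
  · obtain ⟨i, hi, hs, hy⟩ := hks x hkx hmx
    exact hz.ne_height hi hs (hy.trans hmy)
  · exact absurd (hmax k ⟨hk, hkY.trans hmy, hkx, by linarith⟩) (by linarith)

/-- A vertical edge through `z` overlaps the chord and is excluded by the side conditions. A
horizontal one has its ends on opposite sides of `z`; by the two vertex lemmas they are then on
opposite sides of `x` as well, so the edge meets the chord at the height of `z`. -/
theorem not_onEdge (hz : InCell n X Y x Ab z) (h : Chain n X Y) {i : ℕ} (hi : i < n) :
    ¬ OnEdge X Y i z := by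
  rintro ⟨h1, h2⟩
  rcases h.axis i hi with e | e
  · have ho := hz.overlaps e h2
    rw [← e, uIcc_self, mem_singleton_iff] at h1
    rcases le_or_gt (X i) x with hx | hx
    · exact (hz.left i hi ho hx).ne h1.symm
    · exact (hz.right i hi ho hx).ne h1
  · rw [← e, uIcc_self, mem_singleton_iff] at h2
    obtain ⟨k, hk, hkX, hkY⟩ := h.exists_index (m := i + 1) (by omega)
    have l1 := hz.vertex_left h i hi h2.symm
    have r1 := hz.vertex_right h i hi h2.symm
    have l2 := hz.vertex_left h k hk (by rw [hkY, ← e, h2])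
    have r2 := hz.vertex_right h k hk (by rw [hkY, ← e, h2])
    rw [hkX] at l2 r2
    refine hz.ne_height hi ?_ h2.symm
    rcases mem_uIcc.1 h1 with hh | hh
    · left
      refine ⟨?_, ?_⟩
      · by_contra! hc; linarith [r1 hc]
      · by_contra! hc; linarith [l2 hc]
    · right
      refine ⟨?_, ?_⟩
      · by_contra! hc; linarith [r2 hc]
      · by_contra! hc; linarith [l1 hc]

-- Move `z` horizontally to the abscissa `x`: a vertical edge at this height overlaps the chord,
-- hence is on the same side of `z` as of `x`, and the count does not change. Then turn the ray
-- upwards; it meets exactly the edges with `Ab`.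
open Classical in
theorem odd_crossCount (hz : InCell n X Y x Ab z) (h : Chain n X Y) :
    Odd (crossCount n X Y z) ↔
      Odd ((Finset.range n).filter fun i => Spans X x i ∧ Ab i).card := by
  have e1 : crossCount n X Y z = crossCount n X Y (x, z.2) := by
    unfold crossCount
    congr 1
    refine Finset.filter_congr fun i hi => and_congr_left fun hs => ?_
    rw [Finset.mem_range] at hi
    have ho := hz.overlaps (h.spans_axis' hi hs) hs.mem_uIcc
    constructor
    · intro h1
      by_contra! hc
      linarith [hz.left i hi ho hc]
    · exact hz.right i hi ho
  rw [e1, h.odd_crossCount]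
  have e2 : crossCount n Y X (x, z.2).swap =
      ((Finset.range n).filter fun i => Spans X x i ∧ Ab i).card := by
    unfold crossCount
    congr 1
    refine Finset.filter_congr fun i hi => ?_
    rw [Finset.mem_range] at hi
    simp only [Prod.fst_swap, Prod.snd_swap]
    rw [and_comm]
    refine and_congr_right fun hs => ⟨fun h1 => ?_, hz.up i hi hs⟩
    by_contra hc
    linarith [hz.down i hi hs hc]
  rw [e2]

end InCell

/-- The edges that are counted as lying above the height `y`: strictly above for `f = 0`, also
those at height `y` for `f = 1`. -/
def Above (Y : ℕ → ℝ) (y : ℝ) (f i : ℕ) : Prop := y < Y i ∨ (f = 1 ∧ y ≤ Y i)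

open Classical in
/-- The number of edges above the vertex `v`, just right of it. -/
noncomputable def aboveCount (n : ℕ) (X Y : ℕ → ℝ) (v f : ℕ) : ℕ :=
  ((Finset.range n).filter fun i => Spans X (X v) i ∧ Above Y (Y v) f i).card

/-- The vertex `v` is used as the starting point of a rectangle, just above (`f = 0`) or just
below (`f = 1`) of `v`; the parameter `want` is the parity of the points of the rectangle. -/
def Emits (n : ℕ) (X Y : ℕ → ℝ) (want v f : ℕ) : Prop :=
  (∃ i < n, X v < X i) ∧ ((f = 0 ∧ aboveCount n X Y v 0 % 2 = want) ∨
    (f = 1 ∧ aboveCount n X Y v 0 % 2 ≠ want ∧ aboveCount n X Y v 1 % 2 = want))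

/-- The open rectangle that starts at the vertex `v`. -/
def cellSet (n : ℕ) (X Y : ℕ → ℝ) (v f : ℕ) : Set (ℝ × ℝ) :=
  {z | InCell n X Y (X v) (Above Y (Y v) f) z}

/-- `z` has no coordinate in common with a vertex. -/
def Generic (n : ℕ) (X Y : ℕ → ℝ) (z : ℝ × ℝ) : Prop := ∀ i < n, z.1 ≠ X i ∧ z.2 ≠ Y i

/-! ### Every generic point lies in a cell that starts at a vertex -/

namespace Chain

variable {n : ℕ} {X Y : ℕ → ℝ}

theorem cellSet_parity (h : Chain n X Y) {want v f : ℕ} (he : Emits n X Y want v f)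
    {z : ℝ × ℝ} (hz : z ∈ cellSet n X Y v f) : crossCount n X Y z % 2 = want := by
  have h1 := hz.odd_crossCount h
  have h2 : aboveCount n X Y v f % 2 = want := by
    rcases he.2 with ⟨rfl, h⟩ | ⟨rfl, -, h⟩ <;> exact h
  unfold aboveCount at h2
  rw [Nat.odd_iff, Nat.odd_iff] at h1
  omega

theorem generic_not_onEdge (h : Chain n X Y) {z : ℝ × ℝ} (hz : Generic n X Y z) {i : ℕ}
    (hi : i < n) : ¬ OnEdge X Y i z := by
  rintro ⟨h1, h2⟩
  rcases h.axis i hi with e | e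
  · rw [← e, uIcc_self] at h1; exact (hz i hi).1 h1
  · rw [← e, uIcc_self] at h2; exact (hz i hi).2 h2

/-- At most one edge leaves to the right at the height of `v`. If there is one, the two flags give
opposite parities, so exactly one of them has the wanted parity; this is why `Emits` needs only one
rectangle per vertex. -/
theorem aboveCount_one (h : Chain n X Y) {v i : ℕ} (hi : i < n) (hs : Spans X (X v) i)
    (hy : Y i = Y v) : aboveCount n X Y v 1 = aboveCount n X Y v 0 + 1 := by
  classical
  unfold aboveCount
  rw [← Finset.card_insert_of_notMem (a := i)]
  · congr 1
    ext j
    simp only [Finset.mem_filter, Finset.mem_range, Finset.mem_insert]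
    constructor
    · rintro ⟨hj, hsj, hh⟩
      have hle : Y v ≤ Y j := by rcases hh with hh | hh; exacts [hh.le, hh.2]
      rcases hle.eq_or_lt with e | e
      · exact Or.inl (h.eq_of_spans hj hi hsj hs (by rw [hy, e]))
      · exact Or.inr ⟨hj, hsj, Or.inl e⟩
    · rintro (rfl | ⟨hj, hsj, hh⟩)
      · exact ⟨hi, hs, Or.inr ⟨rfl, hy.ge⟩⟩
      · refine ⟨hj, hsj, Or.inl ?_⟩
        simpa [Above] using hh
  · simp [Above, hy]

/-- Slide the chord through `z` to the left until a vertex `v` touches the closed chord. On the way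
the edges that bound the chord stay the same. A vertical edge that overlaps the chord between `v`
and `z` has no end in the closed chord by the choice of `v`; so it sticks out on both sides and
crosses a bounding edge, which is impossible. -/
theorem exists_cell (h : Chain n X Y) {z : ℝ × ℝ} (hg : Generic n X Y z) {want : ℕ}
    (hw : crossCount n X Y z % 2 = want) (h1 : ∃ i < n, X i ≤ z.1) (h2 : ∃ i < n, z.1 < X i) :
    ∃ v < n, ∃ f, Emits n X Y want v f ∧ z ∈ cellSet n X Y v f := by
  classical
  -- heights in the closed chord through `z`
  let H : ℝ → Prop := fun t => (∀ j < n, Spans X z.1 j → z.2 < Y j → t ≤ Y j) ∧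
    ∀ j < n, Spans X z.1 j → ¬ z.2 < Y j → Y j ≤ t
  have hlow : ∀ j < n, ¬ z.2 < Y j → Y j < z.2 := fun j hj hn =>
    lt_of_le_of_ne (not_lt.1 hn) (Ne.symm (hg j hj).2)
  have htop : ∀ j < n, Spans X z.1 j → z.2 < Y j →
      ∃ k < n, Spans X z.1 k ∧ z.2 < Y k ∧ Y k ≤ Y j ∧ H (Y k) := by
    intro j hj hs hy
    obtain ⟨k, hk, hmin⟩ := ((Finset.range n).filter
      fun k => Spans X z.1 k ∧ z.2 < Y k).exists_min_image Y ⟨j, by simp [hj, hs, hy]⟩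
    simp only [Finset.mem_filter, Finset.mem_range] at hk hmin
    exact ⟨k, hk.1, hk.2.1, hk.2.2, hmin j ⟨hj, hs, hy⟩, fun l hl h1 h2 => hmin l ⟨hl, h1, h2⟩,
      fun l hl h1 h2 => (not_lt.1 h2).trans hk.2.2.le⟩
  have hbot : ∀ j < n, Spans X z.1 j → ¬ z.2 < Y j →
      ∃ k < n, Spans X z.1 k ∧ ¬ z.2 < Y k ∧ Y j ≤ Y k ∧ H (Y k) := by
    intro j hj hs hy
    obtain ⟨k, hk, hmin⟩ := ((Finset.range n).filter
      fun k => Spans X z.1 k ∧ ¬ z.2 < Y k).exists_max_image Y ⟨j, by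
        simp only [Finset.mem_filter, Finset.mem_range]; exact ⟨hj, hs, hy⟩⟩
    simp only [Finset.mem_filter, Finset.mem_range] at hk hmin
    exact ⟨k, hk.1, hk.2.1, hk.2.2, hmin j ⟨hj, hs, hy⟩,
      fun l hl h1 h2 => (not_lt.1 hk.2.2).trans h2.le,
      fun l hl h1 h2 => hmin l ⟨hl, h1, h2⟩⟩
  have hleft : ∀ j < n, Spans X z.1 j → H (Y j) →
      ∃ e < n, X e ≤ z.1 ∧ H (Y e) ∧ ∀ x, X e ≤ x → x ≤ z.1 → Spans X x j := by
    intro j hj hs hy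
    obtain ⟨k, hk, hkX, hkY⟩ := h.exists_index (m := j + 1) (by omega)
    have hax := h.spans_axis hj hs
    rcases hs with hs | hs
    · exact ⟨j, hj, hs.1, hy, fun x a b => Or.inl ⟨a, by linarith⟩⟩
    · exact ⟨k, hk, by rw [hkX]; exact hs.1, by rwa [hkY, ← hax],
        fun x a b => Or.inr ⟨by rwa [hkX] at a, by linarith⟩⟩
  -- If some edge passes over the abscissa of `z`, the left end of a nearest one is in the closed
  -- chord; otherwise every height satisfies `H`, and any vertex on the left will do.
  have hne : ∃ m < n, X m ≤ z.1 ∧ H (Y m) := by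
    by_cases hsp : ∃ j < n, Spans X z.1 j
    · obtain ⟨j, hj, hs⟩ := hsp
      have : ∃ k < n, Spans X z.1 k ∧ H (Y k) := by
        by_cases hy : z.2 < Y j
        · obtain ⟨k, a, b, -, -, c⟩ := htop j hj hs hy; exact ⟨k, a, b, c⟩
        · obtain ⟨k, a, b, -, -, c⟩ := hbot j hj hs hy; exact ⟨k, a, b, c⟩
      obtain ⟨k, a, b, c⟩ := this
      obtain ⟨e, he, hx, hH, -⟩ := hleft k a b c
      exact ⟨e, he, hx, hH⟩
    · push Not at hsp
      obtain ⟨i, hi, hx⟩ := h1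
      exact ⟨i, hi, hx, fun j hj hs => absurd hs (hsp j hj), fun j hj hs => absurd hs (hsp j hj)⟩
  obtain ⟨v, hv, hmax⟩ := ((Finset.range n).filter
    fun m => X m ≤ z.1 ∧ H (Y m)).exists_max_image X (by
      obtain ⟨m, a, b, c⟩ := hne
      exact ⟨m, by simp only [Finset.mem_filter, Finset.mem_range]; exact ⟨a, b, c⟩⟩)
  simp only [Finset.mem_filter, Finset.mem_range] at hv hmax
  obtain ⟨hvn, hvx, hvH⟩ := hv
  have hvx' : X v < z.1 := lt_of_le_of_ne hvx (Ne.symm (hg v hvn).1)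
  have F1 : ∀ j < n, Spans X z.1 j → H (Y j) → Spans X (X v) j := by
    intro j hj hs hH
    obtain ⟨e, he, hx, hH', hall⟩ := hleft j hj hs hH
    exact hall _ (hmax e ⟨he, hx, hH'⟩) hvx
  have F2 : ∀ i < n, Spans X (X v) i → H (Y i) → Spans X z.1 i := by
    intro i hi hs hH
    obtain ⟨k, hk, hkX, hkY⟩ := h.exists_index (m := i + 1) (by omega)
    have hax := h.spans_axis hi hs
    rcases hs with hs | hs
    · refine Or.inl ⟨by linarith, ?_⟩
      by_contra! hc
      have := hmax k ⟨hk, by rwa [hkX], by rwa [hkY, ← hax]⟩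
      linarith
    · refine Or.inr ⟨by linarith, ?_⟩
      by_contra! hc
      have := hmax i ⟨hi, hc, hH⟩
      linarith
  -- With the next claim: over `v`, being above or below `z` agrees with being above or below `v`,
  -- except possibly for an edge at the very height of `v`; the flag decides about that edge.
  have F4 : ∀ i < n, Spans X (X v) i → z.2 < Y i → Y v ≤ Y i := by
    intro i hi hs hy
    by_cases hH : H (Y i)
    · exact hvH.1 i hi (F2 i hi hs hH) hy
    · have : ∃ j < n, Spans X z.1 j ∧ z.2 < Y j ∧ Y j < Y i := by
        by_contra! hc
        exact hH ⟨hc, fun j hj _ hn => (not_lt.1 hn).trans hy.le⟩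
      obtain ⟨j, hj, a, b, c⟩ := this
      exact (hvH.1 j hj a b).trans c.le
  have F5 : ∀ i < n, Spans X (X v) i → ¬ z.2 < Y i → Y i ≤ Y v := by
    intro i hi hs hy
    by_cases hH : H (Y i)
    · exact hvH.2 i hi (F2 i hi hs hH) hy
    · have : ∃ j < n, Spans X z.1 j ∧ ¬ z.2 < Y j ∧ Y i < Y j := by
        by_contra! hc
        exact hH ⟨fun j hj _ hn => (not_lt.1 hy).trans hn.le,
          fun j hj a b => hc j hj a (not_lt.1 b)⟩
      obtain ⟨j, hj, a, b, c⟩ := this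
      exact c.le.trans (hvH.2 j hj a b)
  have cell : ∀ f, (∀ i < n, Spans X (X v) i → (Above Y (Y v) f i ↔ z.2 < Y i)) →
      z ∈ cellSet n X Y v f := by
    intro f hf
    refine ⟨fun i hi hs ha => (hf i hi hs).1 ha,
      fun i hi hs ha => hlow i hi fun hc => ha ((hf i hi hs).2 hc), ?_,
      fun i hi _ hx => by linarith⟩
    rintro i hi ⟨e, o1, o2⟩ hx
    by_contra hc
    have hiz : X i < z.1 := lt_of_le_of_ne (not_lt.1 hc) (Ne.symm (hg i hi).1)
    obtain ⟨k, hk, hkX, hkY⟩ := h.exists_index (m := i + 1) (by omega)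
    have n1 : ¬ H (Y i) := fun hH => by
      have := hmax i ⟨hi, hiz.le, hH⟩; linarith
    have n2 : ¬ H (Y (i + 1)) := fun hH => by
      have := hmax k ⟨hk, by rw [hkX, ← e]; exact hiz.le, by rwa [hkY]⟩
      rw [hkX, ← e] at this; linarith
    have nmin : ¬ H (min (Y i) (Y (i + 1))) := by
      rcases min_choice (Y i) (Y (i + 1)) with e | e <;> rwa [e]
    have nmax : ¬ H (max (Y i) (Y (i + 1))) := by
      rcases max_choice (Y i) (Y (i + 1)) with e | e <;> rwa [e]
    have q1 : ∀ j < n, Spans X z.1 j → z.2 < Y j → min (Y i) (Y (i + 1)) < Y j := by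
      intro j hj hs hy
      obtain ⟨k, hk, a, b, c, d⟩ := htop j hj hs hy
      have hs' := F1 k hk a d
      exact (o1 k hk hs' ((hf k hk hs').2 b)).trans_le c
    have q2 : ∀ j < n, Spans X z.1 j → ¬ z.2 < Y j → Y j < max (Y i) (Y (i + 1)) := by
      intro j hj hs hy
      obtain ⟨k, hk, a, b, c, d⟩ := hbot j hj hs hy
      have hs' := F1 k hk a d
      exact c.trans_lt (o2 k hk hs' fun hc => b ((hf k hk hs').1 hc))
    -- The lower end of the vertical edge is not in the closed chord but is below everything that
    -- bounds the chord from above; so it is below some lower bounding edge. Together with `q2` this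
    -- edge is crossed.
    have q3 : ∃ j < n, Spans X z.1 j ∧ ¬ z.2 < Y j ∧ min (Y i) (Y (i + 1)) < Y j := by
      by_contra! hc
      exact nmin ⟨fun j hj a b => (q1 j hj a b).le, fun j hj a b => hc j hj a (not_lt.1 b)⟩
    have q4 : ∃ j < n, Spans X z.1 j ∧ z.2 < Y j ∧ Y j < max (Y i) (Y (i + 1)) := by
      by_contra! hc
      exact nmax ⟨hc, fun j hj a b => (q2 j hj a b).le⟩
    obtain ⟨j, hj, a, b, c⟩ := q3
    obtain ⟨k, hk, a', b', c', d'⟩ := hbot j hj a b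
    have hs' := F1 k hk a' d'
    refine h.no_cross hi hk e (c.trans_le c') (q2 k hk a' b') ?_ ?_
    · rcases hs' with hs' | hs'
      · exact (min_le_left _ _).trans_lt (hs'.1.trans_lt hx)
      · exact (min_le_right _ _).trans_lt (hs'.1.trans_lt hx)
    · rcases a' with a' | a'
      · exact (hiz.trans a'.2).trans_le (le_max_right _ _)
      · exact (hiz.trans a'.2).trans_le (le_max_left _ _)
  have hex : ∃ i < n, X v < X i := by
    obtain ⟨i, hi, hx⟩ := h2
    exact ⟨i, hi, by linarith⟩
  refine ⟨v, hvn, ?_⟩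
  -- An edge that leaves `v` to the right separates the points just above `v` from those just below.
  -- If `z` is on the lower side, that edge has to count as lying above, which is the flag `1`.
  by_cases hcase : ∃ i < n, Spans X (X v) i ∧ Y i = Y v ∧ z.2 < Y v
  · obtain ⟨i, hi, hs, hy, hzv⟩ := hcase
    have hc : z ∈ cellSet n X Y v 1 := by
      refine cell 1 fun j hj hsj => ⟨fun ha => ?_, fun hh => Or.inr ⟨rfl, F4 j hj hsj hh⟩⟩
      rcases ha with ha | ha <;> linarith
    refine ⟨1, ⟨hex, Or.inr ⟨rfl, ?_, ?_⟩⟩, hc⟩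
    all_goals
      have h3 := hc.odd_crossCount h
      have h4 := h.aboveCount_one hi hs hy
      rw [Nat.odd_iff, Nat.odd_iff] at h3
      change _ ↔ aboveCount n X Y v 1 % 2 = 1 at h3
      omega
  · push Not at hcase
    have hc : z ∈ cellSet n X Y v 0 := by
      refine cell 0 fun j hj hsj => ⟨fun ha => ?_, fun hh => Or.inl ?_⟩
      · have ha : Y v < Y j := by simpa [Above] using ha
        by_contra hn
        linarith [F5 j hj hsj hn]
      · refine lt_of_le_of_ne (F4 j hj hsj hh) fun e => ?_
        have := hcase j hj hsj e.symm
        linarith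
    refine ⟨0, ⟨hex, Or.inl ⟨rfl, ?_⟩⟩, hc⟩
    have h3 := hc.odd_crossCount h
    rw [Nat.odd_iff, Nat.odd_iff] at h3
    change _ ↔ aboveCount n X Y v 0 % 2 = 1 at h3
    omega

/-! ### Topology of the region -/

theorem _root_.PolygonPlacement.crossCount_congr {n : ℕ} {X Y : ℕ → ℝ} {x x' y : ℝ}
    (hb : ∀ w ∈ uIcc x x', ∀ i < n, ¬ OnEdge X Y i (w, y)) :
    crossCount n X Y (x, y) = crossCount n X Y (x', y) := by
  classical
  unfold crossCount
  congr 1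
  refine Finset.filter_congr fun i hi => and_congr_left fun hs => ?_
  rw [Finset.mem_range] at hi
  have he : X i ∉ uIcc x x' := fun hm => hb _ hm i hi ⟨by simp, hs.mem_uIcc⟩
  simp only [mem_uIcc, not_or, not_and, not_le] at he
  constructor
  · intro h1; exact he.1 h1.le
  · intro h1; exact he.2 h1.le

/-- Balls of the product metric are squares, so a horizontal and a vertical leg lead from `z` to `w`
without leaving the ball. The second leg is treated by exchanging the coordinates. -/
theorem odd_congr (h : Chain n X Y) {c z w : ℝ × ℝ} {r : ℝ}
    (hb : ∀ u ∈ Metric.ball c r, ∀ i < n, ¬ OnEdge X Y i u) (hz : z ∈ Metric.ball c r)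
    (hw : w ∈ Metric.ball c r) : Odd (crossCount n X Y z) ↔ Odd (crossCount n X Y w) := by
  rw [← ball_prod_same, mem_prod] at hz hw
  have hb' : ∀ u ∈ Metric.ball c.1 r, ∀ v ∈ Metric.ball c.2 r, ∀ i < n, ¬ OnEdge X Y i (u, v) :=
    fun u hu v hv => hb _ (by rw [← ball_prod_same]; exact ⟨hu, hv⟩)
  have c1 := (convex_ball c.1 r).ordConnected
  have c2 := (convex_ball c.2 r).ordConnected
  have e1 : crossCount n X Y z = crossCount n X Y (w.1, z.2) :=
    crossCount_congr fun u hu => hb' u (c1.uIcc_subset hz.1 hw.1 hu) z.2 hz.2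
  have e2 : crossCount n Y X (w.1, z.2).swap = crossCount n Y X w.swap :=
    crossCount_congr fun u hu i hi ho =>
      hb' w.1 hw.1 u (c2.uIcc_subset hz.2 hw.2 hu) i hi ho.swap
  rw [e1, h.odd_crossCount, e2, ← h.odd_crossCount]

theorem isClosed_edges (n : ℕ) (X Y : ℕ → ℝ) :
    IsClosed {z : ℝ × ℝ | ∃ i < n, OnEdge X Y i z} := by
  have : {z : ℝ × ℝ | ∃ i < n, OnEdge X Y i z} =
      ⋃ i ∈ Finset.range n, (uIcc (X i) (X (i + 1)) ×ˢ uIcc (Y i) (Y (i + 1))) := by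
    ext z; simp only [OnEdge, mem_ofPred_eq, mem_iUnion, Finset.mem_range, mem_prod, exists_prop]
  rw [this]
  exact isClosed_biUnion_finset fun i _ => isClosed_Icc.prod isClosed_Icc

theorem exists_ball (h : Chain n X Y) {z : ℝ × ℝ} (hz : ∀ i < n, ¬ OnEdge X Y i z) :
    ∃ r > 0, (∀ u ∈ Metric.ball z r, ∀ i < n, ¬ OnEdge X Y i u) ∧
      ∀ u ∈ Metric.ball z r, (Odd (crossCount n X Y u) ↔ Odd (crossCount n X Y z)) := by
  have hm : z ∈ {z : ℝ × ℝ | ∃ i < n, OnEdge X Y i z}ᶜ := by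
    rintro ⟨i, hi, ho⟩; exact hz i hi ho
  obtain ⟨r, hr, hb⟩ := Metric.isOpen_iff.1 (isClosed_edges n X Y).isOpen_compl z hm
  have hb' : ∀ u ∈ Metric.ball z r, ∀ i < n, ¬ OnEdge X Y i u :=
    fun u hu i hi ho => hb hu ⟨i, hi, ho⟩
  exact ⟨r, hr, hb', fun u hu => h.odd_congr hb' hu (Metric.mem_ball_self hr)⟩

theorem isClosed_region (h : Chain n X Y) : IsClosed (chainRegion n X Y) := by
  rw [← isOpen_compl_iff, Metric.isOpen_iff]
  intro z hz
  simp only [chainRegion, mem_compl_iff, mem_ofPred_eq, not_or, not_exists, not_and] at hz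
  obtain ⟨r, hr, h1, h2⟩ := h.exists_ball hz.1
  refine ⟨r, hr, fun u hu => ?_⟩
  simp only [chainRegion, mem_compl_iff, mem_ofPred_eq, not_or, not_exists, not_and]
  exact ⟨h1 u hu, by rw [h2 u hu]; exact hz.2⟩

theorem exists_generic (n : ℕ) (X Y : ℕ → ℝ) (z : ℝ × ℝ) {r : ℝ} (hr : 0 < r) :
    ∃ w ∈ Metric.ball z r, Generic n X Y w := by
  obtain ⟨a, a1, a2, a3⟩ := exists_notMem_range X n (show z.1 < z.1 + r by linarith)
  obtain ⟨b, b1, b2, b3⟩ := exists_notMem_range Y n (show z.2 < z.2 + r by linarith)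
  refine ⟨(a, b), ?_, fun i hi => ⟨a3 i hi.le, b3 i hi.le⟩⟩
  rw [← ball_prod_same]
  refine ⟨?_, ?_⟩ <;> rw [Metric.mem_ball, Real.dist_eq, abs_lt] <;> constructor <;>
    simp only <;> linarith

/-- Of two points just above and just below the edge, at the same generic abscissa, the upward ray
of the lower one meets exactly one more edge. So one of the two is inside. -/
theorem exists_inside_near (h : Chain n X Y) {i : ℕ} (hi : i < n) (e : Y i = Y (i + 1))
    {z : ℝ × ℝ} (hz : OnEdge X Y i z) {r : ℝ} (hr : 0 < r) :
    ∃ w ∈ Metric.ball z r, Generic n X Y w ∧ Odd (crossCount n X Y w) := by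
  classical
  obtain ⟨z1, z2⟩ := hz
  rw [← e, uIcc_self, mem_singleton_iff] at z2
  have hne : X i ≠ X (i + 1) := fun e' => h.nondeg i hi ⟨e', e⟩
  have hlt : min (X i) (X (i + 1)) < max (X i) (X (i + 1)) := min_lt_max.2 hne
  have hlt' : max (min (X i) (X (i + 1))) (z.1 - r) < min (max (X i) (X (i + 1))) (z.1 + r) := by
    have h1 := z1.1; have h2 := z1.2
    rw [lt_min_iff, max_lt_iff, max_lt_iff]
    refine ⟨⟨hlt, ?_⟩, ?_, by linarith⟩
    · change z.1 ≤ max _ _ at h2; linarith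
    · change min _ _ ≤ z.1 at h1; linarith
  obtain ⟨a, a1, a2, a3⟩ := exists_notMem_range X n hlt'
  rw [max_lt_iff] at a1
  rw [lt_min_iff] at a2
  obtain ⟨u, u1, u2, u3⟩ := exists_gap_right Y n (Y i) hr
  obtain ⟨d, d1, d2, d3⟩ := exists_gap_left Y n (Y i) hr
  have hsp : Spans X a i := by
    rcases lt_or_gt_of_ne hne with hh | hh
    · left; rw [min_eq_left hh.le] at a1; rw [max_eq_right hh.le] at a2; exact ⟨a1.1.le, a2.1⟩
    · right; rw [min_eq_right hh.le] at a1; rw [max_eq_left hh.le] at a2; exact ⟨a1.1.le, a2.1⟩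
  have hcount : crossCount n Y X (a, d).swap = crossCount n Y X (a, u).swap + 1 := by
    unfold crossCount
    rw [← Finset.card_insert_of_notMem (a := i)]
    · congr 1
      ext j
      simp only [Finset.mem_filter, Finset.mem_range, Finset.mem_insert, Prod.fst_swap,
        Prod.snd_swap]
      constructor
      · rintro ⟨hj, hd, hs⟩
        rcases lt_trichotomy (Y j) (Y i) with hh | hh | hh
        · linarith [d3 j hj.le hh]
        · exact Or.inl (h.eq_of_spans hj hi hs hsp hh)
        · exact Or.inr ⟨hj, u3 j hj.le hh, hs⟩
      · rintro (rfl | ⟨hj, hu, hs⟩)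
        · exact ⟨hi, d1, hsp⟩
        · exact ⟨hj, by linarith, hs⟩
    · simp only [Finset.mem_filter, Prod.fst_swap, not_and]
      intro _ hc; linarith
  have gen : ∀ t, (∀ j < n, t ≠ Y j) → Generic n X Y (a, t) :=
    fun t ht j hj => ⟨a3 j hj.le, ht j hj⟩
  have inball : ∀ t, Y i - r < t → t < Y i + r → (a, t) ∈ Metric.ball z r := by
    intro t t1 t2
    rw [← ball_prod_same]
    refine ⟨?_, ?_⟩ <;> rw [Metric.mem_ball, Real.dist_eq, abs_lt] <;> constructor <;>
      simp only <;> linarith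
  by_cases ho : Odd (crossCount n X Y (a, u))
  · refine ⟨(a, u), inball u (by linarith) u2, gen u (fun j hj e => ?_), ho⟩
    have := u3 j hj.le (by linarith)
    linarith
  · refine ⟨(a, d), inball d d2 (by linarith), gen d (fun j hj e => ?_), ?_⟩
    · have := d3 j hj.le (by linarith)
      linarith
    · rw [h.odd_crossCount, hcount, Nat.odd_add_one, ← h.odd_crossCount]
      exact ho

/-- Near a boundary point one side of the edge is inside; away from the boundary the parity is
locally constant. Together with `compl_subset_closure` this allows the boxes to be dense instead of
exhaustive. -/
theorem region_subset_closure (h : Chain n X Y) :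
    chainRegion n X Y ⊆ closure {z | Generic n X Y z ∧ Odd (crossCount n X Y z)} := by
  intro z hz
  rw [Metric.mem_closure_iff]
  intro r hr
  by_cases hb : ∃ i < n, OnEdge X Y i z
  · obtain ⟨i, hi, ho⟩ := hb
    rcases h.axis i hi with e | e
    · obtain ⟨w, hw, hg, hodd⟩ := h.swap.exists_inside_near hi e ho.swap hr
      refine ⟨w.swap, ⟨fun j hj => (hg j hj).symm, by rwa [h.odd_crossCount, Prod.swap_swap]⟩, ?_⟩
      rw [Metric.mem_ball, Prod.dist_eq, max_lt_iff] at hw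
      rw [dist_comm, Prod.dist_eq, max_lt_iff]
      exact ⟨hw.2, hw.1⟩
    · obtain ⟨w, hw, hg, hodd⟩ := h.exists_inside_near hi e ho hr
      exact ⟨w, ⟨hg, hodd⟩, by rw [dist_comm]; exact hw⟩
  · push Not at hb
    have ho : Odd (crossCount n X Y z) := by
      rcases hz with ⟨i, hi, hh⟩ | hh
      · exact absurd hh (hb i hi)
      · exact hh
    obtain ⟨ρ, hρ, h1, h2⟩ := h.exists_ball hb
    obtain ⟨w, hw, hg⟩ := exists_generic n X Y z (lt_min hr hρ)
    rw [Metric.mem_ball, lt_min_iff] at hw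
    exact ⟨w, ⟨hg, (h2 w hw.2).2 ho⟩, by rw [dist_comm]; exact hw.1⟩

theorem compl_subset_closure (h : Chain n X Y) :
    (chainRegion n X Y)ᶜ ⊆ closure {z | Generic n X Y z ∧ ¬ Odd (crossCount n X Y z)} := by
  intro z hz
  rw [Metric.mem_closure_iff]
  intro r hr
  simp only [chainRegion, mem_compl_iff, mem_ofPred_eq, not_or, not_exists, not_and] at hz
  obtain ⟨ρ, hρ, h1, h2⟩ := h.exists_ball hz.1
  obtain ⟨w, hw, hg⟩ := exists_generic n X Y z (lt_min hr hρ)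
  rw [Metric.mem_ball, lt_min_iff] at hw
  exact ⟨w, ⟨hg, fun hc => hz.2 ((h2 w hw.2).1 hc)⟩, by rw [dist_comm]; exact hw.1⟩

/-- A chain has at least two vertices with the largest abscissa. -/
theorem card_right (h : Chain n X Y) [DecidablePred fun v => ∃ i < n, X v < X i] :
    ((Finset.range n).filter fun v => ∃ i < n, X v < X i).card + 2 ≤ n := by
  classical
  have := h.three_le
  obtain ⟨m, hm, hmax⟩ := (Finset.range n).exists_max_image X ⟨0, by simp; omega⟩
  rw [Finset.mem_range] at hm
  have hmax : ∀ k < n, X k ≤ X m := fun k hk => hmax k (Finset.mem_range.2 hk)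
  -- If `m` were the only vertex with the largest abscissa, no vertical edge could end there, and
  -- the boundary would go straight on beyond it.
  obtain ⟨k, hk, hkm, hkX⟩ : ∃ k < n, k ≠ m ∧ X k = X m := by
    by_contra! hc
    obtain ⟨k, hk, -, hlt, -⟩ := (h.straight hm (by
      rintro i hi e ⟨h1, h2⟩
      have e1 : i = m := by by_contra hne; exact hc i hi hne h1
      obtain ⟨k, hk, hkX, hkY⟩ := h.exists_index (m := i + 1) (by omega)
      have e2 : k = m := by by_contra hne; exact hc k hk hne (by rw [hkX, ← e, h1])
      subst e1 e2
      exact h.nondeg k hi ⟨e, hkY⟩)).2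
    linarith [hmax k hk]
  have hsub : ((Finset.range n).filter fun v => ∃ i < n, X v < X i) ⊆
      ((Finset.range n).erase m).erase k := by
    intro v hv
    simp only [Finset.mem_filter, Finset.mem_range] at hv
    obtain ⟨hv, i, hi, hlt⟩ := hv
    have := hmax i hi
    simp only [Finset.mem_erase, Finset.mem_range]
    refine ⟨?_, ?_, hv⟩
    · rintro rfl; linarith
    · rintro rfl; linarith
  have hc := Finset.card_le_card hsub
  rw [Finset.card_erase_of_mem (by simp [hk, hkm]), Finset.card_erase_of_mem (by simp [hm]),
    Finset.card_range] at hc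
  omega

end Chain

/-! ### Polygons as chains -/

/-- A coordinate function of the vertices, the first vertex being repeated at the end. -/
noncomputable def closeUp {n : ℕ} (f : Fin n → ℝ) (k : ℕ) : ℝ :=
  if k < n then cellOf f k else cellOf f 0

theorem closeUp_of_lt {n : ℕ} (f : Fin n → ℝ) (i : Fin n) : closeUp f i = f i := by
  simp [closeUp, cellOf]

theorem closeUp_succ {n : ℕ} (f : Fin n → ℝ) (i : Fin n) :
    closeUp f (i + 1) = f (finRotate n i) := by
  obtain ⟨m, rfl⟩ : ∃ m, n = m + 1 := ⟨n - 1, by have := i.2; omega⟩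
  rcases Nat.lt_or_ge i m with h | h
  · have : finRotate (m + 1) i = ⟨i + 1, by omega⟩ := finRotate_of_lt h
    rw [this]
    simp [closeUp, cellOf, h]
  · have hi : i = ⟨m, by omega⟩ := Fin.ext (by have := i.2; simp; omega)
    rw [hi, finRotate_last']
    simp [closeUp, cellOf]

theorem mem_affineSegment_iff {u v z : ℝ × ℝ} (h : u.1 = v.1 ∨ u.2 = v.2) :
    z ∈ affineSegment ℝ u v ↔ z.1 ∈ uIcc u.1 v.1 ∧ z.2 ∈ uIcc u.2 v.2 := by
  obtain ⟨u1, u2⟩ := u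
  obtain ⟨v1, v2⟩ := v
  obtain ⟨z1, z2⟩ := z
  rw [affineSegment_eq_segment]
  rcases h with h | h
  · simp only at h
    subst h
    rw [← Prod.image_mk_segment_right, segment_eq_uIcc]
    simp [eq_comm, and_comm]
  · simp only at h
    subst h
    rw [← Prod.image_mk_segment_left, segment_eq_uIcc]
    simp [eq_comm]

namespace OrthogonalPolygon

variable {n : ℕ} (P : OrthogonalPolygon n)

/-- The abscissas of the vertices. -/
noncomputable def xs : ℕ → ℝ := closeUp fun k => (P.vertices k).1

/-- The ordinates of the vertices. -/
noncomputable def ys : ℕ → ℝ := closeUp fun k => (P.vertices k).2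

theorem onEdge_iff (i : Fin n) (z : ℝ × ℝ) :
    OnEdge P.xs P.ys i z ↔ z ∈ P.toPolygon.edgeSet ℝ i := by
  have := mem_affineSegment_iff (z := z) (P.axis_parallel i)
  rw [Polygon.edgeSet, OnEdge, xs, ys, closeUp_of_lt, closeUp_of_lt, closeUp_succ, closeUp_succ]
  exact this.symm

theorem vertex_succ (i : Fin n) : (P.xs (i + 1), P.ys (i + 1)) = P.vertices (finRotate n i) := by
  rw [xs, ys, closeUp_succ, closeUp_succ]

theorem chain : Chain n P.xs P.ys where
  three_le := P.three_le
  closedX := by have := P.three_le; simp [xs, closeUp]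
  closedY := by have := P.three_le; simp [ys, closeUp]
  axis i hi := by
    have := P.axis_parallel ⟨i, hi⟩
    rw [xs, ys, closeUp_of_lt _ ⟨i, hi⟩, closeUp_of_lt _ ⟨i, hi⟩, closeUp_succ _ ⟨i, hi⟩,
      closeUp_succ _ ⟨i, hi⟩]
    exact this
  nondeg i hi := by
    have := P.nondegenerate ⟨i, hi⟩
    rw [xs, ys, closeUp_of_lt _ ⟨i, hi⟩, closeUp_of_lt _ ⟨i, hi⟩, closeUp_succ _ ⟨i, hi⟩,
      closeUp_succ _ ⟨i, hi⟩]
    exact fun h => this (Prod.ext h.1 h.2)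
  simple i hi j hj z h1 h2 h3 h4 := by
    by_contra hne
    have hd := P.simple ⟨i, hi⟩ ⟨j, hj⟩ (by simpa using hne)
    rw [Set.disjoint_left] at hd
    refine hd ⟨(P.onEdge_iff ⟨i, hi⟩ z).1 h1, ?_⟩ ⟨(P.onEdge_iff ⟨j, hj⟩ z).1 h2, ?_⟩
    · rw [mem_singleton_iff, ← P.vertex_succ]; exact h3
    · rw [mem_singleton_iff, ← P.vertex_succ]; exact h4

theorem region_eq : P.region = chainRegion n P.xs P.ys := by
  classical
  ext z
  have h1 : z ∈ P.toPolygon.boundary ℝ ↔ ∃ i < n, OnEdge P.xs P.ys i z := by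
    rw [Polygon.boundary, mem_iUnion]
    constructor
    · rintro ⟨i, hi⟩; exact ⟨i, i.2, (P.onEdge_iff i z).2 hi⟩
    · rintro ⟨i, hi, h⟩; exact ⟨⟨i, hi⟩, (P.onEdge_iff ⟨i, hi⟩ z).1 h⟩
  have h2 : {i | P.Crosses z i}.ncard = crossCount n P.xs P.ys z := by
    rw [← Set.ncard_image_of_injective _ Fin.val_injective, crossCount, ← Set.ncard_coe_finset]
    congr 1
    ext i
    simp only [mem_image, Finset.coe_filter, Finset.mem_range, mem_ofPred_eq]
    have key : ∀ k : Fin n, P.Crosses z k ↔ z.1 < P.xs k ∧ Spans P.ys z.2 k := by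
      intro k
      rw [Crosses, Spans, xs, ys, closeUp_of_lt, closeUp_of_lt, closeUp_succ]
    constructor
    · rintro ⟨k, hk, rfl⟩; exact ⟨k.2, (key k).1 hk⟩
    · rintro ⟨hi, h⟩; exact ⟨⟨i, hi⟩, (key _).2 h, rfl⟩
  simp only [region, chainRegion, mem_union, mem_ofPred_eq, h1, h2]

end OrthogonalPolygon

/-! ### Boxes -/

/-- Data for an open axis-parallel rectangle; a side with a nonzero flag is at infinity. -/
structure Box where
  l : ℝ
  r : ℝ
  b : ℝ
  t : ℝ
  fl : ℕ
  fr : ℕ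
  fb : ℕ
  ft : ℕ

/-- The open rectangle of a box. -/
def Box.toSet (B : Box) : Set (ℝ × ℝ) :=
  {z | (B.fl = 0 → B.l < z.1) ∧ (B.fr = 0 → z.1 < B.r) ∧ (B.fb = 0 → B.b < z.2) ∧
    (B.ft = 0 → z.2 < B.t)}

theorem Box.isOpen (B : Box) : IsOpen B.toSet := by
  have h : ∀ (p : Prop) (q : ℝ × ℝ → Prop), IsOpen {z | q z} → IsOpen {z | p → q z} := by
    intro p q hq
    by_cases hp : p <;> simp [hp, hq]
  exact (h _ _ (isOpen_lt continuous_const continuous_fst)).and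
    ((h _ _ (isOpen_lt continuous_fst continuous_const)).and
      ((h _ _ (isOpen_lt continuous_const continuous_snd)).and
        (h _ _ (isOpen_lt continuous_snd continuous_const))))

/-- The flags are at most `1`, and the box is not empty. -/
structure Box.Proper (B : Box) : Prop where
  fl : B.fl ≤ 1
  fr : B.fr ≤ 1
  fb : B.fb ≤ 1
  ft : B.ft ≤ 1
  nonempty : B.toSet.Nonempty

/-- The boxes with numbers from `c₀` to `c₁` are contained in the set `S` and dense in it. -/
structure BoxCover (S : Set (ℝ × ℝ)) (c₀ c₁ : ℕ) (B : ℕ → Box) : Prop where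
  proper : ∀ k, c₀ ≤ k → k < c₁ → (B k).Proper
  sub : ∀ k, c₀ ≤ k → k < c₁ → (B k).toSet ⊆ S
  dense : S ⊆ closure (⋃ k ∈ Ico c₀ c₁, (B k).toSet)

/-- A box without sides at infinity. -/
def Box.Finite (B : Box) : Prop := B.fl = 0 ∧ B.fr = 0 ∧ B.fb = 0 ∧ B.ft = 0

/-- The boxes from `c₀` to `c₁` are the rectangles that start at the vertices of a chain. -/
structure CellBoxes (n : ℕ) (X Y : ℕ → ℝ) (want c₀ c₁ : ℕ) (B : ℕ → Box) : Prop where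
  flags : ∀ k, c₀ ≤ k → k < c₁ → (B k).fl ≤ 1 ∧ (B k).fr ≤ 1 ∧ (B k).fb ≤ 1 ∧ (B k).ft ≤ 1
  cell : ∀ k, c₀ ≤ k → k < c₁ → ∃ v < n, ∃ f, Emits n X Y want v f ∧
    (B k).toSet = cellSet n X Y v f
  surj : ∀ v < n, ∀ f, Emits n X Y want v f → ∃ k, c₀ ≤ k ∧ k < c₁ ∧
    (B k).toSet = cellSet n X Y v f

namespace Chain

variable {n : ℕ} {X Y : ℕ → ℝ}

/-- A point slightly to the right of `v`, and slightly above it for flag `0` or below it for flag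
`1`, satisfies all conditions. -/
theorem cellSet_nonempty (n : ℕ) (X Y : ℕ → ℝ) {want v f : ℕ} (he : Emits n X Y want v f) :
    (cellSet n X Y v f).Nonempty := by
  obtain ⟨a, a1, -, a3⟩ := exists_gap_right X n (X v) one_pos
  rcases he.2 with ⟨rfl, -⟩ | ⟨rfl, -⟩
  · obtain ⟨b, b1, -, b3⟩ := exists_gap_right Y n (Y v) one_pos
    refine ⟨(a, b), fun i hi _ h => b3 i hi.le (by simpa [Above] using h), fun i hi _ h => ?_,
      fun i hi _ h => a3 i hi.le h, fun i hi _ h => lt_of_le_of_lt h a1⟩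
    simp only [Above, zero_ne_one, false_and, or_false, not_lt] at h
    exact lt_of_le_of_lt h b1
  · obtain ⟨b, b1, -, b3⟩ := exists_gap_left Y n (Y v) one_pos
    refine ⟨(a, b), fun i hi _ h => ?_, fun i hi _ h => b3 i hi.le ?_,
      fun i hi _ h => a3 i hi.le h, fun i hi _ h => lt_of_le_of_lt h a1⟩
    · rcases h with h | h
      · exact lt_trans b1 h
      · exact lt_of_lt_of_le b1 h.2
    · simp only [Above, true_and, not_or, not_le] at h
      exact h.2

theorem bounds (X : ℕ → ℝ) (n : ℕ) : ∃ M, ∀ i ≤ n, -M < X i ∧ X i < M := by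
  induction n with
  | zero => exact ⟨|X 0| + 1, fun i hi => by
      obtain rfl : i = 0 := by omega
      exact ⟨by linarith [neg_abs_le (X 0)], by linarith [le_abs_self (X 0)]⟩⟩
  | succ n ih =>
    obtain ⟨M, hM⟩ := ih
    refine ⟨max M (|X (n + 1)| + 1), fun i hi => ?_⟩
    have h1 := le_max_left M (|X (n + 1)| + 1)
    have h2 := le_max_right M (|X (n + 1)| + 1)
    rcases Nat.lt_or_ge n i with h | h
    · obtain rfl : i = n + 1 := by omega
      exact ⟨by linarith [neg_abs_le (X (n + 1))], by linarith [le_abs_self (X (n + 1))]⟩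
    · have := hM i h
      constructor <;> linarith

/-- To the right of or below all vertices the ray to the right crosses nothing; to the left of or
above all vertices the ray upwards crosses nothing. -/
theorem not_odd_far (h : Chain n X Y) {z : ℝ × ℝ}
    (hz : (∀ i ≤ n, z.1 < X i) ∨ (∀ i ≤ n, X i ≤ z.1) ∨ (∀ i ≤ n, z.2 < Y i) ∨
      (∀ i ≤ n, Y i ≤ z.2)) : ¬ Odd (crossCount n X Y z) := by
  classical
  have right : ∀ (X Y : ℕ → ℝ) (z : ℝ × ℝ), (∀ i ≤ n, X i ≤ z.1) → crossCount n X Y z = 0 := by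
    intro X Y z hz
    unfold crossCount
    rw [Finset.card_eq_zero, Finset.filter_eq_empty_iff]
    rintro i hi ⟨h1, -⟩
    linarith [hz i (Finset.mem_range.1 hi).le]
  have below : ∀ (X Y : ℕ → ℝ) (z : ℝ × ℝ), (∀ i ≤ n, z.2 < Y i) → crossCount n X Y z = 0 := by
    intro X Y z hz
    unfold crossCount
    rw [Finset.card_eq_zero, Finset.filter_eq_empty_iff]
    rintro i hi ⟨-, h1⟩
    have hi := Finset.mem_range.1 hi
    have a := hz i hi.le
    have b := hz (i + 1) hi
    rcases h1 with h1 | h1 <;> linarith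
  rcases hz with hz | hz | hz | hz
  · rw [h.odd_crossCount, below _ _ _ hz]; simp
  · rw [right _ _ _ hz]; simp
  · rw [below _ _ _ hz]; simp
  · rw [h.odd_crossCount, right _ _ _ hz]; simp

/-- All points of a cell have odd parity, while far away the parity is even, so no side is at
infinity. For the same reason a generic inside point has vertices on both sides, as `exists_cell`
requires. -/
theorem inside_boxes (h : Chain n X Y) {c₀ c₁ : ℕ} {B : ℕ → Box}
    (hB : CellBoxes n X Y 1 c₀ c₁ B) :
    BoxCover (chainRegion n X Y) c₀ c₁ B ∧ ∀ k, c₀ ≤ k → k < c₁ → (B k).Finite := by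
  have hodd : ∀ k, c₀ ≤ k → k < c₁ → ∀ z ∈ (B k).toSet, Odd (crossCount n X Y z) := by
    intro k h1 h2 z hz
    obtain ⟨v, -, f, he, hs⟩ := hB.cell k h1 h2
    rw [hs] at hz
    exact Nat.odd_iff.2 (h.cellSet_parity he hz)
  have hne : ∀ k, c₀ ≤ k → k < c₁ → (B k).toSet.Nonempty := by
    intro k h1 h2
    obtain ⟨v, -, f, he, hs⟩ := hB.cell k h1 h2
    rw [hs]
    exact cellSet_nonempty n X Y he
  refine ⟨⟨fun k h1 h2 => ?_, fun k h1 h2 z hz => Or.inr (hodd k h1 h2 z hz), ?_⟩, ?_⟩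
  · obtain ⟨a, b, c, d⟩ := hB.flags k h1 h2
    exact ⟨a, b, c, d, hne k h1 h2⟩
  · refine h.region_subset_closure.trans (closure_mono ?_)
    rintro z ⟨hg, ho⟩
    have e1 : ∃ i < n, X i ≤ z.1 := by
      by_contra! hc
      refine h.not_odd_far (Or.inl fun i hi => ?_) ho
      obtain ⟨k, hk, hkX, -⟩ := h.exists_index hi
      rw [← hkX]; exact hc k hk
    have e2 : ∃ i < n, z.1 < X i := by
      by_contra! hc
      refine h.not_odd_far (Or.inr (Or.inl fun i hi => ?_)) ho
      obtain ⟨k, hk, hkX, -⟩ := h.exists_index hi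
      rw [← hkX]; exact hc k hk
    obtain ⟨v, hv, f, he, hz⟩ := h.exists_cell hg (Nat.odd_iff.1 ho) e1 e2
    obtain ⟨k, k1, k2, hs⟩ := hB.surj v hv f he
    exact mem_iUnion₂.2 ⟨k, ⟨k1, k2⟩, by rw [hs]; exact hz⟩
  · intro k h1 h2
    obtain ⟨z, z1, z2, z3, z4⟩ := hne k h1 h2
    obtain ⟨M, hM⟩ := bounds X n
    obtain ⟨M', hM'⟩ := bounds Y n
    refine ⟨?_, ?_, ?_, ?_⟩
    · by_contra hf
      refine h.not_odd_far (Or.inl fun i hi => ?_) (hodd k h1 h2 (min z.1 (-M), z.2)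
        ⟨fun hc => absurd hc hf, fun hc => (min_le_left _ _).trans_lt (z2 hc), z3, z4⟩)
      exact (min_le_right _ _).trans_lt (hM i hi).1
    · by_contra hf
      refine h.not_odd_far (Or.inr (Or.inl fun i hi => ?_)) (hodd k h1 h2 (max z.1 M, z.2)
        ⟨fun hc => (z1 hc).trans_le (le_max_left _ _), fun hc => absurd hc hf, z3, z4⟩)
      exact (hM i hi).2.le.trans (le_max_right _ _)
    · by_contra hf
      refine h.not_odd_far (Or.inr (Or.inr (Or.inl fun i hi => ?_)))
        (hodd k h1 h2 (z.1, min z.2 (-M'))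
        ⟨z1, z2, fun hc => absurd hc hf, fun hc => (min_le_left _ _).trans_lt (z4 hc)⟩)
      exact (min_le_right _ _).trans_lt (hM' i hi).1
    · by_contra hf
      refine h.not_odd_far (Or.inr (Or.inr (Or.inr fun i hi => ?_)))
        (hodd k h1 h2 (z.1, max z.2 M')
        ⟨z1, z2, fun hc => (z3 hc).trans_le (le_max_left _ _), fun hc => absurd hc hf⟩)
      exact (hM' i hi).2.le.trans (le_max_right _ _)

/-- Points to the left or to the right of the whole chain are out of reach of `exists_cell`; the two
half planes take care of them. They use up the two boxes saved by `card_right`. -/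
theorem outside_boxes (h : Chain n X Y) {c₀ c₁ : ℕ} {B : ℕ → Box} {lo hi : ℝ}
    (hB : CellBoxes n X Y 0 c₀ c₁ B) (hc : c₀ ≤ c₁) (hlo : ∀ i < n, lo ≤ X i)
    (hlo' : ∃ i < n, lo = X i) (hhi : ∀ i < n, X i ≤ hi) (hhi' : ∃ i < n, hi = X i)
    (h0 : B c₁ = ⟨0, lo, 0, 0, 1, 0, 1, 1⟩) (h1 : B (c₁ + 1) = ⟨hi, 0, 0, 0, 0, 1, 1, 1⟩) :
    BoxCover (chainRegion n X Y)ᶜ c₀ (c₁ + 2) B := by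
  have s0 : (B c₁).toSet = {z | z.1 < lo} := by rw [h0]; simp [Box.toSet]
  have s1 : (B (c₁ + 1)).toSet = {z | hi < z.1} := by rw [h1]; simp [Box.toSet]
  have cases : ∀ k, k < c₁ + 2 → k < c₁ ∨ k = c₁ ∨ k = c₁ + 1 := by intro k hk; omega
  refine ⟨fun k a b => ?_, fun k a b z hz => ?_, ?_⟩
  · rcases cases k b with b | rfl | rfl
    · obtain ⟨v, -, f, he, hs⟩ := hB.cell k a b
      obtain ⟨c, d, e, g⟩ := hB.flags k a b
      exact ⟨c, d, e, g, by rw [hs]; exact cellSet_nonempty n X Y he⟩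
    · exact ⟨by simp [h0], by simp [h0], by simp [h0], by simp [h0],
        by rw [s0]; exact ⟨(lo - 1, 0), by simp⟩⟩
    · exact ⟨by simp [h1], by simp [h1], by simp [h1], by simp [h1],
        by rw [s1]; exact ⟨(hi + 1, 0), by simp⟩⟩
  · rintro (⟨i, hi', ho⟩ | ho)
    · rcases cases k b with b | rfl | rfl
      · obtain ⟨v, -, f, he, hs⟩ := hB.cell k a b
        rw [hs] at hz
        exact InCell.not_onEdge hz h hi' ho
      · rw [s0] at hz
        obtain ⟨k, hk, hkX, -⟩ := h.exists_index (m := i + 1) (by omega)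
        have : lo ≤ z.1 := (le_min (hlo i hi') (hkX ▸ hlo k hk)).trans ho.1.1
        exact absurd (show z.1 < lo from hz) (not_lt.2 this)
      · rw [s1] at hz
        obtain ⟨k, hk, hkX, -⟩ := h.exists_index (m := i + 1) (by omega)
        have : z.1 ≤ hi := ho.1.2.trans (max_le (hhi i hi') (hkX ▸ hhi k hk))
        exact absurd (show hi < z.1 from hz) (not_lt.2 this)
    · rcases cases k b with b | rfl | rfl
      · obtain ⟨v, -, f, he, hs⟩ := hB.cell k a b
        rw [hs] at hz
        have := h.cellSet_parity he hz
        rw [Nat.odd_iff] at ho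
        omega
      · rw [s0] at hz
        refine h.not_odd_far (Or.inl fun i hi => ?_) ho
        obtain ⟨k, hk, hkX, -⟩ := h.exists_index hi
        rw [← hkX]; exact lt_of_lt_of_le hz (hlo k hk)
      · rw [s1] at hz
        refine h.not_odd_far (Or.inr (Or.inl fun i hi => ?_)) ho
        obtain ⟨k, hk, hkX, -⟩ := h.exists_index hi
        rw [← hkX]; exact (hhi k hk).trans (le_of_lt hz)
  · refine h.compl_subset_closure.trans (closure_mono ?_)
    rintro z ⟨hg, ho⟩
    rw [mem_iUnion₂]
    by_cases e1 : ∃ i < n, X i ≤ z.1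
    · by_cases e2 : ∃ i < n, z.1 < X i
      · obtain ⟨v, hv, f, he, hz⟩ := h.exists_cell hg (want := 0)
          (by rw [Nat.odd_iff] at ho; omega) e1 e2
        obtain ⟨k, k1, k2, hs⟩ := hB.surj v hv f he
        exact ⟨k, ⟨k1, by omega⟩, by rw [hs]; exact hz⟩
      · push Not at e2
        refine ⟨c₁ + 1, ⟨by omega, by omega⟩, ?_⟩
        rw [s1]
        obtain ⟨i, hi', rfl⟩ := hhi'
        exact lt_of_le_of_ne (e2 i hi') (Ne.symm (hg i hi').1)
    · push Not at e1
      refine ⟨c₁, ⟨hc, by omega⟩, ?_⟩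
      rw [s0]
      obtain ⟨i, hi', rfl⟩ := hlo'
      exact e1 i hi'

end Chain

/-! ### Placements -/

/-- The translation by `τ` puts the copy of the box `B`, scaled by `lam`, so that it meets the
box `C`. -/
def Hit (B C : Box) (lam : ℝ) (τ : ℝ × ℝ) : Prop :=
  (C.fl = 0 → C.l - lam * B.r < τ.1) ∧ (C.fr = 0 → τ.1 < C.r - lam * B.l) ∧
    (C.fb = 0 → C.b - lam * B.t < τ.2) ∧ (C.ft = 0 → τ.2 < C.t - lam * B.b)

/-- One coordinate of two boxes that meet; `p` and `q` express that the left and the right end of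
the fixed interval are finite. -/
theorem exists_scaled_between {pl pr l r lam τ : ℝ} {p q : Prop} (hp : pl < pr) (hl : 0 < lam)
    (hlr : p → q → l < r) (h1 : p → l - lam * pr < τ) (h2 : q → τ < r - lam * pl) :
    ∃ z, pl < z ∧ z < pr ∧ (p → l < lam * z + τ) ∧ (q → lam * z + τ < r) := by
  have e1 : p → (l - τ) / lam < pr := fun h => by
    rw [div_lt_iff₀ hl]; linarith [h1 h]
  have e2 : q → pl < (r - τ) / lam := fun h => by
    rw [lt_div_iff₀ hl]; linarith [h2 h]
  have e3 : p → q → (l - τ) / lam < (r - τ) / lam := fun h h' => by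
    have := hlr h h'
    gcongr
  have f1 : ∀ z, (l - τ) / lam < z → l < lam * z + τ := fun z hz => by
    rw [div_lt_iff₀ hl] at hz; linarith
  have f2 : ∀ z, z < (r - τ) / lam → lam * z + τ < r := fun z hz => by
    rw [lt_div_iff₀ hl] at hz; linarith
  by_cases hp' : p <;> by_cases hq' : q
  · obtain ⟨z, a, b⟩ := exists_between
      (max_lt (lt_min hp (e2 hq')) (lt_min (e1 hp') (e3 hp' hq')))
    rw [max_lt_iff] at a; rw [lt_min_iff] at b
    exact ⟨z, a.1, b.1, fun _ => f1 z a.2, fun _ => f2 z b.2⟩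
  · obtain ⟨z, a, b⟩ := exists_between (max_lt hp (e1 hp'))
    rw [max_lt_iff] at a
    exact ⟨z, a.1, b, fun _ => f1 z a.2, fun h => absurd h hq'⟩
  · obtain ⟨z, a, b⟩ := exists_between (lt_min hp (e2 hq'))
    rw [lt_min_iff] at b
    exact ⟨z, a, b.1, fun h => absurd h hp', fun _ => f2 z b.2⟩
  · obtain ⟨z, a, b⟩ := exists_between hp
    exact ⟨z, a, b, fun h => absurd h hp', fun h => absurd h hq'⟩

/-- If the boxes meet, a point of `S` is mapped into the complement of `R`. Conversely, being mapped
into this open complement is stable under small changes, so by density the point can first be moved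
into a box of `S`, and then its image into a box of the complement. -/
theorem fits_iff {S R : Set (ℝ × ℝ)} {a b b' : ℕ} {B : ℕ → Box} (hR : IsClosed R)
    (hS : BoxCover S 0 a B) (hf : ∀ k < a, (B k).Finite) (hR' : BoxCover Rᶜ b b' B) {lam : ℝ}
    (hl : 0 < lam) (τ : ℝ × ℝ) :
    (∀ z ∈ S, lam • z + τ ∈ R) ↔
      ∀ i < a, ∀ j, b ≤ j → j < b' → ¬ Hit (B i) (B j) lam τ := by
  constructor
  · intro h i hi j hj hj' ⟨h1, h2, h3, h4⟩
    obtain ⟨f1, f2, f3, f4⟩ := hf i hi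
    obtain ⟨w, w1, w2, w3, w4⟩ := (hS.proper i (Nat.zero_le _) hi).nonempty
    obtain ⟨u, u1, u2, u3, u4⟩ := (hR'.proper j hj hj').nonempty
    obtain ⟨x, x1, x2, x3, x4⟩ := exists_scaled_between ((w1 f1).trans (w2 f2)) hl
      (fun hp hq => (u1 hp).trans (u2 hq)) h1 h2
    obtain ⟨y, y1, y2, y3, y4⟩ := exists_scaled_between ((w3 f3).trans (w4 f4)) hl
      (fun hp hq => (u3 hp).trans (u4 hq)) h3 h4
    have hm := h (x, y) (hS.sub i (Nat.zero_le _) hi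
      ⟨fun _ => x1, fun _ => x2, fun _ => y1, fun _ => y2⟩)
    exact hR'.sub j hj hj' ⟨x3, x4, y3, y4⟩ hm
  · intro h z hz
    by_contra hn
    have hcont : Continuous fun w : ℝ × ℝ => lam • w + τ := by fun_prop
    have hO : IsOpen ((fun w : ℝ × ℝ => lam • w + τ) ⁻¹' Rᶜ) := hR.isOpen_compl.preimage hcont
    obtain ⟨w, hw1, hw2⟩ := mem_closure_iff.1 (hS.dense hz) _ hO hn
    obtain ⟨i, hi, hwi⟩ := mem_iUnion₂.1 hw2
    have hcont' : Continuous fun u : ℝ × ℝ => lam⁻¹ • (u - τ) := by fun_prop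
    have hO' : IsOpen ((fun u : ℝ × ℝ => lam⁻¹ • (u - τ)) ⁻¹' (B i).toSet) :=
      (B i).isOpen.preimage hcont'
    obtain ⟨u, hu1, hu2⟩ := mem_closure_iff.1 (hR'.dense hw1) _ hO' (by
      simp only [mem_preimage, add_sub_cancel_right, inv_smul_smul₀ hl.ne']; exact hwi)
    obtain ⟨j, hj, huj⟩ := mem_iUnion₂.1 hu2
    obtain ⟨f1, f2, f3, f4⟩ := hf i hi.2
    obtain ⟨a1, a2, a3, a4⟩ := hu1
    obtain ⟨b1, b2, b3, b4⟩ := huj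
    have a1 := a1 f1
    have a2 := a2 f2
    have a3 := a3 f3
    have a4 := a4 f4
    simp only [Prod.smul_fst, Prod.smul_snd, Prod.fst_sub, Prod.snd_sub, smul_eq_mul,
      inv_mul_eq_div] at a1 a2 a3 a4
    rw [lt_div_iff₀ hl] at a1 a3
    rw [div_lt_iff₀ hl] at a2 a4
    refine h i hi.2 j hj.1 hj.2 ⟨fun e => ?_, fun e => ?_, fun e => ?_, fun e => ?_⟩
    · linarith [b1 e]
    · linarith [b2 e]
    · linarith [b3 e]
    · linarith [b4 e]

/-- A generic inside point has a ball around it that avoids the boundary and has constant parity; a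
bounded set fits into it after shrinking. -/
theorem Chain.exists_fits {n : ℕ} {X Y : ℕ → ℝ} (h : Chain n X Y) {S : Set (ℝ × ℝ)}
    (hS : Bornology.IsBounded S) :
    ∃ lam : ℝ, 0 < lam ∧ ∃ τ : ℝ × ℝ, ∀ z ∈ S, lam • z + τ ∈ chainRegion n X Y := by
  have h3 := h.three_le
  have hne : (chainRegion n X Y).Nonempty :=
    ⟨(X 0, Y 0), Or.inl ⟨0, by omega, by simp [OnEdge]⟩⟩
  obtain ⟨w, hg, ho⟩ := closure_nonempty_iff.1 (hne.mono h.region_subset_closure)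
  obtain ⟨r, hr, -, h2⟩ := h.exists_ball fun i hi => h.generic_not_onEdge hg hi
  obtain ⟨M, hM⟩ := hS.exists_norm_le
  refine ⟨r / (|M| + 1), by positivity, w, fun z hz => Or.inr ?_⟩
  refine (h2 _ ?_).2 ho
  rw [Metric.mem_ball, dist_eq_norm, add_sub_cancel_right, norm_smul, Real.norm_of_nonneg
    (by positivity), div_mul_eq_mul_div, div_lt_iff₀ (by positivity)]
  have : ‖z‖ < |M| + 1 := lt_of_le_of_lt ((hM z hz).trans (le_abs_self M)) (by linarith)
  gcongr

/-! ### Moving lines -/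

/-- Moving coordinates: line `x` is at `b x - lam * a x` at time `lam`, and belongs to the class
`cls x`; lines of a smaller class always come first.  The numbers `c x` serve to break ties.  The
pairs `ev 0, ev 1, …` list the pairs of lines that change places when `lam` goes down to `0`. -/
structure Kin where
  L : ℕ
  cls : ℕ → ℕ
  a : ℕ → ℝ
  b : ℕ → ℝ
  c : ℕ → ℝ
  ev : ℕ → ℕ × ℕ

namespace Kin

/-- The order of the lines for very large `lam`. -/
def sig (D : Kin) (x y : ℕ) : Prop :=
  D.cls x < D.cls y ∨ (D.cls x = D.cls y ∧ (D.a y < D.a x ∨ (D.a x = D.a y ∧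
    (D.b x < D.b y ∨ (D.b x = D.b y ∧ D.c x < D.c y)))))

/-- The pair changes places at some positive time. -/
def Valid (D : Kin) (e : ℕ × ℕ) : Prop :=
  e.1 < D.L ∧ e.2 < D.L ∧ D.cls e.1 = D.cls e.2 ∧ D.a e.2 < D.a e.1 ∧ D.b e.2 < D.b e.1

/-- The time at which a pair changes places, with two further components to break ties. -/
noncomputable def key (D : Kin) (e : ℕ × ℕ) : ℝ ×ₗ ℝ ×ₗ ℝ :=
  toLex ((D.b e.1 - D.b e.2) / (D.a e.1 - D.a e.2),
    toLex ((D.c e.1 - D.c e.2) / (D.a e.1 - D.a e.2), D.a e.1 + D.a e.2))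

open Classical in
/-- The ranks of the lines after `k` pairs have changed places. -/
noncomputable def pos (D : Kin) : ℕ → ℕ → ℕ
  | 0, x => 1 + ((Finset.range D.L).filter fun y => D.sig y x).card
  | k + 1, x => if D.Valid (D.ev k) then
      (if x = (D.ev k).1 then D.pos k x + 1 else if x = (D.ev k).2 then D.pos k x - 1
        else D.pos k x) else D.pos k x

/-- The sequence `ev` lists every valid pair once, in the order of decreasing times. -/
structure Ordered (D : Kin) (W : ℕ) : Prop where
  c_inj : ∀ x < D.L, ∀ y < D.L, D.c x = D.c y → x = y
  sorted : ∀ i j, i ≤ j → D.Valid (D.ev i) → D.Valid (D.ev j) → D.key (D.ev j) ≤ D.key (D.ev i)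
  complete : ∀ e, D.Valid e → ∃ k, D.ev k = e
  inj : ∀ i j, D.Valid (D.ev i) → D.ev i = D.ev j → i = j
  bound : ∀ i, D.Valid (D.ev i) → i < W

/-- The pair `(x, y)` is among the first `k` ones. -/
def Flipped (D : Kin) (k x y : ℕ) : Prop := D.Valid (x, y) ∧ ∃ j < k, D.ev j = (x, y)

/-- The order of the lines after `k` changes. -/
def Before (D : Kin) (k x y : ℕ) : Prop :=
  (D.sig x y ∧ ¬ D.Flipped k x y) ∨ D.Flipped k y x

/-- The time `t` lies between the first `k` changes and the later ones. -/
def Thr (D : Kin) (k : ℕ) (t : ℝ ×ₗ ℝ ×ₗ ℝ) : Prop :=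
  (∀ x y, D.Flipped k x y → t ≤ D.key (x, y)) ∧
    ∀ x y, D.Valid (x, y) → ¬ D.Flipped k x y → D.key (x, y) ≤ t

/-- The position of a line at time `t`, with two further components to break ties. -/
noncomputable def val (D : Kin) (t : ℝ ×ₗ ℝ ×ₗ ℝ) (x : ℕ) : ℝ ×ₗ ℝ ×ₗ ℝ :=
  toLex (D.b x - (ofLex t).1 * D.a x, toLex (D.c x - (ofLex (ofLex t).2).1 * D.a x,
    D.a x ^ 2 - (ofLex (ofLex t).2).2 * D.a x))

variable {D : Kin} {W : ℕ}

theorem lex_le_iff (u v : ℝ ×ₗ ℝ ×ₗ ℝ) : u ≤ v ↔ (ofLex u).1 < (ofLex v).1 ∨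
    ((ofLex u).1 = (ofLex v).1 ∧ ((ofLex (ofLex u).2).1 < (ofLex (ofLex v).2).1 ∨
      ((ofLex (ofLex u).2).1 = (ofLex (ofLex v).2).1 ∧
        (ofLex (ofLex u).2).2 ≤ (ofLex (ofLex v).2).2))) := by
  rw [Prod.Lex.le_iff, Prod.Lex.le_iff]

theorem div_lt_iff_lin {u v d t a a' : ℝ} (hd : 0 < d) (ha : a - a' = d) :
    (u - v) / d < t ↔ u - t * a < v - t * a' := by
  rw [div_lt_iff₀ hd, ← ha]
  constructor <;> intro h <;> nlinarith

theorem lt_div_iff_lin {u v d t a a' : ℝ} (hd : 0 < d) (ha : a - a' = d) :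
    t < (u - v) / d ↔ v - t * a' < u - t * a := by
  rw [lt_div_iff₀ hd, ← ha]
  constructor <;> intro h <;> nlinarith

theorem div_eq_iff_lin {u v d t a a' : ℝ} (hd : 0 < d) (ha : a - a' = d) :
    (u - v) / d = t ↔ u - t * a = v - t * a' := by
  rw [div_eq_iff hd.ne', ← ha]
  constructor <;> intro h <;> nlinarith

/-- Each component of the key is the parameter at which two affine functions with slopes `- D.a x`
and `- D.a y` agree. For the last one this is the identity `(a² - a'²) / (a - a') = a + a'`. So the
lexicographic comparisons match component by component. -/
theorem key_le_iff {x y : ℕ} (h : D.a y < D.a x) (t : ℝ ×ₗ ℝ ×ₗ ℝ) :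
    D.key (x, y) ≤ t ↔ D.val t x ≤ D.val t y := by
  have hd : 0 < D.a x - D.a y := sub_pos.2 h
  rw [lex_le_iff, lex_le_iff]
  simp only [key, val, ofLex_toLex]
  rw [div_lt_iff_lin hd rfl, div_eq_iff_lin hd rfl, div_lt_iff_lin hd rfl, div_eq_iff_lin hd rfl]
  have : D.a x + D.a y ≤ (ofLex (ofLex t).2).2 ↔
      D.a x ^ 2 - (ofLex (ofLex t).2).2 * D.a x ≤ D.a y ^ 2 - (ofLex (ofLex t).2).2 * D.a y := by
    constructor <;> intro h <;> nlinarith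
  rw [this]

theorem le_key_iff {x y : ℕ} (h : D.a y < D.a x) (t : ℝ ×ₗ ℝ ×ₗ ℝ) :
    t ≤ D.key (x, y) ↔ D.val t y ≤ D.val t x := by
  have hd : 0 < D.a x - D.a y := sub_pos.2 h
  rw [lex_le_iff, lex_le_iff]
  simp only [key, val, ofLex_toLex]
  rw [lt_div_iff_lin hd rfl, eq_comm, div_eq_iff_lin hd rfl, lt_div_iff_lin hd rfl,
    eq_comm (b := (_ : ℝ) / _), div_eq_iff_lin hd rfl]
  have : (ofLex (ofLex t).2).2 ≤ D.a x + D.a y ↔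
      D.a y ^ 2 - (ofLex (ofLex t).2).2 * D.a y ≤ D.a x ^ 2 - (ofLex (ofLex t).2).2 * D.a x := by
    constructor <;> intro h <;> nlinarith
  rw [this, eq_comm, eq_comm (b := D.c x - _)]

theorem Valid.sig {x y : ℕ} (h : D.Valid (x, y)) : D.sig x y := Or.inr ⟨h.2.2.1, Or.inl h.2.2.2.1⟩

theorem sig_asymm {x y : ℕ} (h : D.sig x y) : ¬ D.sig y x := by
  intro h'
  rcases h with h | ⟨h, h | ⟨h1, h | ⟨h2, h⟩⟩⟩ <;>
    rcases h' with h' | ⟨h', h'' | ⟨h1', h'' | ⟨h2', h''⟩⟩⟩ <;> first | omega | linarith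

theorem Ordered.sig_total (hD : D.Ordered W) {x y : ℕ} (hx : x < D.L) (hy : y < D.L)
    (h : x ≠ y) : D.sig x y ∨ D.sig y x := by
  have hc : D.c x ≠ D.c y := fun e => h (hD.c_inj x hx y hy e)
  unfold sig
  rcases lt_trichotomy (D.cls x) (D.cls y) with e | e | e
  · exact Or.inl (Or.inl e)
  · rcases lt_trichotomy (D.a x) (D.a y) with e1 | e1 | e1
    · exact Or.inr (Or.inr ⟨e.symm, Or.inl e1⟩)
    · rcases lt_trichotomy (D.b x) (D.b y) with e2 | e2 | e2
      · exact Or.inl (Or.inr ⟨e, Or.inr ⟨e1, Or.inl e2⟩⟩)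
      · rcases lt_or_gt_of_ne hc with e3 | e3
        · exact Or.inl (Or.inr ⟨e, Or.inr ⟨e1, Or.inr ⟨e2, e3⟩⟩⟩)
        · exact Or.inr (Or.inr ⟨e.symm, Or.inr ⟨e1.symm, Or.inr ⟨e2.symm, e3⟩⟩⟩)
      · exact Or.inr (Or.inr ⟨e.symm, Or.inr ⟨e1.symm, Or.inl e2⟩⟩)
    · exact Or.inl (Or.inr ⟨e, Or.inl e1⟩)
  · exact Or.inr (Or.inl e)

theorem Before.asymm {k x y : ℕ} (h : D.Before k x y) : ¬ D.Before k y x := by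
  rintro h'
  rcases h with ⟨h1, h2⟩ | h <;> rcases h' with ⟨h1', h2'⟩ | h'
  · exact sig_asymm h1 h1'
  · exact h2 h'
  · exact h2' h
  · exact sig_asymm h.1.sig h'.1.sig

theorem Ordered.total (hD : D.Ordered W) (k : ℕ) {x y : ℕ} (hx : x < D.L) (hy : y < D.L)
    (h : x ≠ y) : D.Before k x y ∨ D.Before k y x := by
  unfold Before
  rcases hD.sig_total hx hy h with hs | hs <;> tauto

theorem Before.cls_le {k x y : ℕ} (h : D.Before k x y) : D.cls x ≤ D.cls y := by
  rcases h with ⟨h | h, -⟩ | h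
  · exact h.le
  · exact h.1.le
  · exact h.1.2.2.1.ge

theorem before_of_cls_lt {k x y : ℕ} (h : D.cls x < D.cls y) : D.Before k x y :=
  Or.inl ⟨Or.inl h, fun hf => h.ne hf.1.2.2.1⟩

/-- Between two changes the combinatorial order agrees with the perturbed positions. A pair with
different slopes that never changes places has a key with nonpositive first component; this is why
`t` must have a positive one. -/
theorem Thr.val_le {k : ℕ} {t : ℝ ×ₗ ℝ ×ₗ ℝ} (ht : D.Thr k t) (h0 : 0 < (ofLex t).1) {x y : ℕ}
    (hx : x < D.L) (hy : y < D.L) (hc : D.cls x = D.cls y) (h : D.Before k x y) :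
    D.val t x ≤ D.val t y := by
  rcases h with ⟨hs, hf⟩ | hf
  · rcases hs with hs | ⟨-, hs | ⟨h1, hs⟩⟩
    · exact absurd hc hs.ne
    · rw [← key_le_iff hs]
      by_cases hb : D.b y < D.b x
      · exact ht.2 x y ⟨hx, hy, hc, hs, hb⟩ hf
      · rw [lex_le_iff]
        left
        refine lt_of_le_of_lt ?_ h0
        exact div_nonpos_of_nonpos_of_nonneg (by simp only; linarith) (by simp only; linarith)
    · rw [lex_le_iff]
      simp only [val, ofLex_toLex, h1]
      rcases hs with hs | ⟨h2, hs⟩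
      · left; linarith
      · right; exact ⟨by rw [h2], Or.inl (by linarith)⟩
  · exact (le_key_iff hf.1.2.2.2.1 t).1 (ht.1 y x hf)

/-- If two lines agree in all components, their `a` differ, since otherwise their `c` would be
equal, and the sum of their `a` is the third component of `t`. For three lines two of these sums
give a contradiction. -/
theorem Ordered.no_triple (hD : D.Ordered W) {t : ℝ ×ₗ ℝ ×ₗ ℝ} {x y z : ℕ} (hx : x < D.L)
    (hy : y < D.L) (hz : z < D.L) (hxy : x ≠ y) (hxz : x ≠ z) (hyz : y ≠ z)
    (h1 : D.val t x = D.val t y) (h2 : D.val t x = D.val t z) : False := by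
  have comp : ∀ u < D.L, ∀ v < D.L, u ≠ v → D.val t u = D.val t v →
      D.a u ≠ D.a v ∧ D.a u + D.a v = (ofLex (ofLex t).2).2 := by
    intro u hu v hv hne h
    have e2 : D.c u - (ofLex (ofLex t).2).1 * D.a u = D.c v - (ofLex (ofLex t).2).1 * D.a v :=
      congrArg (fun w => (ofLex (ofLex w).2).1) h
    have e3 : D.a u ^ 2 - (ofLex (ofLex t).2).2 * D.a u =
        D.a v ^ 2 - (ofLex (ofLex t).2).2 * D.a v := congrArg (fun w => (ofLex (ofLex w).2).2) h
    have hne' : D.a u ≠ D.a v := by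
      intro e
      rw [e] at e2
      exact hne (hD.c_inj u hu v hv (by linarith))
    refine ⟨hne', ?_⟩
    have : (D.a u - D.a v) * (D.a u + D.a v - (ofLex (ofLex t).2).2) = 0 := by linarith
    rcases mul_eq_zero.1 this with h | h
    · exact absurd (sub_eq_zero.1 h) hne'
    · linarith
  obtain ⟨-, a1⟩ := comp x hx y hy hxy h1
  obtain ⟨-, a2⟩ := comp x hx z hz hxz h2
  obtain ⟨a3, -⟩ := comp y hy z hz hyz (h1.symm.trans h2)
  exact a3 (by linarith)

/-- The time of the change itself separates the earlier changes from the later ones, because `Thr`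
has weak inequalities. So a failure after change `k` yields a free point exactly at the time of
change `k`. -/
theorem thr_succ (hD : D.Ordered W) {k : ℕ} (hv : D.Valid (D.ev k)) :
    D.Thr (k + 1) (D.key (D.ev k)) := by
  constructor
  · rintro x y ⟨h, j, hj, e⟩
    rw [← e]
    exact hD.sorted j k (by omega) (by rwa [e]) hv
  · rintro x y h hn
    obtain ⟨j, hj⟩ := hD.complete _ h
    have : k ≤ j := by
      by_contra hc
      exact hn ⟨h, j, by omega, hj⟩
    rw [← hj]
    exact hD.sorted k j this hv (by rwa [hj])

theorem thr_zero (D : Kin) (M : ℝ) : ∃ t, D.Thr 0 t ∧ M < (ofLex t).1 := by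
  obtain ⟨B, hB⟩ : ∃ B : ℝ, ∀ e ∈ Finset.range D.L ×ˢ Finset.range D.L,
      (ofLex (D.key e)).1 ≤ B := by
    obtain ⟨B, hB⟩ := ((Finset.range D.L ×ˢ Finset.range D.L).image
      fun e => (ofLex (D.key e)).1).bddAbove
    exact ⟨B, fun e he => hB (Finset.mem_coe.2 (Finset.mem_image_of_mem _ he))⟩
  refine ⟨toLex (max M B + 1, toLex (0, 0)), ⟨?_, ?_⟩, ?_⟩
  · rintro x y ⟨-, j, hj, -⟩; omega
  · rintro x y hv -
    rw [lex_le_iff]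
    left
    have := hB (x, y) (by simp [hv.1, hv.2.1])
    simp only [ofLex_toLex]
    linarith [le_max_right M B]
  · simp only [ofLex_toLex]
    linarith [le_max_left M B]

theorem exists_thr (hD : D.Ordered W) (k : ℕ) : ∃ t, D.Thr k t ∧ 0 < (ofLex t).1 := by
  induction k with
  | zero => exact thr_zero D 0
  | succ k ih =>
    by_cases hv : D.Valid (D.ev k)
    · refine ⟨_, thr_succ hD hv, ?_⟩
      exact div_pos (sub_pos.2 hv.2.2.2.2) (sub_pos.2 hv.2.2.2.1)
    · obtain ⟨t, ht, h0⟩ := ih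
      have : ∀ x y, D.Flipped (k + 1) x y ↔ D.Flipped k x y := by
        intro x y
        constructor
        · rintro ⟨h, j, hj, e⟩
          refine ⟨h, j, ?_, e⟩
          have : j ≠ k := by rintro rfl; exact hv (by rwa [e])
          omega
        · rintro ⟨h, j, hj, e⟩; exact ⟨h, j, by omega, e⟩
      exact ⟨t, ⟨fun x y h => ht.1 x y ((this x y).1 h),
        fun x y h h' => ht.2 x y h fun hc => h' ((this x y).2 hc)⟩, h0⟩

/-- The index is that of the first valid pair with key at most `t`, or `W` if there is none; entries
that are not valid play no role. -/
theorem exists_thr_at (hD : D.Ordered W) (t : ℝ ×ₗ ℝ ×ₗ ℝ) : ∃ k ≤ W, D.Thr k t := by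
  classical
  by_cases hex : ∃ i, D.Valid (D.ev i) ∧ D.key (D.ev i) ≤ t
  · obtain ⟨hk, hkt⟩ := Nat.find_spec hex
    refine ⟨Nat.find hex, (hD.bound _ hk).le, ?_, ?_⟩
    · rintro x y ⟨h, j, hj, e⟩
      have := Nat.find_min hex hj
      rw [e] at this
      by_contra hc
      exact this ⟨h, (not_le.1 hc).le⟩
    · rintro x y h hn
      obtain ⟨j, hj⟩ := hD.complete _ h
      have : Nat.find hex ≤ j := by
        by_contra hc
        exact hn ⟨h, j, by omega, hj⟩
      rw [← hj]
      exact (hD.sorted _ j this hk (by rwa [hj])).trans hkt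
  · push Not at hex
    refine ⟨W, le_rfl, ?_, ?_⟩
    · rintro x y ⟨h, j, hj, e⟩
      have := hex j (by rwa [e])
      rw [e] at this
      exact this.le
    · rintro x y h hn
      obtain ⟨j, hj⟩ := hD.complete _ h
      exact absurd ⟨h, j, hD.bound j (by rwa [hj]), hj⟩ hn

/-- Different classes are in a fixed order. A cycle within one class would force the three lines
into the same position at a separating time, against `no_triple`. -/
theorem Ordered.trans (hD : D.Ordered W) {k x y z : ℕ} (hx : x < D.L) (hy : y < D.L)
    (hz : z < D.L) (h1 : D.Before k x y) (h2 : D.Before k y z) : D.Before k x z := by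
  by_cases hc : D.cls x < D.cls z
  · exact before_of_cls_lt hc
  · have c1 := h1.cls_le
    have c2 := h2.cls_le
    have hxz : x ≠ z := by rintro rfl; exact h1.asymm h2
    have hxy : x ≠ y := by rintro rfl; exact h1.asymm h1
    have hyz : y ≠ z := by rintro rfl; exact h2.asymm h2
    rcases hD.total k hx hz hxz with h | h
    · exact h
    · obtain ⟨t, ht, h0⟩ := exists_thr hD k
      have e1 := ht.val_le h0 hx hy (by omega) h1
      have e2 := ht.val_le h0 hy hz (by omega) h2
      have e3 := ht.val_le h0 hz hx (by omega) h
      exact (hD.no_triple hx hy hz hxy hxz hyz (le_antisymm e1 (e2.trans e3))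
        (le_antisymm (e1.trans e2) e3)).elim

-- Justifies the incremental definition of `pos`: one valid change reverses exactly one pair in
-- `Before`, so only the two lines concerned gain or lose one predecessor.
open Classical in
theorem Ordered.pos_eq (hD : D.Ordered W) (k : ℕ) {x : ℕ} (hx : x < D.L) :
    D.pos k x = 1 + ((Finset.range D.L).filter fun y => D.Before k y x).card := by
  induction k generalizing x with
  | zero =>
    simp only [pos]
    congr 2
    refine Finset.filter_congr fun y _ => ?_
    simp [Before, Flipped]
  | succ k ih =>
    by_cases hv : D.Valid (D.ev k)
    · generalize he : D.ev k = e at hv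
      obtain ⟨u, v⟩ := e
      have hu : u < D.L := hv.1
      have hvL : v < D.L := hv.2.1
      have huv : u ≠ v := by rintro rfl; exact lt_irrefl _ hv.2.2.2.1
      have fl : ∀ p q, D.Flipped (k + 1) p q ↔ D.Flipped k p q ∨ (p = u ∧ q = v) := by
        intro p q
        constructor
        · rintro ⟨h, j, hj, e⟩
          rcases Nat.lt_succ_iff_lt_or_eq.1 hj with hj | rfl
          · exact Or.inl ⟨h, j, hj, e⟩
          · rw [he] at e
            exact Or.inr ⟨(congrArg Prod.fst e).symm, (congrArg Prod.snd e).symm⟩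
        · rintro (⟨h, j, hj, e⟩ | ⟨rfl, rfl⟩)
          · exact ⟨h, j, by omega, e⟩
          · exact ⟨hv, k, by omega, he⟩
      have nf : ¬ D.Flipped k u v := by
        rintro ⟨h, j, hj, e⟩
        have := hD.inj k j (by rwa [he]) (by rw [he, e])
        omega
      have nf' : ¬ D.Flipped k v u := fun h => sig_asymm h.1.sig hv.sig
      have b1 : D.Before k u v := Or.inl ⟨hv.sig, nf⟩
      have b2 : ¬ D.Before (k + 1) u v := by
        rintro (⟨-, h⟩ | h)
        · exact h ((fl u v).2 (Or.inr ⟨rfl, rfl⟩))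
        · exact sig_asymm h.1.sig hv.sig
      have b3 : D.Before (k + 1) v u := Or.inr ((fl u v).2 (Or.inr ⟨rfl, rfl⟩))
      have bo : ∀ p q, ¬ (p = u ∧ q = v) → ¬ (p = v ∧ q = u) →
          (D.Before (k + 1) p q ↔ D.Before k p q) := by
        intro p q h1 h2
        unfold Before
        rw [fl, fl]
        tauto
      simp only [pos, he]
      rw [if_pos hv, ih hx]
      by_cases hxu : x = u
      · subst hxu
        rw [if_pos rfl, add_assoc, ← Finset.card_insert_of_notMem (a := v)]
        · congr 2
          ext y
          simp only [Finset.mem_insert, Finset.mem_filter, Finset.mem_range]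
          by_cases hyv : y = v
          · subst hyv; simp [b3, hvL]
          · rw [bo y x (fun h => huv h.2) (fun h => hyv h.1)]; simp [hyv]
        · simp only [Finset.mem_filter, not_and]
          exact fun _ => b1.asymm
      · rw [if_neg hxu]
        by_cases hxv : x = v
        · subst hxv
          rw [if_pos rfl]
          have : ((Finset.range D.L).filter fun y => D.Before (k + 1) y x) =
              ((Finset.range D.L).filter fun y => D.Before k y x).erase u := by
            ext y
            simp only [Finset.mem_erase, Finset.mem_filter, Finset.mem_range]
            by_cases hyu : y = u
            · subst hyu; simp [b2]
            · rw [bo y x (fun h => hyu h.1) (fun h => hxu h.2)]; simp [hyu]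
          have hm : u ∈ (Finset.range D.L).filter fun y => D.Before k y x := by simp [hu, b1]
          have hp := Finset.card_pos.2 ⟨u, hm⟩
          rw [this, Finset.card_erase_of_mem hm]
          omega
        · rw [if_neg hxv]
          congr 2
          exact Finset.filter_congr fun y _ =>
            (bo y x (fun h => hxv h.2) (fun h => hxu h.2)).symm
    · have fl : ∀ p q, D.Flipped (k + 1) p q ↔ D.Flipped k p q := by
        intro p q
        constructor
        · rintro ⟨h, j, hj, e⟩
          refine ⟨h, j, ?_, e⟩
          have : j ≠ k := by rintro rfl; exact hv (by rwa [e])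
          omega
        · rintro ⟨h, j, hj, e⟩; exact ⟨h, j, by omega, e⟩
      simp only [pos, if_neg hv]
      rw [ih hx]
      congr 2
      exact Finset.filter_congr fun y _ => by unfold Before; rw [fl, fl]

theorem Ordered.pos_lt (hD : D.Ordered W) {k x y : ℕ} (hx : x < D.L) (hy : y < D.L)
    (h : D.Before k x y) : D.pos k x < D.pos k y := by
  classical
  rw [hD.pos_eq k hx, hD.pos_eq k hy, Nat.add_lt_add_iff_left]
  refine Finset.card_lt_card (Finset.ssubset_iff_of_subset (fun z hz => ?_) |>.2 ⟨x, ?_, ?_⟩)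
  · simp only [Finset.mem_filter, Finset.mem_range] at hz ⊢
    exact ⟨hz.1, hD.trans hz.1 hx hy hz.2 h⟩
  · simp [hx, h]
  · simp only [Finset.mem_filter, not_and]
    exact fun _ hc => hc.asymm hc

theorem Ordered.pos_inj (hD : D.Ordered W) {k x y : ℕ} (hx : x < D.L) (hy : y < D.L)
    (h : D.pos k x = D.pos k y) : x = y := by
  by_contra hne
  rcases hD.total k hx hy hne with hb | hb
  · have := hD.pos_lt hx hy hb; omega
  · have := hD.pos_lt hy hx hb; omega

theorem Ordered.before_of_pos_lt (hD : D.Ordered W) {k x y : ℕ} (hx : x < D.L) (hy : y < D.L)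
    (h : D.pos k x < D.pos k y) : D.Before k x y := by
  have hne : x ≠ y := by rintro rfl; omega
  rcases hD.total k hx hy hne with hb | hb
  · exact hb
  · have := hD.pos_lt hy hx hb; omega

theorem Ordered.one_le_pos (hD : D.Ordered W) (k : ℕ) {x : ℕ} (hx : x < D.L) :
    1 ≤ D.pos k x := by
  rw [hD.pos_eq k hx]; omega

open Classical in
/-- The ranks of the lines in an initial section of the order are the smallest ones. -/
theorem Ordered.pos_down (hD : D.Ordered W) {k : ℕ} (S : ℕ → Prop)
    (hS : ∀ x < D.L, ∀ y < D.L, D.Before k x y → S y → S x) {z : ℕ} (hz : z < D.L) :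
    (S z → D.pos k z ≤ ((Finset.range D.L).filter S).card) ∧
      (¬ S z → ((Finset.range D.L).filter S).card + 1 ≤ D.pos k z) := by
  rw [hD.pos_eq k hz]
  constructor
  · intro h
    have : (Finset.range D.L).filter (fun y => D.Before k y z) ⊆
        ((Finset.range D.L).filter S).erase z := by
      intro y hy
      simp only [Finset.mem_filter, Finset.mem_range, Finset.mem_erase] at hy ⊢
      exact ⟨by rintro rfl; exact hy.2.asymm hy.2, hy.1, hS y hy.1 z hz hy.2 h⟩
    have hc := Finset.card_le_card this
    have hm : z ∈ (Finset.range D.L).filter S := by simp [hz, h]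
    have hp := Finset.card_pos.2 ⟨z, hm⟩
    rw [Finset.card_erase_of_mem hm] at hc
    omega
  · intro h
    rw [add_comm, Nat.add_le_add_iff_left]
    refine Finset.card_le_card fun y hy => ?_
    simp only [Finset.mem_filter, Finset.mem_range] at hy ⊢
    refine ⟨hy.1, ?_⟩
    have hne : y ≠ z := by rintro rfl; exact h hy.2
    rcases hD.total k hy.1 hz hne with hb | hb
    · exact hb
    · exact absurd (hS z hz y hy.1 hb hy.2) h

theorem Ordered.pos_le (hD : D.Ordered W) (k : ℕ) {x : ℕ} (hx : x < D.L) : D.pos k x ≤ D.L := by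
  classical
  have := (hD.pos_down (k := k) (fun _ => True) (fun _ _ _ _ _ _ => trivial) hx).1 trivial
  simpa using this

end Kin

namespace Kin

/-! ### Rectangles in rank space -/

/-- The lines `4 r, …, 4 r + 3` are the left, right, lower and upper side of the rectangle `r`
for `r < m`. -/
structure Boxed (D : Kin) (m : ℕ) : Prop where
  L_eq : D.L = 4 * m
  lx : ∀ r < m, (D.cls (4 * r) = 0 ∨ D.cls (4 * r) = 1) ∧ 0 < D.c (4 * r)
  rx : ∀ r < m, (D.cls (4 * r + 1) = 1 ∨ D.cls (4 * r + 1) = 2) ∧ D.c (4 * r + 1) < 0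
  ly : ∀ r < m, (D.cls (4 * r + 2) = 3 ∨ D.cls (4 * r + 2) = 4) ∧ 0 < D.c (4 * r + 2)
  ry : ∀ r < m, (D.cls (4 * r + 3) = 4 ∨ D.cls (4 * r + 3) = 5) ∧ D.c (4 * r + 3) < 0
  px : ∀ r < m, D.cls (4 * r) = D.cls (4 * r + 1) →
    D.b (4 * r) < D.b (4 * r + 1) ∧ D.a (4 * r + 1) ≤ D.a (4 * r)
  py : ∀ r < m, D.cls (4 * r + 2) = D.cls (4 * r + 3) →
    D.b (4 * r + 2) < D.b (4 * r + 3) ∧ D.a (4 * r + 3) ≤ D.a (4 * r + 2)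
  left : ∃ r < m, D.cls (4 * r) = 0

/-- The coordinate of a line at time `lam`. -/
def at' (D : Kin) (lam : ℝ) (x : ℕ) : ℝ := D.b x - lam * D.a x

/-- At time `lam`, the rectangle `r` contains `τ`. -/
def HitL (D : Kin) (lam : ℝ) (τ : ℝ × ℝ) (r : ℕ) : Prop :=
  (D.cls (4 * r) = 1 → D.at' lam (4 * r) < τ.1) ∧
    (D.cls (4 * r + 1) = 1 → τ.1 < D.at' lam (4 * r + 1)) ∧
    (D.cls (4 * r + 2) = 4 → D.at' lam (4 * r + 2) < τ.2) ∧
    (D.cls (4 * r + 3) = 4 → τ.2 < D.at' lam (4 * r + 3))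

/-- At time `lam`, some point is outside of all rectangles. -/
def Free (D : Kin) (m : ℕ) (lam : ℝ) : Prop := ∃ τ, ∀ r < m, ¬ D.HitL lam τ r

open Classical in
/-- The number of lines of class less than `j`. -/
noncomputable def clsCount (D : Kin) (j : ℕ) : ℕ :=
  ((Finset.range D.L).filter fun z => D.cls z < j).card

/-- The rectangle `r` for given ranks of the lines. -/
def rectOf (p : ℕ → ℕ) (r : ℕ) : Rect :=
  ⟨p (4 * r), p (4 * r + 1), p (4 * r + 2), p (4 * r + 3)⟩

/-- Four rectangles that cover the ranks of the lines at infinity. -/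
noncomputable def frames (D : Kin) : List Rect :=
  [⟨1, D.clsCount 1, 1, D.L + 1⟩, ⟨D.clsCount 2 + 1, D.L + 1, 1, D.L + 1⟩,
    ⟨1, D.L + 1, 1, D.clsCount 4⟩, ⟨1, D.L + 1, D.clsCount 5 + 1, D.L + 1⟩]

/-- The list of rectangles after `k` changes. -/
noncomputable def rects (D : Kin) (m k : ℕ) : List Rect :=
  (List.range m).map (rectOf (D.pos k)) ++ D.frames

/-- The set of rectangles after `k` changes. -/
noncomputable def S (D : Kin) (m k : ℕ) : Finset Rect := (D.rects m k).toFinset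

variable {D : Kin} {W m : ℕ}

theorem mem_S {k : ℕ} {R : Rect} :
    R ∈ D.S m k ↔ (∃ r < m, rectOf (D.pos k) r = R) ∨ R ∈ D.frames := by
  simp [S, rects]

theorem covers_iff {T : Finset Rect} {N : ℕ} : Covers T N ↔ ∀ u v : ℝ, 1 ≤ u → u ≤ N → 1 ≤ v →
    v ≤ N → ∃ R ∈ T, (R.x₀ ≤ u ∧ u ≤ R.x₁) ∧ R.y₀ ≤ v ∧ v ≤ R.y₁ := by
  unfold Covers
  constructor
  · intro h u v h1 h2 h3 h4
    obtain ⟨R, hR, hm⟩ := mem_iUnion₂.1 (h (show (u, v) ∈ _ from ⟨⟨h1, h2⟩, h3, h4⟩))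
    exact ⟨R, hR, hm⟩
  · rintro h ⟨u, v⟩ ⟨⟨h1, h2⟩, h3, h4⟩
    obtain ⟨R, hR, hm⟩ := h u v h1 h2 h3 h4
    exact mem_iUnion₂.2 ⟨R, hR, hm⟩

theorem exists_between_finite (L : ℕ) (A B : ℕ → Prop) (w : ℕ → ℝ)
    (h : ∀ x < L, ∀ y < L, A x → B y → w x ≤ w y) :
    ∃ τ, (∀ x < L, A x → w x ≤ τ) ∧ ∀ y < L, B y → τ ≤ w y := by
  classical
  by_cases hA : ((Finset.range L).filter A).Nonempty
  · obtain ⟨x, hx, hmax⟩ := ((Finset.range L).filter A).exists_max_image w hA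
    simp only [Finset.mem_filter, Finset.mem_range] at hx hmax
    exact ⟨w x, fun z hz hA => hmax z ⟨hz, hA⟩, fun y hy hB => h x hx.1 y hy hx.2 hB⟩
  · obtain ⟨B₀, hB₀⟩ := ((Finset.range L).image w).bddBelow
    refine ⟨B₀, fun x hx hA' => absurd ⟨x, by simp [hx, hA']⟩ hA, fun y hy _ => hB₀ ?_⟩
    exact Finset.mem_coe.2 (Finset.mem_image_of_mem _ (Finset.mem_range.2 hy))

theorem Ordered.pos_cls (hD : D.Ordered W) (k j : ℕ) {z : ℕ} (hz : z < D.L) :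
    (D.cls z < j → D.pos k z ≤ D.clsCount j) ∧ (j ≤ D.cls z → D.clsCount j + 1 ≤ D.pos k z) := by
  classical
  have := hD.pos_down (k := k) (fun z => D.cls z < j)
    (fun x _ y _ hb h => lt_of_le_of_lt hb.cls_le h) hz
  rw [not_lt] at this
  unfold clsCount
  convert this

/-- A rank `u` without line corresponds to a coordinate at time `t`. -/
theorem Thr.exists_coord (hD : D.Ordered W) {k : ℕ} {t : ℝ ×ₗ ℝ ×ₗ ℝ} (ht : D.Thr k t)
    (h0 : 0 < (ofLex t).1) (j : ℕ) (u : ℝ) :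
    ∃ τ : ℝ, ∀ z < D.L, D.cls z = j → ((D.pos k z : ℝ) < u → D.at' (ofLex t).1 z ≤ τ) ∧
      (u < D.pos k z → τ ≤ D.at' (ofLex t).1 z) := by
  obtain ⟨τ, h1, h2⟩ := exists_between_finite D.L (fun z => D.cls z = j ∧ (D.pos k z : ℝ) < u)
    (fun z => D.cls z = j ∧ u < D.pos k z) (D.at' (ofLex t).1) (by
      rintro x hx y hy ⟨a1, a2⟩ ⟨b1, b2⟩
      have hlt : D.pos k x < D.pos k y := by exact_mod_cast a2.trans b2
      have hv := ht.val_le h0 hx hy (a1.trans b1.symm) (hD.before_of_pos_lt hx hy hlt)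
      rw [lex_le_iff] at hv
      simp only [val, ofLex_toLex] at hv
      unfold at'
      rcases hv with hv | hv
      · exact hv.le
      · exact hv.1.le)
  exact ⟨τ, fun z hz hc => ⟨fun h => h1 z hz ⟨hc, h⟩, fun h => h2 z hz ⟨hc, h⟩⟩⟩

/-- The frames force an uncovered point of rank space into the ranks of the finite classes `1` and
`4`. Lines of smaller rank have coordinates at most `τ`, those of larger rank at least `τ`. Weak
inequalities suffice, because the moving rectangles are open and the rank rectangles closed. -/
theorem free_of_not_covers (hD : D.Ordered W) (hB : D.Boxed m) {k : ℕ} {t : ℝ ×ₗ ℝ ×ₗ ℝ}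
    (ht : D.Thr k t) (h0 : 0 < (ofLex t).1) (hc : ¬ Covers (D.S m k) (D.L + 1)) :
    D.Free m (ofLex t).1 := by
  rw [covers_iff] at hc
  push Not at hc
  obtain ⟨u, v, u1, u2, v1, v2, huv⟩ := hc
  have hfr : ∀ R ∈ D.frames, (R.x₀ ≤ u ∧ u ≤ R.x₁) → (R.y₀ : ℝ) ≤ v → (R.y₁ : ℝ) < v :=
    fun R hR => huv R (mem_S.2 (Or.inr hR))
  have f1 : (D.clsCount 1 : ℝ) < u := by
    by_contra! hc
    have := hfr ⟨1, D.clsCount 1, 1, D.L + 1⟩ (by simp [frames]) ⟨by simpa using u1, hc⟩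
      (by simpa using v1)
    exact absurd v2 (not_le.2 this)
  have f2 : u < (D.clsCount 2 + 1 : ℕ) := by
    by_contra! hc
    have := hfr ⟨D.clsCount 2 + 1, D.L + 1, 1, D.L + 1⟩ (by simp [frames]) ⟨hc, u2⟩
      (by simpa using v1)
    exact absurd v2 (not_le.2 this)
  have f3 : (D.clsCount 4 : ℝ) < v :=
    hfr ⟨1, D.L + 1, 1, D.clsCount 4⟩ (by simp [frames]) ⟨by simpa using u1, u2⟩
      (by simpa using v1)
  have f4 : v < (D.clsCount 5 + 1 : ℕ) := by
    by_contra! hc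
    have := hfr ⟨1, D.L + 1, D.clsCount 5 + 1, D.L + 1⟩ (by simp [frames])
      ⟨by simpa using u1, u2⟩ hc
    exact absurd v2 (not_le.2 this)
  obtain ⟨τ₁, hτ₁⟩ := ht.exists_coord hD h0 1 u
  obtain ⟨τ₂, hτ₂⟩ := ht.exists_coord hD h0 4 v
  refine ⟨(τ₁, τ₂), fun r hr hh => ?_⟩
  have hL : ∀ s < 4, 4 * r + s < D.L := fun s hs => by rw [hB.L_eq]; omega
  have hL0 := hL 0 (by omega)
  rw [add_zero] at hL0
  obtain ⟨g1, g2, g3, g4⟩ := hh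
  have e1 : (D.pos k (4 * r) : ℝ) ≤ u := by
    rcases (hB.lx r hr).1 with h | h
    · have : (D.pos k (4 * r) : ℝ) ≤ D.clsCount 1 := by
        exact_mod_cast (hD.pos_cls k 1 hL0).1 (by omega)
      linarith
    · by_contra! hc
      linarith [(hτ₁ _ hL0 h).2 hc, g1 h]
  have e2 : u ≤ D.pos k (4 * r + 1) := by
    rcases (hB.rx r hr).1 with h | h
    · by_contra! hc
      linarith [(hτ₁ _ (hL 1 (by omega)) h).1 hc, g2 h]
    · have : ((D.clsCount 2 + 1 : ℕ) : ℝ) ≤ D.pos k (4 * r + 1) := by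
        exact_mod_cast (hD.pos_cls k 2 (hL 1 (by omega))).2 (by omega)
      linarith
  have e3 : (D.pos k (4 * r + 2) : ℝ) ≤ v := by
    rcases (hB.ly r hr).1 with h | h
    · have : (D.pos k (4 * r + 2) : ℝ) ≤ D.clsCount 4 := by
        exact_mod_cast (hD.pos_cls k 4 (hL 2 (by omega))).1 (by omega)
      linarith
    · by_contra! hc
      linarith [(hτ₂ _ (hL 2 (by omega)) h).2 hc, g3 h]
  have e4 : v ≤ D.pos k (4 * r + 3) := by
    rcases (hB.ry r hr).1 with h | h
    · by_contra! hc
      linarith [(hτ₂ _ (hL 3 (by omega)) h).1 hc, g4 h]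
    · have : ((D.clsCount 5 + 1 : ℕ) : ℝ) ≤ D.pos k (4 * r + 3) := by
        exact_mod_cast (hD.pos_cls k 5 (hL 3 (by omega))).2 (by omega)
      linarith
  have := huv (rectOf (D.pos k) r) (mem_S.2 (Or.inl ⟨r, hr, rfl⟩)) ⟨e1, e2⟩ e3
  exact absurd e4 (not_le.2 this)

/-- The lines on the lower side of the coordinate `τ` in class `j` at time `lam`. -/
def Below (D : Kin) (lam : ℝ) (j : ℕ) (τ : ℝ) (z : ℕ) : Prop :=
  D.cls z < j ∨ (D.cls z = j ∧ (D.at' lam z < τ ∨ (D.at' lam z = τ ∧ D.c z < 0)))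

-- The lines on the lower side of `τ` form an initial section of the order, and `u` is their number
-- plus one half, so it is never the rank of a line. At the time `(lam, 0, 0)` ties in position are
-- broken by `c` alone; hence a line exactly at `τ` is on the lower side iff it is a closing side.
open Classical in
theorem Thr.exists_rank (hD : D.Ordered W) {k : ℕ} {lam : ℝ}
    (ht : D.Thr k (toLex (lam, toLex (0, 0)))) (h0 : 0 < lam) (j : ℕ) (τ : ℝ) :
    ∃ u : ℝ, (D.clsCount j : ℝ) < u ∧ u < (D.clsCount (j + 1) + 1 : ℕ) ∧
      ∀ z < D.L, ((D.pos k z : ℝ) ≤ u → D.Below lam j τ z) ∧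
        (u ≤ D.pos k z → ¬ D.Below lam j τ z) := by
  have hdown : ∀ x < D.L, ∀ y < D.L, D.Before k x y → D.Below lam j τ y → D.Below lam j τ x := by
    intro x hx y hy hb hy'
    have hle := hb.cls_le
    rcases hy' with h | ⟨h, h'⟩
    · exact Or.inl (by omega)
    · rcases hle.eq_or_lt with e | e
      · right
        refine ⟨by omega, ?_⟩
        have hv := ht.val_le h0 hx hy e hb
        rw [lex_le_iff] at hv
        simp only [val, ofLex_toLex, zero_mul, sub_zero] at hv
        unfold at' at h' ⊢
        rcases hv with hv | ⟨hv, hv'⟩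
        · left; rcases h' with h' | h' <;> linarith
        · rcases h' with h' | ⟨h', h''⟩
          · left; linarith
          · right
            refine ⟨by linarith, ?_⟩
            rcases hv' with hv' | hv' <;> linarith
      · exact Or.inl (by omega)
  have c1 : D.clsCount j ≤ ((Finset.range D.L).filter (D.Below lam j τ)).card := by
    unfold clsCount
    refine Finset.card_le_card fun z hz => ?_
    simp only [Finset.mem_filter] at hz ⊢
    exact ⟨hz.1, Or.inl hz.2⟩
  have c2 : ((Finset.range D.L).filter (D.Below lam j τ)).card ≤ D.clsCount (j + 1) := by
    unfold clsCount
    refine Finset.card_le_card fun z hz => ?_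
    simp only [Finset.mem_filter] at hz ⊢
    refine ⟨hz.1, ?_⟩
    rcases hz.2 with h | h <;> omega
  refine ⟨((Finset.range D.L).filter (D.Below lam j τ)).card + 1 / 2, ?_, ?_, ?_⟩
  · have : (D.clsCount j : ℝ) ≤ ((Finset.range D.L).filter (D.Below lam j τ)).card := by
      exact_mod_cast c1
    linarith
  · have : (((Finset.range D.L).filter (D.Below lam j τ)).card : ℝ) ≤ D.clsCount (j + 1) := by
      exact_mod_cast c2
    push_cast
    linarith
  · intro z hz
    obtain ⟨h1, h2⟩ := hD.pos_down (k := k) _ hdown hz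
    constructor
    · intro h
      by_contra hc
      have : (((Finset.range D.L).filter (D.Below lam j τ)).card : ℝ) + 1 ≤ D.pos k z := by
        exact_mod_cast h2 hc
      linarith
    · intro h hc
      have : (D.pos k z : ℝ) ≤ ((Finset.range D.L).filter (D.Below lam j τ)).card := by
        exact_mod_cast h1 hc
      linarith

/-- A rank rectangle that contains `(u, v)` would belong to a moving rectangle that contains `τ`.
The strict inequalities come from the signs of `c`: an opening side at `τ` ranks after `u`, a
closing side at `τ` before `u`. -/
theorem not_covers_of_free (hD : D.Ordered W) (hB : D.Boxed m) {k : ℕ} {lam : ℝ}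
    (ht : D.Thr k (toLex (lam, toLex (0, 0)))) (h0 : 0 < lam) (hf : D.Free m lam) :
    ¬ Covers (D.S m k) (D.L + 1) := by
  obtain ⟨⟨τ₁, τ₂⟩, hτ⟩ := hf
  obtain ⟨u, u1, u2, hu⟩ := ht.exists_rank hD h0 1 τ₁
  obtain ⟨v, v1, v2, hv⟩ := ht.exists_rank hD h0 4 τ₂
  have hcl : ∀ j, D.clsCount j ≤ D.L := by
    intro j
    classical
    unfold clsCount
    exact (Finset.card_filter_le _ _).trans (by simp)
  have hpos : ∀ j, 1 ≤ j → 1 ≤ D.clsCount j := by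
    classical
    intro j hj
    obtain ⟨r, hr, hr'⟩ := hB.left
    unfold clsCount
    refine Finset.card_pos.2 ⟨4 * r, ?_⟩
    simp only [Finset.mem_filter, Finset.mem_range]
    exact ⟨by rw [hB.L_eq]; omega, by omega⟩
  have b1 : (1 : ℝ) ≤ u := by
    have : (1 : ℝ) ≤ D.clsCount 1 := by exact_mod_cast hpos 1 le_rfl
    linarith
  have b2 : (1 : ℝ) ≤ v := by
    have : (1 : ℝ) ≤ D.clsCount 4 := by exact_mod_cast hpos 4 (by omega)
    linarith
  have b3 : u ≤ (D.L + 1 : ℕ) := by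
    have : ((D.clsCount 2 + 1 : ℕ) : ℝ) ≤ (D.L + 1 : ℕ) := by
      exact_mod_cast Nat.succ_le_succ (hcl 2)
    linarith
  have b4 : v ≤ (D.L + 1 : ℕ) := by
    have : ((D.clsCount 5 + 1 : ℕ) : ℝ) ≤ (D.L + 1 : ℕ) := by
      exact_mod_cast Nat.succ_le_succ (hcl 5)
    linarith
  rw [covers_iff]
  intro hc
  obtain ⟨R, hR, ⟨r1, r2⟩, r3, r4⟩ := hc u v b1 b3 b2 b4
  rcases mem_S.1 hR with ⟨r, hr, rfl⟩ | hR
  · have hL : ∀ s < 4, 4 * r + s < D.L := fun s hs => by rw [hB.L_eq]; omega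
    have hL0 := hL 0 (by omega)
    rw [add_zero] at hL0
    refine hτ r hr ⟨fun h => ?_, fun h => ?_, fun h => ?_, fun h => ?_⟩
    · have := (hu _ hL0).1 r1
      have hcp := (hB.lx r hr).2
      rcases this with h' | ⟨-, h' | h'⟩
      · omega
      · exact h'
      · linarith
    · have := (hu _ (hL 1 (by omega))).2 r2
      have hcp := (hB.rx r hr).2
      by_contra hc
      refine this (Or.inr ⟨h, ?_⟩)
      rcases (not_lt.1 hc).lt_or_eq with h | h
      · exact Or.inl h
      · exact Or.inr ⟨h, hcp⟩
    · have := (hv _ (hL 2 (by omega))).1 r3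
      have hcp := (hB.ly r hr).2
      rcases this with h' | ⟨-, h' | h'⟩
      · omega
      · exact h'
      · linarith
    · have := (hv _ (hL 3 (by omega))).2 r4
      have hcp := (hB.ry r hr).2
      by_contra hc
      refine this (Or.inr ⟨h, ?_⟩)
      rcases (not_lt.1 hc).lt_or_eq with h | h
      · exact Or.inl h
      · exact Or.inr ⟨h, hcp⟩
  · simp only [frames, List.mem_cons, List.not_mem_nil, or_false] at hR
    rcases hR with rfl | rfl | rfl | rfl
    · simp only at r2; linarith
    · simp only at r1; linarith
    · simp only at r4; linarith
    · simp only at r3; linarith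

theorem S_succ_of_not_valid {k : ℕ} (hv : ¬ D.Valid (D.ev k)) : D.S m (k + 1) = D.S m k := by
  have : D.pos (k + 1) = D.pos k := by funext x; simp [pos, hv]
  unfold S rects
  rw [this]

/-- The first time at which the rectangles do not cover is the largest one with a free point. -/
theorem largest (hD : D.Ordered W) (hB : D.Boxed m) {k : ℕ}
    (hk : ¬ Covers (D.S m (k + 1)) (D.L + 1)) (hj : ∀ j ≤ k, Covers (D.S m j) (D.L + 1)) :
    IsGreatest {l : ℝ | 0 < l ∧ D.Free m l} (ofLex (D.key (D.ev k))).1 := by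
  have hv : D.Valid (D.ev k) := by
    by_contra hv
    apply hk
    rw [S_succ_of_not_valid hv]
    exact hj k le_rfl
  have h0 : 0 < (ofLex (D.key (D.ev k))).1 :=
    div_pos (sub_pos.2 hv.2.2.2.2) (sub_pos.2 hv.2.2.2.1)
  refine ⟨⟨h0, free_of_not_covers hD hB (thr_succ hD hv) h0 hk⟩, ?_⟩
  rintro lam ⟨hl, hf⟩
  obtain ⟨k', -, ht⟩ := exists_thr_at hD (toLex (lam, toLex (0, 0)))
  have hn := not_covers_of_free hD hB ht hl hf
  have : k < k' := by
    by_contra hc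
    exact hn (hj k' (by omega))
  -- The set is already uncovered at the stage that belongs to `lam`, so the change `k` lies before
  -- that stage, and its time is at least `lam`.
  have hfl : D.Flipped k' (D.ev k).1 (D.ev k).2 := ⟨hv, k, this, rfl⟩
  have hle := ht.1 _ _ hfl
  rw [lex_le_iff] at hle
  rcases hle with h | h
  · exact h.le
  · exact h.1.le

theorem covers_zero (hD : D.Ordered W) (hB : D.Boxed m) {M : ℝ}
    (hM : ∀ lam > M, ¬ D.Free m lam) : Covers (D.S m 0) (D.L + 1) := by
  by_contra hc
  obtain ⟨t, ht, ht'⟩ := thr_zero D (max M 0)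
  exact hM _ ((le_max_left _ _).trans_lt ht')
    (free_of_not_covers hD hB ht ((le_max_right _ _).trans_lt ht') hc)

theorem exists_not_covers (hD : D.Ordered W) (hB : D.Boxed m) {lam : ℝ} (h0 : 0 < lam)
    (hf : D.Free m lam) : ∃ k ≤ W, ¬ Covers (D.S m k) (D.L + 1) := by
  obtain ⟨k, hk, ht⟩ := exists_thr_at hD (toLex (lam, toLex (0, 0)))
  exact ⟨k, hk, not_covers_of_free hD hB ht h0 hf⟩

/-! ### Updates -/

/-- A rectangle that is used to fill up a sequence of updates. -/
def dummy₁ : Rect := ⟨1, 1, 1, 1⟩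

/-- A second rectangle that is used to fill up a sequence of updates. -/
def dummy₂ : Rect := ⟨1, 1, 1, 2⟩

open Classical in
/-- The updates for the change number `k`. -/
noncomputable def quad (D : Kin) (k : ℕ) : List Update :=
  if D.Valid (D.ev k) then
    [.add (rectOf (D.pos (k + 1)) ((D.ev k).1 / 4)), .add (rectOf (D.pos (k + 1)) ((D.ev k).2 / 4)),
      .delete (rectOf (D.pos k) ((D.ev k).1 / 4)), .delete (rectOf (D.pos k) ((D.ev k).2 / 4))]
  else [.add dummy₁, .add dummy₂, .delete dummy₁, .delete dummy₂]

theorem length_quad (D : Kin) (k : ℕ) : (D.quad k).length = 4 := by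
  unfold quad; split <;> rfl

end Kin

/-- The updates can be carried out one after the other, starting from the set `S`, and there are
never more than `n` rectangles. -/
def RunsFrom (N n : ℕ) : Finset Rect → List Update → Prop
  | S, [] => S.card ≤ n
  | S, u :: l => S.card ≤ n ∧ u.Allowed N S ∧ RunsFrom N n (u.apply S) l

theorem RunsFrom.append {N n : ℕ} {S : Finset Rect} {l l' : List Update}
    (h : RunsFrom N n S l) (h' : RunsFrom N n (l.foldl Update.apply S) l') :
    RunsFrom N n S (l ++ l') := by
  induction l generalizing S with
  | nil => exact h'
  | cons u l ih => exact ⟨h.1, h.2.1, ih h.2.2 h'⟩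

theorem RunsFrom.card_le {N n : ℕ} {S : Finset Rect} {l : List Update} (h : RunsFrom N n S l)
    (k : ℕ) : ((l.take k).foldl Update.apply S).card ≤ n := by
  induction l generalizing S k with
  | nil => cases k <;> exact h
  | cons u l ih =>
    cases k with
    | zero => exact h.1
    | succ k => exact ih h.2.2 k

theorem RunsFrom.allowed {N n : ℕ} {S : Finset Rect} {l : List Update} (h : RunsFrom N n S l)
    (k : ℕ) (hk : k < l.length) : (l[k]).Allowed N ((l.take k).foldl Update.apply S) := by
  induction l generalizing S k with
  | nil => simp at hk
  | cons u l ih =>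
    cases k with
    | zero => exact h.2.1
    | succ k => exact ih h.2.2 k (by simpa using hk)

namespace Kin

variable {D : Kin} {W m : ℕ}

/-- Opposite finite sides keep a positive distance at all positive times, because a nonempty box of
`P` has positive extent and so does the box of the complement. So the rank rectangles are never
degenerate. -/
theorem Ordered.sides (hD : D.Ordered W) (hB : D.Boxed m) (k : ℕ) {r : ℕ} (hr : r < m) :
    D.pos k (4 * r) < D.pos k (4 * r + 1) ∧ D.pos k (4 * r + 2) < D.pos k (4 * r + 3) := by
  have hL : ∀ s < 4, 4 * r + s < D.L := fun s hs => by rw [hB.L_eq]; omega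
  obtain ⟨t, ht, h0⟩ := exists_thr hD k
  have main : ∀ x < D.L, ∀ y < D.L, D.cls x ≤ D.cls y → x ≠ y →
      (D.cls x = D.cls y → D.b x < D.b y ∧ D.a y ≤ D.a x) → D.pos k x < D.pos k y := by
    intro x hx y hy hc hne h
    refine hD.pos_lt hx hy ?_
    rcases hc.eq_or_lt with e | e
    · rcases hD.total k hx hy hne with hb | hb
      · exact hb
      · have hv := ht.val_le h0 hy hx e.symm hb
        obtain ⟨h1, h2⟩ := h e
        rw [lex_le_iff] at hv
        simp only [val, ofLex_toLex] at hv
        have := mul_le_mul_of_nonneg_left h2 h0.le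
        rcases hv with hv | ⟨hv, -⟩ <;> linarith
    · exact before_of_cls_lt e
  have h1 := hB.lx r hr
  have h2 := hB.rx r hr
  have h3 := hB.ly r hr
  have h4 := hB.ry r hr
  have hL0 : 4 * r < D.L := hL 0 (by omega)
  exact ⟨main _ hL0 _ (hL 1 (by omega)) (by omega) (by omega) (hB.px r hr),
    main _ (hL 2 (by omega)) _ (hL 3 (by omega)) (by omega) (by omega) (hB.py r hr)⟩

theorem Ordered.within (hD : D.Ordered W) (hB : D.Boxed m) (k : ℕ) {r : ℕ} (hr : r < m) :
    (rectOf (D.pos k) r).Within (D.L + 1) := by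
  have hL : ∀ s < 4, 4 * r + s < D.L := fun s hs => by rw [hB.L_eq]; omega
  obtain ⟨h1, h2⟩ := hD.sides hB k hr
  have := hD.one_le_pos k (hL 0 (by omega))
  have := hD.one_le_pos k (hL 2 (by omega))
  have := hD.pos_le k (hL 1 (by omega))
  have := hD.pos_le k (hL 3 (by omega))
  refine ⟨?_, ?_, ?_, ?_, ?_, ?_⟩ <;> simp only [rectOf] <;> omega

theorem clsCount_le (D : Kin) (j : ℕ) : D.clsCount j ≤ D.L := by
  classical
  unfold clsCount
  exact (Finset.card_filter_le _ _).trans (by simp)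

theorem Boxed.clsCount_pos (hB : D.Boxed m) {j : ℕ} (hj : 1 ≤ j) : 1 ≤ D.clsCount j := by
  classical
  obtain ⟨r, hr, hr'⟩ := hB.left
  unfold clsCount
  refine Finset.card_pos.2 ⟨4 * r, ?_⟩
  simp only [Finset.mem_filter, Finset.mem_range]
  exact ⟨by rw [hB.L_eq]; omega, by omega⟩

theorem Boxed.frames_within (hB : D.Boxed m) {R : Rect} (hR : R ∈ D.frames) :
    R.Within (D.L + 1) := by
  have h1 := hB.clsCount_pos (j := 1) (by omega)
  have h4 := hB.clsCount_pos (j := 4) (by omega)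
  have := D.clsCount_le 1
  have := D.clsCount_le 2
  have := D.clsCount_le 4
  have := D.clsCount_le 5
  simp only [frames, List.mem_cons, List.not_mem_nil, or_false] at hR
  rcases hR with rfl | rfl | rfl | rfl <;>
    (refine ⟨?_, ?_, ?_, ?_, ?_, ?_⟩ <;> simp only <;> omega)

theorem frames_big (D : Kin) {R : Rect} (hR : R ∈ D.frames) : R.x₁ = D.L + 1 ∨ R.y₁ = D.L + 1 := by
  simp only [frames, List.mem_cons, List.not_mem_nil, or_false] at hR
  rcases hR with rfl | rfl | rfl | rfl <;> simp

theorem Ordered.rectOf_not_frame (hD : D.Ordered W) (hB : D.Boxed m) (k : ℕ) {r : ℕ} (hr : r < m) :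
    rectOf (D.pos k) r ∉ D.frames := by
  intro h
  have hL : ∀ s < 4, 4 * r + s < D.L := fun s hs => by rw [hB.L_eq]; omega
  have := hD.pos_le k (hL 1 (by omega))
  have := hD.pos_le k (hL 3 (by omega))
  rcases D.frames_big h with h | h <;> simp only [rectOf] at h <;> omega

theorem Ordered.rectOf_inj (hD : D.Ordered W) (hB : D.Boxed m) {k r r' : ℕ} (hr : r < m)
    (hr' : r' < m) (h : rectOf (D.pos k) r = rectOf (D.pos k) r') : r = r' := by
  have := hD.pos_inj (k := k) (x := 4 * r) (y := 4 * r') (by rw [hB.L_eq]; omega)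
    (by rw [hB.L_eq]; omega) (congrArg Rect.x₀ h)
  omega

theorem Ordered.nodup_rects (hD : D.Ordered W) (hB : D.Boxed m) (k : ℕ) : (D.rects m k).Nodup := by
  unfold rects
  refine List.Nodup.append ?_ ?_ ?_
  · refine List.Nodup.map_on (fun r hr r' hr' h => ?_) List.nodup_range
    exact hD.rectOf_inj hB (List.mem_range.1 hr) (List.mem_range.1 hr') h
  · have h1 := hB.clsCount_pos (j := 1) (by omega)
    have h4 := hB.clsCount_pos (j := 2) (by omega)
    have := D.clsCount_le 1
    have := D.clsCount_le 4
    simp only [frames, List.nodup_cons, List.mem_cons, Rect.mk.injEq, List.not_mem_nil,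
      or_false, List.nodup_nil, and_true, not_or, not_false_eq_true]
    omega
  · intro R h1 h2
    obtain ⟨r, hr, rfl⟩ := List.mem_map.1 h1
    exact hD.rectOf_not_frame hB k (List.mem_range.1 hr) h2

theorem Ordered.card_S (hD : D.Ordered W) (hB : D.Boxed m) (k : ℕ) : (D.S m k).card = m + 4 := by
  rw [S, List.toFinset_card_of_nodup (hD.nodup_rects hB k)]
  simp [rects, frames]

/-- The dummies have width zero, unlike the rectangles of lines, and they do not reach the rank `D.L
+ 1`, unlike the frames. -/
theorem Ordered.dummy_notMem (hD : D.Ordered W) (hB : D.Boxed m) (k : ℕ) {R : Rect}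
    (hR : R = dummy₁ ∨ R = dummy₂) : R ∉ D.S m k := by
  have hm : 1 ≤ m := by obtain ⟨r, hr, -⟩ := hB.left; omega
  rw [mem_S]
  rintro (⟨r, hr, h⟩ | h)
  · have h1 := (hD.sides hB k hr).1
    have h2 := congrArg Rect.x₀ h
    have h3 := congrArg Rect.x₁ h
    simp only [rectOf] at h2 h3
    rcases hR with rfl | rfl <;> simp only [dummy₁, dummy₂] at h2 h3 <;> omega
  · have hL := hB.L_eq
    rcases D.frames_big h with h | h <;> rcases hR with rfl | rfl <;>
      simp only [dummy₁, dummy₂] at h <;> omega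

theorem Boxed.dummy_within (hB : D.Boxed m) {R : Rect} (hR : R = dummy₁ ∨ R = dummy₂) :
    R.Within (D.L + 1) := by
  have hm : 1 ≤ m := by obtain ⟨r, hr, -⟩ := hB.left; omega
  have hL := hB.L_eq
  rcases hR with rfl | rfl <;> (refine ⟨?_, ?_, ?_, ?_, ?_, ?_⟩ <;> simp only [dummy₁, dummy₂] <;>
    omega)

/-- The updates for a change can be carried out, and all sets in between contain the set before
the change or the set after it. -/
theorem Ordered.quad_spec (hD : D.Ordered W) (hB : D.Boxed m) {n : ℕ} (hn : m + 6 ≤ n) (k : ℕ) :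
    RunsFrom (D.L + 1) n (D.S m k) (D.quad k) ∧
      (D.quad k).foldl Update.apply (D.S m k) = D.S m (k + 1) ∧
      ∀ j ≤ 4, D.S m k ⊆ ((D.quad k).take j).foldl Update.apply (D.S m k) ∨
        D.S m (k + 1) ⊆ ((D.quad k).take j).foldl Update.apply (D.S m k) := by
  have hcard := hD.card_S hB k
  by_cases hv : D.Valid (D.ev k)
  · generalize he : D.ev k = e at hv
    obtain ⟨x, y⟩ := e
    have hL := hB.L_eq
    have hx : x < D.L := hv.1
    have hy : y < D.L := hv.2.1
    have hxy : x ≠ y := by rintro rfl; exact lt_irrefl _ hv.2.2.2.1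
    have hcls : D.cls x = D.cls y := hv.2.2.1
    have hrx : x / 4 < m := by omega
    have hry : y / 4 < m := by omega
    -- Two sides of the same rectangle never change places: opposite ones by `px` and `py`, the
    -- others because abscissas and ordinates belong to different classes.
    have hne : x / 4 ≠ y / 4 := by
      intro e
      have h1 := hB.lx _ hrx
      have h2 := hB.rx _ hrx
      have h3 := hB.ly _ hrx
      have h4 := hB.ry _ hrx
      have h5 := hB.px _ hrx
      have h6 := hB.py _ hrx
      have ha : D.a y < D.a x := hv.2.2.2.1
      have hb : D.b y < D.b x := hv.2.2.2.2
      have ex : x = 4 * (x / 4) ∨ x = 4 * (x / 4) + 1 ∨ x = 4 * (x / 4) + 2 ∨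
        x = 4 * (x / 4) + 3 := by omega
      have ey : y = 4 * (x / 4) ∨ y = 4 * (x / 4) + 1 ∨ y = 4 * (x / 4) + 2 ∨
        y = 4 * (x / 4) + 3 := by omega
      generalize x / 4 = r at *
      rcases ex with rfl | rfl | rfl | rfl <;> rcases ey with rfl | rfl | rfl | rfl <;>
        first
        | exact hxy rfl
        | (exfalso; omega)
        | (have := h5 hcls; linarith)
        | (have := h5 hcls.symm; linarith)
        | (have := h6 hcls; linarith)
        | (have := h6 hcls.symm; linarith)
    have hpos : ∀ z, z ≠ x → z ≠ y → D.pos (k + 1) z = D.pos k z := by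
      intro z h1 h2; simp [pos, he, hv, h1, h2]
    have hposx : D.pos (k + 1) x = D.pos k x + 1 := by simp [pos, he, hv]
    have hposy : D.pos (k + 1) y ≠ D.pos k y := by
      have := hD.one_le_pos k hy
      have : D.pos (k + 1) y = D.pos k y - 1 := by simp [pos, he, hv, hxy.symm]
      omega
    have hrect : ∀ r < m, r ≠ x / 4 → r ≠ y / 4 →
        rectOf (D.pos (k + 1)) r = rectOf (D.pos k) r := by
      intro r hr h1 h2
      unfold rectOf
      rw [hpos, hpos, hpos, hpos] <;> omega
    -- a rectangle that changes is not in the old set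
    have hnew : ∀ z w, z < D.L → D.pos (k + 1) z ≠ D.pos k z → w / 4 ≠ z / 4 →
        (∀ z', z' ≠ z → z' ≠ w → D.pos (k + 1) z' = D.pos k z') →
        rectOf (D.pos (k + 1)) (z / 4) ∉ D.S m k := by
      intro z w hz hch hw hsame hmem
      have hzm : z / 4 < m := by omega
      rcases mem_S.1 hmem with ⟨r, hr, h⟩ | h
      · have e : ∀ s < 4, D.pos k (4 * r + s) = D.pos (k + 1) (4 * (z / 4) + s) := by
          intro s hs
          have a0 := congrArg Rect.x₀ h
          have a1 := congrArg Rect.x₁ h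
          have a2 := congrArg Rect.y₀ h
          have a3 := congrArg Rect.y₁ h
          simp only [rectOf] at a0 a1 a2 a3
          interval_cases s
          · exact a0
          · exact a1
          · exact a2
          · exact a3
        -- Some side other than `z` keeps its rank, and ranks are injective; so an old rectangle
        -- with the same coordinates would have to be the same one before the change, although the
        -- rank of `z` has changed.
        obtain ⟨s, hs, hsz⟩ : ∃ s < 4, 4 * (z / 4) + s ≠ z := by
          by_cases h0 : 4 * (z / 4) = z
          · exact ⟨1, by omega, by omega⟩
          · exact ⟨0, by omega, by omega⟩
        have e1 := e s hs
        rw [hsame _ hsz (by omega)] at e1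
        have hrz : r = z / 4 := by
          have := hD.pos_inj (by omega) (by omega) e1
          omega
        have e2 := e (z % 4) (by omega)
        rw [hrz, Nat.div_add_mod] at e2
        exact hch e2.symm
      · exact hD.rectOf_not_frame hB (k + 1) hzm h
    have hA' : rectOf (D.pos (k + 1)) (x / 4) ∉ D.S m k :=
      hnew x y hx (by omega) (Ne.symm hne) hpos
    have hB' : rectOf (D.pos (k + 1)) (y / 4) ∉ D.S m k :=
      hnew y x hy hposy hne fun z h1 h2 => hpos z h2 h1
    have hAB' : rectOf (D.pos (k + 1)) (y / 4) ≠ rectOf (D.pos (k + 1)) (x / 4) :=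
      fun h => hne (hD.rectOf_inj hB hry hrx h).symm
    have hA : rectOf (D.pos k) (x / 4) ∈ D.S m k := mem_S.2 (Or.inl ⟨_, hrx, rfl⟩)
    have hBm : rectOf (D.pos k) (y / 4) ∈ D.S m k := mem_S.2 (Or.inl ⟨_, hry, rfl⟩)
    have hAB : rectOf (D.pos k) (y / 4) ≠ rectOf (D.pos k) (x / 4) :=
      fun h => hne (hD.rectOf_inj hB hry hrx h).symm
    have hwA := hD.within hB (k + 1) hrx
    have hwB := hD.within hB (k + 1) hry
    have hS' : ∀ R, R ∈ D.S m (k + 1) ↔ (R = rectOf (D.pos (k + 1)) (x / 4) ∨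
        R = rectOf (D.pos (k + 1)) (y / 4) ∨ (R ∈ D.S m k ∧ R ≠ rectOf (D.pos k) (x / 4) ∧
          R ≠ rectOf (D.pos k) (y / 4))) := by
      intro R
      constructor
      · intro h
        rcases mem_S.1 h with ⟨r, hr, rfl⟩ | h
        · by_cases h1 : r = x / 4
          · exact Or.inl (by rw [h1])
          · by_cases h2 : r = y / 4
            · exact Or.inr (Or.inl (by rw [h2]))
            · rw [hrect r hr h1 h2]
              exact Or.inr (Or.inr ⟨mem_S.2 (Or.inl ⟨r, hr, rfl⟩),
                fun e => h1 (hD.rectOf_inj hB hr hrx e), fun e => h2 (hD.rectOf_inj hB hr hry e)⟩)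
        · refine Or.inr (Or.inr ⟨mem_S.2 (Or.inr h), ?_, ?_⟩)
          · rintro rfl; exact hD.rectOf_not_frame hB k hrx h
          · rintro rfl; exact hD.rectOf_not_frame hB k hry h
      · rintro (rfl | rfl | ⟨h, h1, h2⟩)
        · exact mem_S.2 (Or.inl ⟨_, hrx, rfl⟩)
        · exact mem_S.2 (Or.inl ⟨_, hry, rfl⟩)
        · rcases mem_S.1 h with ⟨r, hr, rfl⟩ | h
          · refine mem_S.2 (Or.inl ⟨r, hr, hrect r hr ?_ ?_⟩)
            · rintro rfl; exact h1 rfl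
            · rintro rfl; exact h2 rfl
          · exact mem_S.2 (Or.inr h)
    have hq : D.quad k = [.add (rectOf (D.pos (k + 1)) (x / 4)),
        .add (rectOf (D.pos (k + 1)) (y / 4)), .delete (rectOf (D.pos k) (x / 4)),
        .delete (rectOf (D.pos k) (y / 4))] := by
      unfold quad; rw [he, if_pos hv]
    rw [hq]
    generalize rectOf (D.pos (k + 1)) (x / 4) = A' at *
    generalize rectOf (D.pos (k + 1)) (y / 4) = B' at *
    generalize rectOf (D.pos k) (x / 4) = A at *
    generalize rectOf (D.pos k) (y / 4) = B at *
    generalize D.S m k = T at *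
    generalize D.S m (k + 1) = T' at *
    have hAne : A' ≠ A := by rintro rfl; exact hA' hA
    have hAne2 : A' ≠ B := by rintro rfl; exact hA' hBm
    have hBne : B' ≠ A := by rintro rfl; exact hB' hA
    have hBne2 : B' ≠ B := by rintro rfl; exact hB' hBm
    have hT : ((((insert B' (insert A' T)).erase A).erase B)) = T' := by
      ext R
      rw [hS']
      simp only [Finset.mem_erase, Finset.mem_insert]
      constructor
      · rintro ⟨h1, h2, rfl | rfl | h3⟩
        · exact Or.inr (Or.inl rfl)
        · exact Or.inl rfl
        · exact Or.inr (Or.inr ⟨h3, h2, h1⟩)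
      · rintro (rfl | rfl | ⟨h1, h2, h3⟩)
        · exact ⟨hAne2, hAne, Or.inr (Or.inl rfl)⟩
        · exact ⟨hBne2, hBne, Or.inl rfl⟩
        · exact ⟨h3, h2, Or.inr (Or.inr h1)⟩
    have c1 : (insert A' T).card = m + 5 := by rw [Finset.card_insert_of_notMem hA', hcard]
    have c2 : (insert B' (insert A' T)).card = m + 6 := by
      rw [Finset.card_insert_of_notMem (by simp [hAB', hB']), c1]
    have c3 : ((insert B' (insert A' T)).erase A).card ≤ m + 6 := by
      rw [← c2]; exact Finset.card_erase_le
    have c4 : (((insert B' (insert A' T)).erase A).erase B).card ≤ m + 6 :=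
      Finset.card_erase_le.trans c3
    refine ⟨⟨by omega, ⟨hwA, hA'⟩, ?_, ⟨hwB, ?_⟩, ?_, ?_, ?_, ?_, ?_⟩, hT, ?_⟩
    · simp only [Update.apply]; omega
    · simp [Update.apply, hAB', hB']
    · simp only [Update.apply]; omega
    · simp [Update.Allowed, Update.apply, hA]
    · simp only [Update.apply]; omega
    · simp [Update.Allowed, Update.apply, hBm, hAB]
    · exact c4.trans hn
    · intro j hj
      have hsub : T ⊆ insert B' (insert A' T) := by
        intro R hR; simp [hR]
      interval_cases j
      · left; exact fun R hR => hR
      · left; intro R hR; simp [Update.apply, hR]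
      · left; exact hsub
      · right
        change T' ⊆ (insert B' (insert A' T)).erase A
        rw [← hT]; exact Finset.erase_subset _ _
      · right
        change T' ⊆ ((insert B' (insert A' T)).erase A).erase B
        rw [hT]
  · have hq : D.quad k = [.add dummy₁, .add dummy₂, .delete dummy₁, .delete dummy₂] := by
      unfold quad; rw [if_neg hv]
    have hS : D.S m (k + 1) = D.S m k := S_succ_of_not_valid hv
    rw [hq, hS]
    have n1 := hD.dummy_notMem hB k (Or.inl (rfl : dummy₁ = dummy₁))
    have n2 := hD.dummy_notMem hB k (Or.inr (rfl : dummy₂ = dummy₂))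
    have w1 := hB.dummy_within (Or.inl (rfl : dummy₁ = dummy₁))
    have w2 := hB.dummy_within (Or.inr (rfl : dummy₂ = dummy₂))
    have hne : dummy₂ ≠ dummy₁ := by decide
    generalize dummy₁ = d₁ at *
    generalize dummy₂ = d₂ at *
    generalize D.S m k = T at *
    have c1 : (insert d₁ T).card = m + 5 := by rw [Finset.card_insert_of_notMem n1, hcard]
    have c2 : (insert d₂ (insert d₁ T)).card = m + 6 := by
      rw [Finset.card_insert_of_notMem (by simp [hne, n2]), c1]
    have c3 : ((insert d₂ (insert d₁ T)).erase d₁).card ≤ m + 6 := by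
      rw [← c2]; exact Finset.card_erase_le
    have c4 : (((insert d₂ (insert d₁ T)).erase d₁).erase d₂).card ≤ m + 6 :=
      Finset.card_erase_le.trans c3
    have hT : ((insert d₂ (insert d₁ T)).erase d₁).erase d₂ = T := by
      ext R
      simp only [Finset.mem_erase, Finset.mem_insert]
      constructor
      · rintro ⟨h1, h2, rfl | rfl | h3⟩
        · exact absurd rfl h1
        · exact absurd rfl h2
        · exact h3
      · intro h
        exact ⟨by rintro rfl; exact n2 h, by rintro rfl; exact n1 h, Or.inr (Or.inr h)⟩
    refine ⟨⟨by omega, ⟨w1, n1⟩, ?_, ⟨w2, ?_⟩, ?_, ?_, ?_, ?_, ?_⟩, hT, ?_⟩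
    · simp only [Update.apply]; omega
    · simp [Update.apply, hne, n2]
    · simp only [Update.apply]; omega
    · simp [Update.Allowed, Update.apply]
    · simp only [Update.apply]; omega
    · simp [Update.Allowed, Update.apply, hne]
    · exact c4.trans hn
    · intro j hj
      left
      interval_cases j
      · exact fun R hR => hR
      · intro R hR; simp [Update.apply, hR]
      · intro R hR; simp [Update.apply, hR]
      · intro R hR
        have : R ≠ d₁ := by rintro rfl; exact n1 hR
        simp [Update.apply, hR, this]
      · change T ⊆ ((insert d₂ (insert d₁ T)).erase d₁).erase d₂
        rw [hT]

/-- The updates for the changes `c, …, c + E - 1`. -/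
noncomputable def quads (D : Kin) (c E : ℕ) : List Update :=
  (List.range E).flatMap fun i => D.quad (c + i)

theorem quads_succ (D : Kin) (c E : ℕ) : D.quads c (E + 1) = D.quads c E ++ D.quad (c + E) := by
  simp [quads, List.range_succ]

theorem length_quads (D : Kin) (c E : ℕ) : (D.quads c E).length = 4 * E := by
  induction E with
  | zero => rfl
  | succ E ih => rw [quads_succ, List.length_append, ih, length_quad]; ring

theorem Ordered.quads_spec (hD : D.Ordered W) (hB : D.Boxed m) {n : ℕ} (hn : m + 6 ≤ n)
    (c E : ℕ) : RunsFrom (D.L + 1) n (D.S m c) (D.quads c E) ∧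
      (D.quads c E).foldl Update.apply (D.S m c) = D.S m (c + E) ∧
      ∀ i < E, ∀ j ≤ 4, ((D.quads c E).take (4 * i + j)).foldl Update.apply (D.S m c) =
        ((D.quad (c + i)).take j).foldl Update.apply (D.S m (c + i)) := by
  induction E with
  | zero =>
    refine ⟨?_, rfl, fun i hi => absurd hi (Nat.not_lt_zero i)⟩
    have := hD.card_S hB c
    simp only [quads, List.range_zero, List.flatMap_nil, RunsFrom]
    omega
  | succ E ih =>
    obtain ⟨h1, h2, h3⟩ := ih
    obtain ⟨q1, q2, -⟩ := hD.quad_spec hB hn (c + E)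
    rw [quads_succ]
    refine ⟨h1.append (by rwa [h2]), by rw [List.foldl_append, h2, q2]; rfl, fun i hi j hj => ?_⟩
    rcases Nat.lt_succ_iff_lt_or_eq.1 hi with hi | rfl
    · rw [List.take_append_of_le_length (by rw [length_quads]; omega)]
      exact h3 i hi j hj
    · rw [← length_quads D c i, List.take_length_add_append, List.foldl_append, h2]

/-- The updates of one phase: those for `E` changes, and one more if `e = 1`. -/
noncomputable def phaseUpdates (D : Kin) (c E e : ℕ) : List Update :=
  D.quads c E ++ List.replicate e (.add dummy₁)

/-- The instance of Offline Dynamic Rectangle Cover that deals with the changes from `c` on. -/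
noncomputable def phaseInstance (hD : D.Ordered W) (hB : D.Boxed m) {n : ℕ} (hn : m + 6 ≤ n)
    (c E : ℕ) {e : ℕ} (he : e ≤ 1) : CoverInstance :=
  have hr : RunsFrom (D.L + 1) n (D.S m c) (D.phaseUpdates c E e) := by
    obtain ⟨h1, h2, -⟩ := hD.quads_spec hB hn c E
    refine h1.append ?_
    rw [h2]
    have hc := hD.card_S hB (c + E)
    interval_cases e
    · simp only [List.replicate_zero, RunsFrom]; omega
    · refine ⟨by omega, ⟨hB.dummy_within (Or.inl rfl), hD.dummy_notMem hB _ (Or.inl rfl)⟩, ?_⟩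
      simp only [List.replicate_zero, RunsFrom, Update.apply]
      exact (Finset.card_insert_le _ _).trans (by omega)
  { n := n
    N := D.L + 1
    init := D.rects m c
    updates := D.phaseUpdates c E e
    one_le_N := by omega
    init_nodup := hD.nodup_rects hB c
    init_within := fun R hR => by
      rcases List.mem_append.1 hR with h | h
      · obtain ⟨r, hr, rfl⟩ := List.mem_map.1 h
        exact hD.within hB c (List.mem_range.1 hr)
      · exact hB.frames_within h
    allowed := fun k hk => hr.allowed k hk
    card_le := fun k _ => hr.card_le k }

theorem covers_mono {T T' : Finset Rect} {N : ℕ} (h : T ⊆ T') (hc : Covers T N) :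
    Covers T' N := by
  rw [covers_iff] at hc ⊢
  intro u v h1 h2 h3 h4
  obtain ⟨R, hR, h'⟩ := hc u v h1 h2 h3 h4
  exact ⟨R, h hR, h'⟩

/-- Update `i` belongs to the change number `(i - 1) / 4` of the phase. All sets during a change
contain the set before it or the set after it. So if one of them fails to cover while the set before
covers, then the set after fails as well. -/
theorem phase_answer (hD : D.Ordered W) (hB : D.Boxed m) {n : ℕ} (hn : m + 6 ≤ n)
    (c E : ℕ) {e : ℕ} (he : e ≤ 1) (h0 : Covers (D.S m c) (D.L + 1)) {i : ℕ}
    (hi : (phaseInstance hD hB hn c E he).IsAnswer i) :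
    (i = 0 ∧ ∀ j ≤ E, Covers (D.S m (c + j)) (D.L + 1)) ∨
      (1 ≤ i ∧ (i - 1) / 4 < E ∧ ¬ Covers (D.S m (c + (i - 1) / 4 + 1)) (D.L + 1) ∧
        ∀ j ≤ (i - 1) / 4, Covers (D.S m (c + j)) (D.L + 1)) := by
  obtain ⟨-, q2, q3⟩ := hD.quads_spec hB hn c E
  have hlen : (D.phaseUpdates c E e).length = 4 * E + e := by
    simp [phaseUpdates, length_quads]
  have hst : ∀ j ≤ 4 * E, stateAfter (D.rects m c) (D.phaseUpdates c E e) j =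
      ((D.quads c E).take j).foldl Update.apply (D.S m c) := by
    intro j hj
    unfold stateAfter phaseUpdates
    rw [List.take_append_of_le_length (by rw [length_quads]; exact hj)]
    rfl
  have hst4 : ∀ j ≤ E, stateAfter (D.rects m c) (D.phaseUpdates c E e) (4 * j) =
      D.S m (c + j) := by
    intro j hj
    rw [hst _ (by omega)]
    rcases hj.eq_or_lt with rfl | hj
    · rw [← length_quads D c j, List.take_length, q2]
    · have := q3 j hj 0 (by omega)
      rw [add_zero] at this
      rw [this]; rfl
  have hN : (phaseInstance hD hB hn c E he).N = D.L + 1 := rfl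
  have hU : (phaseInstance hD hB hn c E he).updates = D.phaseUpdates c E e := rfl
  have hI : (phaseInstance hD hB hn c E he).init = D.rects m c := rfl
  rcases hi with ⟨h1, h2, h3, h4⟩ | ⟨h1, h2⟩
  · right
    rw [hU, hI, hN] at *
    rw [hlen] at h2
    have hcov : ∀ j ≤ E, 4 * j < i → Covers (D.S m (c + j)) (D.L + 1) := by
      intro j hj hji
      rcases Nat.eq_zero_or_pos j with rfl | hp
      · exact h0
      · rw [← hst4 j hj]; exact h4 _ (by omega) hji
    -- Otherwise `i` would be the filler, which only adds a rectangle to a set that covers.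
    have hE : (i - 1) / 4 < E := by
      by_contra hc
      have hi' : i = 4 * E + 1 := by omega
      have he' : e = 1 := by omega
      subst he' hi'
      apply h3
      have : stateAfter (D.rects m c) (D.phaseUpdates c E 1) (4 * E + 1) =
          insert dummy₁ (D.S m (c + E)) := by
        unfold stateAfter
        rw [← hlen, List.take_length, phaseUpdates, List.foldl_append]
        change List.foldl Update.apply ((D.quads c E).foldl Update.apply (D.S m c)) _ = _
        rw [q2]; rfl
      rw [this]
      exact covers_mono (Finset.subset_insert _ _) (hcov E le_rfl (by omega))
    refine ⟨h1, hE, fun hc => ?_, fun j hj => hcov j (by omega) (by omega)⟩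
    apply h3
    have hj : i - 4 * ((i - 1) / 4) ≤ 4 := by omega
    have key := q3 _ hE _ hj
    have e : 4 * ((i - 1) / 4) + (i - 4 * ((i - 1) / 4)) = i := by omega
    rw [e] at key
    rw [hst i (by omega), key]
    obtain ⟨-, -, q⟩ := hD.quad_spec hB hn (c + (i - 1) / 4)
    rcases q _ hj with q | q
    · exact covers_mono q (hcov _ hE.le (by omega))
    · exact covers_mono q hc
  · left
    refine ⟨h1, fun j hj => ?_⟩
    rcases Nat.eq_zero_or_pos j with rfl | hp
    · exact h0
    · rw [← hst4 j hj]
      refine h2 _ (by omega) ?_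
      rw [hU, hlen]; omega

end Kin

/-! ### Loops that count and loops that search -/

theorem SameOff.refl (A : Prog) (s : Store) : SameOff A s s := ⟨fun _ _ => rfl, fun _ _ => rfl⟩

theorem SameOff.mono {A B : Prog} {s s' : Store} (h : SameOff A s s') (hN : A.wN ⊆ B.wN)
    (hR : A.wR ⊆ B.wR) : SameOff B s s' :=
  ⟨fun a ha => h.nat a fun h' => ha (hN h'), fun a ha => h.real a fun h' => ha (hR h')⟩

theorem SameOff.trans {A : Prog} {s s' s'' : Store} (h : SameOff A s s') (h' : SameOff A s' s'') :
    SameOff A s s'' :=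
  ⟨fun a ha => (h'.nat a ha).trans (h.nat a ha), fun a ha => (h'.real a ha).trans (h.real a ha)⟩

theorem SameOff.seq_left {A B : Prog} {s s' : Store} (h : SameOff A s s') :
    SameOff (.seq A B) s s' :=
  h.mono (by simp [Prog.wN]) (by simp [Prog.wR])

theorem SameOff.seq_right {A B : Prog} {s s' : Store} (h : SameOff B s s') :
    SameOff (.seq A B) s s' :=
  h.mono (by simp [Prog.wN]) (by simp [Prog.wR])

/-- Let `acc` be the number of values of `c` below `e` with the property `b`. -/
abbrev countLoop (c acc : ℕ) (e : NExpr) (b : Test) : Prog :=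
  .seq (.setN acc (.const 0) (.const 0)) (forLoop c e (.ite b (incr acc) .skip))

/-- Let `acc` be the parity of the number of values of `c` below `e` with the property `b`. -/
abbrev parityLoop (c acc : ℕ) (e : NExpr) (b : Test) : Prog :=
  .seq (.setN acc (.const 0) (.const 0))
    (forLoop c e (.ite b (.setN acc (.const 0) (.sub (.const 1) (nv acc))) .skip))

theorem card_filter_range_succ (P : ℕ → Prop) [DecidablePred P] (i : ℕ) :
    ((Finset.range (i + 1)).filter P).card =
      ((Finset.range i).filter P).card + if P i then 1 else 0 := by
  rw [Finset.range_add_one, Finset.filter_insert]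
  split
  · rw [Finset.card_insert_of_notMem (by simp)]
  · rfl

theorem Runs.count {c acc n : ℕ} {e : NExpr} {b : Test} {s : Store} (P : ℕ → Prop)
    [DecidablePred P] (hc : c ≠ acc)
    (he : ∀ s₁, SameOff (countLoop c acc e b) s s₁ → e.eval s₁ = n)
    (hb : ∀ s₁ i, SameOff (countLoop c acc e b) s s₁ → s₁.nat c 0 = i → i < n →
      (b.holds s₁ ↔ P i)) :
    Runs (countLoop c acc e b) s (4 * n + 3) fun s' =>
      s'.nat acc 0 = ((Finset.range n).filter P).card := by
  refine Runs.andThen (t₁ := 1) (t₂ := n * (2 + 2) + 2) (R := fun s' => s' = s.writeN acc 0 0)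
    (Runs.straight rfl le_rfl rfl) (by omega) ?_
  rintro s₀ hs₀ rfl
  refine Runs.for (fun i s' => s'.nat acc 0 = ((Finset.range i).filter P).card)
    (by simp [Prog.wN, hc]) (fun s₁ hs₁ => he s₁ (hs₀.seq_left.trans hs₁.seq_right))
    (by simp [Store.writeN_nat, hc.symm]) ?_
  intro i s₁ hi hs₁ hci hacc
  have hbi := hb s₁ i (hs₀.seq_left.trans hs₁.seq_right) hci hi
  refine Runs.straight rfl le_rfl ?_
  by_cases h : P i
  · simp [Prog.run, hbi, h, Store.writeN_nat, hc.symm, NExpr.eval, hacc, card_filter_range_succ]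
  · simp [Prog.run, hbi, h, Store.writeN_nat, hc.symm, hacc, card_filter_range_succ]

theorem Runs.parity {c acc n : ℕ} {e : NExpr} {b : Test} {s : Store} (P : ℕ → Prop)
    [DecidablePred P] (hc : c ≠ acc)
    (he : ∀ s₁, SameOff (parityLoop c acc e b) s s₁ → e.eval s₁ = n)
    (hb : ∀ s₁ i, SameOff (parityLoop c acc e b) s s₁ → s₁.nat c 0 = i → i < n →
      (b.holds s₁ ↔ P i)) :
    Runs (parityLoop c acc e b) s (4 * n + 3) fun s' =>
      s'.nat acc 0 = ((Finset.range n).filter P).card % 2 := by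
  refine Runs.andThen (t₁ := 1) (t₂ := n * (2 + 2) + 2) (R := fun s' => s' = s.writeN acc 0 0)
    (Runs.straight rfl le_rfl rfl) (by omega) ?_
  rintro s₀ hs₀ rfl
  refine Runs.for (fun i s' => s'.nat acc 0 = ((Finset.range i).filter P).card % 2)
    (by simp [Prog.wN, hc]) (fun s₁ hs₁ => he s₁ (hs₀.seq_left.trans hs₁.seq_right))
    (by simp [Store.writeN_nat, hc.symm]) ?_
  intro i s₁ hi hs₁ hci hacc
  have hbi := hb s₁ i (hs₀.seq_left.trans hs₁.seq_right) hci hi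
  refine Runs.straight rfl le_rfl ?_
  by_cases h : P i
  · simp only [Prog.run, hbi, h, Store.writeN_nat, hc.symm, NExpr.eval, hacc,
      card_filter_range_succ, if_true, false_and, if_false, and_self]
    omega
  · simp [Prog.run, hbi, h, Store.writeN_nat, hc.symm, hacc, card_filter_range_succ]

/-- Among the numbers below `n` with the property `P`, the number `r` has the least value `v`;
`r = n` if there are none. -/
def Best (n : ℕ) (P : ℕ → Prop) (v : ℕ → ℝ) (r : ℕ) : Prop :=
  (r = n ∧ ∀ i < n, ¬ P i) ∨ (r < n ∧ P r ∧ ∀ i < n, P i → v r ≤ v i)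

/-- Search among the values of `c` below `e` with the property `b` for the best one with respect
to the comparison `t`, and store it in `r`. -/
abbrev bestLoop (c r : ℕ) (e : NExpr) (b t : Test) : Prog :=
  .seq (.setN r (.const 0) e)
    (forLoop c e (.ite (.and b (.or (.not (.nlt (nv r) e)) t)) (.setN r (.const 0) (nv c)) .skip))

/-- The value `n` in `r` means that nothing has been found so far, in which case the first candidate
is accepted without comparison. -/
theorem Runs.best {c r n : ℕ} {e : NExpr} {b t : Test} {s : Store} (P : ℕ → Prop) (v : ℕ → ℝ)
    (hc : c ≠ r)
    (he : ∀ s₁, SameOff (bestLoop c r e b t) s s₁ → e.eval s₁ = n)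
    (hb : ∀ s₁ i, SameOff (bestLoop c r e b t) s s₁ → s₁.nat c 0 = i → i < n →
      (b.holds s₁ ↔ P i))
    (ht : ∀ s₁ i j, SameOff (bestLoop c r e b t) s s₁ → s₁.nat c 0 = i → s₁.nat r 0 = j →
      i < n → j < n → (t.holds s₁ ↔ v i < v j)) :
    Runs (bestLoop c r e b t) s (4 * n + 3) fun s' => Best n P v (s'.nat r 0) := by
  have hes := he s (SameOff.refl _ s)
  refine Runs.andThen (t₁ := 1) (t₂ := n * (2 + 2) + 2) (R := fun s' => s' = s.writeN r 0 n)
    (Runs.straight rfl le_rfl (by simp [Prog.run, NExpr.eval, hes])) (by omega) ?_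
  rintro s₀ hs₀ rfl
  refine (Runs.for (fun i s' => (s'.nat r 0 = n ∧ ∀ j < i, ¬ P j) ∨ (s'.nat r 0 < n ∧
      P (s'.nat r 0) ∧ ∀ j < i, P j → v (s'.nat r 0) ≤ v j))
    (by simp [Prog.wN, hc]) (fun s₁ hs₁ => he s₁ (hs₀.seq_left.trans hs₁.seq_right))
    (by simp [Store.writeN_nat, hc.symm]) ?_)
  intro i s₁ hi hs₁ hci hacc
  have hs' := hs₀.seq_left.trans hs₁.seq_right
  have hbi := hb s₁ i hs' hci hi
  have hei := he s₁ hs'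
  have hif : (Test.and b (.or (.not (.nlt (nv r) e)) t)).holds s₁ ↔
      P i ∧ (¬ s₁.nat r 0 < n ∨ t.holds s₁) := by
    rw [Test.holds_and, Test.holds_or, Test.holds_not, Test.holds_nlt, hbi, hei]
    rfl
  have hlast : ∀ (Q : ℕ → Prop), (∀ j < i, Q j) → Q i → ∀ j < i + 1, Q j := by
    intro Q h h' j hj
    rcases Nat.lt_succ_iff_lt_or_eq.1 hj with hj | rfl
    · exact h j hj
    · exact h'
  refine Runs.ite (fun hcond => Runs.straight rfl le_rfl ?_) fun hcond =>
    Runs.straight rfl (Nat.zero_le 1) ?_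
  · obtain ⟨hP, ht'⟩ := hif.1 hcond
    simp only [Prog.run, NExpr.eval, hci, Store.writeN_nat, hc.symm, false_and, if_false,
      and_self, if_true]
    refine Or.inr ⟨hi, hP, hlast _ (fun j hj hPj => ?_) fun _ => le_rfl⟩
    rcases hacc with ⟨-, h2⟩ | ⟨h1, -, h3⟩
    · exact absurd hPj (h2 j hj)
    · exact (((ht s₁ i _ hs' hci rfl hi h1).1 (ht'.resolve_left (not_not.2 h1))).le).trans
        (h3 j hj hPj)
  · rw [hif] at hcond
    simp only [Prog.run, Store.writeN_nat, hc.symm, false_and, if_false]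
    rcases hacc with ⟨h1, h2⟩ | ⟨h1, h2, h3⟩
    · exact Or.inl ⟨h1, hlast _ h2 fun hP => hcond ⟨hP, Or.inl (by omega)⟩⟩
    · refine Or.inr ⟨h1, h2, hlast _ h3 fun hP => ?_⟩
      by_contra hv
      exact hcond ⟨hP, Or.inr ((ht s₁ i _ hs' hci rfl hi h1).2 (not_le.1 hv))⟩

/-! ### Boxes from the vertices of a chain

The vertices of a chain are in the real arrays `xa` and `ya`, and their number in cell `j` of
array `0`.  Array `10` counts the vertices, array `11` is the counter of the inner loops, array
`21` holds the number of boxes.  The boxes are in the real arrays `10`-`13`, with their flags in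
the arrays `30`-`33`. -/

/-- The number `k` of the box that is stored. -/
def boxAt (s : Store) (k : ℕ) : Box :=
  ⟨s.real 10 k, s.real 11 k, s.real 12 k, s.real 13 k, s.nat 30 k, s.nat 31 k, s.nat 32 k,
    s.nat 33 k⟩

theorem boxAt_congr {s s' : Store} {k k' : ℕ} (h0 : s'.real 10 k' = s.real 10 k)
    (h1 : s'.real 11 k' = s.real 11 k) (h2 : s'.real 12 k' = s.real 12 k)
    (h3 : s'.real 13 k' = s.real 13 k) (g0 : s'.nat 30 k' = s.nat 30 k)
    (g1 : s'.nat 31 k' = s.nat 31 k) (g2 : s'.nat 32 k' = s.nat 32 k)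
    (g3 : s'.nat 33 k' = s.nat 33 k) : boxAt s' k' = boxAt s k := by
  simp only [boxAt, h0, h1, h2, h3, g0, g1, g2, g3]

/-- The store contains a chain, and the current vertex is `k`. -/
structure VertexAt (n : ℕ) (X Y : ℕ → ℝ) (xa ya j k : ℕ) (s : Store) : Prop where
  n_eq : s.nat 0 j = n
  x_eq : ∀ i ≤ n, s.real xa i = X i
  y_eq : ∀ i ≤ n, s.real ya i = Y i
  lt : k < n
  k_eq : s.nat 10 0 = k

/-- The edge number `11` passes over the vertex number `10`. -/
abbrev spansTest (xa : ℕ) : Test :=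
  .or (.and (.not (.rlt (.cell xa (nv 10)) (.cell xa (nv 11))))
      (.rlt (.cell xa (nv 10)) (.cell xa (.add (nv 11) (.const 1)))))
    (.and (.not (.rlt (.cell xa (nv 10)) (.cell xa (.add (nv 11) (.const 1)))))
      (.rlt (.cell xa (nv 10)) (.cell xa (nv 11))))

/-- The edge number `11` counts as lying above the vertex number `10`, according to the flag in
array `15`. -/
abbrev aboveTest (ya : ℕ) : Test :=
  .or (.rlt (.cell ya (nv 10)) (.cell ya (nv 11)))
    (.and (.neq (nv 15) (.const 1)) (.not (.rlt (.cell ya (nv 11)) (.cell ya (nv 10)))))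

/-- The vertical edge number `11` overlaps the chord between the edges that are stored in arrays
`17` and `18`. -/
abbrev overlapTest (xa ya j : ℕ) : Test :=
  .and (.req (.cell xa (nv 11)) (.cell xa (.add (nv 11) (.const 1))))
    (.and
      (.or (.not (.nlt (nv 17) (.cell 0 (.const j))))
        (.or (.rlt (.cell ya (nv 11)) (.cell ya (nv 17)))
          (.rlt (.cell ya (.add (nv 11) (.const 1))) (.cell ya (nv 17)))))
      (.or (.not (.nlt (nv 18) (.cell 0 (.const j))))
        (.or (.rlt (.cell ya (nv 18)) (.cell ya (nv 11)))
          (.rlt (.cell ya (nv 18)) (.cell ya (.add (nv 11) (.const 1)))))))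

namespace VertexAt

variable {n : ℕ} {X Y : ℕ → ℝ} {xa ya j k : ℕ} {s : Store}

theorem step (h : VertexAt n X Y xa ya j k s) {A : Prog} {s' : Store} (hs : SameOff A s s')
    (h0 : 0 ∉ A.wN) (h10 : 10 ∉ A.wN) (hR : A.wR = []) : VertexAt n X Y xa ya j k s' where
  n_eq := by rw [hs.nat 0 h0, h.n_eq]
  x_eq := fun i hi => by rw [hs.real xa (by simp [hR]), h.x_eq i hi]
  y_eq := fun i hi => by rw [hs.real ya (by simp [hR]), h.y_eq i hi]
  lt := h.lt
  k_eq := by rw [hs.nat 10 h10, h.k_eq]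

theorem spans (h : VertexAt n X Y xa ya j k s) {i : ℕ} (hi : i < n) (hc : s.nat 11 0 = i) :
    (spansTest xa).holds s ↔ Spans X (X k) i := by
  have := h.lt
  simp only [Test.holds_or, Test.holds_and, Test.holds_not, Test.holds_rlt, RExpr.eval, NExpr.eval,
    hc, h.k_eq, h.x_eq i hi.le, h.x_eq (i + 1) hi, h.x_eq k h.lt.le, not_lt, Spans]

theorem above (h : VertexAt n X Y xa ya j k s) {i f : ℕ} (hi : i < n) (hc : s.nat 11 0 = i)
    (hf : s.nat 15 0 = f) : (aboveTest ya).holds s ↔ Above Y (Y k) f i := by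
  simp only [Test.holds_or, Test.holds_and, Test.holds_not, Test.holds_rlt, Test.holds_neq,
    RExpr.eval, NExpr.eval, hc, h.k_eq, h.y_eq i hi.le, h.y_eq k h.lt.le, not_lt, Above, hf]

/-- The conditions range over all edges above and below the chord, but the nearest ones `u` and `d`
decide; the index `n` stands for a missing edge and makes the condition void. This keeps the test in
constant time. -/
theorem overlaps (h : VertexAt n X Y xa ya j k s) {i u d : ℕ} {Ab : ℕ → Prop} (hi : i < n)
    (hc : s.nat 11 0 = i) (hu : s.nat 17 0 = u) (hd : s.nat 18 0 = d)
    (hU : Best n (fun e => Spans X (X k) e ∧ Ab e) Y u)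
    (hD : Best n (fun e => Spans X (X k) e ∧ ¬ Ab e) (fun e => -Y e) d) :
    (overlapTest xa ya j).holds s ↔ Overlaps n X Y (X k) Ab i := by
  have e1 : (¬ u < n ∨ (Y i < s.real ya u ∨ Y (i + 1) < s.real ya u)) ↔
      ∀ j < n, Spans X (X k) j → Ab j → min (Y i) (Y (i + 1)) < Y j := by
    rcases hU with ⟨rfl, hU⟩ | ⟨hu, hU, hmin⟩
    · simp only [lt_irrefl, not_false_eq_true, true_or, true_iff]
      exact fun j hj h1 h2 => absurd ⟨h1, h2⟩ (hU j hj)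
    · rw [h.y_eq u hu.le, ← min_lt_iff]
      simp only [hu, not_true, false_or]
      exact ⟨fun h j hj h1 h2 => h.trans_le (hmin j hj ⟨h1, h2⟩), fun h => h u hu hU.1 hU.2⟩
  have e2 : (¬ d < n ∨ (s.real ya d < Y i ∨ s.real ya d < Y (i + 1))) ↔
      ∀ j < n, Spans X (X k) j → ¬ Ab j → Y j < max (Y i) (Y (i + 1)) := by
    rcases hD with ⟨rfl, hD⟩ | ⟨hu, hD, hmin⟩
    · simp only [lt_irrefl, not_false_eq_true, true_or, true_iff]
      exact fun j hj h1 h2 => absurd ⟨h1, h2⟩ (hD j hj)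
    · rw [h.y_eq d hu.le, ← lt_max_iff]
      simp only [hu, not_true, false_or]
      exact ⟨fun h j hj h1 h2 => lt_of_le_of_lt (neg_le_neg_iff.1 (hmin j hj ⟨h1, h2⟩)) h,
        fun h => h d hu hD.1 hD.2⟩
  unfold Overlaps
  rw [← e1, ← e2]
  simp only [Test.holds_or, Test.holds_and, Test.holds_not, Test.holds_rlt, Test.holds_req,
    Test.holds_nlt, RExpr.eval, NExpr.eval, hc, h.x_eq i hi.le, h.x_eq (i + 1) hi, h.y_eq i hi.le,
    h.y_eq (i + 1) hi, h.n_eq, hu, hd]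

end VertexAt

/-- Decide whether the vertex number `10` is used, and with which flag. -/
abbrev chooseFlag (xa ya j want : ℕ) : Prog :=
  .seq (countLoop 11 12 (.cell 0 (.const j)) (.rlt (.cell xa (nv 10)) (.cell xa (nv 11))))
  (.seq (.setN 15 (.const 0) (.const 0))
  (.seq (parityLoop 11 13 (.cell 0 (.const j)) (.and (spansTest xa) (aboveTest ya)))
  (.seq (.setN 15 (.const 0) (.const 1))
  (.seq (parityLoop 11 14 (.cell 0 (.const j)) (.and (spansTest xa) (aboveTest ya)))
  (.ite (.nlt (.const 0) (nv 12))
    (.ite (.neq (nv 13) (.const want))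
      (.seq (.setN 15 (.const 0) (.const 0)) (.setN 16 (.const 0) (.const 1)))
      (.ite (.neq (nv 14) (.const want)) (.setN 16 (.const 0) (.const 1))
        (.setN 16 (.const 0) (.const 0))))
    (.setN 16 (.const 0) (.const 0)))))))

theorem runs_chooseFlag {n : ℕ} {X Y : ℕ → ℝ} {xa ya j k want : ℕ} {s : Store}
    (h : VertexAt n X Y xa ya j k s) :
    Runs (chooseFlag xa ya j want) s (12 * n + 20) fun s' =>
      (s'.nat 16 0 = 1 ∧ Emits n X Y want k (s'.nat 15 0)) ∨
        (s'.nat 16 0 = 0 ∧ ∀ f, ¬ Emits n X Y want k f) := by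
  classical
  refine Runs.andThen (t₁ := 4 * n + 3) (t₂ := 8 * n + 17)
    (Runs.count (n := n) (fun i => X k < X i) (by decide) (fun s₁ hs₁ => ?_)
      fun s₁ i hs₁ hi hin => ?_) (by omega) ?_
  · exact (h.step hs₁ (by simp [Prog.wN]) (by simp [Prog.wN]) rfl).n_eq
  · have h' := h.step hs₁ (by simp [Prog.wN]) (by simp [Prog.wN]) rfl
    simp only [Test.holds_rlt, RExpr.eval, NExpr.eval, hi, h'.k_eq, h'.x_eq k h.lt.le,
      h'.x_eq i hin.le]
  intro s₁ hs₁ hE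
  replace h := h.step hs₁ (by simp [Prog.wN]) (by simp [Prog.wN]) rfl
  refine Runs.andThen (t₁ := 1) (t₂ := 8 * n + 16) (R := fun s' => s'.nat 15 0 = 0)
    (Runs.straight rfl le_rfl (by simp [Prog.run, Store.writeN_nat, NExpr.eval])) (by omega) ?_
  intro s₂ hs₂ hF
  replace h := h.step hs₂ (by simp [Prog.wN]) (by simp [Prog.wN]) rfl
  rw [← hs₂.nat 12 (by simp [Prog.wN])] at hE
  refine Runs.andThen (t₁ := 4 * n + 3) (t₂ := 4 * n + 13)
    (Runs.parity (n := n) (fun i => Spans X (X k) i ∧ Above Y (Y k) 0 i) (by decide)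
      (fun s' hs' => ?_) fun s' i hs' hi hin => ?_) (by omega) ?_
  · exact (h.step hs' (by simp [Prog.wN]) (by simp [Prog.wN]) rfl).n_eq
  · have h' := h.step hs' (by simp [Prog.wN]) (by simp [Prog.wN]) rfl
    rw [Test.holds_and, h'.spans hin hi,
      h'.above hin hi (by rw [hs'.nat 15 (by simp [Prog.wN]), hF])]
  intro s₃ hs₃ hC0
  replace h := h.step hs₃ (by simp [Prog.wN]) (by simp [Prog.wN]) rfl
  rw [← hs₃.nat 12 (by simp [Prog.wN])] at hE
  refine Runs.andThen (t₁ := 1) (t₂ := 4 * n + 12) (R := fun s' => s'.nat 15 0 = 1)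
    (Runs.straight rfl le_rfl (by simp [Prog.run, Store.writeN_nat, NExpr.eval])) (by omega) ?_
  intro s₄ hs₄ hF'
  replace h := h.step hs₄ (by simp [Prog.wN]) (by simp [Prog.wN]) rfl
  rw [← hs₄.nat 12 (by simp [Prog.wN])] at hE
  rw [← hs₄.nat 13 (by simp [Prog.wN])] at hC0
  refine Runs.andThen (t₁ := 4 * n + 3) (t₂ := 9)
    (Runs.parity (n := n) (fun i => Spans X (X k) i ∧ Above Y (Y k) 1 i) (by decide)
      (fun s' hs' => ?_) fun s' i hs' hi hin => ?_) (by omega) ?_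
  · exact (h.step hs' (by simp [Prog.wN]) (by simp [Prog.wN]) rfl).n_eq
  · have h' := h.step hs' (by simp [Prog.wN]) (by simp [Prog.wN]) rfl
    rw [Test.holds_and, h'.spans hin hi,
      h'.above hin hi (by rw [hs'.nat 15 (by simp [Prog.wN]), hF'])]
  intro s₅ hs₅ hC1
  rw [← hs₅.nat 12 (by simp [Prog.wN])] at hE
  rw [← hs₅.nat 13 (by simp [Prog.wN])] at hC0
  rw [← hs₅.nat 15 (by simp [Prog.wN])] at hF'
  have hE' : 0 < s₅.nat 12 0 ↔ ∃ i < n, X k < X i := by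
    rw [hE, Finset.card_pos]
    exact ⟨fun ⟨i, hi⟩ => ⟨i, by simpa using hi⟩, fun ⟨i, hi⟩ => ⟨i, by simpa using hi⟩⟩
  have hC0' : s₅.nat 13 0 = aboveCount n X Y k 0 % 2 := by
    rw [hC0]; unfold aboveCount; congr!
  have hC1' : s₅.nat 14 0 = aboveCount n X Y k 1 % 2 := by
    rw [hC1]; unfold aboveCount; congr!
  refine Runs.straight rfl (by simp [Prog.size]) ?_
  simp only [Prog.run, Test.holds_nlt, Test.holds_neq, NExpr.eval, hE', hC0', hC1']
  by_cases e1 : ∃ i < n, X k < X i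
  · by_cases e2 : aboveCount n X Y k 0 % 2 = want
    · simp [e1, e2, Store.writeN_nat, Emits]
    · by_cases e3 : aboveCount n X Y k 1 % 2 = want
      · simp [e1, e2, e3, Store.writeN_nat, Emits, hF']
      · simp [e1, e2, e3, Store.writeN_nat, Emits]
  · simp [e1, Store.writeN_nat, Emits]

/-- Store one side of a box: the value in the array `arr` at the index in `r`, or a side at
infinity if this index is too large. -/
abbrev storeSide (fl bx arr r j : ℕ) : Prog :=
  .ite (.nlt (nv r) (.cell 0 (.const j)))
    (.seq (.setN fl (nv 21) (.const 0)) (.setR bx (nv 21) (.cell arr (nv r))))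
    (.setN fl (nv 21) (.const 1))

theorem runs_storeSide {fl bx arr r j n c : ℕ} {s : Store} (hn : s.nat 0 j = n)
    (hc : s.nat 21 0 = c) (h1 : fl ≠ 21) (h2 : fl ≠ r) :
    Runs (storeSide fl bx arr r j) s 4 fun s' =>
      ((s.nat r 0 < n ∧ s'.nat fl c = 0 ∧ s'.real bx c = s.real arr (s.nat r 0)) ∨
        (¬ s.nat r 0 < n ∧ s'.nat fl c = 1)) ∧
      (∀ i ≠ c, s'.nat fl i = s.nat fl i) ∧ ∀ i ≠ c, s'.real bx i = s.real bx i := by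
  refine Runs.straight rfl le_rfl ?_
  simp only [Prog.run, Test.holds_nlt, NExpr.eval, RExpr.eval, hn, hc]
  by_cases h : s.nat r 0 < n
  · have h3 : ¬ 21 = fl := fun e => h1 e.symm
    have h4 : ¬ r = fl := fun e => h2 e.symm
    simp +contextual [h, Store.writeN_nat, Store.writeR_real, Store.writeN_real, Store.writeR_nat,
      hc, h3, h4]
  · simp +contextual [h, Store.writeN_nat, Store.writeN_real]

/-- Store the box that is bounded by the edges in the arrays `17`-`20`. -/
abbrev storeBox (xa ya j : ℕ) : Prog :=
  .seq (storeSide 30 10 xa 20 j) (.seq (storeSide 31 11 xa 19 j)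
  (.seq (storeSide 32 12 ya 18 j) (.seq (storeSide 33 13 ya 17 j) (incr 21))))

/-- Each of the four families of conditions in `InCell` reduces to its extremal member. If the
family is empty, the best index is `n`, and the side is stored as a side at infinity. -/
theorem runs_storeBox {n : ℕ} {X Y : ℕ → ℝ} {xa ya j k f c : ℕ} {s : Store}
    (h : VertexAt n X Y xa ya j k s) (hc : s.nat 21 0 = c)
    (hxa : ∀ a ∈ [10, 11, 12, 13], xa ≠ a ∧ ya ≠ a)
    (hU : Best n (fun i => Spans X (X k) i ∧ Above Y (Y k) f i) Y (s.nat 17 0))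
    (hD : Best n (fun i => Spans X (X k) i ∧ ¬ Above Y (Y k) f i) (fun i => -Y i) (s.nat 18 0))
    (hR : Best n (fun i => Overlaps n X Y (X k) (Above Y (Y k) f) i ∧ X k < X i) X (s.nat 19 0))
    (hL : Best n (fun i => Overlaps n X Y (X k) (Above Y (Y k) f) i ∧ ¬ X k < X i)
      (fun i => -X i) (s.nat 20 0)) :
    Runs (storeBox xa ya j) s 17 fun s' =>
      s'.nat 21 0 = c + 1 ∧ (∀ i ≠ c, boxAt s' i = boxAt s i) ∧
      ((boxAt s' c).fl ≤ 1 ∧ (boxAt s' c).fr ≤ 1 ∧ (boxAt s' c).fb ≤ 1 ∧ (boxAt s' c).ft ≤ 1) ∧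
      (boxAt s' c).toSet = cellSet n X Y k f := by
  have hk := h.lt
  simp only [List.mem_cons, List.not_mem_nil, or_false, forall_eq_or_imp, forall_eq] at hxa
  obtain ⟨⟨xa0, ya0⟩, ⟨xa1, ya1⟩, ⟨xa2, ya2⟩, xa3, ya3⟩ := hxa
  refine Runs.andThen (runs_storeSide h.n_eq hc (by decide) (by decide))
    (t₂ := 13) (by omega) ?_
  rintro s₁ hs₁ ⟨l1, l2, l3⟩
  have hc₁ := (hs₁.nat 21 (by simp [Prog.wN])).symm ▸ hc
  have hn₁ : s₁.nat 0 j = n := by rw [hs₁.nat 0 (by simp [Prog.wN]), h.n_eq]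
  refine Runs.andThen (runs_storeSide hn₁ hc₁ (by decide) (by decide)) (t₂ := 9) (by omega) ?_
  rintro s₂ hs₂ ⟨r1, r2, r3⟩
  have hc₂ := (hs₂.nat 21 (by simp [Prog.wN])).symm ▸ hc₁
  have hn₂ : s₂.nat 0 j = n := by rw [hs₂.nat 0 (by simp [Prog.wN]), hn₁]
  refine Runs.andThen (runs_storeSide hn₂ hc₂ (by decide) (by decide)) (t₂ := 5) (by omega) ?_
  rintro s₃ hs₃ ⟨b1, b2, b3⟩
  have hc₃ := (hs₃.nat 21 (by simp [Prog.wN])).symm ▸ hc₂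
  have hn₃ : s₃.nat 0 j = n := by rw [hs₃.nat 0 (by simp [Prog.wN]), hn₂]
  refine Runs.andThen (runs_storeSide hn₃ hc₃ (by decide) (by decide)) (t₂ := 1) (by omega) ?_
  rintro s₄ hs₄ ⟨t1, t2, t3⟩
  have hc₄ := (hs₄.nat 21 (by simp [Prog.wN])).symm ▸ hc₃
  refine Runs.straight rfl le_rfl ?_
  have hrun : (incr 21).run s₄ = s₄.writeN 21 0 (c + 1) := by
    simp [Prog.run, NExpr.eval, hc₄]
  rw [hrun]
  have e0 : ∀ i, (s₄.writeN 21 0 (c + 1)).nat 30 i = s₁.nat 30 i := by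
    intro i
    rw [Store.writeN_nat_ne _ _ _ (by decide), hs₄.nat 30 (by simp [Prog.wN]),
      hs₃.nat 30 (by simp [Prog.wN]), hs₂.nat 30 (by simp [Prog.wN])]
  have e1 : ∀ i, (s₄.writeN 21 0 (c + 1)).nat 31 i = s₂.nat 31 i := by
    intro i
    rw [Store.writeN_nat_ne _ _ _ (by decide), hs₄.nat 31 (by simp [Prog.wN]),
      hs₃.nat 31 (by simp [Prog.wN])]
  have e2 : ∀ i, (s₄.writeN 21 0 (c + 1)).nat 32 i = s₃.nat 32 i := by
    intro i
    rw [Store.writeN_nat_ne _ _ _ (by decide), hs₄.nat 32 (by simp [Prog.wN])]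
  have e3 : ∀ i, (s₄.writeN 21 0 (c + 1)).nat 33 i = s₄.nat 33 i := by
    intro i
    rw [Store.writeN_nat_ne _ _ _ (by decide)]
  have g0 : ∀ i, (s₄.writeN 21 0 (c + 1)).real 10 i = s₁.real 10 i := by
    intro i
    rw [Store.writeN_real, hs₄.real 10 (by simp [Prog.wR]),
      hs₃.real 10 (by simp [Prog.wR]), hs₂.real 10 (by simp [Prog.wR])]
  have g1 : ∀ i, (s₄.writeN 21 0 (c + 1)).real 11 i = s₂.real 11 i := by
    intro i
    rw [Store.writeN_real, hs₄.real 11 (by simp [Prog.wR]), hs₃.real 11 (by simp [Prog.wR])]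
  have g2 : ∀ i, (s₄.writeN 21 0 (c + 1)).real 12 i = s₃.real 12 i := by
    intro i
    rw [Store.writeN_real, hs₄.real 12 (by simp [Prog.wR])]
  have g3 : ∀ i, (s₄.writeN 21 0 (c + 1)).real 13 i = s₄.real 13 i := fun i => rfl
  rw [hs₁.nat 19 (by simp [Prog.wN]), hs₁.real xa (by simpa [Prog.wR] using xa0)] at r1
  rw [hs₂.nat 18 (by simp [Prog.wN]), hs₁.nat 18 (by simp [Prog.wN]),
    hs₂.real ya (by simpa [Prog.wR] using ya1), hs₁.real ya (by simpa [Prog.wR] using ya0)] at b1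
  rw [hs₃.nat 17 (by simp [Prog.wN]), hs₂.nat 17 (by simp [Prog.wN]),
    hs₁.nat 17 (by simp [Prog.wN]), hs₃.real ya (by simpa [Prog.wR] using ya2),
    hs₂.real ya (by simpa [Prog.wR] using ya1), hs₁.real ya (by simpa [Prog.wR] using ya0)] at t1
  generalize s.nat 17 0 = u at *
  generalize s.nat 18 0 = d at *
  generalize s.nat 19 0 = r at *
  generalize s.nat 20 0 = l at *
  refine ⟨by simp [Store.writeN_nat], fun i hi => ?_, ?_, ?_⟩
  · apply boxAt_congr
    · rw [g0, l3 i hi]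
    · rw [g1, r3 i hi, hs₁.real 11 (by simp [Prog.wR])]
    · rw [g2, b3 i hi, hs₂.real 12 (by simp [Prog.wR]), hs₁.real 12 (by simp [Prog.wR])]
    · rw [g3, t3 i hi, hs₃.real 13 (by simp [Prog.wR]), hs₂.real 13 (by simp [Prog.wR]),
        hs₁.real 13 (by simp [Prog.wR])]
    · rw [e0, l2 i hi]
    · rw [e1, r2 i hi, hs₁.nat 31 (by simp [Prog.wN])]
    · rw [e2, b2 i hi, hs₂.nat 32 (by simp [Prog.wN]), hs₁.nat 32 (by simp [Prog.wN])]
    · rw [e3, t2 i hi, hs₃.nat 33 (by simp [Prog.wN]), hs₂.nat 33 (by simp [Prog.wN]),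
        hs₁.nat 33 (by simp [Prog.wN])]
  · simp only [boxAt, e0, e1, e2, e3]
    refine ⟨?_, ?_, ?_, ?_⟩
    · rcases l1 with l1 | l1 <;> omega
    · rcases r1 with l1 | l1 <;> omega
    · rcases b1 with l1 | l1 <;> omega
    · rcases t1 with l1 | l1 <;> omega
  · have up : ∀ z : ℝ × ℝ, (s₄.nat 33 c = 0 → z.2 < s₄.real 13 c) ↔
        ∀ i < n, Spans X (X k) i → Above Y (Y k) f i → z.2 < Y i := by
      intro z
      rcases t1 with ⟨h1, h2, h3⟩ | ⟨h1, h2⟩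
      · rw [h2, h3, h.y_eq u h1.le]
        obtain ⟨-, a2, a3⟩ := hU.resolve_left fun e => by omega
        exact ⟨fun hz i hi b1 b2 => (hz rfl).trans_le (a3 i hi ⟨b1, b2⟩),
          fun hz _ => hz u h1 a2.1 a2.2⟩
      · obtain ⟨-, a2⟩ := hU.resolve_right fun e => h1 e.1
        rw [h2]
        exact ⟨fun _ i hi b1 b2 => absurd ⟨b1, b2⟩ (a2 i hi), fun _ h => by omega⟩
    have down : ∀ z : ℝ × ℝ, (s₃.nat 32 c = 0 → s₃.real 12 c < z.2) ↔
        ∀ i < n, Spans X (X k) i → ¬ Above Y (Y k) f i → Y i < z.2 := by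
      intro z
      rcases b1 with ⟨h1, h2, h3⟩ | ⟨h1, h2⟩
      · rw [h2, h3, h.y_eq d h1.le]
        obtain ⟨-, a2, a3⟩ := hD.resolve_left fun e => by omega
        exact ⟨fun hz i hi b1 b2 => lt_of_le_of_lt (neg_le_neg_iff.1 (a3 i hi ⟨b1, b2⟩)) (hz rfl),
          fun hz _ => hz d h1 a2.1 a2.2⟩
      · obtain ⟨-, a2⟩ := hD.resolve_right fun e => h1 e.1
        rw [h2]
        exact ⟨fun _ i hi b1 b2 => absurd ⟨b1, b2⟩ (a2 i hi), fun _ h => by omega⟩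
    have right : ∀ z : ℝ × ℝ, (s₂.nat 31 c = 0 → z.1 < s₂.real 11 c) ↔
        ∀ i < n, Overlaps n X Y (X k) (Above Y (Y k) f) i → X k < X i → z.1 < X i := by
      intro z
      rcases r1 with ⟨h1, h2, h3⟩ | ⟨h1, h2⟩
      · rw [h2, h3, h.x_eq r h1.le]
        obtain ⟨-, a2, a3⟩ := hR.resolve_left fun e => by omega
        exact ⟨fun hz i hi b1 b2 => (hz rfl).trans_le (a3 i hi ⟨b1, b2⟩),
          fun hz _ => hz r h1 a2.1 a2.2⟩
      · obtain ⟨-, a2⟩ := hR.resolve_right fun e => h1 e.1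
        rw [h2]
        exact ⟨fun _ i hi b1 b2 => absurd ⟨b1, b2⟩ (a2 i hi), fun _ h => by omega⟩
    have left : ∀ z : ℝ × ℝ, (s₁.nat 30 c = 0 → s₁.real 10 c < z.1) ↔
        ∀ i < n, Overlaps n X Y (X k) (Above Y (Y k) f) i → X i ≤ X k → X i < z.1 := by
      intro z
      rcases l1 with ⟨h1, h2, h3⟩ | ⟨h1, h2⟩
      · rw [h2, h3, h.x_eq l h1.le]
        obtain ⟨-, a2, a3⟩ := hL.resolve_left fun e => by omega
        exact ⟨fun hz i hi b1 b2 =>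
          lt_of_le_of_lt (neg_le_neg_iff.1 (a3 i hi ⟨b1, not_lt.2 b2⟩)) (hz rfl),
          fun hz _ => hz l h1 a2.1 (not_lt.1 a2.2)⟩
      · obtain ⟨-, a2⟩ := hL.resolve_right fun e => h1 e.1
        rw [h2]
        exact ⟨fun _ i hi b1 b2 => absurd ⟨b1, not_lt.2 b2⟩ (a2 i hi), fun _ h => by omega⟩
    ext z
    simp only [Box.toSet, boxAt, e0, e1, e2, e3, g0, g1, g2, g3, mem_ofPred_eq, cellSet]
    rw [up, down, right, left]
    exact ⟨fun ⟨a, b, c, d⟩ => ⟨d, c, b, a⟩, fun ⟨a, b, c, d⟩ => ⟨d, c, b, a⟩⟩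

/-- Compute and store the box that starts at the vertex number `10`. -/
abbrev emitBox (xa ya j : ℕ) : Prog :=
  .seq (bestLoop 11 17 (.cell 0 (.const j)) (.and (spansTest xa) (aboveTest ya))
    (.rlt (.cell ya (nv 11)) (.cell ya (nv 17))))
  (.seq (bestLoop 11 18 (.cell 0 (.const j)) (.and (spansTest xa) (.not (aboveTest ya)))
    (.rlt (.cell ya (nv 18)) (.cell ya (nv 11))))
  (.seq (bestLoop 11 19 (.cell 0 (.const j))
    (.and (overlapTest xa ya j) (.rlt (.cell xa (nv 10)) (.cell xa (nv 11))))
    (.rlt (.cell xa (nv 11)) (.cell xa (nv 19))))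
  (.seq (bestLoop 11 20 (.cell 0 (.const j))
    (.and (overlapTest xa ya j) (.not (.rlt (.cell xa (nv 10)) (.cell xa (nv 11)))))
    (.rlt (.cell xa (nv 20)) (.cell xa (nv 11))))
  (storeBox xa ya j))))

theorem runs_emitBox {n : ℕ} {X Y : ℕ → ℝ} {xa ya j k f c : ℕ} {s : Store}
    (h : VertexAt n X Y xa ya j k s) (hf : s.nat 15 0 = f) (hcn : s.nat 21 0 = c)
    (hxa : ∀ a ∈ [10, 11, 12, 13], xa ≠ a ∧ ya ≠ a) :
    Runs (emitBox xa ya j) s (16 * n + 29) fun s' =>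
      s'.nat 21 0 = c + 1 ∧ (∀ i ≠ c, boxAt s' i = boxAt s i) ∧
      ((boxAt s' c).fl ≤ 1 ∧ (boxAt s' c).fr ≤ 1 ∧ (boxAt s' c).fb ≤ 1 ∧ (boxAt s' c).ft ≤ 1) ∧
      (boxAt s' c).toSet = cellSet n X Y k f := by
  have hk := h.lt
  -- the edge above
  refine Runs.andThen (t₁ := 4 * n + 3) (t₂ := 12 * n + 26)
    (Runs.best (n := n) (fun i => Spans X (X k) i ∧ Above Y (Y k) f i) Y (by decide)
      (fun s' hs' => ?_) (fun s' i hs' hi hin => ?_) fun s' i i' hs' hi hi' hin hin' => ?_)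
    (by omega) ?_
  · exact (h.step hs' (by simp [Prog.wN]) (by simp [Prog.wN]) rfl).n_eq
  · have h' := h.step hs' (by simp [Prog.wN]) (by simp [Prog.wN]) rfl
    rw [Test.holds_and, h'.spans hin hi,
      h'.above hin hi (by rw [hs'.nat 15 (by simp [Prog.wN]), hf])]
  · have h' := h.step hs' (by simp [Prog.wN]) (by simp [Prog.wN]) rfl
    simp only [Test.holds_rlt, RExpr.eval, NExpr.eval, hi, hi', h'.y_eq i hin.le,
      h'.y_eq i' hin'.le]
  intro s₁ hs₁ hU
  replace h := h.step hs₁ (by simp [Prog.wN]) (by simp [Prog.wN]) rfl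
  have hf₁ := (hs₁.nat 15 (by simp [Prog.wN])) ▸ hf
  -- the edge below
  refine Runs.andThen (t₁ := 4 * n + 3) (t₂ := 8 * n + 23)
    (Runs.best (n := n) (fun i => Spans X (X k) i ∧ ¬ Above Y (Y k) f i) (fun i => -Y i)
      (by decide)
      (fun s' hs' => ?_) (fun s' i hs' hi hin => ?_) fun s' i i' hs' hi hi' hin hin' => ?_)
    (by omega) ?_
  · exact (h.step hs' (by simp [Prog.wN]) (by simp [Prog.wN]) rfl).n_eq
  · have h' := h.step hs' (by simp [Prog.wN]) (by simp [Prog.wN]) rfl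
    rw [Test.holds_and, h'.spans hin hi, Test.holds_not,
      h'.above hin hi (by rw [hs'.nat 15 (by simp [Prog.wN]), hf₁])]
  · have h' := h.step hs' (by simp [Prog.wN]) (by simp [Prog.wN]) rfl
    simp only [Test.holds_rlt, RExpr.eval, NExpr.eval, hi, hi', h'.y_eq i hin.le,
      h'.y_eq i' hin'.le, neg_lt_neg_iff]
  intro s₂ hs₂ hD
  replace h := h.step hs₂ (by simp [Prog.wN]) (by simp [Prog.wN]) rfl
  rw [← hs₂.nat 17 (by simp [Prog.wN])] at hU
  -- the edge on the right
  refine Runs.andThen (t₁ := 4 * n + 3) (t₂ := 4 * n + 20)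
    (Runs.best (n := n) (fun i => Overlaps n X Y (X k) (Above Y (Y k) f) i ∧ X k < X i) X
      (by decide)
      (fun s' hs' => ?_) (fun s' i hs' hi hin => ?_) fun s' i i' hs' hi hi' hin hin' => ?_)
    (by omega) ?_
  · exact (h.step hs' (by simp [Prog.wN]) (by simp [Prog.wN]) rfl).n_eq
  · have h' := h.step hs' (by simp [Prog.wN]) (by simp [Prog.wN]) rfl
    rw [Test.holds_and, h'.overlaps hin hi (by rw [hs'.nat 17 (by simp [Prog.wN])])
      (by rw [hs'.nat 18 (by simp [Prog.wN])]) hU hD]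
    simp only [Test.holds_rlt, RExpr.eval, NExpr.eval, hi, h'.k_eq, h'.x_eq k hk.le,
      h'.x_eq i hin.le]
  · have h' := h.step hs' (by simp [Prog.wN]) (by simp [Prog.wN]) rfl
    simp only [Test.holds_rlt, RExpr.eval, NExpr.eval, hi, hi', h'.x_eq i hin.le,
      h'.x_eq i' hin'.le]
  intro s₃ hs₃ hR
  replace h := h.step hs₃ (by simp [Prog.wN]) (by simp [Prog.wN]) rfl
  rw [← hs₃.nat 17 (by simp [Prog.wN])] at hU
  rw [← hs₃.nat 18 (by simp [Prog.wN])] at hD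
  -- the edge on the left
  refine Runs.andThen (t₁ := 4 * n + 3) (t₂ := 17)
    (Runs.best (n := n) (fun i => Overlaps n X Y (X k) (Above Y (Y k) f) i ∧ ¬ X k < X i)
      (fun i => -X i) (by decide)
      (fun s' hs' => ?_) (fun s' i hs' hi hin => ?_) fun s' i i' hs' hi hi' hin hin' => ?_)
    (by omega) ?_
  · exact (h.step hs' (by simp [Prog.wN]) (by simp [Prog.wN]) rfl).n_eq
  · have h' := h.step hs' (by simp [Prog.wN]) (by simp [Prog.wN]) rfl
    rw [Test.holds_and, h'.overlaps hin hi (by rw [hs'.nat 17 (by simp [Prog.wN])])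
      (by rw [hs'.nat 18 (by simp [Prog.wN])]) hU hD]
    simp only [Test.holds_not, Test.holds_rlt, RExpr.eval, NExpr.eval, hi, h'.k_eq, h'.x_eq k hk.le,
      h'.x_eq i hin.le]
  · have h' := h.step hs' (by simp [Prog.wN]) (by simp [Prog.wN]) rfl
    simp only [Test.holds_rlt, RExpr.eval, NExpr.eval, hi, hi', h'.x_eq i hin.le,
      h'.x_eq i' hin'.le, neg_lt_neg_iff]
  intro s₄ hs₄ hL
  replace h := h.step hs₄ (by simp [Prog.wN]) (by simp [Prog.wN]) rfl
  rw [← hs₄.nat 17 (by simp [Prog.wN])] at hU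
  rw [← hs₄.nat 18 (by simp [Prog.wN])] at hD
  rw [← hs₄.nat 19 (by simp [Prog.wN])] at hR
  have hc : s₄.nat 21 0 = c := by
    rw [hs₄.nat 21 (by simp [Prog.wN]), hs₃.nat 21 (by simp [Prog.wN]),
      hs₂.nat 21 (by simp [Prog.wN]), hs₁.nat 21 (by simp [Prog.wN]), hcn]
  have hbox : ∀ i, boxAt s₄ i = boxAt s i := by
    intro i
    have hN : ∀ a, a ≠ 11 → a ≠ 17 → a ≠ 18 → a ≠ 19 → a ≠ 20 → s₄.nat a i = s.nat a i := by
      intro a h1 h2 h3 h4 h5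
      rw [hs₄.nat a (by simp [Prog.wN, *]), hs₃.nat a (by simp [Prog.wN, *]),
        hs₂.nat a (by simp [Prog.wN, *]), hs₁.nat a (by simp [Prog.wN, *])]
    have hR : ∀ a, s₄.real a i = s.real a i := by
      intro a
      rw [hs₄.real a (by simp [Prog.wR]), hs₃.real a (by simp [Prog.wR]),
        hs₂.real a (by simp [Prog.wR]), hs₁.real a (by simp [Prog.wR])]
    simp only [boxAt, hR, hN 30, hN 31, hN 32, hN 33, ne_eq, not_false_eq_true,
      Nat.reduceEqDiff]
  refine (runs_storeBox h hc hxa hU hD hR hL).mono le_rfl ?_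
  rintro s' - ⟨h1, h2, h3⟩
  exact ⟨h1, fun i hi => (h2 i hi).trans (hbox i), h3⟩

open Classical in
/-- The boxes from `c₀` to `c` are those that start at the first `k` vertices; the other ones are
as in `B₀`. -/
structure CellBoxesTo (n : ℕ) (X Y : ℕ → ℝ) (want c₀ : ℕ) (B₀ : ℕ → Box) (k : ℕ) (B : ℕ → Box)
    (c : ℕ) : Prop where
  le : c₀ ≤ c
  card : c ≤ c₀ + ((Finset.range k).filter fun v => ∃ i < n, X v < X i).card
  old : ∀ i < c₀, B i = B₀ i
  flags : ∀ i, c₀ ≤ i → i < c → (B i).fl ≤ 1 ∧ (B i).fr ≤ 1 ∧ (B i).fb ≤ 1 ∧ (B i).ft ≤ 1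
  cell : ∀ i, c₀ ≤ i → i < c → ∃ v < k, ∃ f, Emits n X Y want v f ∧
    (B i).toSet = cellSet n X Y v f
  surj : ∀ v < k, ∀ f, Emits n X Y want v f → ∃ i, c₀ ≤ i ∧ i < c ∧
    (B i).toSet = cellSet n X Y v f

namespace CellBoxesTo

variable {n : ℕ} {X Y : ℕ → ℝ} {want c₀ k c : ℕ} {B₀ B B' : ℕ → Box}

theorem zero (n : ℕ) (X Y : ℕ → ℝ) (want c₀ : ℕ) (B₀ : ℕ → Box) :
    CellBoxesTo n X Y want c₀ B₀ 0 B₀ c₀ :=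
  ⟨le_rfl, by simp, fun _ _ => rfl, fun _ _ _ => by omega, fun _ _ _ => by omega,
    fun _ h => absurd h (Nat.not_lt_zero _)⟩

theorem skip (h : CellBoxesTo n X Y want c₀ B₀ k B c) (he : ∀ f, ¬ Emits n X Y want k f) :
    CellBoxesTo n X Y want c₀ B₀ (k + 1) B c := by
  classical
  refine ⟨h.le, h.card.trans ?_, h.old, h.flags, fun i h1 h2 => ?_, fun v hv f hf => ?_⟩
  · rw [card_filter_range_succ]; omega
  · obtain ⟨v, hv, r⟩ := h.cell i h1 h2
    exact ⟨v, by omega, r⟩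
  · rcases Nat.lt_succ_iff_lt_or_eq.1 hv with hv | rfl
    · exact h.surj v hv f hf
    · exact absurd hf (he f)

theorem emit (h : CellBoxesTo n X Y want c₀ B₀ k B c) {f : ℕ} (he : Emits n X Y want k f)
    (hB : ∀ i ≠ c, B' i = B i)
    (hfl : (B' c).fl ≤ 1 ∧ (B' c).fr ≤ 1 ∧ (B' c).fb ≤ 1 ∧ (B' c).ft ≤ 1)
    (hs : (B' c).toSet = cellSet n X Y k f) :
    CellBoxesTo n X Y want c₀ B₀ (k + 1) B' (c + 1) := by
  classical
  have hle := h.le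
  refine ⟨by omega, ?_, fun i hi => ?_, fun i h1 h2 => ?_, fun i h1 h2 => ?_, fun v hv f' hf => ?_⟩
  · rw [card_filter_range_succ, if_pos he.1]
    have := h.card
    omega
  · rw [hB i (by omega), h.old i hi]
  · rcases Nat.lt_succ_iff_lt_or_eq.1 h2 with h2 | rfl
    · rw [hB i (by omega)]; exact h.flags i h1 h2
    · exact hfl
  · rcases Nat.lt_succ_iff_lt_or_eq.1 h2 with h2 | rfl
    · rw [hB i (by omega)]
      obtain ⟨v, hv, r⟩ := h.cell i h1 h2
      exact ⟨v, by omega, r⟩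
    · exact ⟨k, by omega, f, he, hs⟩
  · rcases Nat.lt_succ_iff_lt_or_eq.1 hv with hv | rfl
    · obtain ⟨i, h1, h2, h3⟩ := h.surj v hv f' hf
      exact ⟨i, h1, by omega, by rw [hB i (by omega), h3]⟩
    · have : f' = f := by
        have h1 := he.2
        have h2 := hf.2
        rcases h1 with ⟨rfl, h1⟩ | ⟨rfl, h1, -⟩ <;> rcases h2 with ⟨rfl, h2⟩ | ⟨rfl, h2, -⟩ <;>
          first | rfl | exact absurd h1 h2 | exact absurd h2 h1
      subst this
      exact ⟨c, by omega, by omega, hs⟩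

theorem cellBoxes (h : CellBoxesTo n X Y want c₀ B₀ n B c) : CellBoxes n X Y want c₀ c B :=
  ⟨h.flags, h.cell, h.surj⟩

end CellBoxesTo

/-- Compute the boxes that start at the vertices of a chain. -/
abbrev coverLoop (xa ya j want : ℕ) : Prog :=
  forLoop 10 (.cell 0 (.const j))
    (.seq (chooseFlag xa ya j want) (.ite (.neq (nv 16) (.const 1)) (emitBox xa ya j) .skip))

theorem runs_coverLoop {n : ℕ} {X Y : ℕ → ℝ} {xa ya j want c₀ : ℕ} {s : Store}
    (hn : s.nat 0 j = n) (hx : ∀ i ≤ n, s.real xa i = X i) (hy : ∀ i ≤ n, s.real ya i = Y i)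
    (hxa : ∀ a ∈ [10, 11, 12, 13], xa ≠ a ∧ ya ≠ a) (hc : s.nat 21 0 = c₀) :
    Runs (coverLoop xa ya j want) s (n * (28 * n + 52) + 2) fun s' =>
      CellBoxesTo n X Y want c₀ (boxAt s) n (boxAt s') (s'.nat 21 0) := by
  have hmem := hxa
  simp only [List.mem_cons, List.not_mem_nil, or_false, forall_eq_or_imp, forall_eq] at hmem
  obtain ⟨⟨xa0, ya0⟩, ⟨xa1, ya1⟩, ⟨xa2, ya2⟩, xa3, ya3⟩ := hmem
  have key : ∀ (s : Store) (k : ℕ), boxAt (s.writeN 10 0 k) = boxAt s := fun s k => by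
    funext i
    simp [boxAt, Store.writeN_nat, Store.writeN_real]
  refine Runs.for (fun k s' => CellBoxesTo n X Y want c₀ (boxAt s) k (boxAt s') (s'.nat 21 0))
    (by simp [Prog.wN]) (fun s₁ hs₁ => ?_) ?_ ?_
  · simp only [NExpr.eval]
    rw [hs₁.nat 0 (by simp [Prog.wN]), hn]
  · rw [key, Store.writeN_nat_ne _ _ _ (by decide), hc]
    exact CellBoxesTo.zero ..
  · intro k s₁ hk hs₁ hks hinv
    have hV : VertexAt n X Y xa ya j k s₁ := by
      refine ⟨?_, fun i hi => ?_, fun i hi => ?_, hk, hks⟩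
      · rw [hs₁.nat 0 (by simp [Prog.wN]), hn]
      · rw [hs₁.real xa (by simp [Prog.wR, *]), hx i hi]
      · rw [hs₁.real ya (by simp [Prog.wR, *]), hy i hi]
    refine Runs.andThen (runs_chooseFlag hV) (t₂ := 16 * n + 30) (by omega) ?_
    intro s₂ hs₂ hE
    have hV₂ := hV.step hs₂ (by simp [Prog.wN]) (by simp [Prog.wN]) rfl
    have hbox : boxAt s₂ = boxAt s₁ := by
      funext i
      apply boxAt_congr <;> first
        | rw [hs₂.real _ (by simp [Prog.wR])]
        | rw [hs₂.nat _ (by simp [Prog.wN])]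
    rw [← hs₂.nat 21 (by simp [Prog.wN]), ← hbox] at hinv
    refine Runs.ite (fun h => ?_) fun h => ?_
    · rw [Test.holds_neq] at h
      simp only [NExpr.eval] at h
      have hE' := (hE.resolve_right fun e => by omega).2
      refine (runs_emitBox hV₂ rfl rfl hxa).mono le_rfl ?_
      rintro s₃ - ⟨e1, e2, e3, e4⟩
      rw [key, Store.writeN_nat_ne _ _ _ (by decide), e1]
      exact hinv.emit hE' e2 e3 e4
    · rw [Test.holds_neq] at h
      simp only [NExpr.eval] at h
      have hE' := (hE.resolve_left fun e => h e.1).2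
      refine (Runs.skip ?_).mono (Nat.zero_le _) fun _ _ h => h
      rw [key, Store.writeN_nat_ne _ _ _ (by decide)]
      exact hinv.skip hE'

/-- Append the two half planes on the left and on the right of a chain to the boxes. -/
abbrev halfPlanes (xa j : ℕ) : Prog :=
  .seq (bestLoop 11 17 (.cell 0 (.const j)) (.not (.nlt (.const 0) (.const 0)))
    (.rlt (.cell xa (nv 11)) (.cell xa (nv 17))))
  (.seq (bestLoop 11 18 (.cell 0 (.const j)) (.not (.nlt (.const 0) (.const 0)))
    (.rlt (.cell xa (nv 18)) (.cell xa (nv 11))))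
  (.seq (.setR 10 (nv 21) (.cast (.const 0)))
  (.seq (.setR 11 (nv 21) (.cell xa (nv 17)))
  (.seq (.setR 12 (nv 21) (.cast (.const 0)))
  (.seq (.setR 13 (nv 21) (.cast (.const 0)))
  (.seq (.setN 30 (nv 21) (.const 1))
  (.seq (.setN 31 (nv 21) (.const 0))
  (.seq (.setN 32 (nv 21) (.const 1))
  (.seq (.setN 33 (nv 21) (.const 1))
  (.seq (incr 21)
  (.seq (.setR 10 (nv 21) (.cell xa (nv 18)))
  (.seq (.setR 11 (nv 21) (.cast (.const 0)))
  (.seq (.setR 12 (nv 21) (.cast (.const 0)))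
  (.seq (.setR 13 (nv 21) (.cast (.const 0)))
  (.seq (.setN 30 (nv 21) (.const 0))
  (.seq (.setN 31 (nv 21) (.const 1))
  (.seq (.setN 32 (nv 21) (.const 1))
  (.seq (.setN 33 (nv 21) (.const 1)) (incr 21)))))))))))))))))))

theorem runs_halfPlanes {n : ℕ} {X : ℕ → ℝ} {xa j c : ℕ} {s : Store} (h0 : 0 < n)
    (hn : s.nat 0 j = n) (hx : ∀ i ≤ n, s.real xa i = X i)
    (hxa : xa ≠ 10 ∧ xa ≠ 11 ∧ xa ≠ 12 ∧ xa ≠ 13) (hc : s.nat 21 0 = c) :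
    Runs (halfPlanes xa j) s (8 * n + 24) fun s' => s'.nat 21 0 = c + 2 ∧
      (∀ i < c, boxAt s' i = boxAt s i) ∧ ∃ lo hi,
      (∀ i < n, lo ≤ X i) ∧ (∃ i < n, lo = X i) ∧ (∀ i < n, X i ≤ hi) ∧ (∃ i < n, hi = X i) ∧
      boxAt s' c = ⟨0, lo, 0, 0, 1, 0, 1, 1⟩ ∧ boxAt s' (c + 1) = ⟨hi, 0, 0, 0, 0, 1, 1, 1⟩ := by
  have hbest : ∀ {v : ℕ → ℝ} {r : ℕ}, Best n (fun _ => True) v r → r < n ∧ ∀ i < n, v r ≤ v i := by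
    intro v r h
    obtain ⟨h1, -, h2⟩ := h.resolve_left fun e => e.2 0 h0 trivial
    exact ⟨h1, fun i hi => h2 i hi trivial⟩
  refine Runs.andThen (t₁ := 4 * n + 3) (t₂ := 4 * n + 21)
    (Runs.best (n := n) (fun _ => True) X (by decide)
      (fun s' hs' => ?_) (fun s' i hs' hi hin => ?_) fun s' i i' hs' hi hi' hin hin' => ?_)
    (by omega) ?_
  · simp only [NExpr.eval]
    rw [hs'.nat 0 (by simp [Prog.wN]), hn]
  · simp [Test.holds_not, Test.holds_nlt]
  · simp only [Test.holds_rlt, RExpr.eval, NExpr.eval, hi, hi', hs'.real xa (by simp [Prog.wR]),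
      hx i hin.le, hx i' hin'.le]
  intro s₁ hs₁ hlo
  replace hn : s₁.nat 0 j = n := by rw [hs₁.nat 0 (by simp [Prog.wN]), hn]
  replace hx : ∀ i ≤ n, s₁.real xa i = X i := fun i hi => by
    rw [hs₁.real xa (by simp [Prog.wR]), hx i hi]
  refine Runs.andThen (t₁ := 4 * n + 3) (t₂ := 18)
    (Runs.best (n := n) (fun _ => True) (fun i => -X i) (by decide)
      (fun s' hs' => ?_) (fun s' i hs' hi hin => ?_) fun s' i i' hs' hi hi' hin hin' => ?_)
    (by omega) ?_
  · simp only [NExpr.eval]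
    rw [hs'.nat 0 (by simp [Prog.wN]), hn]
  · simp [Test.holds_not, Test.holds_nlt]
  · simp only [Test.holds_rlt, RExpr.eval, NExpr.eval, hi, hi', hs'.real xa (by simp [Prog.wR]),
      hx i hin.le, hx i' hin'.le, neg_lt_neg_iff]
  intro s₂ hs₂ hhi
  rw [← hs₂.nat 17 (by simp [Prog.wN])] at hlo
  replace hx : ∀ i ≤ n, s₂.real xa i = X i := fun i hi => by
    rw [hs₂.real xa (by simp [Prog.wR]), hx i hi]
  obtain ⟨lo1, lo2⟩ := hbest hlo
  obtain ⟨hi1, hi2⟩ := hbest hhi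
  have hc₂ : s₂.nat 21 0 = c := by
    rw [hs₂.nat 21 (by simp [Prog.wN]), hs₁.nat 21 (by simp [Prog.wN]), hc]
  have hbox : ∀ i, boxAt s₂ i = boxAt s i := by
    intro i
    apply boxAt_congr <;> first
      | rw [hs₂.real _ (by simp [Prog.wR]), hs₁.real _ (by simp [Prog.wR])]
      | rw [hs₂.nat _ (by simp [Prog.wN]), hs₁.nat _ (by simp [Prog.wN])]
  obtain ⟨x0, x1, x2, x3⟩ := hxa
  refine Runs.straight rfl le_rfl ?_
  simp only [Prog.run, NExpr.eval, RExpr.eval]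
  refine ⟨?_, fun i hi => ?_, X (s₂.nat 17 0), X (s₂.nat 18 0), lo2, ⟨_, lo1, rfl⟩,
    fun i hi => neg_le_neg_iff.1 (hi2 i hi), ⟨_, hi1, rfl⟩, ?_, ?_⟩
  · simp [Store.writeN_nat, Store.writeR_nat, hc₂]
  · rw [← hbox i]
    have n1 : i ≠ c := by omega
    have n2 : i ≠ c + 1 := by omega
    simp [boxAt, Store.writeN_nat, Store.writeR_nat, Store.writeN_real, Store.writeR_real, hc₂, n1,
      n2]
  · simp [boxAt, Store.writeN_nat, Store.writeR_nat, Store.writeN_real, Store.writeR_real,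
      hx _ lo1.le, *]
  · simp [boxAt, Store.writeN_nat, Store.writeR_nat, Store.writeN_real, Store.writeR_real,
      hx _ hi1.le, *]

/-- Compute boxes for the inside of the first polygon, with numbers below the value in array `22`,
and boxes for the outside of the second polygon, from there on up to the value in array `23`. -/
abbrev allBoxes : Prog :=
  .seq (.setR 0 (.cell 0 (.const 0)) (.cell 0 (.const 0)))
  (.seq (.setR 1 (.cell 0 (.const 0)) (.cell 1 (.const 0)))
  (.seq (.setR 2 (.cell 0 (.const 1)) (.cell 2 (.const 0)))
  (.seq (.setR 3 (.cell 0 (.const 1)) (.cell 3 (.const 0)))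
  (.seq (coverLoop 0 1 0 1)
  (.seq (.setN 22 (.const 0) (nv 21))
  (.seq (coverLoop 2 3 1 0)
  (.seq (halfPlanes 2 1) (.setN 23 (.const 0) (nv 21)))))))))

/-- The stored boxes describe the inside of `P` and the outside of `Q`. -/
structure BoxesOf {p q : ℕ} (P : OrthogonalPolygon p) (Q : OrthogonalPolygon q) (s : Store) :
    Prop where
  p_eq : s.nat 0 0 = p
  q_eq : s.nat 0 1 = q
  card_le : s.nat 22 0 + 2 ≤ p
  le : s.nat 22 0 ≤ s.nat 23 0
  card_le' : s.nat 23 0 ≤ s.nat 22 0 + q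
  inside : BoxCover P.region 0 (s.nat 22 0) (boxAt s)
  finite : ∀ k < s.nat 22 0, (boxAt s k).Finite
  outside : BoxCover Q.regionᶜ (s.nat 22 0) (s.nat 23 0) (boxAt s)
  left : ∃ k, s.nat 22 0 ≤ k ∧ k < s.nat 23 0 ∧ (boxAt s k).fl = 1

theorem BoxCover.congr {S : Set (ℝ × ℝ)} {c₀ c₁ : ℕ} {B B' : ℕ → Box} (h : BoxCover S c₀ c₁ B)
    (hB : ∀ k, c₀ ≤ k → k < c₁ → B' k = B k) : BoxCover S c₀ c₁ B' := by
  refine ⟨fun k h1 h2 => by rw [hB k h1 h2]; exact h.proper k h1 h2,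
    fun k h1 h2 => by rw [hB k h1 h2]; exact h.sub k h1 h2, h.dense.trans (closure_mono ?_)⟩
  refine iUnion₂_mono fun k hk => ?_
  rw [hB k hk.1 hk.2]

theorem runs_allBoxes {p q : ℕ} (P : OrthogonalPolygon p) (Q : OrthogonalPolygon q) :
    Runs allBoxes (encodePolygons P Q) (p * (28 * p + 52) + q * (28 * q + 60) + 34)
      (BoxesOf P Q) := by
  classical
  have hp := P.three_le
  have hq := Q.three_le
  -- Copying the first vertex to the index `n` of each coordinate array turns the input into the
  -- closed coordinate sequences of the chain.
  have hwrap : ∀ {n : ℕ} (f : Fin n → ℝ) (i : ℕ), i ≤ n →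
      (if i = n then cellOf f 0 else cellOf f i) = closeUp f i := by
    intro n f i hi
    unfold closeUp
    rcases hi.eq_or_lt with rfl | hi
    · simp
    · simp [hi, hi.ne]
  refine Runs.andThen (t₁ := 1) (t₂ := p * (28 * p + 52) + q * (28 * q + 60) + 33)
    (R := fun s => ∀ i ≤ p, s.real 0 i = P.xs i) (Runs.straight rfl le_rfl fun i hi => ?_)
    (by omega) ?_
  · rw [OrthogonalPolygon.xs, ← hwrap _ i hi]
    simp [Prog.run, NExpr.eval, RExpr.eval, Store.writeR_real, encodePolygons]
  intro s₁ hs₁ hX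
  refine Runs.andThen (t₁ := 1) (t₂ := p * (28 * p + 52) + q * (28 * q + 60) + 32)
    (R := fun s => ∀ i ≤ p, s.real 1 i = P.ys i) (Runs.straight rfl le_rfl fun i hi => ?_)
    (by omega) ?_
  · rw [OrthogonalPolygon.ys, ← hwrap _ i hi]
    simp [Prog.run, NExpr.eval, RExpr.eval, Store.writeR_real, encodePolygons, hs₁.nat 0,
      hs₁.real 1, Prog.wN, Prog.wR]
  intro s₂ hs₂ hY
  replace hX : ∀ i ≤ p, s₂.real 0 i = P.xs i := by rw [hs₂.real 0 (by simp [Prog.wR])]; exact hX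
  refine Runs.andThen (t₁ := 1) (t₂ := p * (28 * p + 52) + q * (28 * q + 60) + 31)
    (R := fun s => ∀ i ≤ q, s.real 2 i = Q.xs i) (Runs.straight rfl le_rfl fun i hi => ?_)
    (by omega) ?_
  · rw [OrthogonalPolygon.xs, ← hwrap _ i hi]
    simp [Prog.run, NExpr.eval, RExpr.eval, Store.writeR_real, encodePolygons, hs₁.nat 0,
      hs₁.real 2, hs₂.nat 0, hs₂.real 2, Prog.wN, Prog.wR]
  intro s₃ hs₃ hX'
  replace hX : ∀ i ≤ p, s₃.real 0 i = P.xs i := by rw [hs₃.real 0 (by simp [Prog.wR])]; exact hX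
  replace hY : ∀ i ≤ p, s₃.real 1 i = P.ys i := by rw [hs₃.real 1 (by simp [Prog.wR])]; exact hY
  refine Runs.andThen (t₁ := 1) (t₂ := p * (28 * p + 52) + q * (28 * q + 60) + 30)
    (R := fun s => ∀ i ≤ q, s.real 3 i = Q.ys i) (Runs.straight rfl le_rfl fun i hi => ?_)
    (by omega) ?_
  · rw [OrthogonalPolygon.ys, ← hwrap _ i hi]
    simp [Prog.run, NExpr.eval, RExpr.eval, Store.writeR_real, encodePolygons, hs₁.nat 0,
      hs₁.real 3, hs₂.nat 0, hs₂.real 3, hs₃.nat 0, hs₃.real 3, Prog.wN, Prog.wR]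
  intro s₄ hs₄ hY'
  replace hX : ∀ i ≤ p, s₄.real 0 i = P.xs i := by rw [hs₄.real 0 (by simp [Prog.wR])]; exact hX
  replace hY : ∀ i ≤ p, s₄.real 1 i = P.ys i := by rw [hs₄.real 1 (by simp [Prog.wR])]; exact hY
  replace hX' : ∀ i ≤ q, s₄.real 2 i = Q.xs i := by
    rw [hs₄.real 2 (by simp [Prog.wR])]; exact hX'
  have hnat : ∀ a, s₄.nat a = (encodePolygons P Q).nat a := fun a => by
    rw [hs₄.nat a (by simp [Prog.wN]), hs₃.nat a (by simp [Prog.wN]),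
      hs₂.nat a (by simp [Prog.wN]), hs₁.nat a (by simp [Prog.wN])]
  have hpe : s₄.nat 0 0 = p := by rw [hnat]; rfl
  have hqe : s₄.nat 0 1 = q := by rw [hnat]; rfl
  clear hs₁ hs₂ hs₃ hs₄
  refine Runs.andThen (t₂ := q * (28 * q + 60) + 28)
    (runs_coverLoop (c₀ := 0) hpe hX hY (by decide) (by rw [hnat]; rfl)) (by omega) ?_
  intro s₅ hs₅ hP
  refine Runs.andThen (t₁ := 1) (t₂ := q * (28 * q + 60) + 27)
    (R := fun s => s.nat 22 0 = s₅.nat 21 0)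
    (Runs.straight rfl le_rfl (by simp [Prog.run, NExpr.eval, Store.writeN_nat])) (by omega) ?_
  intro s₆ hs₆ ha
  have hb₆ : boxAt s₆ = boxAt s₅ := by
    funext i
    apply boxAt_congr <;> first
      | rw [hs₆.real _ (by simp [Prog.wR])]
      | rw [hs₆.nat _ (by simp [Prog.wN])]
  rw [← hb₆, ← ha] at hP
  have hpe₆ : s₆.nat 0 0 = p := by
    rw [hs₆.nat 0 (by simp [Prog.wN]), hs₅.nat 0 (by simp [Prog.wN]), hpe]
  have hqe₆ : s₆.nat 0 1 = q := by
    rw [hs₆.nat 0 (by simp [Prog.wN]), hs₅.nat 0 (by simp [Prog.wN]), hqe]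
  have hc₆ : s₆.nat 21 0 = s₆.nat 22 0 := by rw [ha, hs₆.nat 21 (by simp [Prog.wN])]
  replace hX' : ∀ i ≤ q, s₆.real 2 i = Q.xs i := by
    rw [hs₆.real 2 (by simp [Prog.wR]), hs₅.real 2 (by simp [Prog.wR])]; exact hX'
  replace hY' : ∀ i ≤ q, s₆.real 3 i = Q.ys i := by
    rw [hs₆.real 3 (by simp [Prog.wR]), hs₅.real 3 (by simp [Prog.wR])]; exact hY'
  clear hs₅ hs₆ hb₆
  refine Runs.andThen (t₂ := 8 * q + 25)
    (runs_coverLoop (want := 0) hqe₆ hX' hY' (by decide) hc₆)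
    (by rw [Nat.mul_add, Nat.mul_add]; omega) ?_
  intro s₇ hs₇ hQ
  have ha₇ := hs₇.nat 22 (by simp [Prog.wN])
  refine Runs.andThen (t₁ := 8 * q + 24) (t₂ := 1)
    (runs_halfPlanes (n := q) (X := Q.xs) (by omega)
      (by rw [hs₇.nat 0 (by simp [Prog.wN]), hqe₆])
      (by rw [hs₇.real 2 (by simp [Prog.wR])]; exact hX') (by decide) rfl) (by omega) ?_
  rintro s₈ hs₈ ⟨hc₈, hb₈, lo, hi, l1, l2, u1, u2, B1, B2⟩
  have ha₈ := hs₈.nat 22 (by simp [Prog.wN])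
  refine Runs.straight rfl le_rfl ?_
  have hrun : (Prog.setN 23 (.const 0) (nv 21)).run s₈ = s₈.writeN 23 0 (s₇.nat 21 0 + 2) := by
    simp [Prog.run, NExpr.eval, hc₈]
  rw [hrun]
  have hbox : boxAt (s₈.writeN 23 0 (s₇.nat 21 0 + 2)) = boxAt s₈ := by
    funext i; simp [boxAt, Store.writeN_nat, Store.writeN_real]
  have e22 : (s₈.writeN 23 0 (s₇.nat 21 0 + 2)).nat 22 0 = s₆.nat 22 0 := by
    rw [Store.writeN_nat_ne _ _ _ (by decide), ha₈, ha₇]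
  have e23 : (s₈.writeN 23 0 (s₇.nat 21 0 + 2)).nat 23 0 = s₇.nat 21 0 + 2 := by
    simp [Store.writeN_nat]
  have e0 : ∀ i, (s₈.writeN 23 0 (s₇.nat 21 0 + 2)).nat 0 i = s₆.nat 0 i := by
    intro i
    rw [Store.writeN_nat_ne _ _ _ (by decide), hs₈.nat 0 (by simp [Prog.wN]),
      hs₇.nat 0 (by simp [Prog.wN])]
  have hP' := P.chain.inside_boxes hP.cellBoxes
  have hcardP := P.chain.card_right
  have hcardQ := Q.chain.card_right
  have c1 := hP.card
  have c2 := hQ.card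
  have c3 := hQ.le
  have hQ' : CellBoxes q Q.xs Q.ys 0 (s₆.nat 22 0) (s₇.nat 21 0) (boxAt s₈) := by
    have h := hQ.cellBoxes
    refine ⟨fun k h1 h2 => by rw [hb₈ k h2]; exact h.flags k h1 h2,
      fun k h1 h2 => by rw [hb₈ k h2]; exact h.cell k h1 h2, fun v hv f hf => ?_⟩
    obtain ⟨k, h1, h2, h3⟩ := h.surj v hv f hf
    exact ⟨k, h1, h2, by rw [hb₈ k h2, h3]⟩
  have hold : ∀ k < s₆.nat 22 0, boxAt s₈ k = boxAt s₆ k := fun k hk => by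
    rw [hb₈ k (by omega), hQ.old k hk]
  constructor
  · rw [e0, hpe₆]
  · rw [e0, hqe₆]
  · rw [e22]; omega
  · rw [e22, e23]; omega
  · rw [e22, e23]; omega
  · rw [e22, hbox, P.region_eq]
    exact hP'.1.congr fun k _ hk => hold k hk
  · rw [e22, hbox]
    exact fun k hk => by rw [hold k hk]; exact hP'.2 k (Nat.zero_le k) hk
  · rw [e22, e23, hbox, Q.region_eq]
    exact Q.chain.outside_boxes hQ' c3 l1 l2 u1 u2 B1 B2
  · rw [e22, e23, hbox]
    exact ⟨s₇.nat 21 0, c3, by omega, by rw [B1]⟩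

/-! ### Lines from boxes -/

/-- Store the four lines of the rectangle for the boxes number `42` and number `43` counted from
the value in array `22`.  Arrays `40` and `41` hold the numbers of rectangles and of lines; the real
arrays `20`-`22` hold the data of the lines, array `44` their classes, and array `45` the first
line of the same rectangle. -/
abbrev storeLines : Prog :=
  .seq (.setR 20 (nv 41) (.cell 11 (nv 42)))
  (.seq (.setR 21 (nv 41) (.cell 10 (.add (nv 22) (nv 43))))
  (.seq (.setR 22 (nv 41) (.cast (.add (nv 41) (.const 1))))
  (.seq (.setN 44 (nv 41) (.sub (.const 1) (.cell 30 (.add (nv 22) (nv 43)))))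
  (.seq (.setN 45 (nv 41) (nv 41))
  (.seq (.setR 20 (.add (nv 41) (.const 1)) (.cell 10 (nv 42)))
  (.seq (.setR 21 (.add (nv 41) (.const 1)) (.cell 11 (.add (nv 22) (nv 43))))
  (.seq (.setR 22 (.add (nv 41) (.const 1))
    (.sub (.cast (.const 0)) (.cast (.add (nv 41) (.const 2)))))
  (.seq (.setN 44 (.add (nv 41) (.const 1)) (.add (.const 1) (.cell 31 (.add (nv 22) (nv 43)))))
  (.seq (.setN 45 (.add (nv 41) (.const 1)) (nv 41))
  (.seq (.setR 20 (.add (nv 41) (.const 2)) (.cell 13 (nv 42)))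
  (.seq (.setR 21 (.add (nv 41) (.const 2)) (.cell 12 (.add (nv 22) (nv 43))))
  (.seq (.setR 22 (.add (nv 41) (.const 2)) (.cast (.add (nv 41) (.const 3))))
  (.seq (.setN 44 (.add (nv 41) (.const 2)) (.sub (.const 4) (.cell 32 (.add (nv 22) (nv 43)))))
  (.seq (.setN 45 (.add (nv 41) (.const 2)) (nv 41))
  (.seq (.setR 20 (.add (nv 41) (.const 3)) (.cell 12 (nv 42)))
  (.seq (.setR 21 (.add (nv 41) (.const 3)) (.cell 13 (.add (nv 22) (nv 43))))
  (.seq (.setR 22 (.add (nv 41) (.const 3))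
    (.sub (.cast (.const 0)) (.cast (.add (nv 41) (.const 4)))))
  (.seq (.setN 44 (.add (nv 41) (.const 3)) (.add (.const 4) (.cell 33 (.add (nv 22) (nv 43)))))
  (.seq (.setN 45 (.add (nv 41) (.const 3)) (nv 41))
  (.seq (.setN 41 (.const 0) (.add (nv 41) (.const 4))) (incr 40)))))))))))))))))))))

/-- The lines of the rectangle `r` are those for the boxes `B` and `C`. -/
structure LinesFor (s : Store) (r : ℕ) (B C : Box) : Prop where
  a0 : s.real 20 (4 * r) = B.r
  a1 : s.real 20 (4 * r + 1) = B.l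
  a2 : s.real 20 (4 * r + 2) = B.t
  a3 : s.real 20 (4 * r + 3) = B.b
  b0 : s.real 21 (4 * r) = C.l
  b1 : s.real 21 (4 * r + 1) = C.r
  b2 : s.real 21 (4 * r + 2) = C.b
  b3 : s.real 21 (4 * r + 3) = C.t
  c0 : s.real 22 (4 * r) = (4 * r + 1 : ℕ)
  c1 : s.real 22 (4 * r + 1) = -(4 * r + 2 : ℕ)
  c2 : s.real 22 (4 * r + 2) = (4 * r + 3 : ℕ)
  c3 : s.real 22 (4 * r + 3) = -(4 * r + 4 : ℕ)
  k0 : s.nat 44 (4 * r) = 1 - C.fl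
  k1 : s.nat 44 (4 * r + 1) = 1 + C.fr
  k2 : s.nat 44 (4 * r + 2) = 4 - C.fb
  k3 : s.nat 44 (4 * r + 3) = 4 + C.ft
  base : ∀ i < 4, s.nat 45 (4 * r + i) = 4 * r

theorem LinesFor.congr {s s' : Store} {r : ℕ} {B C : Box} (h : LinesFor s r B C)
    (h20 : ∀ z < 4 * r + 4, s'.real 20 z = s.real 20 z)
    (h21 : ∀ z < 4 * r + 4, s'.real 21 z = s.real 21 z)
    (h22 : ∀ z < 4 * r + 4, s'.real 22 z = s.real 22 z)
    (h44 : ∀ z < 4 * r + 4, s'.nat 44 z = s.nat 44 z)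
    (h45 : ∀ z < 4 * r + 4, s'.nat 45 z = s.nat 45 z) : LinesFor s' r B C where
  a0 := by rw [h20 _ (by omega), h.a0]
  a1 := by rw [h20 _ (by omega), h.a1]
  a2 := by rw [h20 _ (by omega), h.a2]
  a3 := by rw [h20 _ (by omega), h.a3]
  b0 := by rw [h21 _ (by omega), h.b0]
  b1 := by rw [h21 _ (by omega), h.b1]
  b2 := by rw [h21 _ (by omega), h.b2]
  b3 := by rw [h21 _ (by omega), h.b3]
  c0 := by rw [h22 _ (by omega), h.c0]
  c1 := by rw [h22 _ (by omega), h.c1]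
  c2 := by rw [h22 _ (by omega), h.c2]
  c3 := by rw [h22 _ (by omega), h.c3]
  k0 := by rw [h44 _ (by omega), h.k0]
  k1 := by rw [h44 _ (by omega), h.k1]
  k2 := by rw [h44 _ (by omega), h.k2]
  k3 := by rw [h44 _ (by omega), h.k3]
  base := fun i hi => by rw [h45 _ (by omega), h.base i hi]

theorem runs_storeLines {i j a r : ℕ} {s : Store} (hi : s.nat 42 0 = i) (hj : s.nat 43 0 = j)
    (ha : s.nat 22 0 = a) (hr : s.nat 40 0 = r) (hz : s.nat 41 0 = 4 * r) :
    Runs storeLines s 22 fun s' => s'.nat 40 0 = r + 1 ∧ s'.nat 41 0 = 4 * (r + 1) ∧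
      LinesFor s' r (boxAt s i) (boxAt s (a + j)) ∧
      ∀ z < 4 * r, s'.real 20 z = s.real 20 z ∧ s'.real 21 z = s.real 21 z ∧
        s'.real 22 z = s.real 22 z ∧ s'.nat 44 z = s.nat 44 z ∧ s'.nat 45 z = s.nat 45 z := by
  refine Runs.straight rfl le_rfl ?_
  have e : ∀ d e : ℕ, 4 * r + d = 4 * r + e ↔ d = e := fun d e => by omega
  refine ⟨?_, ?_, ?_, fun z hz' => ?_⟩
  · simp [Prog.run, NExpr.eval, Store.writeN_nat, Store.writeR_nat, hr]
  · simp [Prog.run, NExpr.eval, Store.writeN_nat, Store.writeR_nat, hz]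
    ring
  · constructor
    all_goals first
      | (simp [Prog.run, NExpr.eval, RExpr.eval, Store.writeN_nat, Store.writeR_nat,
          Store.writeN_real, Store.writeR_real, hi, hj, ha, hz, boxAt]; done)
      | skip
    intro d hd
    interval_cases d <;>
      simp [Prog.run, NExpr.eval, RExpr.eval, Store.writeN_nat, Store.writeR_nat,
          Store.writeN_real, Store.writeR_real, hj, ha, hz]
  · have n0 : z ≠ 4 * r := by omega
    have n1 : z ≠ 4 * r + 1 := by omega
    have n2 : z ≠ 4 * r + 2 := by omega
    have n3 : z ≠ 4 * r + 3 := by omega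
    simp [Prog.run, NExpr.eval, RExpr.eval, Store.writeN_nat, Store.writeR_nat,
      Store.writeN_real, Store.writeR_real, hz, n0, n1, n2, n3]

/-- Store the lines for all pairs of a box of the inside and a box of the outside. -/
abbrev allLines : Prog := forLoop 42 (nv 22) (forLoop 43 (.sub (nv 23) (nv 22)) storeLines)

theorem LinesFor.writeN {s : Store} {r a i v : ℕ} {B C : Box} (h : LinesFor s r B C)
    (h44 : a ≠ 44) (h45 : a ≠ 45) : LinesFor (s.writeN a i v) r B C :=
  h.congr (fun _ _ => rfl) (fun _ _ => rfl) (fun _ _ => rfl)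
    (fun _ _ => by rw [Store.writeN_nat_ne _ _ _ h44.symm])
    (fun _ _ => by rw [Store.writeN_nat_ne _ _ _ h45.symm])

/-- Rectangle `r = i * b + j` belongs to the inside box `i` and the outside box `a + j`; quotient
and remainder recover the pair. -/
theorem runs_allLines {a b : ℕ} {s : Store} (ha : s.nat 22 0 = a) (hb : s.nat 23 0 = a + b)
    (h40 : s.nat 40 0 = 0) (h41 : s.nat 41 0 = 0) :
    Runs allLines s (a * (24 * b + 4) + 2) fun s' =>
      s'.nat 40 0 = a * b ∧ s'.nat 41 0 = 4 * (a * b) ∧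
      ∀ r < a * b, LinesFor s' r (boxAt s (r / b)) (boxAt s (a + r % b)) := by
  have hbox : ∀ {s₁ s₂ : Store}, SameOff allLines s₁ s₂ → ∀ i, boxAt s₂ i = boxAt s₁ i := by
    intro s₁ s₂ h i
    apply boxAt_congr <;> first
      | rw [h.real _ (by simp [Prog.wR])]
      | rw [h.nat _ (by simp [Prog.wN])]
  have hin : ∀ {s₁ s₂ : Store}, SameOff (forLoop 43 (.sub (nv 23) (nv 22)) storeLines) s₁ s₂ →
      SameOff allLines s₁ s₂ := fun h => h.mono (by simp [Prog.wN]) (by simp [Prog.wR])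
  refine (Runs.for (n := a) (tA := b * 24 + 2)
    (fun i s' => s'.nat 40 0 = i * b ∧ s'.nat 41 0 = 4 * (i * b) ∧
      ∀ r < i * b, LinesFor s' r (boxAt s (r / b)) (boxAt s (a + r % b)))
    (by simp [Prog.wN]) (fun s₁ hs₁ => ?_) ?_ ?_).mono (by rw [Nat.mul_comm b]) fun _ _ h => h
  · simp only [NExpr.eval]
    rw [hs₁.nat 22 (by simp [Prog.wN]), ha]
  · simp [Store.writeN_nat, h40, h41]
  · intro i s₁ hi hs₁ hci ⟨i1, i2, i3⟩
    refine (Runs.for (n := b) (tA := 22)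
      (fun j s' => s'.nat 40 0 = i * b + j ∧ s'.nat 41 0 = 4 * (i * b + j) ∧
        ∀ r < i * b + j, LinesFor s' r (boxAt s (r / b)) (boxAt s (a + r % b)))
      (by simp [Prog.wN]) (fun s₂ hs₂ => ?_) ?_ ?_).mono le_rfl ?_
    · simp only [NExpr.eval]
      rw [hs₂.nat 22 (by simp [Prog.wN]), hs₁.nat 22 (by simp [Prog.wN]), ha,
        hs₂.nat 23 (by simp [Prog.wN]), hs₁.nat 23 (by simp [Prog.wN]), hb]
      omega
    · refine ⟨by simp [Store.writeN_nat, i1], by simp [Store.writeN_nat, i2], fun r hr => ?_⟩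
      exact (i3 r (by omega)).writeN (by decide) (by decide)
    · intro j s₂ hj hs₂ hcj ⟨j1, j2, j3⟩
      have hall := hs₁.trans (hin hs₂)
      have h42 : s₂.nat 42 0 = i := by rw [hs₂.nat 42 (by simp [Prog.wN]), hci]
      refine (runs_storeLines h42 hcj (by rw [hall.nat 22 (by simp [Prog.wN]), ha]) j1 j2).mono
        le_rfl ?_
      rintro s₃ - ⟨k1, k2, k3, k4⟩
      rw [hbox hall, hbox hall] at k3
      refine ⟨by simp [Store.writeN_nat, k1, Nat.add_assoc],
        by simp [Store.writeN_nat, k2, Nat.add_assoc], fun r hr => ?_⟩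
      refine LinesFor.writeN ?_ (by decide) (by decide)
      rcases Nat.lt_succ_iff_lt_or_eq.1 (show r < i * b + j + 1 by omega) with hr | rfl
      · refine (j3 r hr).congr ?_ ?_ ?_ ?_ ?_
        · exact fun z hz => (k4 z (by omega)).1
        · exact fun z hz => (k4 z (by omega)).2.1
        · exact fun z hz => (k4 z (by omega)).2.2.1
        · exact fun z hz => (k4 z (by omega)).2.2.2.1
        · exact fun z hz => (k4 z (by omega)).2.2.2.2
      · have hb0 : 0 < b := by omega
        have d1 : (i * b + j) / b = i := by
          rw [Nat.mul_comm, Nat.mul_add_div hb0, Nat.div_eq_of_lt hj, Nat.add_zero]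
        have d2 : (i * b + j) % b = j := by
          rw [Nat.mul_comm, Nat.mul_add_mod, Nat.mod_eq_of_lt hj]
        rw [d1, d2]
        exact k3
    · rintro s₃ - ⟨k1, k2, k3⟩
      refine ⟨by simp [Store.writeN_nat, k1, Nat.add_mul], by simp [Store.writeN_nat, k2,
        Nat.add_mul], fun r hr => ?_⟩
      exact (k3 r (by rwa [Nat.add_mul, one_mul] at hr)).writeN (by decide) (by decide)

/-! ### Bounds for the feasible scaling factors -/

theorem Chain.isBounded_region {n : ℕ} {X Y : ℕ → ℝ} (h : Chain n X Y) :
    Bornology.IsBounded (chainRegion n X Y) := by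
  obtain ⟨M, hM⟩ := bounds X n
  obtain ⟨N, hN⟩ := bounds Y n
  refine ((Metric.isBounded_Icc (-M) M).prod (Metric.isBounded_Icc (-N) N)).subset ?_
  rintro z (⟨i, hi, h1, h2⟩ | hz)
  · obtain ⟨a1, a2⟩ := hM i hi.le
    obtain ⟨a3, a4⟩ := hM (i + 1) hi
    obtain ⟨b1, b2⟩ := hN i hi.le
    obtain ⟨b3, b4⟩ := hN (i + 1) hi
    rw [mem_uIcc] at h1 h2
    refine ⟨⟨?_, ?_⟩, ?_, ?_⟩
    · rcases h1 with h1 | h1 <;> linarith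
    · rcases h1 with h1 | h1 <;> linarith
    · rcases h2 with h1 | h1 <;> linarith
    · rcases h2 with h1 | h1 <;> linarith
  · by_contra hc
    refine h.not_odd_far ?_ hz
    simp only [mem_prod, mem_Icc, not_and_or, not_le] at hc
    rcases hc with (hc | hc) | hc | hc
    · exact Or.inl fun i hi => by linarith [(hM i hi).1]
    · exact Or.inr (Or.inl fun i hi => by linarith [(hM i hi).2])
    · exact Or.inr (Or.inr (Or.inl fun i hi => by linarith [(hN i hi).1]))
    · exact Or.inr (Or.inr (Or.inr fun i hi => by linarith [(hN i hi).2]))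

/-- Two different points of `P` would be placed further apart than the norm bound for `Q` permits.
-/
theorem exists_fits_le {p q : ℕ} (P : OrthogonalPolygon p) (Q : OrthogonalPolygon q) :
    ∃ M, ∀ lam > M, ¬ Fits P Q lam := by
  obtain ⟨R, hR⟩ := (Q.region_eq ▸ Q.chain.isBounded_region).exists_norm_le
  have h3 := P.three_le
  have h0 : 0 < p := by omega
  have hu : (P.xs 0, P.ys 0) ∈ P.region := by
    rw [P.region_eq]; exact Or.inl ⟨0, h0, left_mem_uIcc, left_mem_uIcc⟩
  have hw : (P.xs 1, P.ys 1) ∈ P.region := by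
    rw [P.region_eq]; exact Or.inl ⟨0, h0, right_mem_uIcc, right_mem_uIcc⟩
  have hne : (P.xs 0, P.ys 0) ≠ (P.xs 1, P.ys 1) := fun e =>
    P.chain.nondeg 0 h0 ⟨(Prod.ext_iff.1 e).1, (Prod.ext_iff.1 e).2⟩
  generalize (P.xs 0, P.ys 0) = u at *
  generalize (P.xs 1, P.ys 1) = w at *
  have hd : 0 < ‖u - w‖ := norm_pos_iff.2 (sub_ne_zero.2 hne)
  refine ⟨max 0 (2 * R / ‖u - w‖), fun lam hl ⟨τ, hτ⟩ => ?_⟩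
  have hl0 : 0 < lam := lt_of_le_of_lt (le_max_left _ _) hl
  have hl1 : 2 * R / ‖u - w‖ < lam := lt_of_le_of_lt (le_max_right _ _) hl
  rw [div_lt_iff₀ hd] at hl1
  have e : lam • (u - w) = (lam • u + τ) - (lam • w + τ) := by rw [smul_sub]; abel
  have := norm_sub_le (lam • u + τ) (lam • w + τ)
  rw [← e, norm_smul, Real.norm_of_nonneg hl0.le] at this
  linarith [hR _ (hτ u hu), hR _ (hτ w hw)]

theorem exists_fits {p q : ℕ} (P : OrthogonalPolygon p) (Q : OrthogonalPolygon q) :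
    ∃ lam, 0 < lam ∧ Fits P Q lam := by
  obtain ⟨lam, h, τ, hτ⟩ := Q.chain.exists_fits (P.region_eq ▸ P.chain.isBounded_region)
  exact ⟨lam, h, τ, fun z hz => by rw [Q.region_eq]; exact hτ z hz⟩

/-- The lines that are stored, with a sequence of pairs. -/
def kinOf (s : Store) (ev : ℕ → ℕ × ℕ) : Kin :=
  ⟨s.nat 41 0, s.nat 44, s.real 20, s.real 21, s.real 22, ev⟩

/-- The stored lines are those for the boxes that describe `P` and `Q`. -/
structure LinesOf {p q : ℕ} (P : OrthogonalPolygon p) (Q : OrthogonalPolygon q) (m : ℕ)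
    (s : Store) : Prop where
  m_le : m + 6 ≤ p * q
  L_eq : s.nat 41 0 = 4 * m
  m_eq : s.nat 40 0 = m
  c_eq : ∀ z < s.nat 41 0, s.real 22 z = (z + 1 : ℕ) ∨ s.real 22 z = -(z + 1 : ℕ)
  base : ∀ z < s.nat 41 0, s.nat 45 z = 4 * (z / 4)
  boxed : ∀ ev, (kinOf s ev).Boxed m
  free : ∀ ev lam, 0 < lam → ((kinOf s ev).Free m lam ↔ Fits P Q lam)

theorem Box.Proper.lt {B : Box} (h : B.Proper) (hl : B.fl = 0) (hr : B.fr = 0) : B.l < B.r := by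
  obtain ⟨z, h1, h2, -, -⟩ := h.nonempty
  exact (h1 hl).trans (h2 hr)

theorem Box.Proper.lt' {B : Box} (h : B.Proper) (hb : B.fb = 0) (ht : B.ft = 0) : B.b < B.t := by
  obtain ⟨z, -, -, h1, h2⟩ := h.nonempty
  exact (h1 hb).trans (h2 ht)

/-- Translates the geometry into moving lines: a rectangle contains `τ` exactly if its two boxes
meet under the placement, and the flags of the outside box determine the classes of the four sides.
-/
theorem BoxesOf.linesOf {p q a b : ℕ} {P : OrthogonalPolygon p} {Q : OrthogonalPolygon q}
    {s₀ s : Store} (h : BoxesOf P Q s₀) (ha : s₀.nat 22 0 = a) (hb : s₀.nat 23 0 = a + b)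
    (h40 : s.nat 40 0 = a * b) (h41 : s.nat 41 0 = 4 * (a * b))
    (hL : ∀ r < a * b, LinesFor s r (boxAt s₀ (r / b)) (boxAt s₀ (a + r % b))) :
    LinesOf P Q (a * b) s := by
  have hbox : ∀ r < a * b, r / b < a ∧ r % b < b := fun r hr => by
    have hb0 : 0 < b := Nat.pos_of_ne_zero fun e => by simp [e] at hr
    exact ⟨Nat.div_lt_of_lt_mul (by rwa [Nat.mul_comm]), Nat.mod_lt _ hb0⟩
  have hin : ∀ r < a * b, (boxAt s₀ (r / b)).Finite ∧ (boxAt s₀ (r / b)).Proper := fun r hr =>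
    ⟨h.finite _ (by rw [ha]; exact (hbox r hr).1),
      h.inside.proper _ (Nat.zero_le _) (by rw [ha]; exact (hbox r hr).1)⟩
  have hout : ∀ r < a * b, (boxAt s₀ (a + r % b)).Proper := fun r hr =>
    h.outside.proper _ (by omega) (by have := (hbox r hr).2; omega)
  have hpair : ∀ i < a, ∀ j < b, i * b + j < a * b ∧ (i * b + j) / b = i ∧
      (i * b + j) % b = j := fun i hi j hj => by
    have hb0 : 0 < b := by omega
    refine ⟨?_, ?_, ?_⟩
    · calc i * b + j < i * b + b := by omega
        _ = (i + 1) * b := by ring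
        _ ≤ a * b := Nat.mul_le_mul_right b hi
    · rw [Nat.mul_comm, Nat.mul_add_div hb0, Nat.div_eq_of_lt hj, Nat.add_zero]
    · rw [Nat.mul_comm, Nat.mul_add_mod, Nat.mod_eq_of_lt hj]
  have hcases : ∀ z < s.nat 41 0, ∃ r < a * b, z = 4 * r ∨ z = 4 * r + 1 ∨ z = 4 * r + 2 ∨
      z = 4 * r + 3 := fun z hz => ⟨z / 4, by omega, by omega⟩
  refine ⟨?_, h41, h40, fun z hz => ?_, fun z hz => ?_, fun ev => ?_, fun ev lam hl => ?_⟩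
  -- Here `a ≤ p - 2` and `b ≤ q`, so `2 * q ≥ 6` rectangles are left over: four for the frames and
  -- two for the additional rectangles present in the middle of a change.
  · have h1 := h.card_le
    have h2 := h.card_le'
    have h3 := Q.three_le
    have hp : a ≤ p - 2 := by omega
    have hq : b ≤ q := by omega
    calc a * b + 6 ≤ (p - 2) * q + 2 * q := Nat.add_le_add (Nat.mul_le_mul hp hq) (by omega)
      _ = p * q := by rw [← Nat.add_mul]; congr 1; omega
  · obtain ⟨r, hr, rfl | rfl | rfl | rfl⟩ := hcases z hz
    · exact Or.inl (hL r hr).c0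
    · exact Or.inr (hL r hr).c1
    · exact Or.inl (hL r hr).c2
    · exact Or.inr (hL r hr).c3
  · have := (hL (z / 4) (by omega)).base (z % 4) (by omega)
    rwa [Nat.div_add_mod] at this
  · refine ⟨h41, fun r hr => ?_, fun r hr => ?_, fun r hr => ?_, fun r hr => ?_, fun r hr => ?_,
      fun r hr => ?_, ?_⟩ <;> simp only [kinOf]
    · rw [(hL r hr).k0, (hL r hr).c0]
      exact ⟨by omega, by positivity⟩
    · have := (hout r hr).fr
      rw [(hL r hr).k1, (hL r hr).c1]
      exact ⟨by omega, neg_lt_zero.2 (by positivity)⟩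
    · have := (hout r hr).fb
      rw [(hL r hr).k2, (hL r hr).c2]
      exact ⟨by omega, by positivity⟩
    · have := (hout r hr).ft
      rw [(hL r hr).k3, (hL r hr).c3]
      exact ⟨by omega, neg_lt_zero.2 (by positivity)⟩
    · rw [(hL r hr).k0, (hL r hr).k1, (hL r hr).b0, (hL r hr).b1, (hL r hr).a0, (hL r hr).a1]
      intro e
      obtain ⟨⟨f1, f2, f3, f4⟩, hp⟩ := hin r hr
      exact ⟨(hout r hr).lt (by omega) (by omega), (hp.lt f1 f2).le⟩
    · rw [(hL r hr).k2, (hL r hr).k3, (hL r hr).b2, (hL r hr).b3, (hL r hr).a2, (hL r hr).a3]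
      intro e
      obtain ⟨⟨f1, f2, f3, f4⟩, hp⟩ := hin r hr
      have := (hout r hr).fb
      have := (hout r hr).ft
      exact ⟨(hout r hr).lt' (by omega) (by omega), (hp.lt' f3 f4).le⟩
    -- The left half plane outside of `Q`, paired with any inside box, gives a side at minus
    -- infinity; an inside box exists since the region of `P` is not empty.
    · obtain ⟨k, k1, k2, k3⟩ := h.left
      have ha0 : 0 < a := by
        by_contra hc
        obtain rfl : a = 0 := by omega
        have := h.inside.dense
        rw [ha] at this
        simp only [Ico_self, mem_empty_iff_false, iUnion_of_empty, iUnion_empty,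
          closure_empty, subset_empty_iff] at this
        have h3 := P.three_le
        have hu : (P.xs 0, P.ys 0) ∈ P.region := by
          rw [P.region_eq]; exact Or.inl ⟨0, by omega, left_mem_uIcc, left_mem_uIcc⟩
        rw [this] at hu
        exact hu
      have hk : k - a < b := by omega
      obtain ⟨e1, e2, e3⟩ := hpair 0 ha0 _ hk
      refine ⟨0 * b + (k - a), e1, ?_⟩
      rw [(hL _ e1).k0, e3, show a + (k - a) = k by omega, k3]
  · have key : ∀ r < a * b, ∀ τ, (kinOf s ev).HitL lam τ r ↔
        Hit (boxAt s₀ (r / b)) (boxAt s₀ (a + r % b)) lam τ := by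
      intro r hr τ
      have h1 := (hout r hr).fl
      have h2 := (hout r hr).fr
      have h3 := (hout r hr).fb
      have h4 := (hout r hr).ft
      simp only [Kin.HitL, Kin.at', kinOf, Hit]
      rw [(hL r hr).k0, (hL r hr).k1, (hL r hr).k2, (hL r hr).k3, (hL r hr).a0, (hL r hr).a1,
        (hL r hr).a2, (hL r hr).a3, (hL r hr).b0, (hL r hr).b1, (hL r hr).b2, (hL r hr).b3]
      refine and_congr ?_ (and_congr ?_ (and_congr ?_ ?_)) <;> refine imp_congr ?_ Iff.rfl <;> omega
    have hfit := fun τ => fits_iff (Q.region_eq ▸ Q.chain.isClosed_region) h.inside h.finite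
      h.outside hl τ
    unfold Kin.Free Fits
    refine exists_congr fun τ => ?_
    rw [hfit τ, ha, hb]
    constructor
    · intro hh i hi j hj hj'
      obtain ⟨e1, e2, e3⟩ := hpair i hi (j - a) (by omega)
      have := hh _ e1
      rw [key _ e1, e2, e3, show a + (j - a) = j by omega] at this
      exact this
    · intro hh r hr
      rw [key r hr]
      exact hh _ (hbox r hr).1 _ (by omega) (by have := (hbox r hr).2; omega)

/-! ### Ranks and sizes -/

/-- The store contains the lines of `D`. -/
structure KinIn (D : Kin) (s : Store) : Prop where
  L : s.nat 41 0 = D.L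
  cls : s.nat 44 = D.cls
  a : s.real 20 = D.a
  b : s.real 21 = D.b
  c : s.real 22 = D.c

theorem KinIn.step {D : Kin} {s s' : Store} (h : KinIn D s) {A : Prog} (hs : SameOff A s s')
    (h41 : 41 ∉ A.wN) (h44 : 44 ∉ A.wN) (h20 : 20 ∉ A.wR) (h21 : 21 ∉ A.wR) (h22 : 22 ∉ A.wR) :
    KinIn D s' :=
  ⟨by rw [hs.nat 41 h41, h.L], by rw [hs.nat 44 h44, h.cls], by rw [hs.real 20 h20, h.a],
    by rw [hs.real 21 h21, h.b], by rw [hs.real 22 h22, h.c]⟩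

/-- The line number `48` comes before the line number `47`. -/
abbrev sigTest : Test :=
  .or (.nlt (.cell 44 (nv 48)) (.cell 44 (nv 47)))
    (.and (.neq (.cell 44 (nv 48)) (.cell 44 (nv 47)))
      (.or (.rlt (.cell 20 (nv 47)) (.cell 20 (nv 48)))
        (.and (.req (.cell 20 (nv 48)) (.cell 20 (nv 47)))
          (.or (.rlt (.cell 21 (nv 48)) (.cell 21 (nv 47)))
            (.and (.req (.cell 21 (nv 48)) (.cell 21 (nv 47)))
              (.rlt (.cell 22 (nv 48)) (.cell 22 (nv 47))))))))

/-- Compute the ranks of the lines in array `50`. -/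
abbrev ranks : Prog :=
  forLoop 47 (nv 41) (.seq (countLoop 48 49 (nv 41) sigTest)
    (.setN 50 (nv 47) (.add (.const 1) (nv 49))))

theorem runs_ranks {D : Kin} {s : Store} (h : KinIn D s) :
    Runs ranks s (D.L * (4 * D.L + 6) + 2) fun s' => ∀ x < D.L, s'.nat 50 x = D.pos 0 x := by
  classical
  refine Runs.for (fun i s' => ∀ x < i, s'.nat 50 x = D.pos 0 x) (by simp [Prog.wN])
    (fun s₁ hs₁ => ?_) (fun x hx => absurd hx (Nat.not_lt_zero x)) ?_
  · exact (h.step hs₁ (by simp [Prog.wN]) (by simp [Prog.wN]) (by simp [Prog.wR])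
      (by simp [Prog.wR]) (by simp [Prog.wR])).L
  · intro x s₁ hx hs₁ hc hinv
    replace h := h.step hs₁ (by simp [Prog.wN]) (by simp [Prog.wN]) (by simp [Prog.wR])
      (by simp [Prog.wR]) (by simp [Prog.wR])
    refine Runs.andThen (t₁ := 4 * D.L + 3) (t₂ := 1)
      (Runs.count (n := D.L) (fun y => D.sig y x) (by decide) (fun s₂ hs₂ => ?_)
        fun s₂ i hs₂ hi hin => ?_) (by omega) ?_
    · exact (h.step hs₂ (by simp [Prog.wN]) (by simp [Prog.wN]) (by simp [Prog.wR])
        (by simp [Prog.wR]) (by simp [Prog.wR])).L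
    · have h' := h.step hs₂ (by simp [Prog.wN]) (by simp [Prog.wN]) (by simp [Prog.wR])
        (by simp [Prog.wR]) (by simp [Prog.wR])
      have hc' : s₂.nat 47 0 = x := by rw [hs₂.nat 47 (by simp [Prog.wN]), hc]
      simp only [Test.holds_or, Test.holds_and, Test.holds_nlt, Test.holds_neq, Test.holds_rlt,
        Test.holds_req, NExpr.eval, RExpr.eval, hi, hc', h'.cls, h'.a, h'.b, h'.c, Kin.sig]
    · intro s₂ hs₂ hacc
      have hc' : s₂.nat 47 0 = x := by rw [hs₂.nat 47 (by simp [Prog.wN]), hc]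
      refine Runs.straight rfl le_rfl fun z hz => ?_
      simp only [Prog.run, NExpr.eval, Store.writeN_nat, hc', hacc]
      rcases Nat.lt_succ_iff_lt_or_eq.1 hz with hz | rfl
      · simp [hz.ne, hs₂.nat 50 (by simp [Prog.wN]), hinv z hz]
      · simp only [Nat.reduceEqDiff, false_and, if_false, and_self, if_true, Kin.pos]

/-- Count the lines of small classes. -/
abbrev classCounts : Prog :=
  .seq (countLoop 48 51 (nv 41) (.nlt (.cell 44 (nv 48)) (.const 1)))
  (.seq (countLoop 48 52 (nv 41) (.nlt (.cell 44 (nv 48)) (.const 2)))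
  (.seq (countLoop 48 53 (nv 41) (.nlt (.cell 44 (nv 48)) (.const 4)))
  (countLoop 48 54 (nv 41) (.nlt (.cell 44 (nv 48)) (.const 5)))))

theorem runs_classCount {D : Kin} {s : Store} (h : KinIn D s) {acc j : ℕ} (hacc : acc ≠ 41)
    (hacc' : acc ≠ 44) (h48 : acc ≠ 48) :
    Runs (countLoop 48 acc (nv 41) (.nlt (.cell 44 (nv 48)) (.const j))) s (4 * D.L + 3)
      fun s' => s'.nat acc 0 = D.clsCount j := by
  classical
  refine (Runs.count (n := D.L) (fun y => D.cls y < j) h48.symm (fun s₂ hs₂ => ?_)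
    fun s₂ i hs₂ hi hin => ?_).mono le_rfl fun s' _ hs' => ?_
  · simp only [NExpr.eval]
    rw [hs₂.nat 41 (by simp [Prog.wN, hacc.symm]), h.L]
  · simp only [Test.holds_nlt, NExpr.eval, hi]
    rw [hs₂.nat 44 (by simp [Prog.wN, hacc'.symm]), h.cls]
  · rw [hs', Kin.clsCount]

theorem runs_classCounts {D : Kin} {s : Store} (h : KinIn D s) :
    Runs classCounts s (16 * D.L + 12) fun s' => s'.nat 51 0 = D.clsCount 1 ∧
      s'.nat 52 0 = D.clsCount 2 ∧ s'.nat 53 0 = D.clsCount 4 ∧ s'.nat 54 0 = D.clsCount 5 := by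
  refine Runs.andThen (t₂ := 12 * D.L + 9)
    (runs_classCount h (by decide) (by decide) (by decide)) (by omega) ?_
  intro s₁ hs₁ h1
  replace h := h.step hs₁ (by simp [Prog.wN]) (by simp [Prog.wN]) (by simp [Prog.wR])
    (by simp [Prog.wR]) (by simp [Prog.wR])
  refine Runs.andThen (t₂ := 8 * D.L + 6)
    (runs_classCount h (by decide) (by decide) (by decide)) (by omega) ?_
  intro s₂ hs₂ h2
  replace h := h.step hs₂ (by simp [Prog.wN]) (by simp [Prog.wN]) (by simp [Prog.wR])
    (by simp [Prog.wR]) (by simp [Prog.wR])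
  refine Runs.andThen (t₂ := 4 * D.L + 3)
    (runs_classCount h (by decide) (by decide) (by decide)) (by omega) ?_
  intro s₃ hs₃ h4
  replace h := h.step hs₃ (by simp [Prog.wN]) (by simp [Prog.wN]) (by simp [Prog.wR])
    (by simp [Prog.wR]) (by simp [Prog.wR])
  refine (runs_classCount h (by decide) (by decide) (by decide)).mono le_rfl ?_
  intro s₄ hs₄ h5
  refine ⟨?_, ?_, ?_, h5⟩
  · rw [hs₄.nat 51 (by simp [Prog.wN]), hs₃.nat 51 (by simp [Prog.wN]),
      hs₂.nat 51 (by simp [Prog.wN]), h1]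
  · rw [hs₄.nat 52 (by simp [Prog.wN]), hs₃.nat 52 (by simp [Prog.wN]), h2]
  · rw [hs₄.nat 53 (by simp [Prog.wN]), h4]

/-- Let `acc` be the product of `e` and `d`. -/
abbrev mulLoop (c acc : ℕ) (e d : NExpr) : Prog :=
  .seq (.setN acc (.const 0) (.const 0)) (forLoop c e (.setN acc (.const 0) (.add (nv acc) d)))

/-- Natural numbers can only be added and subtracted, so products are formed by repeated addition;
even `(pq)²` steps are affordable. -/
theorem Runs.mul {c acc n k : ℕ} {e d : NExpr} {s : Store} (hc : c ≠ acc)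
    (he : ∀ s₁, SameOff (mulLoop c acc e d) s s₁ → e.eval s₁ = n)
    (hd : ∀ s₁, SameOff (mulLoop c acc e d) s s₁ → d.eval s₁ = k) :
    Runs (mulLoop c acc e d) s (3 * n + 3) fun s' => s'.nat acc 0 = n * k := by
  refine Runs.andThen (t₁ := 1) (t₂ := n * (1 + 2) + 2) (R := fun s' => s' = s.writeN acc 0 0)
    (Runs.straight rfl le_rfl rfl) (by omega) ?_
  rintro s₀ hs₀ rfl
  refine Runs.for (fun i s' => s'.nat acc 0 = i * k)
    (by simp [Prog.wN, hc]) (fun s₁ hs₁ => he s₁ (hs₀.seq_left.trans hs₁.seq_right))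
    (by simp [Store.writeN_nat, hc.symm]) ?_
  intro i s₁ hi hs₁ hci hacc
  refine Runs.straight rfl le_rfl ?_
  simp only [Prog.run, NExpr.eval, hd s₁ (hs₀.seq_left.trans hs₁.seq_right), Store.writeN_nat,
    hc.symm, false_and, if_false, and_self, if_true, hacc]
  ring

/-- Compute the product `n` of the numbers of vertices in array `55`, its square in array `57`, a
quarter of that in array `58`, and the remainder in array `59`. -/
abbrev sizes : Prog :=
  .seq (mulLoop 56 55 (.cell 0 (.const 0)) (.cell 0 (.const 1)))
  (.seq (mulLoop 56 57 (nv 55) (nv 55))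
  (.seq (.setN 58 (.const 0) (.const 0))
  (.seq (forLoop 56 (nv 57)
    (.ite (.nlt (nv 57) (.add (.add (nv 58) (nv 58)) (.add (.add (nv 58) (nv 58)) (.const 4))))
      .skip (incr 58)))
  (.setN 59 (.const 0) (.sub (nv 57)
    (.add (.add (nv 58) (nv 58)) (.add (nv 58) (nv 58))))))))

theorem runs_sizes {p q : ℕ} {s : Store} (hp : s.nat 0 0 = p) (hq : s.nat 0 1 = q) :
    Runs sizes s (3 * p + 3 * (p * q) + 4 * (p * q * (p * q)) + 10) fun s' =>
      s'.nat 55 0 = p * q ∧ s'.nat 57 0 = p * q * (p * q) ∧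
      s'.nat 58 0 = p * q * (p * q) / 4 ∧ s'.nat 59 0 = p * q * (p * q) % 4 := by
  refine Runs.andThen (t₁ := 3 * p + 3) (t₂ := 3 * (p * q) + 4 * (p * q * (p * q)) + 7)
    (Runs.mul (n := p) (k := q) (by decide) (fun s₁ hs₁ => ?_) fun s₁ hs₁ => ?_) (by omega) ?_
  · simp only [NExpr.eval]
    rw [hs₁.nat 0 (by simp [Prog.wN]), hp]
  · simp only [NExpr.eval]
    rw [hs₁.nat 0 (by simp [Prog.wN]), hq]
  intro s₁ hs₁ h1
  refine Runs.andThen (t₁ := 3 * (p * q) + 3) (t₂ := 4 * (p * q * (p * q)) + 4)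
    (Runs.mul (n := p * q) (k := p * q) (by decide) (fun s₂ hs₂ => ?_) fun s₂ hs₂ => ?_)
    (by omega) ?_
  · simp only [NExpr.eval]
    rw [hs₂.nat 55 (by simp [Prog.wN]), h1]
  · simp only [NExpr.eval]
    rw [hs₂.nat 55 (by simp [Prog.wN]), h1]
  intro s₂ hs₂ h2
  rw [← hs₂.nat 55 (by simp [Prog.wN])] at h1
  refine Runs.andThen (t₁ := 1) (t₂ := 4 * (p * q * (p * q)) + 3) (R := fun s => s.nat 58 0 = 0)
    (Runs.straight rfl le_rfl (by simp [Prog.run, NExpr.eval, Store.writeN_nat])) (by omega) ?_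
  intro s₃ hs₃ h3
  rw [← hs₃.nat 55 (by simp [Prog.wN])] at h1
  rw [← hs₃.nat 57 (by simp [Prog.wN])] at h2
  generalize p * q * (p * q) = N at *
  -- The counter moves on as long as four times its successor is at most `N`, so it stops at `N /
  -- 4`; the `N` rounds are more than enough.
  refine Runs.andThen (t₁ := N * (2 + 2) + 2) (t₂ := 1) (R := fun s => s.nat 58 0 = min N (N / 4))
    (Runs.for (fun i s => s.nat 58 0 = min i (N / 4)) (by simp [Prog.wN]) (fun s' hs' => ?_) ?_ ?_)
    (by omega) ?_
  · simp only [NExpr.eval]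
    rw [hs'.nat 57 (by simp [Prog.wN]), h2]
  · simp [Store.writeN_nat, h3]
  · intro i s' hi hs' hci hinv
    have h57 : s'.nat 57 0 = N := by rw [hs'.nat 57 (by simp [Prog.wN]), h2]
    refine Runs.straight rfl le_rfl ?_
    simp only [Prog.run, Test.holds_nlt, NExpr.eval, h57, hinv]
    split
    · simp only [Store.writeN_nat, Nat.reduceEqDiff, false_and, if_false, hinv]
      omega
    · simp only [Store.writeN_nat, Nat.reduceEqDiff, false_and, if_false, and_self, if_true]
      omega
  · intro s₄ hs₄ h4
    rw [← hs₄.nat 55 (by simp [Prog.wN])] at h1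
    rw [← hs₄.nat 57 (by simp [Prog.wN])] at h2
    refine Runs.straight rfl le_rfl ?_
    simp only [Prog.run, NExpr.eval, Store.writeN_nat, Nat.reduceEqDiff, false_and, if_false,
      and_self, if_true, h1, h2, h4, true_and]
    omega

/-! ### Pairs of lines -/

/-- The lines number `47` and `48` change places at some time. -/
abbrev validTest : Test :=
  .and (.neq (.cell 44 (nv 47)) (.cell 44 (nv 48)))
    (.and (.rlt (.cell 20 (nv 48)) (.cell 20 (nv 47)))
      (.rlt (.cell 21 (nv 48)) (.cell 21 (nv 47))))

/-- Store the pair of the lines number `47` and `48` at the index in array `62`. -/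
abbrev storePair : Prog :=
  .seq (.setN 60 (nv 62) (nv 47))
  (.seq (.setN 61 (nv 62) (nv 48))
  (.seq (.ite validTest
    (.seq (.setR 30 (nv 62)
      (.div (.sub (.cell 21 (nv 47)) (.cell 21 (nv 48)))
        (.sub (.cell 20 (nv 47)) (.cell 20 (nv 48)))))
    (.seq (.setR 31 (nv 62)
      (.div (.sub (.cell 22 (nv 47)) (.cell 22 (nv 48)))
        (.sub (.cell 20 (nv 47)) (.cell 20 (nv 48)))))
    (.setR 32 (nv 62) (.add (.cell 20 (nv 47)) (.cell 20 (nv 48)))))) .skip)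
  (incr 62)))

/-- The pairs of lines, in the order of the loops, with their times; pairs from `M` on are
missing. -/
structure PairsTo (D : Kin) (M : ℕ) (s : Store) : Prop where
  lt : ∀ i < M, s.nat 60 i = i / D.L ∧ s.nat 61 i = i % D.L
  ge : ∀ i, M ≤ i → s.nat 60 i = 0 ∧ s.nat 61 i = 0
  key : ∀ i, D.Valid (s.nat 60 i, s.nat 61 i) →
    toLex (s.real 30 i, toLex (s.real 31 i, s.real 32 i)) = D.key (s.nat 60 i, s.nat 61 i)
  no_key : ∀ i, ¬ D.Valid (s.nat 60 i, s.nat 61 i) → s.real 30 i = 0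

theorem PairsTo.congr {D : Kin} {M : ℕ} {s s' : Store} (h : PairsTo D M s)
    (h60 : s'.nat 60 = s.nat 60) (h61 : s'.nat 61 = s.nat 61) (h30 : s'.real 30 = s.real 30)
    (h31 : s'.real 31 = s.real 31) (h32 : s'.real 32 = s.real 32) : PairsTo D M s' := by
  obtain ⟨a, b, c, d⟩ := h
  constructor
  · rwa [h60, h61]
  · rwa [h60, h61]
  · rwa [h60, h61, h30, h31, h32]
  · rwa [h60, h61, h30]

theorem Kin.not_valid_self (D : Kin) (x : ℕ) : ¬ D.Valid (x, x) := fun h => lt_irrefl _ h.2.2.2.1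

/-- For a pair that never changes places the division is avoided and the stored time stays `0`.
Valid pairs have positive times, so the sign of the stored time later serves as the test for
validity. -/
theorem runs_storePair {D : Kin} {s : Store} (h : KinIn D s) {x y M : ℕ} (hx : x < D.L)
    (hy : y < D.L) (h47 : s.nat 47 0 = x) (h48 : s.nat 48 0 = y) (h62 : s.nat 62 0 = M)
    (hM : M / D.L = x) (hM' : M % D.L = y) (hP : PairsTo D M s) :
    Runs storePair s 7 fun s' => s'.nat 62 0 = M + 1 ∧ PairsTo D (M + 1) s' := by
  have hge := hP.ge M le_rfl
  have hno : s.real 30 M = 0 := hP.no_key M (by rw [hge.1, hge.2]; exact D.not_valid_self 0)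
  refine Runs.straight rfl le_rfl ?_
  have hv : ∀ s' : Store, s'.nat 44 = s.nat 44 → s'.nat 47 = s.nat 47 → s'.nat 48 = s.nat 48 →
      s'.real = s.real → (validTest.holds s' ↔ D.Valid (x, y)) := by
    intro s' e1 e2 e3 e4
    simp only [Test.holds_and, Test.holds_neq, Test.holds_rlt, NExpr.eval, RExpr.eval, e1, e2, e3,
      e4, h47, h48, h.cls, h.a, h.b, Kin.Valid, hx, hy, true_and]
  have hv' : validTest.holds ((s.writeN 60 M x).writeN 61 M y) ↔ D.Valid (x, y) :=
    hv _ (by simp [Store.writeN]) (by simp [Store.writeN]) (by simp [Store.writeN]) rfl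
  have hsplit : ∀ (Q : ℕ → Prop), (∀ i ≠ M, Q i) → Q M → ∀ i, Q i := fun Q h1 h2 i => by
    by_cases e : i = M
    · rw [e]; exact h2
    · exact h1 i e
  by_cases hval : D.Valid (x, y)
  · have hrun : storePair.run s = (((((s.writeN 60 M x).writeN 61 M y).writeR 30 M
        ((D.b x - D.b y) / (D.a x - D.a y))).writeR 31 M ((D.c x - D.c y) / (D.a x - D.a y))).writeR
        32 M (D.a x + D.a y)).writeN 62 0 (M + 1) := by
      simp only [Prog.run, NExpr.eval, RExpr.eval, Store.writeN_nat, Store.writeR_real,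
        Store.writeR_nat, Store.writeN_real, h47, h48, h62, h.a, h.b, h.c, hv', hval,
        Nat.reduceEqDiff, false_and, if_false, if_true]
    rw [hrun]
    refine ⟨by simp [Store.writeN_nat], fun i hi => ?_, fun i hi => ?_, hsplit _ (fun i hi => ?_) ?_,
      hsplit _ (fun i hi => ?_) ?_⟩
    · rcases Nat.lt_succ_iff_lt_or_eq.1 hi with hi | rfl
      · simp [Store.writeN_nat, Store.writeR_nat, hi.ne, hP.lt i hi]
      · simp [Store.writeN_nat, Store.writeR_nat, hM, hM']
    · have : i ≠ M := by omega
      simp [Store.writeN_nat, Store.writeR_nat, this, hP.ge i (by omega)]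
    · simpa [Store.writeN_nat, Store.writeR_nat, Store.writeN_real, Store.writeR_real, hi] using
        hP.key i
    · simp [Store.writeN_nat, Store.writeR_nat, Store.writeN_real, Store.writeR_real, Kin.key]
    · simpa [Store.writeN_nat, Store.writeR_nat, Store.writeN_real, Store.writeR_real, hi] using
        hP.no_key i
    · simp [Store.writeN_nat, Store.writeR_nat, hval]
  · have hrun : storePair.run s = ((s.writeN 60 M x).writeN 61 M y).writeN 62 0 (M + 1) := by
      simp only [Prog.run, NExpr.eval, RExpr.eval, Store.writeN_nat, h47, h48, h62, hv', hval,
        Nat.reduceEqDiff, false_and, if_false]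
    rw [hrun]
    refine ⟨by simp [Store.writeN_nat], fun i hi => ?_, fun i hi => ?_, hsplit _ (fun i hi => ?_) ?_,
      hsplit _ (fun i hi => ?_) ?_⟩
    · rcases Nat.lt_succ_iff_lt_or_eq.1 hi with hi | rfl
      · simp [Store.writeN_nat, hi.ne, hP.lt i hi]
      · simp [Store.writeN_nat, hM, hM']
    · have : i ≠ M := by omega
      simp [Store.writeN_nat, this, hP.ge i (by omega)]
    · simpa [Store.writeN_nat, Store.writeN_real, hi] using hP.key i
    · simp [Store.writeN_nat, hval]
    · simpa [Store.writeN_nat, Store.writeN_real, hi] using hP.no_key i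
    · simpa [Store.writeN_nat, Store.writeN_real] using fun _ => hno

/-- Store all pairs of lines. -/
abbrev allPairs : Prog := forLoop 47 (nv 41) (forLoop 48 (nv 41) storePair)

theorem runs_allPairs {D : Kin} {s : Store} (h : KinIn D s) (h62 : s.nat 62 0 = 0)
    (hP : PairsTo D 0 s) :
    Runs allPairs s (D.L * (9 * D.L + 4) + 2) fun s' =>
      s'.nat 62 0 = D.L * D.L ∧ PairsTo D (D.L * D.L) s' := by
  have hw : ∀ {s : Store} {M c v : ℕ}, c ≠ 60 → c ≠ 61 → PairsTo D M s →
      PairsTo D M (s.writeN c 0 v) := fun h1 h2 h =>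
    h.congr (Store.writeN_nat_ne _ _ _ h1.symm) (Store.writeN_nat_ne _ _ _ h2.symm) rfl rfl rfl
  refine (Runs.for (n := D.L) (tA := D.L * 9 + 2) (fun x s' => s'.nat 62 0 = x * D.L ∧
    PairsTo D (x * D.L) s') (by simp [Prog.wN]) (fun s₁ hs₁ => ?_) ?_ ?_).mono
    (by rw [Nat.mul_comm 9]) fun _ _ h => h
  · exact (h.step hs₁ (by simp [Prog.wN]) (by simp [Prog.wN]) (by simp [Prog.wR])
      (by simp [Prog.wR]) (by simp [Prog.wR])).L
  · rw [Nat.zero_mul]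
    exact ⟨by simp [Store.writeN_nat, h62], hw (by decide) (by decide) hP⟩
  · intro x s₁ hx hs₁ hc ⟨i1, i2⟩
    replace h := h.step hs₁ (by simp [Prog.wN]) (by simp [Prog.wN]) (by simp [Prog.wR])
      (by simp [Prog.wR]) (by simp [Prog.wR])
    refine (Runs.for (n := D.L) (tA := 7) (fun y s' => s'.nat 62 0 = x * D.L + y ∧
      PairsTo D (x * D.L + y) s') (by simp [Prog.wN]) (fun s₂ hs₂ => ?_) ?_ ?_).mono le_rfl ?_
    · exact (h.step hs₂ (by simp [Prog.wN]) (by simp [Prog.wN]) (by simp [Prog.wR])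
        (by simp [Prog.wR]) (by simp [Prog.wR])).L
    · exact ⟨by simp [Store.writeN_nat, i1], hw (by decide) (by decide) i2⟩
    · intro y s₂ hy hs₂ hc' ⟨j1, j2⟩
      have h' := h.step hs₂ (by simp [Prog.wN]) (by simp [Prog.wN]) (by simp [Prog.wR])
        (by simp [Prog.wR]) (by simp [Prog.wR])
      have hL : 0 < D.L := by omega
      refine (runs_storePair h' hx hy (by rw [hs₂.nat 47 (by simp [Prog.wN]), hc]) hc' j1 ?_ ?_
        j2).mono le_rfl ?_
      · rw [Nat.mul_comm, Nat.mul_add_div hL, Nat.div_eq_of_lt hy, Nat.add_zero]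
      · rw [Nat.mul_comm, Nat.mul_add_mod, Nat.mod_eq_of_lt hy]
      · rintro s₃ - ⟨k1, k2⟩
        exact ⟨by simp [Store.writeN_nat, k1, Nat.add_assoc], hw (by decide) (by decide) k2⟩
    · rintro s₃ - ⟨k1, k2⟩
      rw [Nat.add_mul, one_mul]
      exact ⟨by simp [Store.writeN_nat, k1], hw (by decide) (by decide) k2⟩

/-- Compute a power of two that is not less than the number of pairs. -/
abbrev powerOfTwo : Prog :=
  .seq (.setN 63 (.const 0) (.const 1))
    (.loop (.nlt (nv 63) (nv 62)) (.setN 63 (.const 0) (.add (nv 63) (nv 63))))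

/-- Rounding up to a power of two makes all blocks of the merge sort full, and at most doubles the
length. -/
theorem runs_powerOfTwo {M : ℕ} {s : Store} (h62 : s.nat 62 0 = M) (hM : 1 ≤ M) :
    Runs powerOfTwo s (2 * M + 2) fun s' => ∃ d, s'.nat 63 0 = 2 ^ d ∧ M ≤ 2 ^ d ∧
      2 ^ d ≤ 2 * M := by
  refine Runs.andThen (t₁ := 1) (t₂ := 2 * M + 1) (R := fun s' => s' = s.writeN 63 0 1)
    (Runs.straight rfl le_rfl rfl) (by omega) ?_
  rintro s₁ hs₁ rfl
  refine (Runs.loop (fun s' => ∃ d, s'.nat 63 0 = 2 ^ d ∧ 2 ^ d ≤ 2 * M)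
    (fun s' => 2 * (M - s'.nat 63 0)) ⟨0, by simp [Store.writeN_nat], by simp; omega⟩ ?_).mono
    (by omega) ?_
  · rintro s₂ hs₂ ⟨d, h1, h2⟩ hb
    have hM' : s₂.nat 62 0 = M := by
      rw [hs₂.nat 62 (by simp [Prog.wN]), hs₁.nat 62 (by simp [Prog.wN]), h62]
    simp only [Test.holds_nlt, NExpr.eval, hM', h1] at hb
    refine ⟨1, Runs.straight rfl le_rfl ⟨⟨d + 1, ?_, ?_⟩, ?_⟩⟩
    · simp [Prog.run, NExpr.eval, Store.writeN_nat, h1]; ring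
    · rw [pow_succ]; omega
    · simp only [Prog.run, NExpr.eval, Store.writeN_nat, h1, and_self, if_true]
      have : 1 ≤ 2 ^ d := Nat.one_le_two_pow
      omega
  · rintro s₂ hs₂ ⟨⟨d, h1, h2⟩, hb⟩
    have hM' : s₂.nat 62 0 = M := by
      rw [hs₂.nat 62 (by simp [Prog.wN]), hs₁.nat 62 (by simp [Prog.wN]), h62]
    simp only [Test.holds_nlt, NExpr.eval, hM', h1, not_lt] at hb
    exact ⟨d, h1, hb, h2⟩

/-- Let array `64` contain the numbers below the value in array `63` in their order. -/
abbrev identityOrder : Prog := forLoop 47 (nv 63) (.setN 64 (nv 47) (nv 47))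

theorem runs_identityOrder {W : ℕ} {s : Store} (h63 : s.nat 63 0 = W)
    (h64 : ∀ i, s.nat 64 i = 0) :
    Runs identityOrder s (3 * W + 2) fun s' => ∀ i, s'.nat 64 i = if i < W then i else 0 := by
  refine (Runs.for (n := W) (tA := 1) (fun k s' => ∀ i, s'.nat 64 i = if i < k then i else 0)
    (by simp [Prog.wN]) (fun s₁ hs₁ => ?_) (by simp [Store.writeN_nat, h64]) ?_).mono (by omega)
    fun _ _ h => h
  · simp only [NExpr.eval]
    rw [hs₁.nat 63 (by simp [Prog.wN]), h63]
  · intro k s₁ hk hs₁ hc hinv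
    refine Runs.straight rfl le_rfl fun i => ?_
    simp only [Prog.run, NExpr.eval, hc, Store.writeN_nat, Nat.reduceEqDiff, false_and, if_false,
      true_and, hinv i]
    split_ifs <;> omega

/-! ### Sorting by merging -/

section Merge

variable {α : Type*} [LinearOrder α]

/-- The numbers `f 0, …, f (W - 1)` are the numbers below `W` in some order, and each of the blocks
of length `w` has decreasing values `K`. -/
structure BlockSorted (W w : ℕ) (K : ℕ → α) (f : ℕ → ℕ) : Prop where
  lt : ∀ x < W, f x < W
  inj : ∀ x < W, ∀ y < W, f x = f y → x = y
  sorted : ∀ x y, x ≤ y → y < W → x / w = y / w → K (f y) ≤ K (f x)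

/-- The state of merging the blocks of length `w` of `f` into blocks of length `2 w` of `g`, when
`o` numbers have been written.  The blocks that are being merged start at `b`, and `i` and `j` are
the next indices in these blocks. -/
structure Merging (W w : ℕ) (K : ℕ → α) (f g : ℕ → ℕ) (o b i j : ℕ) : Prop where
  dvd : 2 * w ∣ b
  b_le : b + 2 * w ≤ W
  o_ge : b ≤ o
  i_ge : b ≤ i
  i_le : i ≤ b + w
  j_ge : b + w ≤ j
  j_le : j ≤ b + 2 * w
  sum : i + j = o + b + w
  used : ∀ x < o, ∃ y, (y < i ∨ (b + w ≤ y ∧ y < j)) ∧ g x = f y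
  inj : ∀ x < o, ∀ y < o, g x = g y → x = y
  sorted : ∀ x y, x ≤ y → y < o → x / (2 * w) = y / (2 * w) → K (g y) ≤ K (g x)
  front : ∀ x, b ≤ x → x < o → ∀ y, ((i ≤ y ∧ y < b + w) ∨ (j ≤ y ∧ y < b + 2 * w)) →
    K (f y) ≤ K (g x)

variable {W w : ℕ} {K : ℕ → α} {f g : ℕ → ℕ} {o b i j : ℕ}

theorem Merging.zero (K : ℕ → α) (f g : ℕ → ℕ) (h : 2 * w ≤ W) : Merging W w K f g 0 0 0 w where
  dvd := dvd_zero _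
  b_le := by omega
  o_ge := le_rfl
  i_ge := le_rfl
  i_le := by omega
  j_ge := by omega
  j_le := by omega
  sum := by omega
  used := fun x hx => absurd hx (Nat.not_lt_zero x)
  inj := fun x hx => absurd hx (Nat.not_lt_zero x)
  sorted := fun x y _ hy => absurd hy (Nat.not_lt_zero y)
  front := fun x _ hx => absurd hx (Nat.not_lt_zero x)

/-- When both blocks are used up, `o` is a multiple of `2 * w`, and since `2 * w` divides `W`, the
next two blocks fit below `W` completely. -/
theorem Merging.reset (h : Merging W w K f g o b i j) (hW : 2 * w ∣ W) (ho : b + 2 * w ≤ o)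
    (ho' : o < W) : Merging W w K f g o o o (o + w) := by
  obtain ⟨h1, h2, h3, h4, h5, h6, h7, h8, h9, h10, h11, h12⟩ := h
  have hob : o = b + 2 * w := by omega
  have hd : 2 * w ∣ o := by rw [hob]; exact h1.add (dvd_refl _)
  refine ⟨hd, ?_, le_rfl, le_rfl, by omega, le_rfl, by omega, by omega, fun x hx => ?_, h10, h11,
    fun x _ _ => by omega⟩
  · obtain ⟨t, rfl⟩ := hW
    obtain ⟨r, hr⟩ := hd
    rw [hr] at ho' ⊢
    have : r < t := lt_of_mul_lt_mul_left ho' (Nat.zero_le _)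
    calc 2 * w * r + 2 * w = 2 * w * (r + 1) := by ring
      _ ≤ 2 * w * t := Nat.mul_le_mul_left _ this
  · obtain ⟨y, hy, e⟩ := h9 x hx
    exact ⟨y, Or.inl (by omega), e⟩

theorem Merging.div_eq (h : Merging W w K f g o b i j) (hw : 0 < w) {c x y : ℕ}
    (hc : c = b ∨ c = b + w) (hx : c ≤ x) (hx' : x < c + w) (hy : c ≤ y) (hy' : y < c + w) :
    x / w = y / w := by
  obtain ⟨r, hr⟩ := h.dvd
  obtain ⟨t, rfl⟩ : ∃ t, c = w * t := by
    rcases hc with rfl | rfl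
    · exact ⟨2 * r, by rw [hr]; ring⟩
    · exact ⟨2 * r + 1, by rw [hr]; ring⟩
  obtain ⟨u, rfl⟩ := Nat.exists_eq_add_of_le hx
  obtain ⟨v, rfl⟩ := Nat.exists_eq_add_of_le hy
  rw [Nat.mul_add_div hw, Nat.mul_add_div hw, Nat.div_eq_of_lt (by omega),
    Nat.div_eq_of_lt (by omega)]

theorem Merging.base_le (h : Merging W w K f g o b i j) (hw : 0 < w) {x : ℕ}
    (ho : o < b + 2 * w) (e : x / (2 * w) = o / (2 * w)) : b ≤ x := by
  obtain ⟨r, hr⟩ := h.dvd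
  obtain ⟨u, hu⟩ := Nat.exists_eq_add_of_le h.o_ge
  have h1 : o / (2 * w) = r := by
    rw [hu, hr, Nat.mul_add_div (by omega), Nat.div_eq_of_lt (by omega), Nat.add_zero]
  rw [h1] at e
  have := Nat.mul_div_le x (2 * w)
  rw [e] at this
  omega

/-- One step of merging: the next number is `f y`. -/
theorem Merging.write (h : Merging W w K f g o b i j) (hf : BlockSorted W w K f) (hw : 0 < w)
    (ho : o < b + 2 * w) {y i' j' : ℕ} {g' : ℕ → ℕ}
    (hy : (y = i ∧ i < b + w ∧ i' = i + 1 ∧ j' = j ∧ (j < b + 2 * w → K (f j) ≤ K (f i))) ∨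
      (y = j ∧ j < b + 2 * w ∧ i' = i ∧ j' = j + 1 ∧ (i < b + w → K (f i) ≤ K (f j))))
    (hg : ∀ x < o, g' x = g x) (hg' : g' o = f y) :
    Merging W w K f g' (o + 1) b i' j' := by
  have hdiv := @Merging.div_eq _ _ _ _ _ _ _ _ _ _ _ h hw
  have hbase := fun x => @Merging.base_le _ _ _ _ _ _ _ _ _ _ _ h hw x
  obtain ⟨h1, h2, h3, h4, h5, h6, h7, h8, h9, h10, h11, h12⟩ := h
  -- Everything written so far comes from places that have been passed, and `f` is injective, so `f
  -- y` is new.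
  have hnew : ∀ x < o, g x ≠ f y := by
    intro x hx e
    obtain ⟨z, hz, ez⟩ := h9 x hx
    have := hf.inj z (by omega) y (by omega) (ez.symm.trans e)
    omega
  -- The chosen value dominates the rest of its own block because that block is sorted, and the rest
  -- of the other block because it dominates its front.
  have hmax : ∀ z, ((i' ≤ z ∧ z < b + w) ∨ (j' ≤ z ∧ z < b + 2 * w)) → K (f z) ≤ K (f y) := by
    have hblock : ∀ c u z, (c = b ∨ c = b + w) → c ≤ u → u ≤ z → z < c + w → K (f z) ≤ K (f u) :=
      fun c u z hc h1 h2 h3 => hf.sorted u z h2 (by omega)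
        (hdiv hc h1 (by omega) (by omega) (by omega))
    intro z hz
    rcases hy with ⟨rfl, a1, rfl, rfl, a2⟩ | ⟨rfl, a1, rfl, rfl, a2⟩
    · rcases hz with hz | hz
      · exact hblock b _ z (Or.inl rfl) (by omega) (by omega) (by omega)
      · exact (hblock (b + w) j' z (Or.inr rfl) (by omega) (by omega) (by omega)).trans
          (a2 (by omega))
    · rcases hz with hz | hz
      · exact (hblock b i' z (Or.inl rfl) (by omega) (by omega) (by omega)).trans
          (a2 (by omega))
      · exact hblock (b + w) _ z (Or.inr rfl) (by omega) (by omega) (by omega)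
  have hyf : (i ≤ y ∧ y < b + w) ∨ (j ≤ y ∧ y < b + 2 * w) := by omega
  have last : ∀ {x}, x < o + 1 → x < o ∨ x = o := fun hx => Nat.lt_succ_iff_lt_or_eq.1 hx
  refine ⟨h1, h2, by omega, by omega, by omega, by omega, by omega, by omega, fun x hx => ?_,
    fun x hx z hz e => ?_, fun x z hxz hz e => ?_, fun x hx hx' z hz => ?_⟩
  · rcases last hx with hx | rfl
    · obtain ⟨z, hz, ez⟩ := h9 x hx
      exact ⟨z, by omega, by rw [hg x hx, ez]⟩
    · exact ⟨y, by omega, hg'⟩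
  · rcases last hx with hx | rfl <;> rcases last hz with hz | rfl
    · rw [hg x hx, hg z hz] at e; exact h10 x hx z hz e
    · rw [hg x hx, hg'] at e; exact absurd e (hnew x hx)
    · rw [hg z hz, hg'] at e; exact absurd e.symm (hnew z hz)
    · rfl
  · rcases last hz with hz | rfl
    · rw [hg x (by omega), hg z hz]; exact h11 x z hxz hz e
    · rcases hxz.lt_or_eq with hx | rfl
      · rw [hg x hx, hg']
        exact h12 x (hbase x ho e) hx y hyf
      · exact le_rfl
  · rcases last hx' with hx' | rfl
    · rw [hg x hx']
      exact h12 x hx hx' z (by omega)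
    · rw [hg']; exact hmax z hz

theorem Merging.blockSorted (h : Merging W w K f g W b i j) (hf : BlockSorted W w K f) :
    BlockSorted W (2 * w) K g := by
  obtain ⟨h1, h2, h3, h4, h5, h6, h7, h8, h9, h10, h11, h12⟩ := h
  refine ⟨fun x hx => ?_, h10, h11⟩
  obtain ⟨y, hy, e⟩ := h9 x hx
  rw [e]
  exact hf.lt y (by omega)

theorem BlockSorted.congr (h : BlockSorted W w K f) (hg : ∀ x < W, g x = f x) :
    BlockSorted W w K g :=
  ⟨fun x hx => by rw [hg x hx]; exact h.lt x hx,
    fun x hx y hy e => h.inj x hx y hy (by rwa [hg x hx, hg y hy] at e),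
    fun x y hxy hy e => by rw [hg x (by omega), hg y hy]; exact h.sorted x y hxy hy e⟩

end Merge

/-- The time of the pair number `i`. -/
noncomputable def timeOf (s : Store) (i : ℕ) : ℝ ×ₗ ℝ ×ₗ ℝ :=
  toLex (s.real 30 i, toLex (s.real 31 i, s.real 32 i))

/-- Compare the times of the pairs at the places `69` and `70` of the order in array `64`. -/
abbrev laterTest : Test :=
  .or (.rlt (.cell 30 (.cell 64 (nv 69))) (.cell 30 (.cell 64 (nv 70))))
    (.and (.req (.cell 30 (.cell 64 (nv 69))) (.cell 30 (.cell 64 (nv 70))))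
      (.or (.rlt (.cell 31 (.cell 64 (nv 69))) (.cell 31 (.cell 64 (nv 70))))
        (.and (.req (.cell 31 (.cell 64 (nv 69))) (.cell 31 (.cell 64 (nv 70))))
          (.rlt (.cell 32 (.cell 64 (nv 69))) (.cell 32 (.cell 64 (nv 70)))))))

theorem holds_laterTest {s : Store} {i j : ℕ} (hi : s.nat 69 0 = i) (hj : s.nat 70 0 = j) :
    laterTest.holds s ↔ timeOf s (s.nat 64 i) < timeOf s (s.nat 64 j) := by
  simp only [Test.holds_or, Test.holds_and, Test.holds_rlt, Test.holds_req, RExpr.eval, NExpr.eval,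
    hi, hj, timeOf, Prod.Lex.toLex_lt_toLex]

/-- One step of merging blocks: array `66` holds the length of the blocks, array `67` the place to
write to in array `65`, and arrays `68`-`70` the start of the blocks and the next places. -/
abbrev mergeStep : Prog :=
  .seq (.ite (.nlt (nv 67) (.add (nv 68) (.add (nv 66) (nv 66)))) .skip
    (.seq (.setN 68 (.const 0) (nv 67)) (.seq (.setN 69 (.const 0) (nv 67))
      (.setN 70 (.const 0) (.add (nv 67) (nv 66))))))
  (.ite (.and (.nlt (nv 69) (.add (nv 68) (nv 66)))
      (.or (.not (.nlt (nv 70) (.add (nv 68) (.add (nv 66) (nv 66))))) (.not laterTest)))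
    (.seq (.setN 65 (nv 67) (.cell 64 (nv 69))) (incr 69))
    (.seq (.setN 65 (nv 67) (.cell 64 (nv 70))) (incr 70)))

theorem runs_mergeStep {W w o : ℕ} {s : Store} (hw : 0 < w) (hW : 2 * w ∣ W) (ho : o < W)
    (h66 : s.nat 66 0 = w) (h67 : s.nat 67 0 = o)
    (hf : BlockSorted W w (timeOf s) (s.nat 64))
    (hm : Merging W w (timeOf s) (s.nat 64) (s.nat 65) o (s.nat 68 0) (s.nat 69 0) (s.nat 70 0)) :
    Runs mergeStep s 7 fun s' => Merging W w (timeOf s) (s.nat 64) (s'.nat 65) (o + 1)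
      (s'.nat 68 0) (s'.nat 69 0) (s'.nat 70 0) := by
  refine Runs.andThen (t₁ := 4) (t₂ := 3) (R := fun s' => s'.nat 64 = s.nat 64 ∧
    s'.nat 66 = s.nat 66 ∧ s'.nat 67 = s.nat 67 ∧ s'.real = s.real ∧
    Merging W w (timeOf s) (s.nat 64) (s'.nat 65) o (s'.nat 68 0) (s'.nat 69 0) (s'.nat 70 0) ∧
      o < s'.nat 68 0 + 2 * w)
    (Runs.ite (fun h => Runs.straight rfl (Nat.zero_le 3) ?_) fun h => Runs.straight rfl le_rfl ?_)
    le_rfl ?_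
  · simp only [Test.holds_nlt, NExpr.eval, h66, h67] at h
    exact ⟨rfl, rfl, rfl, rfl, hm, by simp only [Prog.run]; omega⟩
  · simp only [Test.holds_nlt, NExpr.eval, h66, h67, not_lt] at h
    refine ⟨by simp [Prog.run, Store.writeN], by simp [Prog.run, Store.writeN],
      by simp [Prog.run, Store.writeN], rfl, ?_, ?_⟩
    · have := hm.reset hW (by omega) ho
      simpa [Prog.run, Store.writeN, NExpr.eval, h66, h67] using this
    · simp [Prog.run, Store.writeN, NExpr.eval, h67, hw]
  · rintro s₁ - ⟨e64, e66, e67, eR, hm', hlt⟩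
    have hK : timeOf s₁ = timeOf s := by funext i; simp [timeOf, eR]
    generalize hb : s₁.nat 68 0 = b at *
    generalize hi : s₁.nat 69 0 = i at *
    generalize hj : s₁.nat 70 0 = j at *
    have hlater := holds_laterTest hi hj
    rw [hK, e64] at hlater
    have hsum := hm'.sum
    have hile := hm'.i_le
    refine Runs.ite (fun h => Runs.straight rfl le_rfl ?_) fun h => Runs.straight rfl le_rfl ?_
    · rw [Test.holds_and, Test.holds_or, Test.holds_not, Test.holds_not, hlater, not_lt] at h
      simp only [Test.holds_nlt, NExpr.eval, e66, h66, hb, hi, hj] at h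
      have e68 : ((Prog.seq (.setN 65 (nv 67) (.cell 64 (nv 69))) (incr 69)).run s₁).nat 68 0 =
          b := by simp [Prog.run, Store.writeN, hb]
      rw [e68]
      refine hm'.write hf hw hlt (y := i) (Or.inl ⟨rfl, h.1, ?_, ?_, fun hj => ?_⟩) (fun x hx => ?_)
        ?_
      · simp [Prog.run, Store.writeN, NExpr.eval, hi]
      · simp [Prog.run, Store.writeN, hj]
      · exact h.2.resolve_left (fun hc => hc (by omega))
      · simp [Prog.run, Store.writeN, NExpr.eval, e67, h67, hx.ne]
      · simp [Prog.run, Store.writeN, NExpr.eval, e67, h67, hi, e64]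
    · rw [Test.holds_and, Test.holds_or, Test.holds_not, Test.holds_not, hlater, not_lt] at h
      simp only [Test.holds_nlt, NExpr.eval, e66, h66, hb, hi, hj] at h
      have hj' : j < b + 2 * w := by
        by_contra hc
        have h' : i < b + w := by have := hm'.j_le; omega
        exact h ⟨h', Or.inl (by omega)⟩
      have e68 : ((Prog.seq (.setN 65 (nv 67) (.cell 64 (nv 70))) (incr 70)).run s₁).nat 68 0 =
          b := by simp [Prog.run, Store.writeN, hb]
      rw [e68]
      refine hm'.write hf hw hlt (y := j) (Or.inr ⟨rfl, hj', ?_, ?_, fun hi => ?_⟩) (fun x hx => ?_)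
        ?_
      · simp [Prog.run, Store.writeN, hi]
      · simp [Prog.run, Store.writeN, NExpr.eval, hj]
      · by_contra hc
        exact h ⟨hi, Or.inr (not_le.1 hc).le⟩
      · simp [Prog.run, Store.writeN, NExpr.eval, e67, h67, hx.ne]
      · simp [Prog.run, Store.writeN, NExpr.eval, e67, h67, hj, e64]

/-- Merge the blocks of the order in array `64`. -/
abbrev mergePass : Prog :=
  .seq (.setN 68 (.const 0) (.const 0))
  (.seq (.setN 69 (.const 0) (.const 0))
  (.seq (.setN 70 (.const 0) (nv 66))
  (.seq (forLoop 67 (nv 63) mergeStep) (forLoop 67 (nv 63) (.setN 64 (nv 67) (.cell 65 (nv 67)))))))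

theorem timeOf_congr {s s' : Store} (h30 : s'.real 30 = s.real 30) (h31 : s'.real 31 = s.real 31)
    (h32 : s'.real 32 = s.real 32) : timeOf s' = timeOf s := by
  funext i; simp [timeOf, h30, h31, h32]

theorem runs_mergePass {W w : ℕ} {s : Store} (hw : 0 < w) (hW : 2 * w ∣ W) (hWle : 2 * w ≤ W)
    (h63 : s.nat 63 0 = W) (h66 : s.nat 66 0 = w) (hf : BlockSorted W w (timeOf s) (s.nat 64)) :
    Runs mergePass s (12 * W + 7) fun s' => BlockSorted W (2 * w) (timeOf s) (s'.nat 64) ∧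
      ∀ i, W ≤ i → s'.nat 64 i = s.nat 64 i := by
  refine Runs.andThen (t₁ := 1) (t₂ := 12 * W + 6) (R := fun s' => s' = s.writeN 68 0 0)
    (Runs.straight rfl le_rfl rfl) (by omega) ?_
  rintro s₁ hs₁ rfl
  refine Runs.andThen (t₁ := 1) (t₂ := 12 * W + 5)
    (R := fun s' => s' = (s.writeN 68 0 0).writeN 69 0 0)
    (Runs.straight rfl le_rfl rfl) (by omega) ?_
  rintro s₁ hs₂ rfl
  refine Runs.andThen (t₁ := 1) (t₂ := 12 * W + 4)
    (R := fun s' => s' = ((s.writeN 68 0 0).writeN 69 0 0).writeN 70 0 w)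
    (Runs.straight rfl le_rfl (by simp [Prog.run, NExpr.eval, Store.writeN_nat, h66])) (by omega) ?_
  rintro s₁ hs₃ rfl
  set s₀ := ((s.writeN 68 0 0).writeN 69 0 0).writeN 70 0 w with hs₀
  have e63 : s₀.nat 63 0 = W := by simp [hs₀, Store.writeN_nat, h63]
  have e66 : s₀.nat 66 0 = w := by simp [hs₀, Store.writeN_nat, h66]
  have e64 : s₀.nat 64 = s.nat 64 := by simp [hs₀, Store.writeN]
  have hK₀ : timeOf s₀ = timeOf s := rfl
  have hall : ∀ s₁, SameOff (forLoop 67 (nv 63) mergeStep) s₀ s₁ → s₁.nat 63 0 = W ∧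
      s₁.nat 66 0 = w ∧ s₁.nat 64 = s.nat 64 ∧ timeOf s₁ = timeOf s := by
    intro s₁ h
    refine ⟨?_, ?_, ?_, ?_⟩
    · rw [h.nat 63 (by simp [Prog.wN]), e63]
    · rw [h.nat 66 (by simp [Prog.wN]), e66]
    · rw [h.nat 64 (by simp [Prog.wN]), e64]
    · rw [timeOf_congr (h.real 30 (by simp [Prog.wR])) (h.real 31 (by simp [Prog.wR]))
        (h.real 32 (by simp [Prog.wR])), hK₀]
  refine Runs.andThen (t₁ := W * (7 + 2) + 2) (t₂ := W * (1 + 2) + 2)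
    (Runs.for (n := W) (fun o s' => Merging W w (timeOf s) (s.nat 64) (s'.nat 65) o
      (s'.nat 68 0) (s'.nat 69 0) (s'.nat 70 0)) (by simp [Prog.wN]) (fun s₁ hs₁ => ?_) ?_ ?_)
    (by omega) ?_
  · exact (hall s₁ hs₁).1
  · have := Merging.zero (timeOf s) (s.nat 64) (s.nat 65) hWle
    simpa [hs₀, Store.writeN] using this
  · intro o s₁ ho hs₁ hc hinv
    obtain ⟨-, a2, a3, a4⟩ := hall s₁ hs₁
    rw [← a3, ← a4] at hinv
    refine (runs_mergeStep hw hW ho a2 hc (by rw [a3, a4]; exact hf) hinv).mono le_rfl ?_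
    intro s₂ _ h
    rw [a3, a4] at h
    simpa [Store.writeN] using h
  · intro s₁ hs₁ hm
    obtain ⟨a1, a2, a3, a4⟩ := hall s₁ hs₁
    have hsorted := hm.blockSorted hf
    refine (Runs.for (n := W) (tA := 1) (fun o s' => (∀ i < o, s'.nat 64 i = s₁.nat 65 i) ∧
      ∀ i, o ≤ i → s'.nat 64 i = s.nat 64 i) (by simp [Prog.wN]) (fun s₂ hs₂ => ?_) ?_ ?_).mono
      le_rfl ?_
    · simp only [NExpr.eval]
      rw [hs₂.nat 63 (by simp [Prog.wN]), a1]
    · exact ⟨fun i hi => absurd hi (Nat.not_lt_zero i), fun i _ => by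
        rw [Store.writeN_nat_ne _ _ _ (by decide), a3]⟩
    · intro o s₂ ho hs₂ hc ⟨i1, i2⟩
      refine Runs.straight rfl le_rfl ?_
      have e65 := hs₂.nat 65 (by simp [Prog.wN])
      refine ⟨fun i hi => ?_, fun i hi => ?_⟩
      · rcases Nat.lt_succ_iff_lt_or_eq.1 hi with hi | rfl
        · simp [Prog.run, NExpr.eval, Store.writeN_nat, hc, hi.ne, i1 i hi]
        · simp [Prog.run, NExpr.eval, Store.writeN_nat, hc, e65]
      · have : i ≠ o := by omega
        simp [Prog.run, NExpr.eval, Store.writeN_nat, hc, this, i2 i (by omega)]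
    · rintro s₂ - ⟨h1, h2⟩
      exact ⟨hsorted.congr h1, h2⟩

/-- Sort the pairs in array `64` by their times. -/
abbrev sortPairs : Prog :=
  .seq (.setN 66 (.const 0) (.const 1))
    (.loop (.nlt (nv 66) (nv 63))
      (.seq mergePass (.setN 66 (.const 0) (.add (nv 66) (nv 66)))))

/-- The block length doubles in each of the `d` passes; the potential is the number of passes still
to come times the cost of one pass. -/
theorem runs_sortPairs {d : ℕ} {s : Store} (h63 : s.nat 63 0 = 2 ^ d)
    (h64 : ∀ i, s.nat 64 i = if i < 2 ^ d then i else 0) :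
    Runs sortPairs s (d * (12 * 2 ^ d + 9) + 2) fun s' =>
      BlockSorted (2 ^ d) (2 ^ d) (timeOf s') (s'.nat 64) ∧ ∀ i, 2 ^ d ≤ i → s'.nat 64 i = 0 := by
  refine Runs.andThen (t₁ := 1) (t₂ := d * (12 * 2 ^ d + 9) + 1)
    (R := fun s' => s' = s.writeN 66 0 1) (Runs.straight rfl le_rfl rfl) (by omega) ?_
  rintro s₀ hs₀ rfl
  have e63 : (s.writeN 66 0 1).nat 63 0 = 2 ^ d := by simp [Store.writeN_nat, h63]
  refine (Runs.loop (fun s' => ∃ e ≤ d, s'.nat 66 0 = 2 ^ e ∧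
    BlockSorted (2 ^ d) (2 ^ e) (timeOf s') (s'.nat 64) ∧ ∀ i, 2 ^ d ≤ i → s'.nat 64 i = 0)
    (fun s' => (d - Nat.log 2 (s'.nat 66 0)) * (12 * 2 ^ d + 9))
    ⟨0, Nat.zero_le d, by simp [Store.writeN_nat], ?_, fun i hi => ?_⟩ ?_).mono ?_ ?_
  · have hlt : ∀ x < 2 ^ d, (s.writeN 66 0 1).nat 64 x = x := fun x hx => by
      simp [Store.writeN_nat, h64, hx]
    refine ⟨fun x hx => by rwa [hlt x hx], fun x hx y hy e => by rwa [hlt x hx, hlt y hy] at e,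
      fun x y _ _ e => ?_⟩
    simp only [pow_zero, Nat.div_one] at e
    rw [e]
  · simp [Store.writeN_nat, h64, not_lt.2 hi]
  · rintro s₁ hs₁ ⟨e, he, h1, h2, h3⟩ hb
    have a63 : s₁.nat 63 0 = 2 ^ d := by rw [hs₁.nat 63 (by simp [Prog.wN]), e63]
    simp only [Test.holds_nlt, NExpr.eval, h1, a63] at hb
    have hed : e < d := (Nat.pow_lt_pow_iff_right (by decide)).1 hb
    have h2e : 2 * 2 ^ e = 2 ^ (e + 1) := by ring
    refine ⟨12 * 2 ^ d + 8, Runs.andThen (t₂ := 1) (runs_mergePass (by positivity)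
      (by rw [h2e]; exact pow_dvd_pow 2 hed) (by rw [h2e]; exact Nat.pow_le_pow_right (by decide) hed)
      a63 h1 h2) (by omega) ?_⟩
    rintro s₂ hs₂ ⟨k1, k2⟩
    have hK : timeOf s₂ = timeOf s₁ := timeOf_congr (hs₂.real 30 (by simp [Prog.wR]))
      (hs₂.real 31 (by simp [Prog.wR])) (hs₂.real 32 (by simp [Prog.wR]))
    have a66 : s₂.nat 66 0 = 2 ^ e := by rw [hs₂.nat 66 (by simp [Prog.wN]), h1]
    have hrun : (Prog.setN 66 (.const 0) (.add (nv 66) (nv 66))).run s₂ =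
        s₂.writeN 66 0 (2 ^ (e + 1)) := by
      simp [Prog.run, NExpr.eval, a66, pow_succ, mul_two]
    refine Runs.straight rfl le_rfl ?_
    rw [hrun]
    refine ⟨⟨e + 1, hed, by simp [Store.writeN_nat], ?_, fun i hi => ?_⟩, ?_⟩
    · rw [← h2e, Store.writeN_nat_ne _ _ _ (by decide)]
      exact hK ▸ k1
    · rw [Store.writeN_nat_ne _ _ _ (by decide), k2 i hi, h3 i hi]
    · have e1 : (s₂.writeN 66 0 (2 ^ (e + 1))).nat 66 0 = 2 ^ (e + 1) := by simp [Store.writeN_nat]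
      simp only [e1, h1, Nat.log_pow (by decide : 1 < 2)]
      obtain ⟨k, rfl⟩ : ∃ k, d = e + 1 + k := ⟨d - (e + 1), by omega⟩
      rw [show e + 1 + k - (e + 1) = k by omega, show e + 1 + k - e = k + 1 by omega, Nat.add_mul]
      omega
  · simp [Store.writeN_nat]
  · rintro s₁ hs₁ ⟨⟨e, he, h1, h2, h3⟩, hb⟩
    have a63 : s₁.nat 63 0 = 2 ^ d := by rw [hs₁.nat 63 (by simp [Prog.wN]), e63]
    simp only [Test.holds_nlt, NExpr.eval, h1, a63, not_lt] at hb
    have : d ≤ e := (Nat.pow_le_pow_iff_right (by decide)).1 hb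
    obtain rfl : e = d := by omega
    exact ⟨h2, h3⟩

/-! ### The sequence of changes -/

theorem BlockSorted.exists_eq {α : Type*} [LinearOrder α] {W w : ℕ} {K : ℕ → α} {f : ℕ → ℕ}
    (h : BlockSorted W w K f) {y : ℕ} (hy : y < W) : ∃ x < W, f x = y := by
  have hinj : Function.Injective fun x : Fin W => (⟨f x, h.lt x x.2⟩ : Fin W) := fun x y e =>
    Fin.ext (h.inj x x.2 y y.2 (Fin.mk.inj_iff.1 e))
  obtain ⟨x, hx⟩ := (Finite.injective_iff_surjective.1 hinj) ⟨y, hy⟩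
  exact ⟨x, x.2, Fin.mk.inj_iff.1 hx⟩

/-- Only valid pairs matter. The padding, and all entries of the order beyond `W`, read a pair of a
line with itself, which is never valid. A number below `L²` determines its pair by quotient and
remainder, so a valid pair occurs once. The tie-breaking numbers are distinct since their absolute
values are `z + 1`. -/
theorem ordered_of_sorted {D : Kin} {s : Store} {W : ℕ}
    (hP : PairsTo D (D.L * D.L) s) (hW : D.L * D.L ≤ W)
    (hs : BlockSorted W W (timeOf s) (s.nat 64)) (h0 : ∀ i, W ≤ i → s.nat 64 i = 0)
    (hev : ∀ k, D.ev k = (s.nat 60 (s.nat 64 k), s.nat 61 (s.nat 64 k)))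
    (hc : ∀ z < D.L, D.c z = (z + 1 : ℕ) ∨ D.c z = -(z + 1 : ℕ)) : D.Ordered W := by
  have hlt : ∀ i, D.Valid (s.nat 60 i, s.nat 61 i) → i < D.L * D.L := by
    intro i hi
    by_contra hc
    obtain ⟨h1, h2⟩ := hP.ge i (not_lt.1 hc)
    rw [h1, h2] at hi
    exact D.not_valid_self 0 hi
  have hzero : ¬ D.Valid (s.nat 60 0, s.nat 61 0) := by
    intro h
    obtain ⟨h1, h2⟩ := hP.lt 0 (hlt 0 h)
    rw [h1, h2, Nat.zero_div, Nat.zero_mod] at h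
    exact D.not_valid_self 0 h
  have hbound : ∀ i, D.Valid (D.ev i) → i < W := by
    intro i hi
    by_contra hc
    rw [hev, h0 i (not_lt.1 hc)] at hi
    exact hzero hi
  refine ⟨fun x hx y hy e => ?_, fun i j hij hi hj => ?_, fun e he => ?_, fun i j hi e => ?_, hbound⟩
  · have hx' : (0 : ℝ) < (x + 1 : ℕ) := by positivity
    have hy' : (0 : ℝ) < (y + 1 : ℕ) := by positivity
    have : ((x + 1 : ℕ) : ℝ) = (y + 1 : ℕ) := by
      rcases hc x hx with h1 | h1 <;> rcases hc y hy with h2 | h2 <;> rw [h1, h2] at e <;> linarith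
    have := Nat.cast_injective this
    omega
  · have hjW := hbound j hj
    have := hs.sorted i j hij hjW (by rw [Nat.div_eq_of_lt hjW, Nat.div_eq_of_lt (by omega)])
    rw [hev] at hi hj
    unfold timeOf at this
    rw [hP.key _ hi, hP.key _ hj] at this
    rwa [hev, hev]
  · obtain ⟨x, y⟩ := e
    have hx : x < D.L := he.1
    have hy : y < D.L := he.2.1
    have hL : 0 < D.L := by omega
    have hi : D.L * x + y < D.L * D.L := by
      calc D.L * x + y < D.L * x + D.L := by omega
        _ = D.L * (x + 1) := by ring
        _ ≤ D.L * D.L := Nat.mul_le_mul_left _ hx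
    obtain ⟨k, -, hk⟩ := hs.exists_eq (hi.trans_le hW)
    refine ⟨k, ?_⟩
    obtain ⟨h1, h2⟩ := hP.lt _ hi
    rw [hev, hk, h1, h2, Nat.mul_add_div hL, Nat.div_eq_of_lt hy, Nat.add_zero, Nat.mul_add_mod,
      Nat.mod_eq_of_lt hy]
  · have hj : D.Valid (D.ev j) := e ▸ hi
    have hiW := hbound i hi
    have hjW := hbound j hj
    rw [hev] at hi hj
    obtain ⟨i1, i2⟩ := hP.lt _ (hlt _ hi)
    obtain ⟨j1, j2⟩ := hP.lt _ (hlt _ hj)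
    rw [hev, hev, Prod.mk.injEq, i1, i2, j1, j2] at e
    refine hs.inj i hiW j hjW ?_
    rw [← Nat.div_add_mod (s.nat 64 i) D.L, e.1, e.2, Nat.div_add_mod]

/-! ### Output of rectangles -/

theorem getD_append_singleton {α : Type*} (l : List α) (v d : α) (j : ℕ) :
    (l ++ [v]).getD j d = if j = l.length then v else l.getD j d := by
  rcases lt_trichotomy j l.length with h | rfl | h
  · rw [List.getD_append _ _ _ _ h, if_neg h.ne]
  · simp
  · rw [if_neg h.ne', List.getD_eq_default _ _ h.le, List.getD_eq_default]
    simp; omega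

/-- The four arrays that start with the array `k` of the copy number `g` list the coordinates of
the rectangles. -/
def RectsIn (g k : ℕ) (s : Store) (l : List Rect) : Prop :=
  ∀ j, s.nat (200 * (k + 1) + g) j = (l.map Rect.x₀).getD j 0 ∧
    s.nat (200 * (k + 2) + g) j = (l.map Rect.x₁).getD j 0 ∧
    s.nat (200 * (k + 3) + g) j = (l.map Rect.y₀).getD j 0 ∧
    s.nat (200 * (k + 4) + g) j = (l.map Rect.y₁).getD j 0

/-- Append a rectangle to a list; `cu` holds the length of the list. -/
abbrev emitRect (g k cu : ℕ) (e₀ e₁ e₂ e₃ : NExpr) : Prog :=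
  .seq (.setN (200 * (k + 1) + g) (nv cu) e₀)
  (.seq (.setN (200 * (k + 2) + g) (nv cu) e₁)
  (.seq (.setN (200 * (k + 3) + g) (nv cu) e₂)
  (.seq (.setN (200 * (k + 4) + g) (nv cu) e₃) (incr cu))))

/-- The expressions depend only on arrays below `200` and the output goes to arrays from `200` on,
so the four values do not disturb one another. -/
theorem runs_emitRect {g k cu : ℕ} {e₀ e₁ e₂ e₃ : NExpr} {s : Store} {l : List Rect} {R : Rect}
    (hcu : cu < 200) (hl : RectsIn g k s l) (hlen : s.nat cu 0 = l.length)
    (he : ∀ s' : Store, (∀ a < 200, s'.nat a = s.nat a) → e₀.eval s' = R.x₀ ∧ e₁.eval s' = R.x₁ ∧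
      e₂.eval s' = R.y₀ ∧ e₃.eval s' = R.y₁) :
    Runs (emitRect g k cu e₀ e₁ e₂ e₃) s 5 fun s' => RectsIn g k s' (l ++ [R]) ∧
      s'.nat cu 0 = (l ++ [R]).length := by
  refine Runs.straight rfl le_rfl ?_
  have d1 : ¬ cu = 200 * (k + 1) + g := by omega
  have d2 : ¬ cu = 200 * (k + 2) + g := by omega
  have d3 : ¬ cu = 200 * (k + 3) + g := by omega
  have d4 : ¬ cu = 200 * (k + 4) + g := by omega
  have hrun : (emitRect g k cu e₀ e₁ e₂ e₃).run s = ((((s.writeN (200 * (k + 1) + g) l.length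
      R.x₀).writeN (200 * (k + 2) + g) l.length R.x₁).writeN (200 * (k + 3) + g) l.length
      R.y₀).writeN (200 * (k + 4) + g) l.length R.y₁).writeN cu 0 (l.length + 1) := by
    have hsame : ∀ (s' : Store) (k' v : ℕ), (∀ a < 200, s'.nat a = s.nat a) → ∀ a < 200,
        (s'.writeN (200 * (k' + 1) + g) l.length v).nat a = s.nat a := by
      intro s' k' v h a ha
      rw [Store.writeN_nat_ne _ _ _ (by omega), h a ha]
    have h0 := he s fun _ _ => rfl
    have s1 := hsame s k R.x₀ fun _ _ => rfl
    have s2 := hsame _ (k + 1) R.x₁ s1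
    have s3 := hsame _ (k + 2) R.y₀ s2
    have s4 := hsame _ (k + 3) R.y₁ s3
    simp only [Nat.add_assoc, Nat.reduceAdd] at s2 s3 s4
    simp only [Prog.run, NExpr.eval, hlen, h0.1, s1 cu hcu, (he _ s1).2.1, s2 cu hcu,
      (he _ s2).2.2.1, s3 cu hcu, (he _ s3).2.2.2, s4 cu hcu]
  rw [hrun]
  refine ⟨fun j => ?_, by simp [Store.writeN_nat]⟩
  obtain ⟨h1, h2, h3, h4⟩ := hl j
  have n : ∀ a b, a ≠ b → ¬ 200 * (k + a) + g = 200 * (k + b) + g := fun a b h => by omega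
  simp only [List.map_append, List.map_cons, List.map_nil, getD_append_singleton, List.length_map,
    Store.writeN_nat]
  simp only [n 1 2 (by decide), n 1 3 (by decide), n 1 4 (by decide), n 2 1 (by decide),
    n 2 3 (by decide), n 2 4 (by decide), n 3 1 (by decide), n 3 2 (by decide), n 3 4 (by decide),
    n 4 1 (by decide), n 4 2 (by decide), n 4 3 (by decide), false_and, if_false, true_and,
    Ne.symm d1, Ne.symm d2, Ne.symm d3, Ne.symm d4, h1, h2, h3, h4, and_self]

/-- The arrays of the copy number `g` list the updates; array `72` holds their number. -/
structure UpdatesIn (g : ℕ) (s : Store) (l : List Update) : Prop where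
  flags : ∀ j, s.nat (1200 + g) j = (l.map Update.flag).getD j 0
  rects : RectsIn g 6 s (l.map Update.rect)
  length : s.nat 72 0 = l.length

/-- Append an update to the list. -/
abbrev emitUpdate (g fl : ℕ) (e₀ e₁ e₂ e₃ : NExpr) : Prog :=
  .seq (.setN (1200 + g) (nv 72) (.const fl)) (emitRect g 6 72 e₀ e₁ e₂ e₃)

theorem runs_emitUpdate {g fl : ℕ} {e₀ e₁ e₂ e₃ : NExpr} {s : Store} {l : List Update} {u : Update}
    (hl : UpdatesIn g s l) (hfl : u.flag = fl)
    (he : ∀ s' : Store, (∀ a < 200, s'.nat a = s.nat a) → e₀.eval s' = u.rect.x₀ ∧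
      e₁.eval s' = u.rect.x₁ ∧ e₂.eval s' = u.rect.y₀ ∧ e₃.eval s' = u.rect.y₁) :
    Runs (emitUpdate g fl e₀ e₁ e₂ e₃) s 6 fun s' => UpdatesIn g s' (l ++ [u]) := by
  obtain ⟨h1, h2, h3⟩ := hl
  refine Runs.andThen (t₁ := 1) (t₂ := 5) (R := fun s' => s' = s.writeN (1200 + g) l.length fl)
    (Runs.straight rfl le_rfl (by simp [Prog.run, NExpr.eval, h3])) le_rfl ?_
  rintro s₁ hs₁ rfl
  have hsame : ∀ a, a ≠ 1200 + g → (s.writeN (1200 + g) l.length fl).nat a = s.nat a :=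
    fun a ha => Store.writeN_nat_ne _ _ _ ha
  refine (runs_emitRect (l := l.map Update.rect) (R := u.rect) (by decide) (fun j => ?_) ?_
    fun s' hs' => ?_).mono le_rfl ?_
  · rw [hsame _ (by omega), hsame _ (by omega), hsame _ (by omega), hsame _ (by omega)]
    exact h2 j
  · rw [hsame _ (by omega), h3, List.length_map]
  · exact he s' fun a ha => by rw [hs' a ha, hsame a (by omega)]
  · rintro s₂ hs₂ ⟨k1, k2⟩
    refine ⟨fun j => ?_, by simpa using k1, by simpa using k2⟩
    rw [hs₂.nat _ (by simp [Prog.wN]; omega), List.map_append, List.map_cons, List.map_nil,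
      getD_append_singleton, List.length_map, ← h1 j, hfl]
    simp [Store.writeN_nat]

/-! ### The updates for one change -/

/-- The arrays that may be overwritten while the instance number `g` is set up and solved. -/
def Scratch (g a : ℕ) : Prop := a = 50 ∨ (71 ≤ a ∧ a ≤ 80) ∨ (200 ≤ a ∧ a % 200 = g)

/-- The data from which the instances are made. -/
structure Setup (D : Kin) (m n E e : ℕ) (s : Store) : Prop where
  m_eq : s.nat 40 0 = m
  L_eq : s.nat 41 0 = D.L
  base : ∀ z < D.L, s.nat 45 z = 4 * (z / 4)
  c₁ : s.nat 51 0 = D.clsCount 1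
  c₂ : s.nat 52 0 = D.clsCount 2
  c₄ : s.nat 53 0 = D.clsCount 4
  c₅ : s.nat 54 0 = D.clsCount 5
  n_eq : s.nat 55 0 = n
  E_eq : s.nat 58 0 = E
  e_eq : s.nat 59 0 = e
  ev : ∀ k, D.ev k = (s.nat 60 (s.nat 64 k), s.nat 61 (s.nat 64 k))
  valid : ∀ k, 0 < s.real 30 (s.nat 64 k) ↔ D.Valid (D.ev k)
  key : ∀ k, D.Valid (D.ev k) → s.real 30 (s.nat 64 k) = (ofLex (D.key (D.ev k))).1

theorem Setup.step {D : Kin} {m n E e g : ℕ} {s s' : Store} (h : Setup D m n E e s) {A : Prog}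
    (hs : SameOff A s s') (hN : ∀ a ∈ A.wN, Scratch g a) (hR : 30 ∉ A.wR) :
    Setup D m n E e s' := by
  have hn : ∀ a, a < 200 → a ≠ 50 → (a < 71 ∨ 80 < a) → s'.nat a = s.nat a :=
    fun a h1 h2 h3 => hs.nat a fun ha => by
      have := hN a ha
      unfold Scratch at this
      omega
  obtain ⟨h1, h2, h3, h4, h5, h6, h7, h8, h9, h10, h11, h12, h13⟩ := h
  have e30 := hs.real 30 hR
  have e60 := hn 60 (by decide) (by decide) (by decide)
  have e61 := hn 61 (by decide) (by decide) (by decide)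
  have e64 := hn 64 (by decide) (by decide) (by decide)
  constructor
  · rwa [hn _ (by decide) (by decide) (by decide)]
  · rwa [hn _ (by decide) (by decide) (by decide)]
  · rwa [hn _ (by decide) (by decide) (by decide)]
  · rwa [hn _ (by decide) (by decide) (by decide)]
  · rwa [hn _ (by decide) (by decide) (by decide)]
  · rwa [hn _ (by decide) (by decide) (by decide)]
  · rwa [hn _ (by decide) (by decide) (by decide)]
  · rwa [hn _ (by decide) (by decide) (by decide)]
  · rwa [hn _ (by decide) (by decide) (by decide)]
  · rwa [hn _ (by decide) (by decide) (by decide)]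
  · rwa [e60, e61, e64]
  · rwa [e30, e64]
  · rwa [e30, e64]

/-- Array `50` holds the ranks of the lines after `k` changes. -/
def PosIn (D : Kin) (k : ℕ) (s : Store) : Prop := ∀ z < D.L, s.nat 50 z = D.pos k z

theorem RectsIn.congr {g k : ℕ} {s s' : Store} {l : List Rect} (h : RectsIn g k s l)
    (hs : ∀ i, 1 ≤ i → i ≤ 4 → s'.nat (200 * (k + i) + g) = s.nat (200 * (k + i) + g)) :
    RectsIn g k s' l := by
  intro j
  rw [hs 1 (by decide) (by decide), hs 2 (by decide) (by decide), hs 3 (by decide) (by decide),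
    hs 4 (by decide) (by decide)]
  exact h j

theorem UpdatesIn.congr {g : ℕ} {s s' : Store} {l : List Update} (h : UpdatesIn g s l)
    (hs : ∀ i, 6 ≤ i → s'.nat (200 * i + g) = s.nat (200 * i + g)) (h72 : s'.nat 72 = s.nat 72) :
    UpdatesIn g s' l := by
  obtain ⟨h1, h2, h3⟩ := h
  exact ⟨by rwa [hs 6 (by decide)], h2.congr fun i h1 h4 => hs _ (by omega), by rwa [h72]⟩

/-- The state while the updates for the change of the lines `x` and `y` are made. -/
structure Changing (D : Kin) (m n E e g k x y : ℕ) (l : List Update) (s : Store) : Prop where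
  setup : Setup D m n E e s
  pos : PosIn D k s
  updates : UpdatesIn g s l
  x_eq : s.nat 78 0 = x
  y_eq : s.nat 79 0 = y

/-- The rank of the side number `i` of the rectangle that contains a line. -/
abbrev sideRank (v i : ℕ) : NExpr := .cell 50 (.add (.cell 45 (nv v)) (.const i))

/-- Append an update with the rectangle that contains a line. -/
abbrev emitLine (g fl v : ℕ) : Prog :=
  emitUpdate g fl (sideRank v 0) (sideRank v 1) (sideRank v 2) (sideRank v 3)

/-- Let the lines change places. -/
abbrev changeUp : Prog :=
  .seq (.setN 50 (nv 78) (.add (.cell 50 (nv 78)) (.const 1)))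
    (.setN 50 (nv 79) (.sub (.cell 50 (nv 79)) (.const 1)))

/-- Undo the change. -/
abbrev changeDown : Prog :=
  .seq (.setN 50 (nv 79) (.add (.cell 50 (nv 79)) (.const 1)))
    (.setN 50 (nv 78) (.sub (.cell 50 (nv 78)) (.const 1)))

theorem runs_emitChanging {D : Kin} {m n E e g k x y fl : ℕ} {l : List Update} {s : Store}
    (h : Changing D m n E e g k x y l s) (hg : g < 200) {u : Update} (hfl : u.flag = fl)
    {e₀ e₁ e₂ e₃ : NExpr}
    (he : ∀ s' : Store, (∀ a < 200, s'.nat a = s.nat a) → e₀.eval s' = u.rect.x₀ ∧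
      e₁.eval s' = u.rect.x₁ ∧ e₂.eval s' = u.rect.y₀ ∧ e₃.eval s' = u.rect.y₁) :
    Runs (emitUpdate g fl e₀ e₁ e₂ e₃) s 6 (Changing D m n E e g k x y (l ++ [u])) := by
  refine (runs_emitUpdate h.updates hfl he).mono le_rfl fun s' hs' hu => ?_
  refine ⟨h.setup.step (g := g) hs' ?_ (by simp [Prog.wR]), fun z hz => ?_, hu, ?_, ?_⟩
  · intro a ha
    simp only [Prog.wN, List.mem_append, List.mem_singleton] at ha
    unfold Scratch
    omega
  · rw [hs'.nat 50 (by simp [Prog.wN]; omega)]; exact h.pos z hz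
  · rw [hs'.nat 78 (by simp [Prog.wN]; omega)]; exact h.x_eq
  · rw [hs'.nat 79 (by simp [Prog.wN]; omega)]; exact h.y_eq

theorem sideRank_eval {D : Kin} {m n E e k z v : ℕ} {s s' : Store} (hS : Setup D m n E e s)
    (hP : PosIn D k s) (hL : D.L = 4 * m) (hz : z < D.L) (hv : s.nat v 0 = z) (hv' : v < 200)
    (hs : ∀ a < 200, s'.nat a = s.nat a) {i : ℕ} (hi : i < 4) :
    (sideRank v i).eval s' = D.pos k (4 * (z / 4) + i) := by
  simp only [NExpr.eval, hs 50 (by decide), hs 45 (by decide), hs v hv', hv, hS.base z hz]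
  exact hP _ (by omega)

theorem runs_emitLine {D : Kin} {m n E e g k x y fl v z : ℕ} {l : List Update} {s : Store}
    (h : Changing D m n E e g k x y l s) (hg : g < 200) (hL : D.L = 4 * m) (hz : z < D.L)
    (hv : s.nat v 0 = z) (hv' : v < 200) {u : Update} (hfl : u.flag = fl)
    (hu : u.rect = Kin.rectOf (D.pos k) (z / 4)) :
    Runs (emitLine g fl v) s 6 (Changing D m n E e g k x y (l ++ [u])) := by
  refine runs_emitChanging h hg hfl fun s' hs' => ?_
  rw [hu]
  exact ⟨sideRank_eval h.setup h.pos hL hz hv hv' hs' (by decide),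
    sideRank_eval h.setup h.pos hL hz hv hv' hs' (by decide),
    sideRank_eval h.setup h.pos hL hz hv hv' hs' (by decide),
    sideRank_eval h.setup h.pos hL hz hv hv' hs' (by decide)⟩

theorem Changing.of_ranks {D : Kin} {m n E e g k k' x y : ℕ} {l : List Update} {s s' : Store}
    (h : Changing D m n E e g k x y l s) {A : Prog} (hs : SameOff A s s')
    (hN : ∀ a ∈ A.wN, a = 50) (hR : A.wR = []) (hp : PosIn D k' s') :
    Changing D m n E e g k' x y l s' := by
  have hn : ∀ a ≠ 50, s'.nat a = s.nat a := fun a ha => hs.nat a fun h => ha (hN a h)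
  exact ⟨h.setup.step (g := g) hs (fun a ha => Or.inl (hN a ha)) (by simp [hR]), hp,
    h.updates.congr (fun i hi => hn _ (by omega)) (hn _ (by decide)),
    by rw [hn _ (by decide), h.x_eq], by rw [hn _ (by decide), h.y_eq]⟩

theorem runs_changeUp {D : Kin} {m n E e g k x y : ℕ} {l : List Update} {s : Store}
    (h : Changing D m n E e g k x y l s) (hev : D.ev k = (x, y)) (hv : D.Valid (x, y)) :
    Runs changeUp s 2 (Changing D m n E e g (k + 1) x y l) := by
  have hxy : x ≠ y := by rintro rfl; exact D.not_valid_self _ hv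
  refine (Runs.straight (Q := PosIn D (k + 1)) rfl le_rfl fun z hz => ?_).mono le_rfl
    fun s' hs' hp => h.of_ranks hs' (by simp [Prog.wN]) rfl hp
  have hx := h.pos x hv.1
  have hy := h.pos y hv.2.1
  have hz' := h.pos z hz
  simp only [Prog.run, NExpr.eval, Store.writeN_nat, h.x_eq, h.y_eq, Nat.reduceEqDiff, false_and,
    if_false, true_and, hx, hy, hz', hxy.symm, Kin.pos, hev, hv, if_true]
  by_cases h1 : z = y
  · subst h1; simp [hxy.symm]
  · by_cases h2 : z = x
    · subst h2; simp [h1]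
    · simp [h1, h2]

/-- The truncated subtraction in the change is undone by an addition because every rank is at least
`1`. -/
theorem runs_changeDown {D : Kin} {W m n E e g k x y : ℕ} {l : List Update} {s : Store}
    (hD : D.Ordered W) (h : Changing D m n E e g (k + 1) x y l s) (hev : D.ev k = (x, y))
    (hv : D.Valid (x, y)) : Runs changeDown s 2 (Changing D m n E e g k x y l) := by
  have hxy : x ≠ y := by rintro rfl; exact D.not_valid_self _ hv
  refine (Runs.straight (Q := PosIn D k) rfl le_rfl fun z hz => ?_).mono le_rfl
    fun s' hs' hp => h.of_ranks hs' (by simp [Prog.wN]) rfl hp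
  have hx := h.pos x hv.1
  have hy := h.pos y hv.2.1
  have hz' := h.pos z hz
  have h1 : 1 ≤ D.pos k y := hD.one_le_pos k hv.2.1
  simp only [Kin.pos, hev, hv, if_true, hxy.symm, if_false] at hx hy hz'
  simp only [Prog.run, NExpr.eval, Store.writeN_nat, h.x_eq, h.y_eq, Nat.reduceEqDiff, false_and,
    if_false, true_and, hx, hy, hz', hxy]
  by_cases h1 : z = y
  · subst h1; simp only [hxy.symm, if_false, if_true]; omega
  · by_cases h2 : z = x
    · subst h2; simp
    · simp [h1, h2]

/-- Append the four updates for the change whose number is in array `76`; array `77` records the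
index of the change for each of them. -/
abbrev emitQuad (g : ℕ) : Prog :=
  .seq (.seq (.setN 75 (.const 0) (.cell 64 (nv 76)))
  (.seq (.setN 77 (nv 72) (nv 75))
  (.seq (.setN 77 (.add (nv 72) (.const 1)) (nv 75))
  (.seq (.setN 77 (.add (nv 72) (.const 2)) (nv 75))
  (.seq (.setN 77 (.add (nv 72) (.const 3)) (nv 75))
  (.seq (.setN 78 (.const 0) (.cell 60 (nv 75)))
  (.setN 79 (.const 0) (.cell 61 (nv 75)))))))))
  (.seq (.ite (.rlt (.cast (.const 0)) (.cell 30 (nv 75)))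
    (.seq changeUp (.seq (emitLine g 1 78) (.seq (emitLine g 1 79)
      (.seq changeDown (.seq (emitLine g 0 78) (.seq (emitLine g 0 79) changeUp))))))
    (.seq (emitUpdate g 1 (.const 1) (.const 1) (.const 1) (.const 1))
      (.seq (emitUpdate g 1 (.const 1) (.const 1) (.const 1) (.const 2))
      (.seq (emitUpdate g 0 (.const 1) (.const 1) (.const 1) (.const 1))
        (emitUpdate g 0 (.const 1) (.const 1) (.const 1) (.const 2))))))
  (incr 76))

/-- The additions use the new ranks and the deletions the old ones. Going forth, back and forth
again avoids keeping two copies of the ranks. -/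
theorem runs_quadUpdates {D : Kin} {W m n E e g k x y : ℕ} {l : List Update} {s : Store}
    (hD : D.Ordered W) (hL : D.L = 4 * m) (hg : g < 200) (h : Changing D m n E e g k x y l s)
    (hev : D.ev k = (x, y)) (hv : D.Valid (x, y)) :
    Runs (.seq changeUp (.seq (emitLine g 1 78) (.seq (emitLine g 1 79)
      (.seq changeDown (.seq (emitLine g 0 78) (.seq (emitLine g 0 79) changeUp)))))) s 30
      (Changing D m n E e g (k + 1) x y (l ++ D.quad k)) := by
  refine Runs.andThen (t₂ := 28) (runs_changeUp h hev hv) le_rfl fun s₁ _ h => ?_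
  refine Runs.andThen (t₂ := 22) (runs_emitLine h hg hL hv.1 h.x_eq (by decide)
    (u := .add (Kin.rectOf (D.pos (k + 1)) (x / 4))) rfl rfl) le_rfl fun s₂ _ h => ?_
  refine Runs.andThen (t₂ := 16) (runs_emitLine h hg hL hv.2.1 h.y_eq (by decide)
    (u := .add (Kin.rectOf (D.pos (k + 1)) (y / 4))) rfl rfl) le_rfl fun s₃ _ h => ?_
  refine Runs.andThen (t₂ := 14) (runs_changeDown hD h hev hv) le_rfl fun s₄ _ h => ?_
  refine Runs.andThen (t₂ := 8) (runs_emitLine h hg hL hv.1 h.x_eq (by decide)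
    (u := .delete (Kin.rectOf (D.pos k) (x / 4))) rfl rfl) le_rfl fun s₅ _ h => ?_
  refine Runs.andThen (t₂ := 2) (runs_emitLine h hg hL hv.2.1 h.y_eq (by decide)
    (u := .delete (Kin.rectOf (D.pos k) (y / 4))) rfl rfl) le_rfl fun s₆ _ h => ?_
  refine (runs_changeUp h hev hv).mono le_rfl fun s₇ _ h => ?_
  have hq : D.quad k = [.add (Kin.rectOf (D.pos (k + 1)) (x / 4)),
      .add (Kin.rectOf (D.pos (k + 1)) (y / 4)), .delete (Kin.rectOf (D.pos k) (x / 4)),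
      .delete (Kin.rectOf (D.pos k) (y / 4))] := by
    unfold Kin.quad; rw [hev, if_pos hv]
  rw [hq]
  simpa only [List.append_assoc, List.cons_append, List.nil_append] using h

theorem runs_dummyUpdates {D : Kin} {m n E e g k x y : ℕ} {l : List Update} {s : Store}
    (hg : g < 200) (h : Changing D m n E e g k x y l s) (hv : ¬ D.Valid (D.ev k)) :
    Runs (.seq (emitUpdate g 1 (.const 1) (.const 1) (.const 1) (.const 1))
      (.seq (emitUpdate g 1 (.const 1) (.const 1) (.const 1) (.const 2))
      (.seq (emitUpdate g 0 (.const 1) (.const 1) (.const 1) (.const 1))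
        (emitUpdate g 0 (.const 1) (.const 1) (.const 1) (.const 2))))) s 24
      (Changing D m n E e g (k + 1) x y (l ++ D.quad k)) := by
  refine Runs.andThen (t₂ := 18) (runs_emitChanging h hg (u := .add Kin.dummy₁) rfl
    fun _ _ => ⟨rfl, rfl, rfl, rfl⟩) le_rfl fun s₁ _ h => ?_
  refine Runs.andThen (t₂ := 12) (runs_emitChanging h hg (u := .add Kin.dummy₂) rfl
    fun _ _ => ⟨rfl, rfl, rfl, rfl⟩) le_rfl fun s₂ _ h => ?_
  refine Runs.andThen (t₂ := 6) (runs_emitChanging h hg (u := .delete Kin.dummy₁) rfl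
    fun _ _ => ⟨rfl, rfl, rfl, rfl⟩) le_rfl fun s₃ _ h => ?_
  refine (runs_emitChanging h hg (u := .delete Kin.dummy₂) rfl
    fun _ _ => ⟨rfl, rfl, rfl, rfl⟩).mono le_rfl fun s₄ _ h => ?_
  have hq : D.quad k = [.add Kin.dummy₁, .add Kin.dummy₂, .delete Kin.dummy₁,
      .delete Kin.dummy₂] := by
    unfold Kin.quad; rw [if_neg hv]
  obtain ⟨h1, h2, h3, h4, h5⟩ := h
  refine ⟨h1, fun z hz => ?_, ?_, h4, h5⟩
  · rw [h2 z hz]; simp [Kin.pos, hv]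
  · rw [hq]
    simpa only [List.append_assoc, List.cons_append, List.nil_append] using h3

/-- The state after the updates for `i` changes, starting from the change number `c`. -/
structure Emitted (D : Kin) (m n E e g c i : ℕ) (s : Store) : Prop where
  setup : Setup D m n E e s
  pos : PosIn D (c + i) s
  updates : UpdatesIn g s (D.quads c i)
  count : s.nat 76 0 = c + i
  source : ∀ j < 4 * i, s.nat 77 j = s.nat 64 (c + j / 4)

theorem runs_emitQuad {D : Kin} {W m n E e g c i : ℕ} {s : Store} (hD : D.Ordered W)
    (hL : D.L = 4 * m) (hg : g < 200) (h : Emitted D m n E e g c i s) :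
    Runs (emitQuad g) s 39 (Emitted D m n E e g c (i + 1)) := by
  obtain ⟨h1, h2, h3, h4, h5⟩ := h
  have hlen : s.nat 72 0 = 4 * i := by rw [h3.length, Kin.length_quads]
  obtain ⟨x, y, hev⟩ : ∃ x y, D.ev (c + i) = (x, y) := ⟨_, _, rfl⟩
  have hxy := h1.ev (c + i)
  rw [hev, Prod.mk.injEq] at hxy
  refine Runs.andThen (t₁ := 7) (t₂ := 32) (R := fun s' => s'.nat 75 0 = s.nat 64 (c + i) ∧
    s'.nat 78 0 = x ∧ s'.nat 79 0 = y ∧ ∀ j < 4 * (i + 1), s'.nat 77 j = s.nat 64 (c + j / 4))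
    (Runs.straight rfl le_rfl ?_) le_rfl ?_
  · simp only [Prog.run, NExpr.eval, Store.writeN_nat, Nat.reduceEqDiff, false_and, if_false,
      and_self, if_true, true_and, h4, hlen, hxy]
    intro j hj
    split_ifs with e1 e2 e3 e4
    · congr 1; omega
    · congr 1; omega
    · congr 1; omega
    · congr 1; omega
    · exact h5 j (by omega)
  rintro s₁ hs₁ ⟨j75, j78, j79, j77⟩
  have hk : Changing D m n E e g (c + i) x y (D.quads c i) s₁ := by
    refine ⟨h1.step (g := g) hs₁ ?_ (by simp [Prog.wR]), fun z hz => ?_, h3.congr (fun a ha =>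
      hs₁.nat _ ?_) (hs₁.nat _ (by simp [Prog.wN])), j78, j79⟩
    · intro a ha
      simp only [Prog.wN, List.mem_append, List.mem_singleton] at ha
      unfold Scratch
      omega
    · rw [hs₁.nat 50 (by simp [Prog.wN])]; exact h2 z hz
    · simp only [Prog.wN, List.mem_append, List.mem_singleton]
      omega
  have e64 : s₁.nat 64 = s.nat 64 := hs₁.nat _ (by simp [Prog.wN])
  have e76 : s₁.nat 76 0 = c + i := by rw [hs₁.nat 76 (by simp [Prog.wN]), h4]
  have hb : (Test.rlt (.cast (.const 0)) (.cell 30 (nv 75))).holds s₁ ↔ D.Valid (x, y) := by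
    simp only [Test.holds_rlt, RExpr.eval, NExpr.eval, Nat.cast_zero, j75]
    rw [← hev, ← hk.setup.valid, e64]
  refine Runs.andThen (t₁ := 31) (t₂ := 1) (Runs.ite (t := 30)
    (fun hv => runs_quadUpdates hD hL hg hk hev (hb.1 hv))
    (fun hv => (runs_dummyUpdates hg hk (by rwa [hev, ← hb])).mono (by decide) fun _ _ h => h))
    le_rfl fun s₂ hs₂ hk => ?_
  have hw : ∀ {a : ℕ}, a < 200 → a ≠ 50 → a ≠ 72 → s₂.nat a = s₁.nat a := by
    intro a ha ha' ha''
    refine hs₂.nat _ ?_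
    simp only [Prog.wN, List.mem_append, List.mem_singleton]
    omega
  refine (Runs.straight (Q := fun s' => s'.nat 76 0 = c + (i + 1)) rfl le_rfl ?_).mono le_rfl
    fun s₃ hs₃ h76 => ?_
  · simp only [Prog.run, NExpr.eval, Store.writeN_nat, and_self, if_true,
      hw (a := 76) (by decide) (by decide) (by decide), e76]
    rfl
  have hw' : ∀ {a : ℕ}, a ≠ 76 → s₃.nat a = s₂.nat a := fun ha => hs₃.nat _ (by simpa [Prog.wN])
  obtain ⟨k1, k2, k3, -, -⟩ := hk
  refine ⟨k1.step (g := g) hs₃ (by simp [Prog.wN, Scratch]) (by simp [Prog.wR]), fun z hz => ?_,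
    ?_, h76, fun j hj => ?_⟩
  · rw [hw' (by decide)]; exact k2 z hz
  · rw [Kin.quads_succ]
    exact k3.congr (fun a ha => hw' (by omega)) (hw' (by decide))
  · rw [hw' (by decide), hw (by decide) (by decide) (by decide), j77 j hj, hw' (by decide),
      hw (by decide) (by decide) (by decide), e64]

/-! ### Instances of Offline Dynamic Rectangle Cover -/

/-- The rank of the side number `i` of the rectangle whose number is in array `73`. -/
abbrev rankOf (i : ℕ) : NExpr :=
  .cell 50 (.add (.add (.add (nv 73) (nv 73)) (.add (nv 73) (nv 73))) (.const i))

/-- List the initial rectangles of an instance. -/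
abbrev emitInit (g : ℕ) : Prog :=
  .seq (.seq (.setN 71 (.const 0) (.const 0)) (.setN 72 (.const 0) (.const 0)))
  (.seq (forLoop 73 (nv 40) (emitRect g 1 71 (rankOf 0) (rankOf 1) (rankOf 2) (rankOf 3)))
  (.seq (emitRect g 1 71 (.const 1) (nv 51) (.const 1) (.add (nv 41) (.const 1)))
  (.seq (emitRect g 1 71 (.add (nv 52) (.const 1)) (.add (nv 41) (.const 1)) (.const 1)
    (.add (nv 41) (.const 1)))
  (.seq (emitRect g 1 71 (.const 1) (.add (nv 41) (.const 1)) (.const 1) (nv 53))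
  (emitRect g 1 71 (.const 1) (.add (nv 41) (.const 1)) (.add (nv 54) (.const 1))
    (.add (nv 41) (.const 1)))))))

/-- The state while the initial rectangles are listed. -/
structure Listing (D : Kin) (m n E e g c : ℕ) (l : List Rect) (s : Store) : Prop where
  setup : Setup D m n E e s
  pos : PosIn D c s
  rects : RectsIn g 1 s l
  length : s.nat 71 0 = l.length
  zero : s.nat 72 0 = 0

theorem Listing.counter {D : Kin} {m n E e g c : ℕ} {l : List Rect} {s : Store} {v : ℕ}
    (h : Listing D m n E e g c l s) : Listing D m n E e g c l (s.writeN 73 0 v) := by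
  have hs : SameOff (.setN 73 (.const 0) (.const v)) s (s.writeN 73 0 v) :=
    (Exec.setN s 73 (.const 0) (.const v)).sameOff
  have hn : ∀ a ≠ 73, (s.writeN 73 0 v).nat a = s.nat a := fun a ha => hs.nat a (by simpa [Prog.wN])
  exact ⟨h.setup.step (g := g) hs (by simp [Prog.wN, Scratch]) (by simp [Prog.wR]),
    fun z hz => by rw [hn _ (by decide)]; exact h.pos z hz,
    h.rects.congr fun i h1 h2 => hn _ (by omega), by rw [hn _ (by decide), h.length],
    by rw [hn _ (by decide), h.zero]⟩

theorem runs_emitListing {D : Kin} {m n E e g c : ℕ} {l : List Rect} {s : Store} {R : Rect}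
    {e₀ e₁ e₂ e₃ : NExpr} (hg : g < 200) (h : Listing D m n E e g c l s)
    (he : ∀ s' : Store, (∀ a < 200, s'.nat a = s.nat a) → e₀.eval s' = R.x₀ ∧ e₁.eval s' = R.x₁ ∧
      e₂.eval s' = R.y₀ ∧ e₃.eval s' = R.y₁) :
    Runs (emitRect g 1 71 e₀ e₁ e₂ e₃) s 5 (Listing D m n E e g c (l ++ [R])) := by
  refine (runs_emitRect (by decide) h.rects h.length he).mono le_rfl ?_
  rintro s' hs' ⟨h1, h2⟩
  refine ⟨h.setup.step (g := g) hs' ?_ (by simp [Prog.wR]), fun z hz => ?_, h1, h2, ?_⟩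
  · intro a ha
    simp only [Prog.wN, List.mem_append, List.mem_singleton] at ha
    unfold Scratch
    omega
  · rw [hs'.nat 50 (by simp [Prog.wN]; omega)]; exact h.pos z hz
  · rw [hs'.nat 72 (by simp [Prog.wN]; omega)]; exact h.zero

theorem runs_emitInit {D : Kin} {m n E e g c : ℕ} {s : Store} (hL : D.L = 4 * m) (hg : g < 200)
    (hS : Setup D m n E e s) (hP : PosIn D c s) (hR : RectsIn g 1 s []) :
    Runs (emitInit g) s (7 * m + 24) (Listing D m n E e g c (D.rects m c)) := by
  refine Runs.andThen (t₁ := 2) (t₂ := 7 * m + 22) (R := Listing D m n E e g c [])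
    ((Runs.straight (Q := fun s => s.nat 71 0 = 0 ∧ s.nat 72 0 = 0) rfl le_rfl ?_).mono le_rfl ?_)
    (by omega) fun s₀ hs₀ h => ?_
  · simp [Prog.run, NExpr.eval, Store.writeN_nat]
  · rintro s₀ hs₀ ⟨h1, h2⟩
    refine ⟨hS.step (g := g) hs₀ (by simp [Prog.wN, Scratch]) (by simp [Prog.wR]), fun z hz => ?_,
      hR.congr fun i h1 h2 => hs₀.nat _ (by simp [Prog.wN]; omega), h1, h2⟩
    rw [hs₀.nat 50 (by simp [Prog.wN])]; exact hP z hz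
  refine Runs.andThen (t₁ := m * (5 + 2) + 2) (t₂ := 20) (Runs.for
    (fun r => Listing D m n E e g c ((List.range r).map (Kin.rectOf (D.pos c))))
    (by simp [Prog.wN]; omega) (fun s₁ hs₁ => ?_) h.counter fun r s₁ hr hs₁ hc h => ?_)
    (by omega) fun s₁ _ h => ?_
  · simp only [NExpr.eval]
    rw [hs₁.nat 40 (by simp [Prog.wN]; omega), h.setup.m_eq]
  · refine (runs_emitListing (R := Kin.rectOf (D.pos c) r) hg h fun s' hs' => ?_).mono le_rfl
      fun s₂ _ h => ?_
    · have hi : ∀ i < 4, (rankOf i).eval s' = D.pos c (4 * r + i) := by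
        intro i hi
        simp only [NExpr.eval, hs' 50 (by decide), hs' 73 (by decide), hc]
        rw [h.pos _ (by omega)]
        congr 1
        omega
      exact ⟨hi 0 (by decide), hi 1 (by decide), hi 2 (by decide), hi 3 (by decide)⟩
    · rw [List.range_succ, List.map_append]
      exact h.counter
  have hv : ∀ {s s' : Store}, Setup D m n E e s → (∀ a < 200, s'.nat a = s.nat a) →
      s'.nat 41 0 = D.L ∧ s'.nat 51 0 = D.clsCount 1 ∧ s'.nat 52 0 = D.clsCount 2 ∧
      s'.nat 53 0 = D.clsCount 4 ∧ s'.nat 54 0 = D.clsCount 5 := by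
    intro s s' hS hs'
    rw [hs' 41 (by decide), hs' 51 (by decide), hs' 52 (by decide), hs' 53 (by decide),
      hs' 54 (by decide)]
    exact ⟨hS.L_eq, hS.c₁, hS.c₂, hS.c₄, hS.c₅⟩
  refine Runs.andThen (t₂ := 15) (runs_emitListing (R := ⟨1, D.clsCount 1, 1, D.L + 1⟩) hg h
    fun s' hs' => ?_) le_rfl fun s₂ _ h => ?_
  · obtain ⟨h1, h2, h3, h4, h5⟩ := hv h.setup hs'
    simp [NExpr.eval, h1, h2]
  refine Runs.andThen (t₂ := 10) (runs_emitListing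
    (R := ⟨D.clsCount 2 + 1, D.L + 1, 1, D.L + 1⟩) hg h fun s' hs' => ?_) le_rfl fun s₃ _ h => ?_
  · obtain ⟨h1, h2, h3, h4, h5⟩ := hv h.setup hs'
    simp [NExpr.eval, h1, h3]
  refine Runs.andThen (t₂ := 5) (runs_emitListing (R := ⟨1, D.L + 1, 1, D.clsCount 4⟩) hg h
    fun s' hs' => ?_) le_rfl fun s₄ _ h => ?_
  · obtain ⟨h1, h2, h3, h4, h5⟩ := hv h.setup hs'
    simp [NExpr.eval, h1, h4]
  refine (runs_emitListing (R := ⟨1, D.L + 1, D.clsCount 5 + 1, D.L + 1⟩) hg h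
    fun s' hs' => ?_).mono le_rfl fun s₅ _ h => ?_
  · obtain ⟨h1, h2, h3, h4, h5⟩ := hv h.setup hs'
    simp [NExpr.eval, h1, h5]
  simpa only [Kin.rects, Kin.frames, List.append_assoc, List.cons_append, List.nil_append] using h

/-- The arrays of the copy number `g` of the rectangle cover program. -/
def arrayOf (g a : ℕ) : ℕ := 200 * (a + 1) + g

theorem arrayOf_injective (g : ℕ) : (arrayOf g).Injective := fun a b h => by
  unfold arrayOf at h; omega

/-- Write down an instance. -/
abbrev emitInstance (g : ℕ) : Prog :=
  .seq (emitInit g)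
  (.seq (forLoop 74 (nv 58) (emitQuad g))
  (.seq (.ite (.nlt (.const 0) (nv 59)) (emitUpdate g 1 (.const 1) (.const 1) (.const 1) (.const 1))
    .skip)
  (.seq (.setN (200 + g) (.const 0) (nv 55))
  (.seq (.setN (200 + g) (.const 1) (.add (nv 41) (.const 1)))
  (.seq (.setN (200 + g) (.const 2) (nv 71))
  (.setN (200 + g) (.const 3) (nv 72)))))))

/-- The arrays for the copies from `g` on are empty. -/
def Fresh (g : ℕ) (s : Store) : Prop := ∀ g', g ≤ g' → g' < 200 → ∀ a i,
  s.nat (arrayOf g' a) i = 0 ∧ s.real (arrayOf g' a) i = 0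

theorem Emitted.counter {D : Kin} {m n E e g c i v : ℕ} {s : Store}
    (h : Emitted D m n E e g c i s) : Emitted D m n E e g c i (s.writeN 74 0 v) := by
  have hs : SameOff (.setN 74 (.const 0) (.const v)) s (s.writeN 74 0 v) :=
    (Exec.setN s 74 (.const 0) (.const v)).sameOff
  have hn : ∀ a ≠ 74, (s.writeN 74 0 v).nat a = s.nat a := fun a ha => hs.nat a (by simpa [Prog.wN])
  exact ⟨h.setup.step (g := g) hs (by simp [Prog.wN, Scratch]) (by simp [Prog.wR]),
    fun z hz => by rw [hn _ (by decide)]; exact h.pos z hz,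
    h.updates.congr (fun i hi => hn _ (by omega)) (hn _ (by decide)),
    by rw [hn _ (by decide), h.count],
    fun j hj => by rw [hn _ (by decide), hn _ (by decide)]; exact h.source j hj⟩

theorem runs_emitQuads {D : Kin} {W m n E e g c : ℕ} {s : Store} (hD : D.Ordered W)
    (hL : D.L = 4 * m) (hg : g < 200) (h : Emitted D m n E e g c 0 s) :
    Runs (forLoop 74 (nv 58) (emitQuad g)) s (41 * E + 2) (Emitted D m n E e g c E) := by
  refine (Runs.for (n := E) (tA := 39) (Emitted D m n E e g c) (by simp [Prog.wN]; omega)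
    (fun s₁ hs₁ => ?_) h.counter fun i s₁ hi hs₁ hc h => ?_).mono (by omega) fun _ _ h => h
  · simp only [NExpr.eval]
    rw [hs₁.nat 58 (by simp [Prog.wN]; omega), h.setup.E_eq]
  · exact (runs_emitQuad hD hL hg h).mono le_rfl fun _ _ h => h.counter

theorem runs_filler {D : Kin} {m n E e g c : ℕ} {s : Store} (he : e ≤ 1)
    (h : Emitted D m n E e g c E s) :
    Runs (.ite (.nlt (.const 0) (nv 59)) (emitUpdate g 1 (.const 1) (.const 1) (.const 1)
      (.const 1)) .skip) s 7 fun s' => UpdatesIn g s' (D.phaseUpdates c E e) := by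
  refine Runs.ite (t := 6) (fun hb => ?_) fun hb => ?_
  · have : e = 1 := by
      simp only [Test.holds_nlt, NExpr.eval, h.setup.e_eq] at hb
      omega
    subst this
    exact runs_emitUpdate (u := .add Kin.dummy₁) h.updates rfl fun _ _ => ⟨rfl, rfl, rfl, rfl⟩
  · have : e = 0 := by
      simp only [Test.holds_nlt, NExpr.eval, h.setup.e_eq] at hb
      omega
    subst this
    refine (Runs.skip ?_).mono (by decide) fun _ _ h => h
    simpa [Kin.phaseUpdates] using h.updates

/-- The encoding fixes every cell, including those past the ends of the lists and those of all other
arrays; therefore the copy must have been untouched before. -/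
theorem view_eq_encode {I : CoverInstance} {g : ℕ} {s : Store}
    (h0 : ∀ i, s.nat (200 + g) i = [I.n, I.N, I.init.length, I.updates.length].getD i 0)
    (hR : RectsIn g 1 s I.init) (hU : UpdatesIn g s I.updates)
    (hN : ∀ a ≥ 10, ∀ i, s.nat (arrayOf g a) i = 0) (hr : ∀ a i, s.real (arrayOf g a) i = 0) :
    s.view (arrayOf g) = I.encode := by
  have hnat : (s.view (arrayOf g)).nat = I.encode.nat := by
    funext a i
    obtain ⟨r1, r2, r3, r4⟩ := hR i
    obtain ⟨u1, u2, u3, u4⟩ := hU.rects i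
    simp only [List.map_map] at u1 u2 u3 u4
    match a with
    | 0 => exact h0 i
    | 1 => exact r1
    | 2 => exact r2
    | 3 => exact r3
    | 4 => exact r4
    | 5 => exact hU.flags i
    | 6 => exact u1
    | 7 => exact u2
    | 8 => exact u3
    | 9 => exact u4
    | a + 10 => exact hN (a + 10) (by omega) i
  have hreal : (s.view (arrayOf g)).real = I.encode.real := by
    funext a i
    exact hr a i
  calc s.view (arrayOf g) = ⟨(s.view (arrayOf g)).nat, (s.view (arrayOf g)).real⟩ := rfl
    _ = I.encode := by rw [hnat, hreal]

theorem runs_emitInstance {D : Kin} {W m n E e g c : ℕ} {s : Store} (hD : D.Ordered W)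
    (hB : D.Boxed m) (hn : m + 6 ≤ n) (he : e ≤ 1) (hg : g < 200) (hS : Setup D m n E e s)
    (hP : PosIn D c s) (h76 : s.nat 76 0 = c) (hF : Fresh g s) :
    Runs (emitInstance g) s (7 * m + 41 * E + 37) fun s' =>
      s'.view (arrayOf g) = (Kin.phaseInstance hD hB hn c E he).encode ∧ Setup D m n E e s' ∧
      PosIn D (c + E) s' ∧ s'.nat 76 0 = c + E ∧
      ∀ j < 4 * E, s'.nat 77 j = s'.nat 64 (c + j / 4) := by
  have hL := hB.L_eq
  have hF' : ∀ a i, s.nat (200 * (a + 1) + g) i = 0 := fun a i => (hF g le_rfl hg a i).1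
  have hR : RectsIn g 1 s [] := fun j =>
    ⟨hF' 1 j, hF' 2 j, hF' 3 j, hF' 4 j⟩
  refine Runs.andThen (t₂ := 41 * E + 13) (runs_emitInit hL hg hS hP hR) (by omega)
    fun s₁ hs₁ h1 => ?_
  have n₁ : ∀ a, a ≠ 50 → (a < 71 ∨ 73 < a) → (∀ i, 2 ≤ i → i ≤ 5 → a ≠ 200 * i + g) →
      s₁.nat a = s.nat a := by
    intro a h1 h2 h3
    have := h3 2 (by decide) (by decide)
    have := h3 3 (by decide) (by decide)
    have := h3 4 (by decide) (by decide)
    have := h3 5 (by decide) (by decide)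
    refine hs₁.nat a ?_
    simp only [Prog.wN, List.mem_append, List.mem_singleton]
    omega
  have hE : Emitted D m n E e g c 0 s₁ := by
    refine ⟨h1.setup, h1.pos, ⟨fun j => ?_, fun j => ?_, ?_⟩, ?_, by simp⟩
    · rw [n₁ _ (by omega) (by omega) (by omega)]; simpa [Kin.quads] using hF' 5 j
    · rw [n₁ _ (by omega) (by omega) (by omega), n₁ _ (by omega) (by omega) (by omega),
        n₁ _ (by omega) (by omega) (by omega), n₁ _ (by omega) (by omega) (by omega)]
      exact ⟨hF' 6 j, hF' 7 j, hF' 8 j, hF' 9 j⟩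
    · rw [h1.zero]; rfl
    · rw [n₁ _ (by omega) (by omega) (by omega), h76]; rfl
  refine Runs.andThen (t₂ := 11) (runs_emitQuads hD hL hg hE) (by omega) fun s₂ hs₂ h2 => ?_
  refine Runs.andThen (t₂ := 4) (runs_filler he h2) (by omega) fun s₃ hs₃ h3 => ?_
  have n₃ : ∀ a, a ≠ 50 → (a < 72 ∨ 79 < a) → (∀ i, 6 ≤ i → i ≤ 10 → a ≠ 200 * i + g) →
      s₃.nat a = s₁.nat a := by
    intro a h1 h2 h3
    have := h3 6 (by decide) (by decide)
    have := h3 7 (by decide) (by decide)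
    have := h3 8 (by decide) (by decide)
    have := h3 9 (by decide) (by decide)
    have := h3 10 (by decide) (by decide)
    rw [hs₃.nat a, hs₂.nat a]
    · simp only [Prog.wN, List.mem_append, List.mem_singleton]
      omega
    · simp only [Prog.wN, List.mem_append, List.mem_singleton, List.not_mem_nil, or_false]
      omega
  have n₃' : ∀ a, a < 200 → a ≠ 72 → s₃.nat a = s₂.nat a := by
    intro a h1 h2
    refine hs₃.nat a ?_
    simp only [Prog.wN, List.mem_append, List.mem_singleton, List.not_mem_nil, or_false]
    omega
  have hS₃ : Setup D m n E e s₃ := by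
    refine h2.setup.step (g := g) hs₃ ?_ (by simp [Prog.wR])
    intro a ha
    simp only [Prog.wN, List.mem_append, List.mem_singleton, List.not_mem_nil, or_false] at ha
    unfold Scratch
    omega
  have h71 : s₃.nat 71 0 = (D.rects m c).length := by
    rw [n₃ _ (by omega) (by omega) (by omega), h1.length]
  have h72 := h3.length
  have hr : ∀ a, s₃.real a = s.real a := fun a => by
    rw [hs₃.real a (by simp [Prog.wR]), hs₂.real a (by simp [Prog.wR]),
      hs₁.real a (by simp [Prog.wR])]
  refine (Runs.straight (Q := fun s' => ∀ i, s'.nat (200 + g) i =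
    [n, D.L + 1, (D.rects m c).length, (D.phaseUpdates c E e).length].getD i 0) rfl le_rfl ?_).mono
    le_rfl fun s₄ hs₄ h4 => ?_
  · have a1 : ¬ 41 = 200 + g := by omega
    have a2 : ¬ 71 = 200 + g := by omega
    have a3 : ¬ 72 = 200 + g := by omega
    intro i
    have hz : s₃.nat (200 + g) i = 0 := by
      rw [n₃ _ (by omega) (by omega) (by omega), n₁ _ (by omega) (by omega) (by omega)]
      exact hF' 0 i
    simp only [Prog.run, NExpr.eval, Store.writeN_nat, a1, a2, a3, false_and, if_false, true_and,
      hS₃.n_eq, hS₃.L_eq, h71, h72]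
    match i with
    | 0 => simp
    | 1 => simp
    | 2 => simp
    | 3 => simp
    | i + 4 => simpa using hz
  have n₄ : ∀ a, a ≠ 200 + g → s₄.nat a = s₃.nat a := fun a ha => hs₄.nat a (by simpa [Prog.wN])
  refine ⟨view_eq_encode h4 ?_ ?_ (fun a ha i => ?_) (fun a i => ?_), ?_, fun z hz => ?_, ?_,
    fun j hj => ?_⟩
  · exact h1.rects.congr fun i i1 i2 => by
      rw [n₄ _ (by omega), n₃ _ (by omega) (by omega) (by omega)]
  · exact h3.congr (fun i hi => n₄ _ (by omega)) (n₄ _ (by omega))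
  · unfold arrayOf
    rw [n₄ _ (by omega), n₃ _ (by omega) (by omega) (by omega),
      n₁ _ (by omega) (by omega) (by omega)]
    exact hF' a i
  · rw [hs₄.real _ (by simp [Prog.wR]), hr]
    exact (hF g le_rfl hg a i).2
  · refine hS₃.step (g := g) hs₄ ?_ (by simp [Prog.wR])
    intro a ha
    simp only [Prog.wN, List.mem_append, List.mem_singleton] at ha
    unfold Scratch
    omega
  · rw [n₄ _ (by omega), n₃' _ (by omega) (by omega)]; exact h2.pos z hz
  · rw [n₄ _ (by omega), n₃' _ (by omega) (by omega)]; exact h2.count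
  · rw [n₄ _ (by omega), n₃' _ (by omega) (by omega), n₄ _ (by omega), n₃' _ (by omega) (by omega)]
    exact h2.source j hj

/-! ### The phases -/

/-- Record the time of the change at which a free point appears. -/
abbrev recordAnswer (g : ℕ) : Prog :=
  .ite (.and (.nlt (.const 0) (nv (arrayOf g 10))) (.neq (nv 80) (.const 0)))
    (.seq (.setN 80 (.const 0) (.const 1))
      (.setR 4 (.const 0) (.cell 30 (.cell 77 (.sub (nv (arrayOf g 10)) (.const 1)))))) .skip

/-- Look for the first set of rectangles that does not cover among the results of `E` changes. -/
abbrev phase (A : Prog) (g : ℕ) : Prog :=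
  .seq (emitInstance g) (.seq (A.rename (arrayOf g)) (recordAnswer g))

/-- The first phases, one after the other. -/
def phases (A : Prog) : ℕ → Prog
  | 0 => .skip
  | g + 1 => .seq (phases A g) (phase A g)

/-- Either the rectangles still cover after all of the first `k` changes, or the time of the first
change after which they do not is recorded. -/
def AnswerAt (D : Kin) (m k : ℕ) (s : Store) : Prop :=
  (s.nat 80 0 = 0 ∧ ∀ j ≤ k, Covers (D.S m j) (D.L + 1)) ∨
    (s.nat 80 0 = 1 ∧ ∃ k', s.real 4 0 = (ofLex (D.key (D.ev k'))).1 ∧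
      ¬ Covers (D.S m (k' + 1)) (D.L + 1) ∧ ∀ j ≤ k', Covers (D.S m j) (D.L + 1))

/-- The state before the phase `g`. -/
structure PhaseStart (D : Kin) (m n E e g : ℕ) (s : Store) : Prop where
  setup : Setup D m n E e s
  pos : PosIn D (g * E) s
  count : s.nat 76 0 = g * E
  fresh : Fresh g s
  answer : AnswerAt D m (g * E) s

/-- Once an answer is recorded, later phases may start from a set that does not cover, and their
results mean nothing; the flag in array `80` shields the recorded value. Array `77`, read at the
answer minus one, leads back to the time of the change. -/
theorem runs_recordAnswer {D : Kin} {W m n E e g c : ℕ} {s : Store} (hD : D.Ordered W)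
    (hB : D.Boxed m) (hn : m + 6 ≤ n) (he : e ≤ 1) (hS : Setup D m n E e s)
    (h77 : ∀ j < 4 * E, s.nat 77 j = s.nat 64 (c + j / 4)) (hA : AnswerAt D m c s)
    (hi : (Kin.phaseInstance hD hB hn c E he).IsAnswer (s.nat (arrayOf g 10) 0)) :
    Runs (recordAnswer g) s 3 (AnswerAt D m (c + E)) := by
  refine Runs.ite (t := 2) (fun hb => ?_) fun hb => (Runs.skip ?_).mono (by decide) fun _ _ h => h
  · rw [Test.holds_and, Test.holds_nlt, Test.holds_neq] at hb
    simp only [NExpr.eval] at hb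
    rcases hA with ⟨-, hcov⟩ | ⟨h1, -⟩
    · rcases Kin.phase_answer hD hB hn c E he (hcov c le_rfl) hi with ⟨h0, -⟩ | ⟨h1, hE, h2, h3⟩
      · omega
      · have h10 : ¬ arrayOf g 10 = 80 := by unfold arrayOf; omega
        refine Runs.straight rfl le_rfl (Or.inr ⟨?_, c + (s.nat (arrayOf g 10) 0 - 1) / 4, ?_, h2,
          fun j hj => ?_⟩)
        · simp [Prog.run, NExpr.eval, Store.writeN_nat, Store.writeR_nat]
        · simp only [Prog.run, NExpr.eval, RExpr.eval, Store.writeN_nat, Store.writeN_real,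
            Store.writeR_real, Nat.reduceEqDiff, h10, false_and, if_false, and_self, if_true]
          rw [h77 _ (by omega)]
          refine hS.key _ ?_
          by_contra hv
          exact h2 (by rw [Kin.S_succ_of_not_valid hv]; exact h3 _ le_rfl)
        · rcases le_total j c with hjc | hjc
          · exact hcov j hjc
          · obtain ⟨i, rfl⟩ := Nat.exists_eq_add_of_le hjc
            exact h3 i (by omega)
    · omega
  · rw [Test.holds_and, Test.holds_nlt, Test.holds_neq] at hb
    simp only [NExpr.eval] at hb
    rcases hA with ⟨h0, hcov⟩ | h1
    · rcases Kin.phase_answer hD hB hn c E he (hcov c le_rfl) hi with ⟨-, h2⟩ | ⟨h1, -⟩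
      · refine Or.inl ⟨h0, fun j hj => ?_⟩
        rcases le_total j c with hjc | hjc
        · exact hcov j hjc
        · obtain ⟨i, rfl⟩ := Nat.exists_eq_add_of_le hjc
          exact h2 i (by omega)
      · exact absurd ⟨by omega, h0⟩ hb
    · exact Or.inr h1

theorem scratch_of_mem_rename {A : Prog} {g a : ℕ} (hg : g < 200)
    (ha : a ∈ A.wN.map (arrayOf g) ∨ a ∈ A.wR.map (arrayOf g)) : 200 ≤ a ∧ a % 200 = g := by
  obtain ⟨b, rfl⟩ : ∃ b, arrayOf g b = a := by
    rcases ha with ha | ha <;> obtain ⟨b, -, h⟩ := List.mem_map.1 ha <;> exact ⟨b, h⟩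
  unfold arrayOf
  omega

/-- The side length `4 * m + 1` is at most `4 * n`, so the given program applies with `c = 4`.
Copies of different number use arrays of different residue modulo `200`, so the later copies remain
empty. -/
theorem runs_phase {A : Prog} {T : ℕ → ℕ → ℕ} (hA : SolvesRectangleCover A 4 T) {D : Kin}
    {W m n E e g : ℕ} {s : Store} (hD : D.Ordered W) (hB : D.Boxed m) (hn : m + 6 ≤ n)
    (he : e ≤ 1) (hg : g < 200) (h : PhaseStart D m n E e g s) :
    Runs (phase A g) s (7 * m + 41 * E + 40 + T n (4 * E + e)) (PhaseStart D m n E e (g + 1)) := by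
  have hL := hB.L_eq
  have hsc : ∀ a ∈ (phase A g).wN, Scratch g a := by
    intro a ha
    simp only [Prog.wN, List.mem_append, List.mem_singleton, List.not_mem_nil, or_false,
      Prog.wN_rename] at ha
    unfold Scratch
    by_cases h2 : a ∈ A.wN.map (arrayOf g)
    · exact Or.inr (Or.inr (scratch_of_mem_rename hg (Or.inl h2)))
    · simp only [h2, false_or] at ha
      omega
  have hscR : ∀ a ∈ (phase A g).wR, a = 4 ∨ (200 ≤ a ∧ a % 200 = g) := by
    intro a ha
    simp only [Prog.wR, List.mem_append, List.mem_singleton, List.not_mem_nil, or_false, false_or,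
      Prog.wR_rename] at ha
    rcases ha with ha | ha
    · exact Or.inr (scratch_of_mem_rename hg (Or.inr ha))
    · exact Or.inl ha
  have key : Runs (phase A g) s (7 * m + 41 * E + 40 + T n (4 * E + e)) fun s' =>
      Setup D m n E e s' ∧ PosIn D (g * E + E) s' ∧ s'.nat 76 0 = g * E + E ∧
        AnswerAt D m (g * E + E) s' := by
    refine Runs.andThen (t₂ := T n (4 * E + e) + 3) (runs_emitInstance hD hB hn he hg h.setup h.pos
      h.count h.fresh) (by omega) ?_
    rintro s₁ hs₁ ⟨hview, hS₁, hP₁, h76₁, h77₁⟩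
    obtain ⟨u, t, hex, ht, hans⟩ := hA (Kin.phaseInstance hD hB hn (g * E) E he)
      (show D.L + 1 ≤ 4 * n by omega)
    have hlen : (Kin.phaseInstance hD hB hn (g * E) E he).updates.length = 4 * E + e := by
      simp [Kin.phaseInstance, Kin.phaseUpdates, Kin.length_quads]
    rw [hlen] at ht
    obtain ⟨s₂, hex₂, hview₂⟩ := hex.rename (arrayOf_injective g) s₁ hview
    have hans₂ : u.nat 10 0 = s₂.nat (arrayOf g 10) 0 := by rw [← hview₂]; rfl
    rw [hans₂] at hans
    refine Runs.andThen (t₁ := T n (4 * E + e)) (t₂ := 3) (R := fun s => s = s₂)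
      ⟨s₂, t, hex₂, ht, rfl⟩ le_rfl ?_
    rintro s₂ hs₂ rfl
    have n₂ : ∀ a < 200, s₂.nat a = s₁.nat a := fun a ha => hs₂.nat a fun h => by
      rw [Prog.wN_rename] at h
      have := scratch_of_mem_rename hg (Or.inl h)
      omega
    have r₂ : ∀ a < 200, s₂.real a = s₁.real a := fun a ha => hs₂.real a fun h => by
      rw [Prog.wR_rename] at h
      have := scratch_of_mem_rename hg (Or.inr h)
      omega
    have hS₂ : Setup D m n E e s₂ := by
      refine hS₁.step (g := g) hs₂ (fun a ha => ?_) fun ha => ?_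
      · rw [Prog.wN_rename] at ha
        exact Or.inr (Or.inr (scratch_of_mem_rename hg (Or.inl ha)))
      · rw [Prog.wR_rename] at ha
        have := scratch_of_mem_rename hg (Or.inr ha)
        omega
    have h80 : s₂.nat 80 = s.nat 80 := by
      rw [n₂ _ (by decide), hs₁.nat]
      simp only [Prog.wN, List.mem_append, List.mem_singleton, List.not_mem_nil, or_false]
      omega
    have h4 : s₂.real 4 = s.real 4 := by
      rw [r₂ _ (by decide), hs₁.real]
      simp [Prog.wR]
    refine (runs_recordAnswer hD hB hn he hS₂ (c := g * E) (fun j hj => ?_) ?_ hans).mono le_rfl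
      fun s₃ hs₃ hans => ⟨hS₂.step (g := g) hs₃ (by simp [Prog.wN, Scratch]) (by simp [Prog.wR]),
        fun z hz => ?_, ?_, hans⟩
    · rw [n₂ _ (by decide), n₂ _ (by decide)]; exact h77₁ j hj
    · have := h.answer
      unfold AnswerAt at this ⊢
      rwa [h80, h4]
    · rw [hs₃.nat 50 (by simp [Prog.wN]), n₂ _ (by decide)]; exact hP₁ z hz
    · rw [hs₃.nat 76 (by simp [Prog.wN]), n₂ _ (by decide)]; exact h76₁
  refine key.mono le_rfl ?_
  rintro s' hs' ⟨h1, h2, h3, h4⟩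
  refine ⟨h1, ?_, ?_, fun g' hg1 hg2 a i => ?_, ?_⟩
  · rwa [Nat.succ_mul]
  · rwa [Nat.succ_mul]
  · rw [hs'.nat _ fun ha => ?_, hs'.real _ fun ha => ?_]
    · exact h.fresh g' (by omega) hg2 a i
    · have := hscR _ ha
      unfold arrayOf at this
      omega
    · have := hsc _ ha
      unfold Scratch arrayOf at this
      omega
  · rwa [Nat.succ_mul]

theorem runs_phases {A : Prog} {T : ℕ → ℕ → ℕ} (hA : SolvesRectangleCover A 4 T) {D : Kin}
    {W m n E e : ℕ} {s : Store} (hD : D.Ordered W) (hB : D.Boxed m) (hn : m + 6 ≤ n)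
    (he : e ≤ 1) (h : PhaseStart D m n E e 0 s) {g : ℕ} (hg : g ≤ 200) :
    Runs (phases A g) s (g * (7 * m + 41 * E + 40 + T n (4 * E + e)))
      (PhaseStart D m n E e g) := by
  induction g with
  | zero => exact (Runs.skip h).mono (Nat.zero_le _) fun _ _ h => h
  | succ g ih =>
    exact Runs.andThen (ih (by omega)) (Nat.succ_mul g _).ge
      fun s₁ _ h => runs_phase hA hD hB hn he (by omega) h

/-! ### The whole program -/

/-- List all pairs of lines and sort them by their times. -/
abbrev sortedPairs : Prog :=
  .seq allPairs (.seq powerOfTwo (.seq identityOrder sortPairs))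

/-- Compute everything that the phases need. -/
abbrev prepare : Prog :=
  .seq allBoxes (.seq allLines (.seq ranks (.seq classCounts (.seq sizes sortedPairs))))

theorem lt_of_mem_prepare : (∀ a ∈ prepare.wN, a < 71) ∧ ∀ a ∈ prepare.wR, a < 71 := by
  constructor <;> decide +kernel

theorem lt_of_mem_allBoxes : (∀ a ∈ allBoxes.wN, a < 40) ∧ ∀ a ∈ allBoxes.wR, a < 20 := by
  constructor <;> decide +kernel

theorem runs_sortedPairs {D : Kin} {n N : ℕ} {s : Store} (h : KinIn D s) (hL : 1 ≤ D.L)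
    (hLn : D.L ≤ 4 * n) (hn : n * n = N) (h62 : s.nat 62 0 = 0) (h64 : ∀ i, s.nat 64 i = 0)
    (hP : PairsTo D 0 s) :
    Runs sortedPairs s (296 * N + 393 * (Nat.log 2 (32 * N) * N)) fun s' => ∃ W ≤ 32 * N,
      D.L * D.L ≤ W ∧ PairsTo D (D.L * D.L) s' ∧ BlockSorted W W (timeOf s') (s'.nat 64) ∧
      ∀ i, W ≤ i → s'.nat 64 i = 0 := by
  have hL1 : D.L ≤ D.L * D.L := Nat.le_mul_self _
  have hLN : D.L * D.L ≤ 16 * N := by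
    calc D.L * D.L ≤ (4 * n) * (4 * n) := Nat.mul_le_mul hLn hLn
      _ = 16 * N := by rw [← hn]; ring
  refine Runs.andThen (t₂ := 134 * N + 393 * (Nat.log 2 (32 * N) * N)) (runs_allPairs h h62 hP)
    ?_ ?_
  · rw [show D.L * (9 * D.L + 4) = 9 * (D.L * D.L) + 4 * D.L by ring]
    have : n ≤ n * n := Nat.le_mul_self _
    omega
  rintro s₁ hs₁ ⟨k62, hP₁⟩
  refine Runs.andThen (t₂ := 98 * N + 2 + 393 * (Nat.log 2 (32 * N) * N))
    (runs_powerOfTwo k62 (hL.trans hL1)) (by omega) ?_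
  rintro s₂ hs₂ ⟨d, k63, hd1, hd2⟩
  have hd : 2 ^ d ≤ 32 * N := by omega
  have hdB : d ≤ Nat.log 2 (32 * N) := Nat.le_log_of_pow_le one_lt_two hd
  refine Runs.andThen (t₂ := 2 + 393 * (Nat.log 2 (32 * N) * N)) (runs_identityOrder k63
    fun i => ?_) (by omega) ?_
  · rw [hs₂.nat 64 (by simp [Prog.wN]), hs₁.nat 64 (by simp [Prog.wN]), h64]
  intro s₃ hs₃ k64
  have j63 : s₃.nat 63 0 = 2 ^ d := by rw [hs₃.nat 63 (by simp [Prog.wN]), k63]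
  refine (runs_sortPairs j63 k64).mono ?_ ?_
  -- The constant is `12 * 32 + 9`, as the padded length is at most `32 * N` and `N` is positive.
  · have : d * (12 * 2 ^ d + 9) ≤ Nat.log 2 (32 * N) * (393 * N) :=
      Nat.mul_le_mul hdB (by omega)
    rw [Nat.mul_left_comm] at this
    omega
  · rintro s₄ hs₄ ⟨k1, k2⟩
    have hsn : ∀ a, a = 60 ∨ a = 61 → s₄.nat a = s₁.nat a := by
      rintro a (rfl | rfl) <;>
        rw [hs₄.nat _ (by simp [Prog.wN]), hs₃.nat _ (by simp [Prog.wN]),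
          hs₂.nat _ (by simp [Prog.wN])]
    have hsr : ∀ a, s₄.real a = s₁.real a := fun a => by
      rw [hs₄.real a (by simp [Prog.wR]), hs₃.real a (by simp [Prog.wR]),
        hs₂.real a (by simp [Prog.wR])]
    exact ⟨2 ^ d, hd, hd1, hP₁.congr (hsn _ (Or.inl rfl)) (hsn _ (Or.inr rfl)) (hsr _) (hsr _)
      (hsr _), k1, k2⟩

/-- The lines in the store `s` with the sequence of changes in the store `s'`. -/
def kinWith (s s' : Store) : Kin :=
  kinOf s fun k => (s'.nat 60 (s'.nat 64 k), s'.nat 61 (s'.nat 64 k))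

theorem runs_prepare {p q n : ℕ} (P : OrthogonalPolygon p) (Q : OrthogonalPolygon q)
    (hn : p * q = n) :
    Runs prepare (encodePolygons P Q) (714 * (n * n) + 393 * (Nat.log 2 (32 * (n * n)) * (n * n)))
      fun s => ∃ D m W, Kin.Ordered D W ∧ D.Boxed m ∧ m + 6 ≤ n ∧ W ≤ 32 * (n * n) ∧
        (∀ lam, 0 < lam → (D.Free m lam ↔ Fits P Q lam)) ∧ PosIn D 0 s ∧
        Setup D m n (n * n / 4) (n * n % 4) s := by
  have hp3 := P.three_le
  have hq3 := Q.three_le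
  have hpn : p ≤ n := hn ▸ Nat.le_mul_of_pos_right _ (by omega)
  have hqn : q ≤ n := hn ▸ Nat.le_mul_of_pos_left _ (by omega)
  have hN0 : ∀ a i, a ≠ 0 → (encodePolygons P Q).nat a i = 0 := fun a i ha => by
    cases a with
    | zero => exact absurd rfl ha
    | succ a => rfl
  have hR0 : ∀ a i, 4 ≤ a → (encodePolygons P Q).real a i = 0 := fun a i ha => by
    obtain ⟨b, rfl⟩ := Nat.exists_eq_add_of_le' ha
    rfl
  obtain ⟨N, hN⟩ : ∃ N, n * n = N := ⟨_, rfl⟩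
  have hnN : n ≤ N := hN ▸ Nat.le_mul_self n
  rw [hN]
  refine Runs.andThen (t₂ := 512 * N + 393 * (Nat.log 2 (32 * N) * N)) (runs_allBoxes P Q) ?_
    fun s₁ hs₁ h₁ => ?_
  · have h1 : p * p ≤ N := hN ▸ Nat.mul_le_mul hpn hpn
    have h2 : q * q ≤ N := hN ▸ Nat.mul_le_mul hqn hqn
    rw [show p * (28 * p + 52) = 28 * (p * p) + 52 * p by ring,
      show q * (28 * q + 60) = 28 * (q * q) + 60 * q by ring]
    omega
  obtain ⟨a, ha⟩ : ∃ a, s₁.nat 22 0 = a := ⟨_, rfl⟩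
  obtain ⟨b, hb⟩ : ∃ b, s₁.nat 23 0 = a + b := by
    obtain ⟨b, hb⟩ := Nat.exists_eq_add_of_le h₁.le
    exact ⟨b, by rw [hb, ha]⟩
  have han : a ≤ n := by have := h₁.card_le; omega
  have hbn : b ≤ n := by have := h₁.card_le'; omega
  have e₁ : ∀ c, 40 ≤ c → ∀ i, s₁.nat c i = 0 := fun c hc i => by
    rw [hs₁.nat c fun h => absurd (lt_of_mem_allBoxes.1 c h) (by omega), hN0 _ _ (by omega)]
  have r₁ : ∀ c, 20 ≤ c → ∀ i, s₁.real c i = 0 := fun c hc i => by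
    rw [hs₁.real c fun h => absurd (lt_of_mem_allBoxes.2 c h) (by omega), hR0 _ _ (by omega)]
  refine Runs.andThen (t₂ := 482 * N + 393 * (Nat.log 2 (32 * N) * N))
    (runs_allLines ha hb (e₁ _ (by decide) _) (e₁ _ (by decide) _)) ?_ ?_
  · have h1 : a * b ≤ N := hN ▸ Nat.mul_le_mul han hbn
    rw [show a * (24 * b + 4) = 24 * (a * b) + 4 * a by ring]
    omega
  rintro s₂ hs₂ ⟨h40, h41, hlines⟩
  have hlin := h₁.linesOf ha hb h40 h41 hlines
  generalize hm : a * b = m at *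
  have hmn : m + 6 ≤ n := hn ▸ hlin.m_le
  -- The sequence of changes is known only after sorting. The initial ranks, the class counts,
  -- validity and keys do not involve it, so a constant sequence stands in until then.
  obtain ⟨D, hD⟩ : ∃ D, D = kinOf s₂ fun _ => (0, 0) := ⟨_, rfl⟩
  have hDL : D.L = 4 * m := by rw [hD]; exact hlin.L_eq
  have hm1 : 1 ≤ m := by
    obtain ⟨r, hr, -⟩ := (hlin.boxed fun _ => (0, 0)).left
    omega
  have hK₂ : KinIn D s₂ := by rw [hD]; exact ⟨rfl, rfl, rfl, rfl, rfl⟩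
  have hLN : D.L * D.L ≤ 16 * N := by
    calc D.L * D.L ≤ (4 * n) * (4 * n) := Nat.mul_le_mul (by omega) (by omega)
      _ = 16 * N := by rw [← hN]; ring
  refine Runs.andThen (t₂ := 392 * N + 393 * (Nat.log 2 (32 * N) * N)) (runs_ranks hK₂) ?_
    fun s₃ hs₃ h50 => ?_
  · rw [show D.L * (4 * D.L + 6) = 4 * (D.L * D.L) + 6 * D.L by ring]
    omega
  have hK₃ := hK₂.step hs₃ (by simp [Prog.wN]) (by simp [Prog.wN]) (by simp [Prog.wR])
    (by simp [Prog.wR]) (by simp [Prog.wR])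
  refine Runs.andThen (t₂ := 316 * N + 393 * (Nat.log 2 (32 * N) * N)) (runs_classCounts hK₃)
    (by omega) fun s₄ hs₄ ⟨h51, h52, h53, h54⟩ => ?_
  have hK₄ := hK₃.step hs₄ (by simp [Prog.wN]) (by simp [Prog.wN]) (by simp [Prog.wR])
    (by simp [Prog.wR]) (by simp [Prog.wR])
  have h00 : s₄.nat 0 = s₁.nat 0 := by
    rw [hs₄.nat 0 (by simp [Prog.wN]), hs₃.nat 0 (by simp [Prog.wN]),
      hs₂.nat 0 (by simp [Prog.wN])]
  refine Runs.andThen (t₂ := 296 * N + 393 * (Nat.log 2 (32 * N) * N))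
    (runs_sizes (p := p) (q := q) (by rw [h00, h₁.p_eq]) (by rw [h00, h₁.q_eq]))
    (by rw [hn, hN]; omega) ?_
  rw [hn, hN]
  rintro s₅ hs₅ ⟨h55, -, h58, h59⟩
  have hK₅ := hK₄.step hs₅ (by simp [Prog.wN]) (by simp [Prog.wN]) (by simp [Prog.wR])
    (by simp [Prog.wR]) (by simp [Prog.wR])
  have w₂ : ∀ c ∈ allLines.wN, c < 47 := by decide +kernel
  have w₃ : ∀ c ∈ ranks.wN, c = 47 ∨ c = 48 ∨ c = 49 ∨ c = 50 := by decide +kernel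
  have w₄ : ∀ c ∈ classCounts.wN, c = 48 ∨ (51 ≤ c ∧ c < 55) := by decide +kernel
  have w₅ : ∀ c ∈ sizes.wN, 55 ≤ c ∧ c < 60 := by decide +kernel
  have w₆ : ∀ c ∈ sortedPairs.wN, c = 47 ∨ c = 48 ∨ 60 ≤ c := by decide +kernel
  have z₅ : ∀ c, 60 ≤ c → ∀ i, s₅.nat c i = 0 := by
    intro c hc i
    rw [hs₅.nat c fun h => ?_, hs₄.nat c fun h => ?_, hs₃.nat c fun h => ?_, hs₂.nat c fun h => ?_,
      e₁ c (by omega)]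
    · exact absurd (w₂ c h) (by omega)
    · exact absurd (w₃ c h) (by omega)
    · exact absurd (w₄ c h) (by omega)
    · exact absurd (w₅ c h) (by omega)
  have y₅ : ∀ c, 30 ≤ c → ∀ i, s₅.real c i = 0 := by
    intro c hc i
    rw [hs₅.real c, hs₄.real c, hs₃.real c, hs₂.real c, r₁ c (by omega)] <;>
      (simp [Prog.wR] <;> omega)
  refine (runs_sortedPairs hK₅ (by omega) (by omega) hN (z₅ _ (by decide) _) (z₅ _ (by decide))
    ⟨fun i hi => absurd hi (Nat.not_lt_zero i), fun i _ => ⟨z₅ _ (by decide) _, z₅ _ (by decide) _⟩,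
      fun i hi => ?_, fun i _ => y₅ _ (by decide) _⟩).mono le_rfl ?_
  · rw [z₅ _ (by decide), z₅ _ (by decide)] at hi
    exact absurd hi (D.not_valid_self 0)
  rintro s₆ hs₆ ⟨W, hW, hLW, hP, hsort, h64⟩
  have hP' : PairsTo (kinWith s₂ s₆) (D.L * D.L) s₆ := by
    subst hD
    exact ⟨hP.lt, hP.ge, hP.key, hP.no_key⟩
  have hB := hlin.boxed fun k => (s₆.nat 60 (s₆.nat 64 k), s₆.nat 61 (s₆.nat 64 k))
  have n₆ : ∀ c, c ≠ 47 → c ≠ 48 → c < 60 → s₆.nat c = s₅.nat c := by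
    intro c h1 h2 h3
    exact hs₆.nat c fun h => absurd (w₆ c h) (by omega)
  have n₅ : ∀ c, c < 55 → s₅.nat c = s₄.nat c := by
    intro c h1
    exact hs₅.nat c fun h => absurd (w₅ c h) (by omega)
  have n₄ : ∀ c, c < 51 → c ≠ 48 → s₄.nat c = s₃.nat c := by
    intro c h1 h2
    exact hs₄.nat c fun h => absurd (w₄ c h) (by omega)
  have n₃ : ∀ c, c < 47 → s₃.nat c = s₂.nat c := by
    intro c h1
    exact hs₃.nat c fun h => absurd (w₃ c h) (by omega)
  have n₂ : ∀ c, c < 47 → s₆.nat c = s₂.nat c := fun c hc => by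
    rw [n₆ c (by omega) (by omega) (by omega), n₅ c (by omega), n₄ c (by omega) (by omega), n₃ c hc]
  refine ⟨kinWith s₂ s₆, m, W, ordered_of_sorted (by subst hD; exact hP') (by subst hD; exact hLW)
    hsort h64 (fun _ => rfl) hlin.c_eq, hB, hmn, hW, hlin.free _, fun z hz => ?_, ?_⟩
  · rw [n₆ _ (by decide) (by decide) (by decide), n₅ _ (by decide), n₄ _ (by decide) (by decide)]
    subst hD
    exact h50 z hz
  · have hc : ∀ c, 51 ≤ c → c < 55 → s₆.nat c = s₄.nat c := fun c h1 h2 => by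
      rw [n₆ c (by omega) (by omega) (by omega), n₅ c h2]
    have hv : ∀ i, 0 < s₆.real 30 i ↔ (kinWith s₂ s₆).Valid (s₆.nat 60 i, s₆.nat 61 i) := by
      intro i
      constructor
      · intro h
        by_contra hv
        exact h.ne' (hP'.no_key i hv)
      · intro hv
        have := congrArg (fun u => (ofLex u).1) (hP'.key i hv)
        simp only [ofLex_toLex] at this
        rw [this]
        exact div_pos (sub_pos.2 hv.2.2.2.2) (sub_pos.2 hv.2.2.2.1)
    refine ⟨by rw [n₂ _ (by decide), h40], by rw [n₂ _ (by decide)]; rfl, fun z hz => ?_,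
      ?_, ?_, ?_, ?_, by rw [n₆ _ (by decide) (by decide) (by decide), h55],
      by rw [n₆ _ (by decide) (by decide) (by decide), h58],
      by rw [n₆ _ (by decide) (by decide) (by decide), h59], fun _ => rfl, fun k => hv _,
      fun k hk => ?_⟩
    · rw [n₂ _ (by decide)]; exact hlin.base z hz
    · rw [hc _ (by decide) (by decide), h51]; subst hD; rfl
    · rw [hc _ (by decide) (by decide), h52]; subst hD; rfl
    · rw [hc _ (by decide) (by decide), h53]; subst hD; rfl
    · rw [hc _ (by decide) (by decide), h54]; subst hD; rfl
    · exact congrArg (fun u => (ofLex u).1) (hP'.key _ hk)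

theorem runs_prepare_start {p q n : ℕ} (P : OrthogonalPolygon p) (Q : OrthogonalPolygon q)
    (hn : p * q = n) :
    Runs prepare (encodePolygons P Q) (714 * (n * n) + 393 * (Nat.log 2 (32 * (n * n)) * (n * n)))
      fun s => ∃ D m W, Kin.Ordered D W ∧ D.Boxed m ∧ m + 6 ≤ n ∧ W ≤ 32 * (n * n) ∧
        (∀ lam, 0 < lam → (D.Free m lam ↔ Fits P Q lam)) ∧
        PhaseStart D m n (n * n / 4) (n * n % 4) 0 s := by
  refine (runs_prepare P Q hn).mono le_rfl ?_
  rintro s hs ⟨D, m, W, hD, hB, hm, hW, hfree, hpos, hsetup⟩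
  have hN0 : ∀ a i, 71 ≤ a → s.nat a i = 0 := fun a i ha => by
    rw [hs.nat a fun h => absurd (lt_of_mem_prepare.1 _ h) (by omega)]
    obtain ⟨b, rfl⟩ := Nat.exists_eq_add_of_le' (show 1 ≤ a by omega)
    rfl
  have hR0 : ∀ a i, 71 ≤ a → s.real a i = 0 := fun a i ha => by
    rw [hs.real a fun h => absurd (lt_of_mem_prepare.2 _ h) (by omega)]
    obtain ⟨b, rfl⟩ := Nat.exists_eq_add_of_le' (show 4 ≤ a by omega)
    rfl
  refine ⟨D, m, W, hD, hB, hm, hW, hfree, hsetup, by rwa [Nat.zero_mul], ?_, fun g _ hg a i => ?_,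
    Or.inl ⟨hN0 _ _ (by decide), fun j hj => ?_⟩⟩
  · rw [Nat.zero_mul, hN0 _ _ (by decide)]
  · have : 71 ≤ arrayOf g a := by unfold arrayOf; omega
    exact ⟨hN0 _ _ this, hR0 _ _ this⟩
  -- Beyond `M` nothing fits, so the rectangles cover at the start; the maximum with `1` keeps `lam`
  -- positive, where free points and placements correspond.
  · obtain ⟨M, hM⟩ := exists_fits_le P Q
    rw [Nat.zero_mul, Nat.le_zero] at hj
    subst hj
    refine Kin.covers_zero hD hB (M := max M 1) fun lam hlam => ?_
    rw [hfree lam (one_pos.trans_le ((le_max_right _ _).trans hlam.le))]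
    exact hM lam ((le_max_left _ _).trans_lt hlam)

/-- From `n ≥ 9` one has `32 ≤ n²`, so the argument of the binary logarithm is at most `n⁴`; and
`log 2 > 1 / 2`. The bound `1 ≤ log n` absorbs the terms without logarithm. -/
theorem log_two_le {n : ℕ} (hn : 9 ≤ n) :
    1 ≤ Real.log n ∧ (Nat.log 2 (32 * (n * n)) : ℝ) ≤ 8 * Real.log n := by
  have hn0 : (0 : ℝ) < n := by exact_mod_cast (by omega : 0 < n)
  constructor
  · rw [Real.le_log_iff_exp_le hn0]
    have : (9 : ℝ) ≤ n := by exact_mod_cast hn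
    linarith [Real.exp_one_lt_d9]
  · have h1 : 2 ^ Nat.log 2 (32 * (n * n)) ≤ n ^ 4 := by
      refine (Nat.pow_log_le_self 2 (by positivity)).trans ?_
      have : 32 ≤ n * n := by nlinarith
      calc 32 * (n * n) ≤ n * n * (n * n) := Nat.mul_le_mul_right _ this
        _ = n ^ 4 := by ring
    have h2 : ((2 : ℝ) ^ Nat.log 2 (32 * (n * n))) ≤ (n : ℝ) ^ 4 := by exact_mod_cast h1
    have h3 := Real.log_le_log (by positivity) h2
    rw [Real.log_pow, Real.log_pow] at h3
    have h4 := Real.log_two_gt_d9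
    have h5 : (0 : ℝ) ≤ Nat.log 2 (32 * (n * n)) := by positivity
    push_cast at h3
    nlinarith

/-- After all `W` entries the rectangles cannot have covered throughout, since small copies of `P`
fit; so an answer has been recorded, and `Kin.largest` applies. -/
theorem AnswerAt.isLargestScaling {p q : ℕ} {P : OrthogonalPolygon p} {Q : OrthogonalPolygon q}
    {D : Kin} {m k W : ℕ} {s : Store} (h : AnswerAt D m k s) (hD : D.Ordered W) (hB : D.Boxed m)
    (hk : W ≤ k) (hfree : ∀ lam, 0 < lam → (D.Free m lam ↔ Fits P Q lam)) :
    IsLargestScaling P Q (s.real 4 0) := by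
  rcases h with ⟨-, h⟩ | ⟨-, k', h1, h2, h3⟩
  · obtain ⟨lam, h0, hf⟩ := exists_fits P Q
    obtain ⟨j, hj, hc⟩ := Kin.exists_not_covers hD hB h0 ((hfree lam h0).2 hf)
    exact absurd (h j (hj.trans hk)) hc
  · rw [h1]
    have := Kin.largest hD hB h2 h3
    unfold IsLargestScaling
    convert this using 1
    ext l
    exact and_congr_right fun h => (hfree l h).symm

theorem computes_largest_scaling {A : Prog} {T : ℕ → ℕ → ℕ} (hA : SolvesRectangleCover A 4 T) :
    ComputesLargestScaling (.seq prepare (phases A 160)) fun p q =>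
      ((20000 : ℕ) : ℝ) *
        (((p : ℝ) * q) ^ 2 * Real.log ((p : ℝ) * q) + T (p * q) ((p * q) ^ 2)) := by
  intro p q P Q
  have hp3 := P.three_le
  have hq3 := Q.three_le
  obtain ⟨n, hn⟩ : ∃ n, p * q = n := ⟨_, rfl⟩
  have hn9 : 9 ≤ n := hn ▸ Nat.mul_le_mul hp3 hq3
  -- A square is `0` or `1` modulo `4`, so four updates per entry and at most one filler make
  -- exactly `n * n` updates.
  have he : n * n % 4 ≤ 1 := by
    rcases Nat.even_or_odd' n with ⟨k, rfl | rfl⟩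
    · rw [show 2 * k * (2 * k) = 4 * (k * k) by ring]; omega
    · rw [show (2 * k + 1) * (2 * k + 1) = 4 * (k * k + k) + 1 by ring]; omega
  have hnn : n ≤ n * n := Nat.le_mul_self n
  have h9 : 9 * 9 ≤ n * n := Nat.mul_le_mul hn9 hn9
  obtain ⟨s, t, hex, ht, hs⟩ : Runs (.seq prepare (phases A 160)) (encodePolygons P Q)
      (714 * (n * n) + 393 * (Nat.log 2 (32 * (n * n)) * (n * n)) +
        160 * (58 * (n * n) + T n (n * n))) fun s => IsLargestScaling P Q (s.real 4 0) := by
    refine Runs.andThen (runs_prepare_start P Q hn) le_rfl ?_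
    rintro s₁ - ⟨D, m, W, hD, hB, hm, hW, hfree, hstart⟩
    refine (runs_phases hA hD hB hm he hstart (g := 160) (by decide)).mono ?_ fun s₂ _ h => ?_
    · refine Nat.mul_le_mul_left _ ?_
      rw [Nat.div_add_mod]
      omega
    -- The 160 phases handle `160 * (n * n / 4)` entries, which is at least `32 * (n * n) ≥ W`
    -- because `n ≥ 9`.
    · exact h.answer.isLargestScaling hD hB (by omega) hfree
  refine ⟨s, t, hex, ?_, hs⟩
  have htR : (t : ℝ) ≤ 714 * ((n : ℝ) * n) +
      393 * ((Nat.log 2 (32 * (n * n)) : ℝ) * ((n : ℝ) * n)) +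
      160 * (58 * ((n : ℝ) * n) + T n (n * n)) := by exact_mod_cast ht
  refine htR.trans ?_
  obtain ⟨h1, h2⟩ := log_two_le hn9
  have hpq : (p : ℝ) * q = n := by exact_mod_cast hn
  beta_reduce
  rw [hpq, hn, sq n]
  -- The coefficients sum to `714 + 160 * 58 + 393 * 8 = 13138` for the logarithmic term and `160`
  -- for `T`; the constant `20000` covers both.
  have hN : (0 : ℝ) ≤ (n : ℝ) * n := by positivity
  have hT : (0 : ℝ) ≤ T n (n * n) := Nat.cast_nonneg _
  have h3 := mul_le_mul_of_nonneg_right h1 hN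
  have h4 := mul_le_mul_of_nonneg_right h2 hN
  push_cast
  nlinarith

end PolygonPlacement

theorem lemma6p1 :
    ∃ c K : ℕ, ∀ (T : ℕ → ℕ → ℕ) (A : PolygonPlacement.Prog),
      PolygonPlacement.SolvesRectangleCover A c T →
        ∃ B : PolygonPlacement.Prog, PolygonPlacement.ComputesLargestScaling B fun p q =>
          (K : ℝ) * (((p : ℝ) * q) ^ 2 * Real.log ((p : ℝ) * q) + T (p * q) ((p * q) ^ 2)) :=
  ⟨4, 20000, fun _ _ hA => ⟨_, PolygonPlacement.computes_largest_scaling hA⟩⟩
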